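/- **Nonabelian bundle gerbes, gerbes and local data.** Let $M$ be a (Hausdorff) smooth manifold and $H$ a Lie group. An *$H$-principal bibundle* is a bundle that is at the same time a left and a right principal $H$-bundle, with commuting actions; for $e\in E$, $\varphi_e\in\mathrm{Aut}(H)$ is defined by $\varphi_e(h)\,e=e\triangleleft h$. Products $E\tilde E=\{[e,\tilde e]\}$, $[e\triangleleft h,\tilde e]=[e,h\tilde e]$, inverses $E^{-1}$ and pull-backs of bibundles are again bibundles; a bibundle is trivial iff it has a global central section, i.e. a global section $\sigma$ with $h\sigma=\sigma\triangleleft h$. For a central section $f$ of $T$, $\varphi_E(f)$ denotes the central section of $ETE^{-1}$ given locally by $s f s^{-1}$, $s$ any local section of $E$. Products of sections are compared after the canonical cancellations $E^{-1}E=1=EE^{-1}$. * A *bundle gerbe* $(\mathcal E,Y,M,f)$ consists of a surjective submersion $Y\to M$, a bibundle $\mathcal E$ on $Y^{[2]}=Y\times_MY$ and a global central section $f$ of $(\mathcal E_{12}\mathcal E_{23}\mathcal E_{13}^{-1})^{-1}$ on $Y^{[3]}$ with $f_{124}\,\varphi_{12}(f_{234})=f_{134}\,f_{123}$ on $Y^{[4]}$.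 Two bundle gerbes $(\mathcal E,Y,M,f)$, $(\mathcal E',Y',M,f')$ are *stably isomorphic* if there are a bibundle $\mathcal N$ on $Z=Y\times_MY'$, a bibundle $\eta$ on $Z^{[2]}$ with a global central section $\ell$ of $\eta^{-1}$, and an isomorphism $\mathcal N_1\,q'^*\mathcal E'\,\mathcal N_2^{-1}=\eta\,q^*\mathcal E$ such that $\varphi_1(q'^*f')=\ell_{13}^{-1}\,q^*f\,\varphi_{12}(\ell_{23})\,\ell_{12}$ on $Z^{[3]}$, where $q,q'$ are the projections from $Z^{[n]}$ to $Y^{[n]}$, $Y'^{[n]}$. * A *gerbe* on $M$ consists of an open cover $\{O_\alpha\}$ of $M$, bibundles $\mathcal E_{\alpha\beta}$ on $O_{\alpha\beta}$ and global central sections $f_{\alpha\beta\gamma}$ of $(\mathcal E_{\alpha\beta}\mathcal E_{\beta\gamma}\mathcal E_{\alpha\gamma}^{-1})^{-1}$ on $O_{\alpha\beta\gamma}$ with $f_{\alpha\beta\delta}\,\varphi_{\alpha\beta}(f_{\beta\gamma\delta})=f_{\alpha\gamma\delta}\,f_{\alpha\beta\gamma}$ on $O_{\alpha\beta\gamma\delta}$.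 Two gerbes are *stably equivalent* if, on some common refinement of their covers, there are bibundles $\mathcal N_\alpha$ on $O_\alpha$, bibundles $\eta_{\alpha\beta}$ on $O_{\alpha\beta}$ with global central sections $\ell_{\alpha\beta}$ of $\eta_{\alpha\beta}^{-1}$, and isomorphisms $\mathcal N_\alpha\mathcal E'_{\alpha\beta}\mathcal N_\beta^{-1}=\eta_{\alpha\beta}\mathcal E_{\alpha\beta}$ with $\varphi_\alpha(f'_{\alpha\beta\gamma})=\ell_{\alpha\gamma}^{-1}\,f_{\alpha\beta\gamma}\,\varphi_{\alpha\beta}(\ell_{\beta\gamma})\,\ell_{\alpha\beta}$. * *Local data* on $M$ consist of an open cover $\{O_\alpha\}$ with a refinement $\{O_\alpha^i\}$, $O^i_\alpha\subseteq O_\alpha$, such that for every finite set of indices the sets $O^i_{\alpha\beta\cdots}=O^i_\alpha\cap O^i_\beta\cap\cdots$ cover $O_{\alpha\beta\cdots}$, and smooth maps $h^{ij}_{\alpha\beta}:O^i_{\alpha\beta}\cap O^j_{\alpha\beta}\to H$, $\varphi^i_{\alpha\beta}:O^i_{\alpha\beta}\to\mathrm{Aut}(H)$, $f^i_{\alpha\beta\gamma}:O^i_{\alpha\beta\gamma}\to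 H$ with $$h^{ij}_{\alpha\beta}h^{jk}_{\alpha\beta}=h^{ik}_{\alpha\beta},\quad \mathrm{Ad}_{h^{ij}_{\alpha\beta}}=\varphi^i_{\alpha\beta}\circ(\varphi^j_{\alpha\beta})^{-1},\quad h^{ij}_{\alpha\beta}\,\varphi^j_{\alpha\beta}(h^{ij}_{\beta\gamma})=f^i_{\alpha\beta\gamma}\,h^{ij}_{\alpha\gamma}\,(f^j_{\alpha\beta\gamma})^{-1},$$ $$\varphi^i_{\alpha\beta}\circ\varphi^i_{\beta\gamma}=\mathrm{Ad}_{f^i_{\alpha\beta\gamma}}\circ\varphi^i_{\alpha\gamma},\quad \varphi^i_{\alpha\beta}(f^i_{\beta\gamma\delta})\,f^i_{\alpha\beta\delta}=f^i_{\alpha\beta\gamma}\,f^i_{\alpha\gamma\delta}$$ wherever both sides are defined. Two sets of local data are *stably isomorphic* if, on some common refinement of their covers, there are local data $\{h^{ij}_\alpha,\varphi^i_\alpha\}$ of bibundles on the $O_\alpha$ (that is, smooth maps with $h^{ij}_\alpha h^{jk}_\alpha=h^{ik}_\alpha$ and $\mathrm{Ad}_{h^{ij}_\alpha}=\varphi^i_\alpha\circ(\varphi^j_\alpha)^{-1}$)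 and smooth maps $\ell^i_{\alpha\beta}:O^i_{\alpha\beta}\to H$ with $$h^{ij}_\alpha\,\varphi^j_\alpha(h'^{ij}_{\alpha\beta})\,\varphi^j_\alpha\varphi'^j_{\alpha\beta}(\varphi^j_\beta)^{-1}\big((h^{ij}_\beta)^{-1}\big)=\ell^i_{\alpha\beta}\,h^{ij}_{\alpha\beta}\,(\ell^j_{\alpha\beta})^{-1},\quad \varphi^i_\alpha\circ\varphi'^i_{\alpha\beta}\circ(\varphi^i_\beta)^{-1}=\mathrm{Ad}_{\ell^i_{\alpha\beta}}\circ\varphi^i_{\alpha\beta},$$ $$\varphi^i_\alpha(f'^i_{\alpha\beta\gamma})=\ell^i_{\alpha\beta}\,\varphi^i_{\alpha\beta}(\ell^i_{\beta\gamma})\,f^i_{\alpha\beta\gamma}\,(\ell^i_{\alpha\gamma})^{-1}.$$ Then: 1. Stable isomorphism of bundle gerbes, stable equivalence of gerbes and stable isomorphism of local data are equivalence relations. 2. For every bundle gerbe there are an open cover $\{O_\alpha\}$ of $M$ and smooth local sections $\sigma_\alpha:O_\alpha\to Y$. The pull-backs $\mathcal E_{\alpha\beta}=(\sigma_\alpha,\sigma_\beta)^*\mathcal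 E$, $f_{\alpha\beta\gamma}=(\sigma_\alpha,\sigma_\beta,\sigma_\gamma)^*f$ form a gerbe, whose stable equivalence class does not depend on the cover and the sections. 3. The map so defined, from stable isomorphism classes of bundle gerbes on $M$ to stable equivalence classes of gerbes on $M$, is a bijection. 4. Every gerbe has local data: there are a refinement (in the above two-index sense) of its cover and smooth sections $t^i_{\alpha\beta}$ of $\mathcal E_{\alpha\beta}$ over $O^i_{\alpha\beta}$, and $t^i_{\alpha\beta}=h^{ij}_{\alpha\beta}t^j_{\alpha\beta}$, $\varphi^i_{\alpha\beta}=\varphi_{t^i_{\alpha\beta}}$, $f_{\alpha\beta\gamma}^{-1}=(f^i_{\alpha\beta\gamma})^{-1}\,t^i_{\alpha\beta}\,t^i_{\beta\gamma}\,(t^i_{\alpha\gamma})^{-1}$ define local data. All local data arise in this way. Assigning to a gerbe any of its local data gives a well-defined bijection from stable equivalence classes of gerbes to stable isomorphism classes of local data. Hence classes of bundle gerbes also correspond bijectively to classes of local data. -/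

import Mathlib

open Set TopologicalSpace
open scoped Manifold ContDiff Topology

universe u

namespace NBG

noncomputable section

/-! ### Bitorsors: the fibres of principal bibundles -/

/-- A set with commuting left and right actions of `H`, each of them simply transitive.
These are the fibres of `H`-principal bibundles. -/
structure Bitorsor (H : Type u) [Group H] : Type (u + 1) where
  carrier : Type u
  /-- left action `h e` -/
  l : H → carrier → carrier
  /-- right action `e ◁ h` -/
  r : carrier → H → carrier
  nonempty : Nonempty carrier
  l_one : ∀ e, l 1 e = e
  l_mul : ∀ h k e, l (h * k) e = l h (l k e)
  r_one : ∀ e, r e 1 = e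
  r_mul : ∀ e h k, r e (h * k) = r (r e h) k
  comm : ∀ k e h, r (l k e) h = l k (r e h)
  l_simply : ∀ e e', ∃! h, l h e' = e
  r_simply : ∀ e e', ∃! h, r e' h = e

namespace Bitorsor

variable {H : Type u} [Group H]

instance : CoeSort (Bitorsor H) (Type u) := ⟨Bitorsor.carrier⟩

variable (T T' : Bitorsor H)

/-- The unique `h` with `h e' = e`. -/
def div (e e' : T) : H := (T.l_simply e e').choose

/-- The unique `h` with `e' ◁ h = e`. -/
def rdiv (e e' : T) : H := (T.r_simply e e').choose

/-- The map `φ_e : H → H` characterised by `φ_e(h) e = e ◁ h`. -/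
def phi (e : T) (h : H) : H := T.div (T.r e h) e

/-- The inverse of `φ_e`, characterised by `e ◁ φ_e⁻¹(h) = h e`. -/
def phiInv (e : T) (h : H) : H := T.rdiv (T.l h e) e

lemma l_div (e e' : T) : T.l (T.div e e') e' = e := (T.l_simply e e').choose_spec.1

lemma r_rdiv (e e' : T) : T.r e' (T.rdiv e e') = e := (T.r_simply e e').choose_spec.1

lemma div_eq {e e' : T} {h : H} (hh : T.l h e' = e) : T.div e e' = h :=
  (T.l_simply e e').unique (T.l_div e e') hh

lemma rdiv_eq {e e' : T} {h : H} (hh : T.r e' h = e) : T.rdiv e e' = h :=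
  (T.r_simply e e').unique (T.r_rdiv e e') hh

lemma l_phi (e : T) (h : H) : T.l (T.phi e h) e = T.r e h := T.l_div _ _

lemma r_phiInv (e : T) (h : H) : T.r e (T.phiInv e h) = T.l h e := T.r_rdiv _ _

/-- The inverse bitorsor `T⁻¹`: the same set with `h e⁻¹ = (e ◁ h⁻¹)⁻¹` and
`e⁻¹ ◁ h = (h⁻¹ e)⁻¹`. -/
def inv : Bitorsor H where
  carrier := T.carrier
  l h e := T.r e h⁻¹
  r e h := T.l h⁻¹ e
  nonempty := T.nonempty
  l_one e := by simp [T.r_one]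
  l_mul h k e := by simp [T.r_mul]
  r_one e := by simp [T.l_one]
  r_mul e h k := by simp [T.l_mul]
  comm k e h := by simp [T.comm]
  l_simply e e' := by
    refine ⟨(T.rdiv e e')⁻¹, by simp [T.r_rdiv], fun h hh => ?_⟩
    rw [T.rdiv_eq hh, inv_inv]
  r_simply e e' := by
    refine ⟨(T.div e e')⁻¹, by simp [T.l_div], fun h hh => ?_⟩
    rw [T.div_eq hh, inv_inv]

variable {T} in
/-- The point `e⁻¹` of `T⁻¹` (the same point as `e`). -/
def pinv (e : T) : T.inv := e

variable {T} in
/-- The point `x` of `T` corresponding to the point `e = x⁻¹` of `T⁻¹`. -/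
def ofInv (e : T.inv) : T := e

/-- The equivalence relation `(e ◁ h, e') ∼ (e, h e')` on `T × T'`. -/
def mulSetoid : Setoid (T.carrier × T'.carrier) where
  r p q := ∃ h : H, q.1 = T.r p.1 h ∧ p.2 = T'.l h q.2
  iseqv :=
    { refl := fun p => ⟨1, by simp [T.r_one], by simp [T'.l_one]⟩
      symm := by
        rintro ⟨a, b⟩ ⟨c, d⟩ ⟨h, h1, h2⟩
        refine ⟨h⁻¹, ?_, ?_⟩
        · simp only at h1 h2 ⊢
          rw [h1, ← T.r_mul, mul_inv_cancel, T.r_one]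
        · simp only at h1 h2 ⊢
          rw [h2, ← T'.l_mul, inv_mul_cancel, T'.l_one]
      trans := by
        rintro ⟨a, b⟩ ⟨c, d⟩ ⟨e, f⟩ ⟨h, h1, h2⟩ ⟨k, k1, k2⟩
        refine ⟨h * k, ?_, ?_⟩
        · simp only at h1 k1 ⊢
          rw [k1, h1, T.r_mul]
        · simp only at h2 k2 ⊢
          rw [h2, k2, T'.l_mul] }

variable {T T'} in
/-- The class `[e, e']` in the product `T T'`. -/
def pt (e : T) (e' : T') : Quotient (mulSetoid T T') := Quotient.mk _ (e, e')

variable {T T'} in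
lemma pt_eq_iff {e f : T} {e' f' : T'} :
    pt e e' = pt f f' ↔ ∃ h : H, f = T.r e h ∧ e' = T'.l h f' := by
  unfold pt
  rw [Quotient.eq]
  rfl

variable {T T'} in
lemma pt_r (e : T) (h : H) (e' : T') : pt (T.r e h) e' = pt e (T'.l h e') :=
  (pt_eq_iff.2 ⟨h, rfl, rfl⟩).symm

/-- The product bitorsor `T T'`: classes `[e, e']` with `[e ◁ h, e'] = [e, h e']`,
`h [e, e'] = [h e, e']` and `[e, e'] ◁ h = [e, e' ◁ h]`. -/
def mul : Bitorsor H where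
  carrier := Quotient (mulSetoid T T')
  l h := Quotient.map' (fun p => (T.l h p.1, p.2)) (by
    rintro ⟨a, b⟩ ⟨c, d⟩ ⟨k, h1, h2⟩
    exact ⟨k, by simp only at h1 ⊢; rw [h1, T.comm], h2⟩)
  r q h := Quotient.map' (fun p => (p.1, T'.r p.2 h)) (by
    rintro ⟨a, b⟩ ⟨c, d⟩ ⟨k, h1, h2⟩
    exact ⟨k, h1, by simp only at h2 ⊢; rw [h2, T'.comm]⟩) q
  nonempty := by
    obtain ⟨e⟩ := T.nonempty
    obtain ⟨e'⟩ := T'.nonempty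
    exact ⟨pt e e'⟩
  l_one := by
    rintro ⟨e, e'⟩
    change pt (T.l 1 e) e' = pt e e'
    rw [T.l_one]
  l_mul := by
    rintro h k ⟨e, e'⟩
    change pt (T.l (h * k) e) e' = pt (T.l h (T.l k e)) e'
    rw [T.l_mul]
  r_one := by
    rintro ⟨e, e'⟩
    change pt e (T'.r e' 1) = pt e e'
    rw [T'.r_one]
  r_mul := by
    rintro ⟨e, e'⟩ h k
    change pt e (T'.r e' (h * k)) = pt e (T'.r (T'.r e' h) k)
    rw [T'.r_mul]
  comm := by
    rintro k ⟨e, e'⟩ h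
    rfl
  l_simply := by
    rintro ⟨a, a'⟩ ⟨b, b'⟩
    have key : ∀ h, pt (T.l h b) b' = pt a a' ↔ T.l h b = T.r a (T'.div a' b') := by
      intro h
      constructor
      · intro hh
        obtain ⟨k, h1, h2⟩ := pt_eq_iff.1 hh.symm
        rw [T'.div_eq h2.symm, h1]
      · intro hh
        rw [hh, pt_r, T'.l_div]
    obtain ⟨h, h1, h2⟩ := T.l_simply (T.r a (T'.div a' b')) b
    exact ⟨h, (key h).2 h1, fun k hk => h2 k ((key k).1 hk)⟩
  r_simply := by
    rintro ⟨a, a'⟩ ⟨b, b'⟩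
    have key : ∀ h, pt b (T'.r b' h) = pt a a' ↔ T'.r b' h = T'.l (T.rdiv a b) a' := by
      intro h
      constructor
      · intro hh
        obtain ⟨k, h1, h2⟩ := pt_eq_iff.1 hh
        rw [T.rdiv_eq h1.symm, h2]
      · intro hh
        rw [hh, ← pt_r, T.r_rdiv]
    obtain ⟨h, h1, h2⟩ := T'.r_simply (T'.l (T.rdiv a b) a') b'
    exact ⟨h, (key h).2 h1, fun k hk => h2 k ((key k).1 hk)⟩

variable {T T'} in
/-- The class `[e, e']` as a point of the bitorsor `T T'`. -/
def pair (e : T) (e' : T') : T.mul T' := pt e e'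

variable {T T'} in
lemma mul_div (e f : T) (e' f' : T') :
    (T.mul T').div (pair e e') (pair f f') = T.div e f * T.phi f (T'.div e' f') := by
  apply div_eq
  change pt (T.l _ f) f' = pt e e'
  rw [T.l_mul, T.l_phi, ← T.comm, T.l_div, pt_r, T'.l_div]

variable {T T'} in
lemma mul_phi (e : T) (e' : T') (h : H) :
    (T.mul T').phi (pair e e') h = T.phi e (T'.phi e' h) := by
  apply div_eq
  change pt (T.l _ e) e' = pt e (T'.r e' h)
  rw [T.l_phi, pt_r, T'.l_phi]

variable {T T'} in
lemma mul_phiInv (e : T) (e' : T') (h : H) :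
    (T.mul T').phiInv (pair e e') h = T'.phiInv e' (T.phiInv e h) := by
  apply rdiv_eq
  change pt e (T'.r e' _) = pt (T.l h e) e'
  rw [T'.r_phiInv, ← pt_r, T.r_phiInv]

lemma r_inv_phiInv (e : T) (h : H) : T.r e (T.phiInv e h)⁻¹ = T.l h⁻¹ e := by
  have h1 : T.r (T.l h⁻¹ e) (T.phiInv e h) = e := by
    rw [T.comm, r_phiInv, ← T.l_mul, inv_mul_cancel, T.l_one]
  calc T.r e (T.phiInv e h)⁻¹ = T.r (T.r (T.l h⁻¹ e) (T.phiInv e h)) (T.phiInv e h)⁻¹ := by rw [h1]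
    _ = T.l h⁻¹ e := by rw [← T.r_mul, mul_inv_cancel, T.r_one]

lemma l_inv_phi (e : T) (h : H) : T.l (T.phi e h)⁻¹ e = T.r e h⁻¹ := by
  have h1 : T.l (T.phi e h) (T.r e h⁻¹) = e := by
    rw [← T.comm, l_phi, ← T.r_mul, mul_inv_cancel, T.r_one]
  calc T.l (T.phi e h)⁻¹ e = T.l (T.phi e h)⁻¹ (T.l (T.phi e h) (T.r e h⁻¹)) := by rw [h1]
    _ = T.r e h⁻¹ := by rw [← T.l_mul, inv_mul_cancel, T.l_one]

lemma inv_div (e f : T) : T.inv.div (pinv e) (pinv f) = T.phiInv f (T.div e f)⁻¹ := by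
  apply div_eq
  change T.r f (T.phiInv f (T.div e f)⁻¹)⁻¹ = e
  rw [r_inv_phiInv, inv_inv, l_div]

lemma inv_phi (e : T) (h : H) : T.inv.phi (pinv e) h = T.phiInv e h := by
  apply div_eq
  exact T.r_inv_phiInv e h

lemma inv_phiInv (e : T) (h : H) : T.inv.phiInv (pinv e) h = T.phi e h := by
  apply rdiv_eq
  exact T.l_inv_phi e h

end Bitorsor

/-! ### Base spaces -/

/-- A subset `S` of a manifold `X`, used as the base of bundles.  It stands for the embedded
submanifolds that occur below (open subsets of a manifold, fibre products of submersions);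
smoothness of a map defined on `S` is smoothness within `S` in charts of `X`
(which for an embedded submanifold is smoothness on the submanifold). -/
structure Base : Type (u + 1) where
  E : Type
  [normed : NormedAddCommGroup E]
  [normedSpace : NormedSpace ℝ E]
  F : Type
  [topF : TopologicalSpace F]
  I : ModelWithCorners ℝ E F
  X : Type u
  [topX : TopologicalSpace X]
  [charted : ChartedSpace F X]
  [isManifold : IsManifold I ∞ X]
  S : Set X

attribute [instance] Base.normed Base.normedSpace Base.topF Base.topX Base.charted
  Base.isManifold

namespace Base

instance : CoeSort Base.{u} (Type u) := ⟨fun B => {x : B.X // x ∈ B.S}⟩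

/-- A smooth map `B' → B` (given by a map of the ambient manifolds that is smooth on `B'`). -/
structure Map (B' B : Base.{u}) where
  toFun : B'.X → B.X
  smooth : ContMDiffOn B'.I B.I ∞ toFun B'.S
  maps : MapsTo toFun B'.S B.S

namespace Map

variable {B' B : Base.{u}} (g : Map B' B)

/-- The map on points. -/
def pt (x : B') : B := ⟨g.toFun x.1, g.maps x.2⟩

lemma continuous_pt : Continuous g.pt :=
  (continuousOn_iff_continuous_domRestrict.1 g.smooth.continuousOn).subtype_mk _

/-- Preimage of an open set. -/
def comap (U : Opens B) : Opens B' := ⟨g.pt ⁻¹' U, U.isOpen.preimage g.continuous_pt⟩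

end Map

end Base

section Smooth

variable {k : ℕ} {H : Type u} [TopologicalSpace H] [ChartedSpace (EuclideanSpace ℝ (Fin k)) H]
  [Group H]

variable (k) in
/-- `f : B → H` is smooth on the open subset `U` of `B`. -/
def SmoothOn {B : Base.{u}} (f : B → H) (U : Opens B) : Prop :=
  ContMDiffOn B.I (𝓡 k) ∞ (Function.extend Subtype.val f (fun _ => 1))
    (Subtype.val '' (U : Set B))

variable (k) in
/-- `(x, h) ↦ f x h` is smooth on `U × H`. -/
def SmoothOn₂ {B : Base.{u}} (f : B → H → H) (U : Opens B) : Prop :=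
  ContMDiffOn (B.I.prod (𝓡 k)) (𝓡 k) ∞
    (fun p : B.X × H => Function.extend Subtype.val (fun x => f x p.2) (fun _ => 1) p.1)
    ((Subtype.val '' (U : Set B)) ×ˢ univ)

variable {B B' : Base.{u}}

lemma extend_val {α : Type*} (f : B → α) (j : B.X → α) (x : B) :
    Function.extend Subtype.val f j x.1 = f x :=
  Subtype.val_injective.extend_apply f j x

lemma SmoothOn.mono {f : B → H} {U V : Opens B} (hf : SmoothOn k f U) (h : V ≤ U) :
    SmoothOn k f V :=
  ContMDiffOn.mono hf (image_mono h)

lemma SmoothOn₂.mono {f : B → H → H} {U V : Opens B} (hf : SmoothOn₂ k f U) (h : V ≤ U) :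
    SmoothOn₂ k f V :=
  ContMDiffOn.mono hf (prod_mono (image_mono h) subset_rfl)

lemma SmoothOn.congr {f g : B → H} {U : Opens B} (hf : SmoothOn k f U)
    (h : ∀ x ∈ U, g x = f x) : SmoothOn k g U := by
  refine ContMDiffOn.congr hf ?_
  rintro _ ⟨x, hx, rfl⟩
  rw [extend_val, extend_val, h x hx]

lemma SmoothOn₂.congr {f g : B → H → H} {U : Opens B} (hf : SmoothOn₂ k f U)
    (h : ∀ x ∈ U, ∀ a, g x a = f x a) : SmoothOn₂ k g U := by
  refine ContMDiffOn.congr hf ?_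
  rintro ⟨_, a⟩ ⟨⟨x, hx, rfl⟩, -⟩
  simp only [extend_val, h x hx]

lemma SmoothOn.mul [LieGroup (𝓡 k) ∞ H] {f g : B → H} {U : Opens B} (hf : SmoothOn k f U)
    (hg : SmoothOn k g U) : SmoothOn k (fun x => f x * g x) U := by
  refine (ContMDiffOn.mul (I := 𝓡 k) (n := ∞) hf hg).congr ?_
  rintro _ ⟨x, hx, rfl⟩
  simp only [extend_val, Pi.mul_apply]

lemma SmoothOn.inv [LieGroup (𝓡 k) ∞ H] {f : B → H} {U : Opens B} (hf : SmoothOn k f U) :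
    SmoothOn k (fun x => (f x)⁻¹) U := by
  refine (ContMDiffOn.inv (I := 𝓡 k) (n := ∞) hf).congr ?_
  rintro _ ⟨x, hx, rfl⟩
  simp only [extend_val]

lemma SmoothOn₂.apply {f : B → H → H} {g : B → H} {U : Opens B} (hf : SmoothOn₂ k f U)
    (hg : SmoothOn k g U) : SmoothOn k (fun x => f x (g x)) U := by
  have h1 : ContMDiffOn B.I (B.I.prod (𝓡 k)) ∞
      (fun x => (x, Function.extend Subtype.val g (fun _ => 1) x))
      (Subtype.val '' (U : Set B)) := contMDiffOn_id.prodMk hg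
  refine (ContMDiffOn.comp hf h1 (fun x hx => ⟨hx, mem_univ _⟩)).congr ?_
  rintro _ ⟨x, hx, rfl⟩
  simp only [Function.comp, extend_val]

lemma SmoothOn₂.comp {f g : B → H → H} {U : Opens B} (hf : SmoothOn₂ k f U)
    (hg : SmoothOn₂ k g U) : SmoothOn₂ k (fun x a => f x (g x a)) U := by
  have h1 : ContMDiffOn (B.I.prod (𝓡 k)) (B.I.prod (𝓡 k)) ∞
      (fun p : B.X × H => (p.1,
        Function.extend Subtype.val (fun x => g x p.2) (fun _ => 1) p.1))
      ((Subtype.val '' (U : Set B)) ×ˢ univ) := contMDiffOn_fst.prodMk hg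
  refine (ContMDiffOn.comp hf h1 (fun x hx => ⟨hx.1, mem_univ _⟩)).congr ?_
  rintro ⟨_, a⟩ ⟨⟨x, hx, rfl⟩, -⟩
  simp only [Function.comp, extend_val]

lemma SmoothOn.pullback (g : Base.Map B' B) {f : B → H} {U : Opens B} (hf : SmoothOn k f U) :
    SmoothOn k (fun x => f (g.pt x)) (g.comap U) := by
  have h1 : ContMDiffOn B'.I B.I ∞ g.toFun (Subtype.val '' (g.comap U : Set B')) :=
    g.smooth.mono (by rintro _ ⟨x, -, rfl⟩; exact x.2)
  refine (ContMDiffOn.comp hf h1 ?_).congr ?_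
  · rintro _ ⟨x, hx, rfl⟩
    exact ⟨g.pt x, hx, rfl⟩
  · rintro _ ⟨x, hx, rfl⟩
    rw [extend_val]
    exact (extend_val f _ (g.pt x)).symm

lemma SmoothOn₂.pullback (g : Base.Map B' B) {f : B → H → H} {U : Opens B}
    (hf : SmoothOn₂ k f U) : SmoothOn₂ k (fun x => f (g.pt x)) (g.comap U) := by
  have h1 : ContMDiffOn (B'.I.prod (𝓡 k)) (B.I.prod (𝓡 k)) ∞
      (fun p : B'.X × H => (g.toFun p.1, p.2))
      ((Subtype.val '' (g.comap U : Set B')) ×ˢ univ) := by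
    have h0 : ContMDiffOn B'.I B.I ∞ g.toFun (Subtype.val '' (g.comap U : Set B')) :=
      g.smooth.mono (by rintro _ ⟨x, -, rfl⟩; exact x.2)
    exact ContMDiffOn.prodMk (ContMDiffOn.comp (f := Prod.fst) h0 contMDiffOn_fst
      (fun p hp => hp.1)) contMDiffOn_snd
  refine (ContMDiffOn.comp hf h1 ?_).congr ?_
  · rintro ⟨_, a⟩ ⟨⟨x, hx, rfl⟩, -⟩
    exact ⟨⟨g.pt x, hx, rfl⟩, mem_univ _⟩
  · rintro ⟨_, a⟩ ⟨⟨x, hx, rfl⟩, -⟩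
    simp only [extend_val]
    exact (extend_val (fun x => f x a) (fun _ => 1) (g.pt x)).symm

end Smooth

/-! ### Principal bibundles -/

section Bibundles

variable (k : ℕ) (H : Type u) [TopologicalSpace H] [ChartedSpace (EuclideanSpace ℝ (Fin k)) H]
  [Group H]

/-- A (smooth) `H`-principal bibundle on `B`: a family of `H`-bitorsors `fib b`, together with an
atlas of charts, i.e. an open cover `dom i` of `B` and sections `t i` over `dom i` (the values of
`t i` outside `dom i` play no role) whose transition functions `h^{ij}`, `t i = h^{ij} t j`, are
smooth, and such that the right action is smooth in these charts, i.e. `φ^i = φ_{t i}` and its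
inverse are smooth in `(b, h)`.  The total space is glued from the `dom i × H`. -/
structure Bibundle (B : Base.{u}) : Type (u + 1) where
  fib : B → Bitorsor H
  idx : Type u
  dom : idx → Opens B
  dom_cover : ∀ b, ∃ i, b ∈ dom i
  t : idx → ∀ b, fib b
  trans_smooth : ∀ i j, SmoothOn k (fun b => (fib b).div (t i b) (t j b)) (dom i ⊓ dom j)
  phi_smooth : ∀ i, SmoothOn₂ k (fun b => (fib b).phi (t i b)) (dom i)
  phiInv_smooth : ∀ i, SmoothOn₂ k (fun b => (fib b).phiInv (t i b)) (dom i)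

variable {k H} {B B' : Base.{u}}

namespace Bibundle

/-- `s` is a smooth section over `U`: its local representatives `s^i`, `s = s^i t i`, are smooth.
(The values of `s` outside `U` play no role.) -/
def IsSection (E : Bibundle k H B) (U : Opens B) (s : ∀ b, E.fib b) : Prop :=
  ∀ i, SmoothOn k (fun b => (E.fib b).div (s b) (E.t i b)) (U ⊓ E.dom i)

/-- Pull-back of a bibundle. -/
def pullback (E : Bibundle k H B) (g : Base.Map B' B) : Bibundle k H B' where
  fib b := E.fib (g.pt b)
  idx := E.idx
  dom i := g.comap (E.dom i)
  dom_cover b := E.dom_cover (g.pt b)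
  t i b := E.t i (g.pt b)
  trans_smooth i j := (E.trans_smooth i j).pullback g
  phi_smooth i := (E.phi_smooth i).pullback g
  phiInv_smooth i := (E.phiInv_smooth i).pullback g

variable [LieGroup (𝓡 k) ∞ H]

/-- The inverse bibundle `E⁻¹`. -/
def inv (E : Bibundle k H B) : Bibundle k H B where
  fib b := (E.fib b).inv
  idx := E.idx
  dom := E.dom
  dom_cover := E.dom_cover
  t i b := Bitorsor.pinv (E.t i b)
  trans_smooth i j :=
    (((E.phiInv_smooth j).mono inf_le_right).apply (E.trans_smooth i j).inv).congr
      (fun _ _ => Bitorsor.inv_div _ _ _)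
  phi_smooth i := (E.phiInv_smooth i).congr (fun _ _ _ => Bitorsor.inv_phi _ _ _)
  phiInv_smooth i := (E.phi_smooth i).congr (fun _ _ _ => Bitorsor.inv_phiInv _ _ _)

/-- The product bibundle `E E'`. -/
def mul (E E' : Bibundle k H B) : Bibundle k H B where
  fib b := (E.fib b).mul (E'.fib b)
  idx := E.idx × E'.idx
  dom i := E.dom i.1 ⊓ E'.dom i.2
  dom_cover b := by
    obtain ⟨i, hi⟩ := E.dom_cover b
    obtain ⟨j, hj⟩ := E'.dom_cover b
    exact ⟨(i, j), hi, hj⟩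
  t i b := Bitorsor.pair (E.t i.1 b) (E'.t i.2 b)
  trans_smooth i j :=
    (((E.trans_smooth i.1 j.1).mono (inf_le_inf inf_le_left inf_le_left)).mul
      (((E.phi_smooth j.1).mono (inf_le_right.trans inf_le_left)).apply
        ((E'.trans_smooth i.2 j.2).mono (inf_le_inf inf_le_right inf_le_right)))).congr
      (fun _ _ => Bitorsor.mul_div _ _ _ _)
  phi_smooth i :=
    (((E.phi_smooth i.1).mono inf_le_left).comp
      ((E'.phi_smooth i.2).mono inf_le_right)).congr (fun _ _ _ => Bitorsor.mul_phi _ _ _)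
  phiInv_smooth i :=
    (((E'.phiInv_smooth i.2).mono inf_le_right).comp
      ((E.phiInv_smooth i.1).mono inf_le_left)).congr (fun _ _ _ => Bitorsor.mul_phiInv _ _ _)

/-- The element `x` of the fibre of `((A B) C⁻¹)⁻¹` is `[a, b, c⁻¹]⁻¹`; equivalently, `x⁻¹`
identifies the element `[a, b]` of `A B` with the element `c` of `C`. -/
def Rep {A B' C : Bibundle k H B} {b : B} (x : ((A.mul B').mul C.inv).inv.fib b)
    (a : A.fib b) (a' : B'.fib b) (c : C.fib b) : Prop :=
  x = Bitorsor.pinv (Bitorsor.pair (Bitorsor.pair a a') (Bitorsor.pinv c))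

end Bibundle

/-- A morphism (hence isomorphism) of bibundles: a map over the identity of the base, compatible
with both actions, that maps smooth sections to smooth sections. -/
structure BibundleIso (E E' : Bibundle k H B) where
  toFun : ∀ b, E.fib b → E'.fib b
  map_l : ∀ b h e, toFun b ((E.fib b).l h e) = (E'.fib b).l h (toFun b e)
  map_r : ∀ b e h, toFun b ((E.fib b).r e h) = (E'.fib b).r (toFun b e) h
  smooth : ∀ i, E'.IsSection (E.dom i) (fun b => toFun b (E.t i b))

/-- A global central section; a bibundle is trivial iff it has one. -/
structure CentralSection (E : Bibundle k H B) where
  val : ∀ b, E.fib b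
  smooth : E.IsSection ⊤ val
  central : ∀ b h, (E.fib b).l h (val b) = (E.fib b).r (val b) h

end Bibundles

/-! ### Bundle gerbes -/

section BundleGerbes

variable (k : ℕ) (H : Type u) [TopologicalSpace H] [ChartedSpace (EuclideanSpace ℝ (Fin k)) H]
  [Group H] [LieGroup (𝓡 k) ∞ H]
  (m : ℕ) (M : Type u) [TopologicalSpace M] [ChartedSpace (EuclideanSpace ℝ (Fin m)) M]
  [IsManifold (𝓡 m) ∞ M]

/-- A surjective submersion `proj : Y → M` from a Hausdorff manifold `Y`. -/
structure Submersion : Type (u + 1) where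
  n : ℕ
  Y : Type u
  [topY : TopologicalSpace Y]
  [charted : ChartedSpace (EuclideanSpace ℝ (Fin n)) Y]
  [isManifold : IsManifold (𝓡 n) ∞ Y]
  [t2 : T2Space Y]
  proj : Y → M
  surjective : Function.Surjective proj
  isSubmersion : Manifold.IsSubmersion (𝓡 n) (𝓡 m) ∞ proj

attribute [instance] Submersion.topY Submersion.charted Submersion.isManifold Submersion.t2

variable {m M}

namespace Submersion

variable (P P' : Submersion m M)

/-- The fibre product `Y^{[2]}`. -/
def dbl : Base.{u} where
  E := EuclideanSpace ℝ (Fin P.n) × EuclideanSpace ℝ (Fin P.n)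
  F := ModelProd (EuclideanSpace ℝ (Fin P.n)) (EuclideanSpace ℝ (Fin P.n))
  I := (𝓡 P.n).prod (𝓡 P.n)
  X := P.Y × P.Y
  S := {y | P.proj y.1 = P.proj y.2}

/-- The fibre product `Y^{[3]}`. -/
def tpl : Base.{u} where
  E := EuclideanSpace ℝ (Fin P.n) × (EuclideanSpace ℝ (Fin P.n) × EuclideanSpace ℝ (Fin P.n))
  F := ModelProd (EuclideanSpace ℝ (Fin P.n))
    (ModelProd (EuclideanSpace ℝ (Fin P.n)) (EuclideanSpace ℝ (Fin P.n)))
  I := (𝓡 P.n).prod ((𝓡 P.n).prod (𝓡 P.n))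
  X := P.Y × (P.Y × P.Y)
  S := {y | P.proj y.1 = P.proj y.2.1 ∧ P.proj y.2.1 = P.proj y.2.2}

/-- The projection `p₁₂ : Y^{[3]} → Y^{[2]}`. -/
def p12 : Base.Map P.tpl P.dbl where
  toFun y := (y.1, y.2.1)
  smooth := (contMDiff_fst.prodMk (contMDiff_fst.comp contMDiff_snd)).contMDiffOn
  maps _ hy := hy.1

/-- The projection `p₂₃ : Y^{[3]} → Y^{[2]}`. -/
def p23 : Base.Map P.tpl P.dbl where
  toFun y := (y.2.1, y.2.2)
  smooth := (contMDiff_snd (I := 𝓡 P.n) (J := (𝓡 P.n).prod (𝓡 P.n)) (M := P.Y)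
    (N := P.Y × P.Y)).contMDiffOn
  maps _ hy := hy.2

/-- The projection `p₁₃ : Y^{[3]} → Y^{[2]}`. -/
def p13 : Base.Map P.tpl P.dbl where
  toFun y := (y.1, y.2.2)
  smooth := (contMDiff_fst.prodMk (contMDiff_snd.comp contMDiff_snd)).contMDiffOn
  maps _ hy := hy.1.trans hy.2

/-- The fibre product `Z = Y ×_M Y'`. -/
def fibProd : Base.{u} where
  E := EuclideanSpace ℝ (Fin P.n) × EuclideanSpace ℝ (Fin P'.n)
  F := ModelProd (EuclideanSpace ℝ (Fin P.n)) (EuclideanSpace ℝ (Fin P'.n))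
  I := (𝓡 P.n).prod (𝓡 P'.n)
  X := P.Y × P'.Y
  S := {z | P.proj z.1 = P'.proj z.2}

/-- The fibre product `Z^{[2]}` for `Z = Y ×_M Y'`. -/
def fibProdDbl : Base.{u} where
  E := (EuclideanSpace ℝ (Fin P.n) × EuclideanSpace ℝ (Fin P'.n)) ×
    (EuclideanSpace ℝ (Fin P.n) × EuclideanSpace ℝ (Fin P'.n))
  F := ModelProd (ModelProd (EuclideanSpace ℝ (Fin P.n)) (EuclideanSpace ℝ (Fin P'.n)))
    (ModelProd (EuclideanSpace ℝ (Fin P.n)) (EuclideanSpace ℝ (Fin P'.n)))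
  I := ((𝓡 P.n).prod (𝓡 P'.n)).prod ((𝓡 P.n).prod (𝓡 P'.n))
  X := (P.Y × P'.Y) × (P.Y × P'.Y)
  S := {z | P.proj z.1.1 = P'.proj z.1.2 ∧ P.proj z.2.1 = P'.proj z.2.2 ∧
    P.proj z.1.1 = P.proj z.2.1}

/-- The first projection `Z^{[2]} → Z`. -/
def z1 : Base.Map (fibProdDbl P P') (fibProd P P') where
  toFun z := z.1
  smooth := (contMDiff_fst (I := (𝓡 P.n).prod (𝓡 P'.n)) (J := (𝓡 P.n).prod (𝓡 P'.n))
    (M := P.Y × P'.Y) (N := P.Y × P'.Y)).contMDiffOn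
  maps _ hz := hz.1

/-- The second projection `Z^{[2]} → Z`. -/
def z2 : Base.Map (fibProdDbl P P') (fibProd P P') where
  toFun z := z.2
  smooth := (contMDiff_snd (I := (𝓡 P.n).prod (𝓡 P'.n)) (J := (𝓡 P.n).prod (𝓡 P'.n))
    (M := P.Y × P'.Y) (N := P.Y × P'.Y)).contMDiffOn
  maps _ hz := hz.2.1

/-- The projection `q : Z^{[2]} → Y^{[2]}`. -/
def q : Base.Map (fibProdDbl P P') P.dbl where
  toFun z := (z.1.1, z.2.1)
  smooth := ((contMDiff_fst.comp contMDiff_fst).prodMk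
    (contMDiff_fst.comp contMDiff_snd)).contMDiffOn
  maps _ hz := hz.2.2

/-- The projection `q' : Z^{[2]} → Y'^{[2]}`. -/
def q' : Base.Map (fibProdDbl P P') P'.dbl where
  toFun z := (z.1.2, z.2.2)
  smooth := ((contMDiff_snd.comp contMDiff_fst).prodMk
    (contMDiff_snd.comp contMDiff_snd)).contMDiffOn
  maps _ hz := hz.1.symm.trans (hz.2.2.trans hz.2.1)

end Submersion

variable (m M)

/-- A bundle gerbe `(ℰ, Y, M, f)`: a bibundle `ℰ` on `Y^{[2]}` and a global central section `f` of
`(ℰ₁₂ ℰ₂₃ ℰ₁₃⁻¹)⁻¹` on `Y^{[3]}` satisfying the cocycle condition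
`f₁₂₄ φ₁₂(f₂₃₄) = f₁₃₄ f₁₂₃` on `Y^{[4]}`.

The cocycle condition is spelled out pointwise, on representatives.  With
`f₂₃₄ = [e₂₃, e₃₄, e₂₄⁻¹]⁻¹` and `f₁₂₄ = [e₁₂, e₂₄, e₁₄⁻¹]⁻¹`, the left-hand side
`f₁₂₄ φ₁₂(f₂₃₄) = f₁₂₄ e₁₂ f₂₃₄ e₁₂⁻¹` is `[e₁₄, e₃₄⁻¹, e₂₃⁻¹, e₁₂⁻¹]`; with
`f₁₂₃ = [e₁₂, e₂₃, e₁₃⁻¹]⁻¹` and `f₁₃₄ = [e₁₃, e₃₄, e'₁₄⁻¹]⁻¹`, the right-hand side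
`f₁₃₄ f₁₂₃` is `[e'₁₄, e₃₄⁻¹, e₂₃⁻¹, e₁₂⁻¹]`. -/
structure BundleGerbe : Type (u + 1) where
  P : Submersion m M
  E : Bibundle k H P.dbl
  f : CentralSection (((E.pullback P.p12).mul (E.pullback P.p23)).mul (E.pullback P.p13).inv).inv
  cocycle : ∀ (y₁ y₂ y₃ y₄ : P.Y) (h₁₂ : P.proj y₁ = P.proj y₂) (h₂₃ : P.proj y₂ = P.proj y₃)
    (h₃₄ : P.proj y₃ = P.proj y₄)
    (e₁₂ : E.fib ⟨(y₁, y₂), h₁₂⟩) (e₂₃ : E.fib ⟨(y₂, y₃), h₂₃⟩) (e₃₄ : E.fib ⟨(y₃, y₄), h₃₄⟩)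
    (e₁₃ : E.fib ⟨(y₁, y₃), h₁₂.trans h₂₃⟩) (e₂₄ : E.fib ⟨(y₂, y₄), h₂₃.trans h₃₄⟩)
    (e₁₄ e'₁₄ : E.fib ⟨(y₁, y₄), h₁₂.trans (h₂₃.trans h₃₄)⟩),
    Bibundle.Rep (f.val ⟨(y₂, y₃, y₄), h₂₃, h₃₄⟩) e₂₃ e₃₄ e₂₄ →
    Bibundle.Rep (f.val ⟨(y₁, y₂, y₄), h₁₂, h₂₃.trans h₃₄⟩) e₁₂ e₂₄ e₁₄ →
    Bibundle.Rep (f.val ⟨(y₁, y₂, y₃), h₁₂, h₂₃⟩) e₁₂ e₂₃ e₁₃ →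
    Bibundle.Rep (f.val ⟨(y₁, y₃, y₄), h₁₂.trans h₂₃, h₃₄⟩) e₁₃ e₃₄ e'₁₄ →
    e₁₄ = e'₁₄

variable {k H m M}

/-- Stable isomorphism of bundle gerbes: there are a bibundle `N` on `Z = Y ×_M Y'`, a bibundle `η`
on `Z^{[2]}` with a global central section `ℓ` of `η⁻¹` (so `η⁻¹` is trivial), an isomorphism
`N₁ q'^*ℰ' N₂⁻¹ = η q^*ℰ`, and
`φ₁(q'^*f') = ℓ₁₃⁻¹ q^*f φ₁₂(ℓ₂₃) ℓ₁₂` on `Z^{[3]}`.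

The last condition is spelled out on representatives.  Let `n_i` be points of `N` over the `i`-th
point of `Z`.  The hypotheses `Θ [n₁, e'₁₂, n₂⁻¹] = [ℓ₁₂⁻¹, e₁₂]` etc. say that
`ℓ₁₂ = [e₁₂, n₂, e'₁₂⁻¹, n₁⁻¹]` etc.  With `f' = [e'₁₂, e'₂₃, e'₁₃⁻¹]⁻¹`, the left-hand side is
`[n₁, e'₁₃, e'₂₃⁻¹, e'₁₂⁻¹, n₁⁻¹]`; with `f = [e₁₂, e₂₃, e₁₃⁻¹]⁻¹` and
`ℓ₁₃ = [d₁₃, n₃, e'₁₃⁻¹, n₁⁻¹]`, the right-hand side is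
`[n₁, e'₁₃, n₃⁻¹, d₁₃⁻¹, e₁₃, n₃, e'₂₃⁻¹, e'₁₂⁻¹, n₁⁻¹]`, so that they agree iff `e₁₃ = d₁₃`. -/
def BundleGerbe.StableIso (G G' : BundleGerbe k H m M) : Prop :=
  ∃ (N : Bibundle k H (Submersion.fibProd G.P G'.P))
    (η : Bibundle k H (Submersion.fibProdDbl G.P G'.P))
    (ℓ : CentralSection η.inv)
    (Θ : BibundleIso
      (((N.pullback (Submersion.z1 G.P G'.P)).mul
        (G'.E.pullback (Submersion.q' G.P G'.P))).mul
          (N.pullback (Submersion.z2 G.P G'.P)).inv)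
      (η.mul (G.E.pullback (Submersion.q G.P G'.P)))),
    ∀ (y₁ y₂ y₃ : G.P.Y) (y'₁ y'₂ y'₃ : G'.P.Y)
      (h₁ : G.P.proj y₁ = G'.P.proj y'₁) (h₂ : G.P.proj y₂ = G'.P.proj y'₂)
      (h₃ : G.P.proj y₃ = G'.P.proj y'₃)
      (h₁₂ : G.P.proj y₁ = G.P.proj y₂) (h₂₃ : G.P.proj y₂ = G.P.proj y₃)
      (h'₁₂ : G'.P.proj y'₁ = G'.P.proj y'₂) (h'₂₃ : G'.P.proj y'₂ = G'.P.proj y'₃)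
      (n₁ : N.fib ⟨(y₁, y'₁), h₁⟩) (n₂ : N.fib ⟨(y₂, y'₂), h₂⟩) (n₃ : N.fib ⟨(y₃, y'₃), h₃⟩)
      (e₁₂ : G.E.fib ⟨(y₁, y₂), h₁₂⟩) (e₂₃ : G.E.fib ⟨(y₂, y₃), h₂₃⟩)
      (e₁₃ d₁₃ : G.E.fib ⟨(y₁, y₃), h₁₂.trans h₂₃⟩)
      (e'₁₂ : G'.E.fib ⟨(y'₁, y'₂), h'₁₂⟩) (e'₂₃ : G'.E.fib ⟨(y'₂, y'₃), h'₂₃⟩)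
      (e'₁₃ : G'.E.fib ⟨(y'₁, y'₃), h'₁₂.trans h'₂₃⟩),
      Θ.toFun ⟨((y₁, y'₁), (y₂, y'₂)), h₁, h₂, h₁₂⟩
        (Bitorsor.pair (Bitorsor.pair n₁ e'₁₂) (Bitorsor.pinv n₂)) =
        Bitorsor.pair (Bitorsor.ofInv (ℓ.val ⟨((y₁, y'₁), (y₂, y'₂)), h₁, h₂, h₁₂⟩)) e₁₂ →
      Θ.toFun ⟨((y₂, y'₂), (y₃, y'₃)), h₂, h₃, h₂₃⟩
        (Bitorsor.pair (Bitorsor.pair n₂ e'₂₃) (Bitorsor.pinv n₃)) =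
        Bitorsor.pair (Bitorsor.ofInv (ℓ.val ⟨((y₂, y'₂), (y₃, y'₃)), h₂, h₃, h₂₃⟩)) e₂₃ →
      Θ.toFun ⟨((y₁, y'₁), (y₃, y'₃)), h₁, h₃, h₁₂.trans h₂₃⟩
        (Bitorsor.pair (Bitorsor.pair n₁ e'₁₃) (Bitorsor.pinv n₃)) =
        Bitorsor.pair
          (Bitorsor.ofInv (ℓ.val ⟨((y₁, y'₁), (y₃, y'₃)), h₁, h₃, h₁₂.trans h₂₃⟩)) d₁₃ →
      Bibundle.Rep (G'.f.val ⟨(y'₁, y'₂, y'₃), h'₁₂, h'₂₃⟩) e'₁₂ e'₂₃ e'₁₃ →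
      Bibundle.Rep (G.f.val ⟨(y₁, y₂, y₃), h₁₂, h₂₃⟩) e₁₂ e₂₃ e₁₃ →
      e₁₃ = d₁₃

end BundleGerbes

/-! ### Gerbes on `M` -/

section Gerbes

variable (M : Type u)

/-- An open cover `{O_α}` of `M`. -/
structure Cover [TopologicalSpace M] : Type (u + 1) where
  idx : Type u
  O : idx → Opens M
  covers : ∀ x, ∃ α, x ∈ O α

/-- A cover `{O_α}` together with a refinement `{O^i_α}`, `O^i_α ⊆ O_α`, such that for any finite
set of indices `α, β, …` the sets `O^i_{αβ…} = O^i_α ∩ O^i_β ∩ …` (with one common `i`) cover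
`O_{αβ…}`. -/
structure RefinedCover [TopologicalSpace M] : Type (u + 1) extends Cover M where
  idx' : Type u
  O' : idx' → idx → Opens M
  le : ∀ i α, O' i α ≤ O α
  covers' : ∀ (A : Finset idx) (x : M), (∀ α ∈ A, x ∈ O α) → ∃ i, ∀ α ∈ A, x ∈ O' i α

variable (k : ℕ) (H : Type u) [TopologicalSpace H] [ChartedSpace (EuclideanSpace ℝ (Fin k)) H]
  [Group H] [LieGroup (𝓡 k) ∞ H]
  (m : ℕ) [TopologicalSpace M] [ChartedSpace (EuclideanSpace ℝ (Fin m)) M]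
  [IsManifold (𝓡 m) ∞ M]

variable {M} in
/-- A subset of `M` as a base space. -/
def onSet (S : Set M) : Base.{u} where
  E := EuclideanSpace ℝ (Fin m)
  F := EuclideanSpace ℝ (Fin m)
  I := 𝓡 m
  X := M
  S := S

variable {M} in
/-- The inclusion of subsets of `M`. -/
def incl {S S' : Set M} (h : S ⊆ S') : Base.Map (onSet m S) (onSet m S') where
  toFun x := x
  smooth := (contMDiff_id (I := 𝓡 m) (M := M)).contMDiffOn
  maps := h

variable {M} in
/-- The base space `U ∩ V`. -/
abbrev on2 (U V : Opens M) : Base.{u} := onSet m {x | x ∈ U ∧ x ∈ V}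

variable {M} in
/-- The base space `U ∩ V ∩ W`. -/
abbrev on3 (U V W : Opens M) : Base.{u} := onSet m {x | x ∈ U ∧ x ∈ V ∧ x ∈ W}

variable {M} in
/-- The inclusion `U ∩ V ∩ W → U ∩ V`. -/
def r12 (U V W : Opens M) : Base.Map (on3 m U V W) (on2 m U V) := incl m fun _ h => ⟨h.1, h.2.1⟩

variable {M} in
/-- The inclusion `U ∩ V ∩ W → V ∩ W`. -/
def r23 (U V W : Opens M) : Base.Map (on3 m U V W) (on2 m V W) := incl m fun _ h => h.2

variable {M} in
/-- The inclusion `U ∩ V ∩ W → U ∩ W`. -/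
def r13 (U V W : Opens M) : Base.Map (on3 m U V W) (on2 m U W) := incl m fun _ h => ⟨h.1, h.2.2⟩

variable {M} in
/-- The inclusion `U ∩ V → U' ∩ V'` for `U ⊆ U'` and `V ⊆ V'`. -/
def incl2 {U V U' V' : Opens M} (h : U ≤ U') (h' : V ≤ V') :
    Base.Map (on2 m U V) (on2 m U' V') := incl m fun _ hx => ⟨h hx.1, h' hx.2⟩

variable {M} in
/-- The inclusion `U ∩ V → U`. -/
def inclL (U V : Opens M) : Base.Map (on2 m U V) (onSet m (U : Set M)) := incl m fun _ hx => hx.1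

variable {M} in
/-- The inclusion `U ∩ V → V`. -/
def inclR (U V : Opens M) : Base.Map (on2 m U V) (onSet m (V : Set M)) := incl m fun _ hx => hx.2

/-- A gerbe on `M`: a cover `{O_α}`, bibundles `E α β` on the double overlaps `O_{αβ}`, and
global central sections `f α β γ` of `(E_{αβ} E_{βγ} E_{αγ}⁻¹)⁻¹` on the triple overlaps with
`f_{αβδ} φ_{αβ}(f_{βγδ}) = f_{αγδ} f_{αβγ}` on quadruple overlaps.  The latter condition is spelled
out on representatives exactly as for bundle gerbes. -/
structure Gerbe : Type (u + 1) where
  C : Cover M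
  E : ∀ α β, Bibundle k H (on2 m (C.O α) (C.O β))
  f : ∀ α β γ, CentralSection
    ((((E α β).pullback (r12 m (C.O α) (C.O β) (C.O γ))).mul
      ((E β γ).pullback (r23 m (C.O α) (C.O β) (C.O γ)))).mul
        ((E α γ).pullback (r13 m (C.O α) (C.O β) (C.O γ))).inv).inv
  cocycle : ∀ (α β γ δ : C.idx) (x : M)
    (hα : x ∈ C.O α) (hβ : x ∈ C.O β) (hγ : x ∈ C.O γ) (hδ : x ∈ C.O δ)
    (e₁₂ : (E α β).fib ⟨x, hα, hβ⟩) (e₂₃ : (E β γ).fib ⟨x, hβ, hγ⟩)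
    (e₃₄ : (E γ δ).fib ⟨x, hγ, hδ⟩) (e₁₃ : (E α γ).fib ⟨x, hα, hγ⟩)
    (e₂₄ : (E β δ).fib ⟨x, hβ, hδ⟩) (e₁₄ e'₁₄ : (E α δ).fib ⟨x, hα, hδ⟩),
    Bibundle.Rep ((f β γ δ).val ⟨x, hβ, hγ, hδ⟩) e₂₃ e₃₄ e₂₄ →
    Bibundle.Rep ((f α β δ).val ⟨x, hα, hβ, hδ⟩) e₁₂ e₂₄ e₁₄ →
    Bibundle.Rep ((f α β γ).val ⟨x, hα, hβ, hγ⟩) e₁₂ e₂₃ e₁₃ →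
    Bibundle.Rep ((f α γ δ).val ⟨x, hα, hγ, hδ⟩) e₁₃ e₃₄ e'₁₄ →
    e₁₄ = e'₁₄

variable {k H m M}

/-- Stable equivalence of gerbes: on a common refinement `{P_a}` of the two covers
(`P_a ⊆ O_{r a} ∩ O'_{r' a}`) there are bibundles `N_a` on `P_a`, and bibundles `η_{ab}` on `P_{ab}`
with global central sections `ℓ_{ab}` of `η_{ab}⁻¹`, and isomorphisms
`N_a E'_{ab} N_b⁻¹ = η_{ab} E_{ab}` with
`φ_a(f'_{abc}) = ℓ_{ac}⁻¹ f_{abc} φ_{ab}(ℓ_{bc}) ℓ_{ab}`; the last condition is spelled out on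
representatives exactly as for bundle gerbes. -/
def Gerbe.StableEquiv (G G' : Gerbe M k H m) : Prop :=
  ∃ (P : Cover M) (r : P.idx → G.C.idx) (r' : P.idx → G'.C.idx)
    (hr : ∀ a, P.O a ≤ G.C.O (r a)) (hr' : ∀ a, P.O a ≤ G'.C.O (r' a))
    (N : ∀ a, Bibundle k H (onSet m (P.O a : Set M)))
    (η : ∀ a b, Bibundle k H (on2 m (P.O a) (P.O b)))
    (ℓ : ∀ a b, CentralSection (η a b).inv)
    (Θ : ∀ a b, BibundleIso
      ((((N a).pullback (inclL m (P.O a) (P.O b))).mul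
        ((G'.E (r' a) (r' b)).pullback (incl2 m (hr' a) (hr' b)))).mul
          ((N b).pullback (inclR m (P.O a) (P.O b))).inv)
      ((η a b).mul ((G.E (r a) (r b)).pullback (incl2 m (hr a) (hr b))))),
    ∀ (a b c : P.idx) (x : M) (ha : x ∈ P.O a) (hb : x ∈ P.O b) (hc : x ∈ P.O c)
      (n₁ : (N a).fib ⟨x, ha⟩) (n₂ : (N b).fib ⟨x, hb⟩) (n₃ : (N c).fib ⟨x, hc⟩)
      (e₁₂ : (G.E (r a) (r b)).fib ⟨x, hr a ha, hr b hb⟩)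
      (e₂₃ : (G.E (r b) (r c)).fib ⟨x, hr b hb, hr c hc⟩)
      (e₁₃ d₁₃ : (G.E (r a) (r c)).fib ⟨x, hr a ha, hr c hc⟩)
      (e'₁₂ : (G'.E (r' a) (r' b)).fib ⟨x, hr' a ha, hr' b hb⟩)
      (e'₂₃ : (G'.E (r' b) (r' c)).fib ⟨x, hr' b hb, hr' c hc⟩)
      (e'₁₃ : (G'.E (r' a) (r' c)).fib ⟨x, hr' a ha, hr' c hc⟩),
      (Θ a b).toFun ⟨x, ha, hb⟩
        (Bitorsor.pair (Bitorsor.pair n₁ e'₁₂) (Bitorsor.pinv n₂)) =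
        Bitorsor.pair (Bitorsor.ofInv ((ℓ a b).val ⟨x, ha, hb⟩)) e₁₂ →
      (Θ b c).toFun ⟨x, hb, hc⟩
        (Bitorsor.pair (Bitorsor.pair n₂ e'₂₃) (Bitorsor.pinv n₃)) =
        Bitorsor.pair (Bitorsor.ofInv ((ℓ b c).val ⟨x, hb, hc⟩)) e₂₃ →
      (Θ a c).toFun ⟨x, ha, hc⟩
        (Bitorsor.pair (Bitorsor.pair n₁ e'₁₃) (Bitorsor.pinv n₃)) =
        Bitorsor.pair (Bitorsor.ofInv ((ℓ a c).val ⟨x, ha, hc⟩)) d₁₃ →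
      Bibundle.Rep
        ((G'.f (r' a) (r' b) (r' c)).val ⟨x, hr' a ha, hr' b hb, hr' c hc⟩) e'₁₂ e'₂₃ e'₁₃ →
      Bibundle.Rep
        ((G.f (r a) (r b) (r c)).val ⟨x, hr a ha, hr b hb, hr c hc⟩) e₁₂ e₂₃ e₁₃ →
      e₁₃ = d₁₃

/-- Smooth local sections `σ_α : O_α → Y` of a submersion `Y → M`, relative to an open cover.
(The values of `σ α` outside `O_α` play no role.) -/
structure LocalSections (P : Submersion m M) : Type (u + 1) where
  C : Cover M
  σ : C.idx → M → P.Y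
  smooth : ∀ α, ContMDiffOn (𝓡 m) (𝓡 P.n) ∞ (σ α) (C.O α)
  isSection : ∀ α, ∀ x ∈ C.O α, P.proj (σ α x) = x

namespace LocalSections

variable {P : Submersion m M} (L : LocalSections P)

/-- The map `(σ_α, σ_β) : O_{αβ} → Y^{[2]}`. -/
def map2 (α β : L.C.idx) : Base.Map (on2 m (L.C.O α) (L.C.O β)) P.dbl where
  toFun x := (L.σ α x, L.σ β x)
  smooth := ((L.smooth α).mono fun _ h => h.1).prodMk ((L.smooth β).mono fun _ h => h.2)
  maps x h := (L.isSection α x h.1).trans (L.isSection β x h.2).symm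

/-- The map `(σ_α, σ_β, σ_γ) : O_{αβγ} → Y^{[3]}`. -/
def map3 (α β γ : L.C.idx) : Base.Map (on3 m (L.C.O α) (L.C.O β) (L.C.O γ)) P.tpl where
  toFun x := (L.σ α x, L.σ β x, L.σ γ x)
  smooth := ((L.smooth α).mono fun _ h => h.1).prodMk
    (((L.smooth β).mono fun _ h => h.2.1).prodMk ((L.smooth γ).mono fun _ h => h.2.2))
  maps x h := ⟨(L.isSection α x h.1).trans (L.isSection β x h.2.1).symm,
    (L.isSection β x h.2.1).trans (L.isSection γ x h.2.2).symm⟩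

end LocalSections

/-- The gerbe obtained from a bundle gerbe by pull-back along local sections `σ_α : O_α → Y`:
`E_{αβ} = (σ_α, σ_β)^* ℰ` and `f_{αβγ} = (σ_α, σ_β, σ_γ)^* f`. -/
def BundleGerbe.toGerbe (G : BundleGerbe k H m M) (L : LocalSections G.P) : Gerbe M k H m where
  C := L.C
  E α β := G.E.pullback (L.map2 α β)
  f α β γ :=
    { val := fun x => G.f.val ((L.map3 α β γ).pt x)
      smooth := fun i => ((G.f.smooth i).pullback (L.map3 α β γ)).mono fun _ hx => hx
      central := fun x h => G.f.central ((L.map3 α β γ).pt x) h }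
  cocycle α β γ δ x hα hβ hγ hδ e₁₂ e₂₃ e₃₄ e₁₃ e₂₄ e₁₄ e'₁₄ h1 h2 h3 h4 :=
    G.cocycle (L.σ α x) (L.σ β x) (L.σ γ x) (L.σ δ x)
      ((L.isSection α x hα).trans (L.isSection β x hβ).symm)
      ((L.isSection β x hβ).trans (L.isSection γ x hγ).symm)
      ((L.isSection γ x hγ).trans (L.isSection δ x hδ).symm)
      e₁₂ e₂₃ e₃₄ e₁₃ e₂₄ e₁₄ e'₁₄ h1 h2 h3 h4

/-! ### Local data on `M` -/

variable (k m) in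
/-- A map `φ` from `U ⊆ M` to `Aut(H)` is smooth: `(x, h) ↦ φ_x(h)` and `(x, h) ↦ φ_x⁻¹(h)` are
smooth on `U × H`.  (In particular each `φ_x` is an automorphism of the Lie group `H`.) -/
def SmoothAut (φ : M → MulAut H) (U : Set M) : Prop :=
  ContMDiffOn ((𝓡 m).prod (𝓡 k)) (𝓡 k) ∞ (fun p : M × H => φ p.1 p.2) (U ×ˢ univ) ∧
  ContMDiffOn ((𝓡 m).prod (𝓡 k)) (𝓡 k) ∞ (fun p : M × H => (φ p.1).symm p.2) (U ×ˢ univ)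

/-- The set `O^i_{αβ} = O^i_α ∩ O^i_β`. -/
def RefinedCover.D2 (C : RefinedCover M) (i : C.idx') (α β : C.idx) : Set M :=
  {x | x ∈ C.O' i α ∧ x ∈ C.O' i β}

/-- The set `O^i_{αβγ} = O^i_α ∩ O^i_β ∩ O^i_γ`. -/
def RefinedCover.D3 (C : RefinedCover M) (i : C.idx') (α β γ : C.idx) : Set M :=
  {x | x ∈ C.O' i α ∧ x ∈ C.O' i β ∧ x ∈ C.O' i γ}

variable (k H m M) in
/-- Local data `{h^{ij}_{αβ}, φ^i_{αβ}, f^i_{αβγ}}` on `M`: smooth maps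
`h^{ij}_{αβ} : O^{ij}_{αβ} → H`, `φ^i_{αβ} : O^i_{αβ} → Aut(H)`, `f^i_{αβγ} : O^i_{αβγ} → H` such that
`{h^{ij}_{αβ}, φ^i_{αβ}}` are local data of a bibundle on `O_{αβ}` and the nonabelian Čech
2-cocycle relations hold.  Here `O^{ij}_{αβ} = O^i_{αβ} ∩ O^j_{αβ}`; values outside the indicated
domains play no role. -/
structure LocalData : Type (u + 1) where
  C : RefinedCover M
  h : C.idx' → C.idx' → C.idx → C.idx → M → H
  φ : C.idx' → C.idx → C.idx → M → MulAut H
  f : C.idx' → C.idx → C.idx → C.idx → M → H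
  h_smooth : ∀ i j α β, ContMDiffOn (𝓡 m) (𝓡 k) ∞ (h i j α β) (C.D2 i α β ∩ C.D2 j α β)
  φ_smooth : ∀ i α β, SmoothAut k m (φ i α β) (C.D2 i α β)
  f_smooth : ∀ i α β γ, ContMDiffOn (𝓡 m) (𝓡 k) ∞ (f i α β γ) (C.D3 i α β γ)
  h_cocycle : ∀ i j l α β, ∀ x ∈ C.D2 i α β ∩ C.D2 j α β ∩ C.D2 l α β,
    h i j α β x * h j l α β x = h i l α β x
  Ad_h : ∀ i j α β, ∀ x ∈ C.D2 i α β ∩ C.D2 j α β,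
    MulAut.conj (h i j α β x) = φ i α β x * (φ j α β x)⁻¹
  h_mul : ∀ i j α β γ, ∀ x ∈ C.D3 i α β γ ∩ C.D3 j α β γ,
    h i j α β x * φ j α β x (h i j β γ x) = f i α β γ x * h i j α γ x * (f j α β γ x)⁻¹
  φ_mul : ∀ i α β γ, ∀ x ∈ C.D3 i α β γ,
    φ i α β x * φ i β γ x = MulAut.conj (f i α β γ x) * φ i α γ x
  f_cocycle : ∀ i α β γ δ, ∀ x ∈ C.D3 i α β γ, x ∈ C.O' i δ →
    φ i α β x (f i β γ δ x) * f i α β δ x = f i α β γ x * f i α γ δ x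

/-- Stable isomorphism of local data: on a common refinement `{P_a, P^i_a}` of the two (refined)
covers, `P^i_a ⊆ O^{s i}_{r a} ∩ O'^{s' i}_{r' a}`, there are local data
`{hN^{ij}_a, φN^i_a}` of bibundles `N_a` on `P_a` and smooth maps `ℓ^i_{ab} : P^i_{ab} → H` with
`hN^{ij}_a φN^j_a(h'^{ij}_{ab}) φN^j_a φ'^j_{ab} (φN^j_b)⁻¹((hN^{ij}_b)⁻¹) = ℓ^i_{ab} h^{ij}_{ab} (ℓ^j_{ab})⁻¹`,
`φN^i_a φ'^i_{ab} (φN^i_b)⁻¹ = Ad_{ℓ^i_{ab}} φ^i_{ab}` and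
`φN^i_a(f'^i_{abc}) = ℓ^i_{ab} φ^i_{ab}(ℓ^i_{bc}) f^i_{abc} (ℓ^i_{ac})⁻¹`. -/
def LocalData.StableIso (L L' : LocalData M k H m) : Prop :=
  ∃ (P : RefinedCover M) (r : P.idx → L.C.idx) (r' : P.idx → L'.C.idx)
    (s : P.idx' → L.C.idx') (s' : P.idx' → L'.C.idx')
    (hN : P.idx' → P.idx' → P.idx → M → H) (φN : P.idx' → P.idx → M → MulAut H)
    (ℓ : P.idx' → P.idx → P.idx → M → H),
    (∀ a, P.O a ≤ L.C.O (r a)) ∧ (∀ a, P.O a ≤ L'.C.O (r' a)) ∧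
    (∀ i a, P.O' i a ≤ L.C.O' (s i) (r a)) ∧ (∀ i a, P.O' i a ≤ L'.C.O' (s' i) (r' a)) ∧
    (∀ i j a, ContMDiffOn (𝓡 m) (𝓡 k) ∞ (hN i j a) ((P.O' i a : Set M) ∩ P.O' j a)) ∧
    (∀ i a, SmoothAut k m (φN i a) (P.O' i a)) ∧
    (∀ i a b, ContMDiffOn (𝓡 m) (𝓡 k) ∞ (ℓ i a b) (P.D2 i a b)) ∧
    (∀ i j l a, ∀ x ∈ (P.O' i a : Set M) ∩ P.O' j a ∩ P.O' l a,
      hN i j a x * hN j l a x = hN i l a x) ∧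
    (∀ i j a, ∀ x ∈ (P.O' i a : Set M) ∩ P.O' j a,
      MulAut.conj (hN i j a x) = φN i a x * (φN j a x)⁻¹) ∧
    (∀ i j a b, ∀ x ∈ P.D2 i a b ∩ P.D2 j a b,
      hN i j a x * φN j a x (L'.h (s' i) (s' j) (r' a) (r' b) x) *
        (φN j a x * L'.φ (s' j) (r' a) (r' b) x * (φN j b x)⁻¹) (hN i j b x)⁻¹ =
      ℓ i a b x * L.h (s i) (s j) (r a) (r b) x * (ℓ j a b x)⁻¹) ∧
    (∀ i a b, ∀ x ∈ P.D2 i a b,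
      φN i a x * L'.φ (s' i) (r' a) (r' b) x * (φN i b x)⁻¹ =
      MulAut.conj (ℓ i a b x) * L.φ (s i) (r a) (r b) x) ∧
    (∀ i a b c, ∀ x ∈ P.D3 i a b c,
      φN i a x (L'.f (s' i) (r' a) (r' b) (r' c) x) =
      ℓ i a b x * L.φ (s i) (r a) (r b) x (ℓ i b c x) * L.f (s i) (r a) (r b) (r c) x *
        (ℓ i a c x)⁻¹)

/-- `L` is a set of local data of the gerbe `G`: the cover of `L` is a refinement of the cover of
`G`, and there are smooth sections `t^i_{ab}` over `O^i_{ab}` of (the restrictions of) the bibundles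
`E_{ab}` such that `t^i_{ab} = h^{ij}_{ab} t^j_{ab}`, `φ^i_{ab} = φ_{t^i_{ab}}` and
`f_{abc}⁻¹ = (f^i_{abc})⁻¹ t^i_{ab} t^i_{bc} (t^i_{ac})⁻¹`. -/
def LocalData.IsLocalDataOf (L : LocalData M k H m) (G : Gerbe M k H m) : Prop :=
  ∃ (r : L.C.idx → G.C.idx) (hr : ∀ a, L.C.O a ≤ G.C.O (r a))
    (t : ∀ (i : L.C.idx') (a b : L.C.idx) (x : on2 m (L.C.O' i a) (L.C.O' i b)),
      ((G.E (r a) (r b)).pullback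
        (incl2 m ((L.C.le i a).trans (hr a)) ((L.C.le i b).trans (hr b)))).fib x),
    (∀ i a b, ((G.E (r a) (r b)).pullback
      (incl2 m ((L.C.le i a).trans (hr a)) ((L.C.le i b).trans (hr b)))).IsSection ⊤ (t i a b)) ∧
    (∀ i j a b x (hia : x ∈ L.C.O' i a) (hib : x ∈ L.C.O' i b)
      (hja : x ∈ L.C.O' j a) (hjb : x ∈ L.C.O' j b),
      t i a b ⟨x, hia, hib⟩ =
        ((G.E (r a) (r b)).fib ⟨x, hr a (L.C.le i a hia), hr b (L.C.le i b hib)⟩).l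
          (L.h i j a b x) (t j a b ⟨x, hja, hjb⟩)) ∧
    (∀ i a b x (ha : x ∈ L.C.O' i a) (hb : x ∈ L.C.O' i b) (g : H),
      L.φ i a b x g =
        ((G.E (r a) (r b)).fib ⟨x, hr a (L.C.le i a ha), hr b (L.C.le i b hb)⟩).phi
          (t i a b ⟨x, ha, hb⟩) g) ∧
    (∀ i a b c x (ha : x ∈ L.C.O' i a) (hb : x ∈ L.C.O' i b) (hc : x ∈ L.C.O' i c),
      Bibundle.Rep
        ((G.f (r a) (r b) (r c)).val
          ⟨x, hr a (L.C.le i a ha), hr b (L.C.le i b hb), hr c (L.C.le i c hc)⟩)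
        (((G.E (r a) (r b)).fib ⟨x, hr a (L.C.le i a ha), hr b (L.C.le i b hb)⟩).l
          (L.f i a b c x)⁻¹ (t i a b ⟨x, ha, hb⟩))
        (t i b c ⟨x, hb, hc⟩) (t i a c ⟨x, ha, hc⟩))

end Gerbes

end

end NBG

/-! A central section of `(E₁₂ E₂₃ E₁₃⁻¹)⁻¹` is the same thing as an isomorphism of bibundles `E₁₂
E₂₃ = E₁₃`. The section `f` of a gerbe is therefore a multiplication, and its cocycle condition is
associativity (`Tri.assoc`). In the same way `(η, ℓ, Θ)` in a stable isomorphism amounts to an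
isomorphism `N₁ E'₁₂ = E₁₂ N₂`, because `ℓ` trivialises `η`; the condition on `ℓ` says that these
isomorphisms respect the two multiplications. They are handled as smooth relations: triangles `a b =
c` (`IsTri`, `IsTriangle`) and squares `n₁ e' = e n₂` (`IsSq`, `IsSquare`), in which one entry is a
smooth function of the others. `CentralSection.isTriangle`, `BibundleIso.isSquare` and their
converses translate, so that both stable relations become the existence of a `Comparison`.

Comparisons of gerbes compose by stacking squares, with columns `N N'`, and are inverted by
inverting the columns. Two refinement maps `r`, `r'` into the cover of one gerbe are compared by
`N_a = E_{r a, r' a}`, the squares being instances of associativity. This gives the equivalence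
relation on gerbes.

Local data are coordinates. Local sections `t^i_{ab}` turn a gerbe into functions `h`, `φ`, `f`, and
the relations imposed on these are exactly what is needed to glue the bibundles and the
multiplication back together (`Gerbe.exists_localData`, `LocalData.exists_gerbe`). A comparison
written in coordinates is a stable isomorphism of local data, and conversely
(`stableIso_of_stableEquiv`, `stableEquiv_of_stableIso`).

For bundle gerbes the central fact is `BundleGerbe.stableIso_iff_toGerbe`: pull-back along local
sections preserves and reflects the stable relations. To recover a bibundle on `Y ×_M Y'` from a
comparison of the induced gerbes, take `E_{y,σ(x)} N_a E'_{y',σ'(x)}⁻¹` at a point `(y, y')` over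
`x`. Squares with unit horizontal sides identify the bibundles for different `a`, so that they
descend. Surjectivity on classes comes from the disjoint union of the members of a cover, which
submerses onto `M` (`Gerbe.exists_bundleGerbe`). -/

namespace NBG

/-! ### Calculus in bitorsors -/

namespace Bitorsor

variable {H : Type u} [Group H] (T : Bitorsor H)

lemma l_injective (e : T) {g h : H} (hgh : T.l g e = T.l h e) : g = h := by
  rw [← T.div_eq hgh, T.div_eq rfl]

lemma r_injective (e : T) {g h : H} (hgh : T.r e g = T.r e h) : g = h := by
  rw [← T.rdiv_eq hgh, T.rdiv_eq rfl]

@[simp] lemma l_inv_l (g : H) (e : T) : T.l g⁻¹ (T.l g e) = e := by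
  rw [← T.l_mul, inv_mul_cancel, T.l_one]

@[simp] lemma l_l_inv (g : H) (e : T) : T.l g (T.l g⁻¹ e) = e := by
  rw [← T.l_mul, mul_inv_cancel, T.l_one]

@[simp] lemma r_inv_r (g : H) (e : T) : T.r (T.r e g⁻¹) g = e := by
  rw [← T.r_mul, inv_mul_cancel, T.r_one]

@[simp] lemma r_r_inv (g : H) (e : T) : T.r (T.r e g) g⁻¹ = e := by
  rw [← T.r_mul, mul_inv_cancel, T.r_one]

@[simp] lemma div_self (e : T) : T.div e e = 1 := T.div_eq (T.l_one e)

@[simp] lemma div_l_self (g : H) (e : T) : T.div (T.l g e) e = g := T.div_eq rfl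

lemma div_l (g : H) (e f : T) : T.div (T.l g e) f = g * T.div e f := by
  apply T.div_eq
  rw [T.l_mul, T.l_div]

lemma div_mul_div (e f d : T) : T.div e f * T.div f d = T.div e d := by
  symm
  apply T.div_eq
  rw [T.l_mul, T.l_div, T.l_div]

lemma div_inv (e f : T) : (T.div e f)⁻¹ = T.div f e := by
  rw [inv_eq_iff_mul_eq_one, T.div_mul_div, T.div_self]

lemma div_l_right (g : H) (e f : T) : T.div e (T.l g f) = T.div e f * g⁻¹ := by
  rw [← T.div_inv, T.div_l, mul_inv_rev, T.div_inv]

lemma phi_mul (e : T) (g h : H) : T.phi e (g * h) = T.phi e g * T.phi e h := by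
  apply T.div_eq
  rw [T.l_mul, T.l_phi, ← T.comm, T.l_phi, T.r_mul]

lemma phiInv_phi (e : T) (h : H) : T.phiInv e (T.phi e h) = h :=
  T.rdiv_eq (T.l_phi e h).symm

lemma phi_phiInv (e : T) (h : H) : T.phi e (T.phiInv e h) = h :=
  T.div_eq (T.r_phiInv e h).symm

/-- `φ_e` as an automorphism of `H`. -/
noncomputable def phiAut (e : T) : MulAut H where
  toFun := T.phi e
  invFun := T.phiInv e
  left_inv := T.phiInv_phi e
  right_inv := T.phi_phiInv e
  map_mul' := T.phi_mul e

lemma phiAut_apply (e : T) (h : H) : T.phiAut e h = T.phi e h := rfl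

@[simp] lemma phi_one (e : T) : T.phi e 1 = 1 := map_one (T.phiAut e)

@[simp] lemma phi_inv (e : T) (h : H) : T.phi e h⁻¹ = (T.phi e h)⁻¹ := map_inv (T.phiAut e) h

lemma phi_injective (e : T) : Function.Injective (T.phi e) := (T.phiAut e).injective

lemma r_eq_l (e : T) (h : H) : T.r e h = T.l (T.phi e h) e := (T.l_phi e h).symm

lemma phi_l (g : H) (e : T) (h : H) : T.phi (T.l g e) h = g * T.phi e h * g⁻¹ := by
  apply T.div_eq
  rw [T.l_mul, T.l_inv_l, T.l_mul, T.l_phi, T.comm]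

/-- Changing the base point conjugates `φ` by the quotient of the points; smoothness of `φ` along
one section thus passes to every smooth section. -/
lemma phi_eq_div (e f : T) (h : H) :
    T.phi e h = T.div e f * T.phi f h * (T.div e f)⁻¹ := by
  rw [← T.phi_l, T.l_div]

lemma phiInv_eq_div (e f : T) (h : H) :
    T.phiInv e h = T.phiInv f ((T.div e f)⁻¹ * h * T.div e f) := by
  apply T.phi_injective e
  rw [T.phi_phiInv, T.phi_eq_div e f, T.phi_phiInv]
  group

/-- The bitorsor with underlying set `H` and right action twisted by an automorphism. -/
def twist (φ : MulAut H) : Bitorsor H where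
  carrier := H
  l h e := h * e
  r e h := e * φ h
  nonempty := ⟨1⟩
  l_one := one_mul
  l_mul := mul_assoc
  r_one e := by simp
  r_mul e h k := by simp [mul_assoc]
  comm k e h := mul_assoc _ _ _
  l_simply e e' := ⟨e * e'⁻¹, by simp, fun h hh => by simp [← hh]⟩
  r_simply e e' := ⟨φ⁻¹ (e'⁻¹ * e), by simp, fun h hh => by simp [← hh]⟩

lemma twist_div (φ : MulAut H) (e f : H) : (twist φ).div e f = e * f⁻¹ :=
  (twist φ).div_eq (inv_mul_cancel_right e f)

lemma twist_phi (φ : MulAut H) (e : H) (h : H) : (twist φ).phi e h = e * φ h * e⁻¹ :=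
  (twist φ).div_eq (inv_mul_cancel_right (e * φ h) e)

lemma twist_phiInv (φ : MulAut H) (e : H) (h : H) :
    (twist φ).phiInv e h = φ.symm (e⁻¹ * h * e) := by
  refine (twist φ).rdiv_eq ?_
  change e * φ (φ.symm (e⁻¹ * h * e)) = h * e
  rw [MulEquiv.apply_symm_apply, mul_assoc, mul_inv_cancel_left]

variable {T}

lemma pair_l {T' : Bitorsor H} (g : H) (e : T) (e' : T') :
    (T.mul T').l g (pair e e') = pair (T.l g e) e' := rfl

lemma pair_r {T' : Bitorsor H} (g : H) (e : T) (e' : T') :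
    (T.mul T').r (pair e e') g = pair e (T'.r e' g) := rfl

lemma pair_mid {T' : Bitorsor H} (g : H) (e : T) (e' : T') :
    pair (T.r e g) e' = pair e (T'.l g e') := pt_r _ _ _

lemma exists_pair {T' : Bitorsor H} (p : T.mul T') : ∃ (e : T) (e' : T'), p = pair e e' := by
  induction p using Quotient.inductionOn with
  | h p => exact ⟨p.1, p.2, rfl⟩

/-- The discrepancy between the first factors is moved across the product by the rule `[e ◁ h, e'] =
[e, h e']`. -/
lemma exists_pair_left {T' : Bitorsor H} (e : T) (p : T.mul T') : ∃ e' : T', p = pair e e' := by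
  obtain ⟨f, f', rfl⟩ := exists_pair p
  refine ⟨T'.l (T.rdiv f e) f', ?_⟩
  rw [← pair_mid, r_rdiv]

lemma pinv_l (g : H) (e : T) : T.inv.l g (pinv e) = pinv (T.r e g⁻¹) := rfl

lemma pinv_r (g : H) (e : T) : T.inv.r (pinv e) g = pinv (T.l g⁻¹ e) := rfl

/-! ### Commutative squares of bitorsors -/

variable {N₁ E' N₂ E : Bitorsor H}

/-- A relation `n₁ e' = e n₂` that identifies the bitorsors `N₁ E'` and `E N₂`. -/
structure IsSq (R : N₁ → E' → N₂ → E → Prop) : Prop where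
  nonempty : ∃ n₁ e' n₂ e, R n₁ e' n₂ e
  phi_eq : ∀ {n₁ e' n₂ e}, R n₁ e' n₂ e →
    ∀ h, N₁.phi n₁ (E'.phi e' h) = E.phi e (N₂.phi n₂ h)
  l_iff : ∀ {n₁ e' n₂ e}, R n₁ e' n₂ e → ∀ g k m p,
    (R (N₁.l g n₁) (E'.l k e') (N₂.l m n₂) (E.l p e) ↔ g * N₁.phi n₁ k = p * E.phi e m)

namespace IsSq

variable {R : N₁ → E' → N₂ → E → Prop}

/-- One quadruple determines the whole square, since any other arises from it by left translations
and `l_iff` decides those. This equation between quotients is the working form of a square. -/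
lemma iff (hR : IsSq R) {n₁ e' n₂ e} (h : R n₁ e' n₂ e) (a b c d) :
    R a b c d ↔
      N₁.div a n₁ * N₁.phi n₁ (E'.div b e') = E.div d e * E.phi e (N₂.div c n₂) := by
  rw [← hR.l_iff h]
  simp only [l_div]

/-- Each entry occurs once in the equation of `IsSq.iff`, through a quotient, so the equation can be
solved for it; `existsUnique'` and `existsUnique₂` solve it for other entries. -/
lemma existsUnique (hR : IsSq R) (n₁ e' n₂) : ∃! e, R n₁ e' n₂ e := by
  obtain ⟨a, b, c, d, h⟩ := hR.nonempty
  refine ⟨E.l (N₁.div n₁ a * N₁.phi a (E'.div e' b) * (E.phi d (N₂.div n₂ c))⁻¹) d, ?_, ?_⟩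
  · simp only
    rw [hR.iff h, div_l_self, inv_mul_cancel_right]
  · intro y hy
    rw [hR.iff h] at hy
    rw [hy, mul_inv_cancel_right, l_div]

lemma existsUnique' (hR : IsSq R) (n₁ n₂ e) : ∃! e', R n₁ e' n₂ e := by
  obtain ⟨a, b, c, d, h⟩ := hR.nonempty
  refine ⟨E'.l (N₁.phiInv a ((N₁.div n₁ a)⁻¹ * (E.div e d * E.phi d (N₂.div n₂ c)))) b, ?_, ?_⟩
  · simp only
    rw [hR.iff h, div_l_self, phi_phiInv, mul_inv_cancel_left]
  · intro y hy
    rw [hR.iff h] at hy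
    rw [← hy, inv_mul_cancel_left, phiInv_phi, l_div]

lemma eq (hR : IsSq R) {n₁ e' n₂ e d} (h : R n₁ e' n₂ e) (h' : R n₁ e' n₂ d) : e = d :=
  (hR.existsUnique n₁ e' n₂).unique h h'

lemma left (hR : IsSq R) {n₁ e' n₂ e} (g : H) (h : R n₁ e' n₂ e) :
    R (N₁.l g n₁) e' n₂ (E.l g e) := by
  have := (hR.l_iff h g 1 1 g).2 (by simp)
  simpa only [l_one] using this

/-- This balance makes the relation descend to the product `N₁ E'`; `mid'` does the same for `E N₂`.
-/
lemma mid (hR : IsSq R) {n₁ e' n₂ e} (g : H) :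
    R (N₁.r n₁ g) e' n₂ e ↔ R n₁ (E'.l g e') n₂ e := by
  obtain ⟨d, h, -⟩ := hR.existsUnique n₁ e' n₂
  rw [hR.iff h, hR.iff h, r_eq_l]
  simp

lemma mid' (hR : IsSq R) {n₁ e' n₂ e} (g : H) :
    R n₁ e' (N₂.l g n₂) e ↔ R n₁ e' n₂ (E.r e g) := by
  obtain ⟨d, h, -⟩ := hR.existsUnique' n₁ n₂ e
  rw [hR.iff h, hR.iff h, r_eq_l]
  simp

/-- Right translations become left translations through `φ`, and `phi_eq` says that the two sides
contribute the same element. -/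
lemma right (hR : IsSq R) {n₁ e' n₂ e} (g : H) (h : R n₁ e' n₂ e) :
    R n₁ (E'.r e' g) (N₂.r n₂ g) e := by
  rw [hR.iff h, r_eq_l, r_eq_l]
  simp [hR.phi_eq h]

end IsSq

/-- The square generated by one commutative quadruple. -/
def sqOf (n₁ : N₁) (e' : E') (n₂ : N₂) (e : E) (a : N₁) (b : E') (c : N₂) (d : E) : Prop :=
  N₁.div a n₁ * N₁.phi n₁ (E'.div b e') = E.div d e * E.phi e (N₂.div c n₂)

lemma sqOf_self (n₁ : N₁) (e' : E') (n₂ : N₂) (e : E) : sqOf n₁ e' n₂ e n₁ e' n₂ e := by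
  simp [sqOf]

/-- Agreement of the automorphisms at the generating quadruple is enough: at another quadruple both
sides are conjugated, by elements that `sqOf` declares equal. -/
lemma isSq_sqOf {n₁ : N₁} {e' : E'} {n₂ : N₂} {e : E}
    (h : ∀ h, N₁.phi n₁ (E'.phi e' h) = E.phi e (N₂.phi n₂ h)) : IsSq (sqOf n₁ e' n₂ e) where
  nonempty := ⟨n₁, e', n₂, e, sqOf_self _ _ _ _⟩
  phi_eq := by
    intro a b c d habcd x
    unfold sqOf at habcd
    rw [N₁.phi_eq_div a n₁, E'.phi_eq_div b e', E.phi_eq_div d e, N₂.phi_eq_div c n₂]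
    simp only [phi_mul, phi_inv, h]
    calc _ = (N₁.div a n₁ * N₁.phi n₁ (E'.div b e')) * E.phi e (N₂.phi n₂ x) *
          (N₁.div a n₁ * N₁.phi n₁ (E'.div b e'))⁻¹ := by group
      _ = _ := by rw [habcd]; group
  l_iff := by
    intro a b c d habcd g k m p
    unfold sqOf at habcd ⊢
    rw [div_l, div_l, div_l, div_l, N₁.phi_eq_div a n₁, E.phi_eq_div d e, phi_mul, phi_mul]
    calc _ ↔ g * N₁.div a n₁ * (N₁.phi n₁ k) * (N₁.div a n₁)⁻¹ *
            (N₁.div a n₁ * N₁.phi n₁ (E'.div b e')) =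
          p * E.div d e * (E.phi e m) * (E.div d e)⁻¹ * (E.div d e * E.phi e (N₂.div c n₂)) := by
          simp only [mul_assoc, inv_mul_cancel_left]
      _ ↔ _ := by rw [habcd, mul_left_inj]; simp only [mul_assoc]

/-- A relation `a b = c` that identifies the bitorsors `A B` and `C`. -/
structure IsTri {A B C : Bitorsor H} (R : A → B → C → Prop) : Prop where
  nonempty : ∃ a b c, R a b c
  phi_eq : ∀ {a b c}, R a b c → ∀ h, A.phi a (B.phi b h) = C.phi c h
  l_iff : ∀ {a b c}, R a b c → ∀ g k p,
    (R (A.l g a) (B.l k b) (C.l p c) ↔ g * A.phi a k = p)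

namespace IsTri

variable {A B C D F : Bitorsor H} {R : A → B → C → Prop} {R' : D → F → C → Prop}

lemma iff (hR : IsTri R) {a b c} (h : R a b c) (a' b' c') :
    R a' b' c' ↔ A.div a' a * A.phi a (B.div b' b) = C.div c' c := by
  rw [← hR.l_iff h]
  simp only [l_div]

lemma existsUnique (hR : IsTri R) (a b) : ∃! c, R a b c := by
  obtain ⟨a', b', c', h⟩ := hR.nonempty
  refine ⟨C.l (A.div a a' * A.phi a' (B.div b b')) c', ?_, ?_⟩
  · simp only
    rw [hR.iff h, div_l_self]
  · intro y hy
    rw [hR.iff h] at hy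
    rw [hy, l_div]

lemma existsUnique_left (hR : IsTri R) (b c) : ∃! a, R a b c := by
  obtain ⟨a', b', c', h⟩ := hR.nonempty
  refine ⟨A.l (C.div c c' * (A.phi a' (B.div b b'))⁻¹) a', ?_, ?_⟩
  · simp only
    rw [hR.iff h, div_l_self, inv_mul_cancel_right]
  · intro y hy
    rw [hR.iff h] at hy
    rw [← hy, mul_inv_cancel_right, l_div]

lemma existsUnique_right (hR : IsTri R) (a c) : ∃! b, R a b c := by
  obtain ⟨a', b', c', h⟩ := hR.nonempty
  refine ⟨B.l (A.phiInv a' ((A.div a a')⁻¹ * C.div c c')) b', ?_, ?_⟩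
  · simp only
    rw [hR.iff h, div_l_self, phi_phiInv, mul_inv_cancel_left]
  · intro y hy
    rw [hR.iff h] at hy
    rw [← hy, inv_mul_cancel_left, phiInv_phi, l_div]

lemma left (hR : IsTri R) {a b c} (g : H) (h : R a b c) : R (A.l g a) b (C.l g c) := by
  have := (hR.l_iff h g 1 g).2 (by simp)
  simpa only [l_one] using this

/-- The square `a b = d f`, both products being equal to the diagonal `c`. Applied to the
multiplication of a gerbe, it produces squares out of associativity alone. -/
lemma isSq (hR : IsTri R) (hR' : IsTri R') :
    IsSq (fun (a : A) (b : B) (f : F) (d : D) => ∃ c, R a b c ∧ R' d f c) where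
  nonempty := by
    obtain ⟨a, b, c, h⟩ := hR.nonempty
    obtain ⟨d⟩ := D.nonempty
    obtain ⟨f, hf, -⟩ := hR'.existsUnique_right d c
    exact ⟨a, b, f, d, c, h, hf⟩
  phi_eq := by
    rintro a b f d ⟨c, h1, h2⟩ h
    rw [hR.phi_eq h1, hR'.phi_eq h2]
  l_iff := by
    rintro a b f d ⟨c, h1, h2⟩ g k m p
    constructor
    · rintro ⟨c', h3, h4⟩
      rw [← C.l_div c' c, hR.l_iff h1] at h3
      rw [← C.l_div c' c, hR'.l_iff h2] at h4
      rw [h3, h4]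
    · intro h
      exact ⟨C.l _ c, (hR.l_iff h1 _ _ _).2 rfl, (hR'.l_iff h2 _ _ _).2 h.symm⟩

end IsTri

lemma phi_pair_pinv {A B C : Bitorsor H} (a : A) (b : B) (c : C) (g : H) :
    ((A.mul B).mul C.inv).phi (pair (pair a b) (pinv c)) g =
      A.phi a (B.phi b (C.phiInv c g)) := by
  rw [mul_phi, mul_phi, inv_phi]

/-- The automorphism attached to `[a, b, c⁻¹]` is `φ_a φ_b φ_c⁻¹`, and a point is central when its
automorphism is the identity. -/
lemma central_iff {A B C : Bitorsor H} (a : A) (b : B) (c : C) :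
    (∀ h, ((A.mul B).mul C.inv).inv.l h (pinv (pair (pair a b) (pinv c))) =
      ((A.mul B).mul C.inv).inv.r (pinv (pair (pair a b) (pinv c))) h) ↔
    ∀ h, A.phi a (B.phi b h) = C.phi c h := by
  -- Inversion exchanges the two actions and inverts the group element, so the comparison is made at
  -- `h⁻¹`.
  have key : ∀ h, ((A.mul B).mul C.inv).inv.l h (pinv (pair (pair a b) (pinv c))) =
      ((A.mul B).mul C.inv).inv.r (pinv (pair (pair a b) (pinv c))) h ↔
      A.phi a (B.phi b (C.phiInv c h)) = h := by
    intro h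
    rw [pinv_l, pinv_r, r_eq_l, phi_pair_pinv, ← inv_inj (b := h)]
    have : A.phi a (B.phi b (C.phiInv c h⁻¹)) = (A.phi a (B.phi b (C.phiInv c h)))⁻¹ := by
      have h1 : C.phiInv c h⁻¹ = (C.phiInv c h)⁻¹ := by
        apply C.phi_injective c; rw [phi_inv, phi_phiInv, phi_phiInv]
      rw [h1, phi_inv, phi_inv]
    rw [this]
    exact ⟨fun hh => l_injective _ _ hh, fun hh => by rw [hh]⟩
  constructor
  · intro h g
    have := (key (C.phi c g)).1 (h _)
    rwa [phiInv_phi] at this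
  · intro h g
    rw [key, h, phi_phiInv]

/-- Centrality lets the translation `p` of the last factor pass to the front, where it meets `g
φ_a(k)`; simple transitivity then compares the two. -/
lemma isTri_of_central {A B C : Bitorsor H} {x : ((A.mul B).mul C.inv).inv}
    (hx : ∀ h, ((A.mul B).mul C.inv).inv.l h x = ((A.mul B).mul C.inv).inv.r x h) :
    IsTri (fun (a : A) (b : B) (c : C) => x = pinv (pair (pair a b) (pinv c))) where
  nonempty := by
    obtain ⟨p, c, h⟩ := exists_pair (ofInv x)
    obtain ⟨a, b, rfl⟩ := exists_pair p
    exact ⟨a, b, ofInv c, h⟩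
  phi_eq := by
    rintro a b c rfl
    exact (central_iff a b c).1 hx
  l_iff := by
    rintro a b c rfl g k p
    have hx' : ∀ h, ((A.mul B).mul C.inv).r (pair (pair a b) (pinv c)) h =
        ((A.mul B).mul C.inv).l h (pair (pair a b) (pinv c)) := by
      intro h
      have := hx h⁻¹
      rwa [pinv_l, pinv_r, inv_inv] at this
    have h1 : pair (A.l g a) (B.l k b) = (A.mul B).l (g * A.phi a k) (pair a b) := by
      rw [← pair_mid, A.comm, A.r_eq_l, ← A.l_mul, pair_l]
    have h2 : pinv (C.l p c) = C.inv.r (pinv c) p⁻¹ := by rw [pinv_r, inv_inv]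
    rw [h1, h2, ← pair_r, ← pair_l, Bitorsor.comm, hx', ← Bitorsor.l_mul]
    constructor
    · intro h
      have h3 : ((A.mul B).mul C.inv).l 1 (pair (pair a b) (pinv c)) = _ :=
        (Bitorsor.l_one _ _).trans h
      exact mul_inv_eq_one.1 (l_injective _ _ h3).symm
    · rintro rfl
      rw [mul_inv_cancel, Bitorsor.l_one]

/-! ### Composition and inversion of squares -/

section

variable {N₁' N₂' E'' : Bitorsor H}

/-- The vertical composition of two squares. -/
def sqComp (R : N₁ → E' → N₂ → E → Prop) (R' : N₁' → E'' → N₂' → E' → Prop)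
    (p : N₁.mul N₁') (e'' : E'') (q : N₂.mul N₂') (e : E) : Prop :=
  ∃ n₁ n₁' n₂ n₂' e', p = pair n₁ n₁' ∧ q = pair n₂ n₂' ∧ R n₁ e' n₂ e ∧ R' n₁' e'' n₂' e'

variable {R : N₁ → E' → N₂ → E → Prop} {R' : N₁' → E'' → N₂' → E' → Prop}

/-- The definition of `sqComp` lets the representatives of the two columns vary; prescribed ones
serve as well, because the intermediate point absorbs the difference. -/
lemma sqComp_pair_iff (hR : IsSq R) (hR' : IsSq R') (n₁ : N₁) (n₁' : N₁') (e'' : E'')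
    (n₂ : N₂) (n₂' : N₂') (e : E) :
    sqComp R R' (pair n₁ n₁') e'' (pair n₂ n₂') e ↔ ∃ e', R n₁ e' n₂ e ∧ R' n₁' e'' n₂' e' := by
  constructor
  · rintro ⟨m₁, m₁', m₂, m₂', e', h1, h2, h3, h4⟩
    obtain ⟨g, rfl, rfl⟩ := pt_eq_iff.1 h1
    obtain ⟨k, rfl, rfl⟩ := pt_eq_iff.1 h2
    -- `g` and `k` are the changes of representatives in the left and the right column.
    refine ⟨E'.r (E'.l g e') k⁻¹, ?_, ?_⟩
    · have := hR.right k⁻¹ ((hR.mid g).1 h3)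
      rwa [r_r_inv] at this
    · rw [hR'.mid', r_inv_r]
      exact hR'.left g h4
  · rintro ⟨e', h1, h2⟩
    exact ⟨n₁, n₁', n₂, n₂', e', rfl, rfl, h1, h2⟩

lemma isSq_sqComp (hR : IsSq R) (hR' : IsSq R') : IsSq (sqComp R R') where
  nonempty := by
    obtain ⟨n₁', e'', n₂', e', h'⟩ := hR'.nonempty
    obtain ⟨n₁⟩ := N₁.nonempty
    obtain ⟨n₂⟩ := N₂.nonempty
    obtain ⟨e, h, -⟩ := hR.existsUnique n₁ e' n₂
    exact ⟨pair n₁ n₁', e'', pair n₂ n₂', e, n₁, n₁', n₂, n₂', e', rfl, rfl, h, h'⟩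
  phi_eq := by
    rintro _ e'' _ e ⟨n₁, n₁', n₂, n₂', e', rfl, rfl, h1, h2⟩ h
    rw [mul_phi, mul_phi, hR'.phi_eq h2, hR.phi_eq h1]
  l_iff := by
    rintro _ e'' _ e ⟨n₁, n₁', n₂, n₂', e', rfl, rfl, h1, h2⟩ g k m p
    rw [pair_l, pair_l, sqComp_pair_iff hR hR', mul_phi]
    constructor
    · rintro ⟨d, h3, h4⟩
      rw [← E'.l_div d e', hR.l_iff h1] at h3
      rw [← N₁'.l_one n₁', ← N₂'.l_one n₂', ← E'.l_div d e', hR'.l_iff h2] at h4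
      rw [phi_one, one_mul, mul_one] at h4
      rw [h4, h3]
    · intro h
      refine ⟨E'.l (N₁'.phi n₁' k) e', (hR.l_iff h1 _ _ _ _).2 h, ?_⟩
      have := (hR'.l_iff h2 1 k 1 (N₁'.phi n₁' k)).2 (by simp)
      simpa only [l_one] using this

/-- The vertical inverse of a square. -/
def sqInv (R : N₁ → E' → N₂ → E → Prop) (n₁ : N₁.inv) (e : E) (n₂ : N₂.inv) (e' : E') : Prop :=
  R (ofInv n₁) e' (ofInv n₂) e

/-- `n₁ e' = e n₂` is rewritten as `n₁⁻¹ e = e' n₂⁻¹`. Left translations of an inverse column are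
right translations of the original one, so the automorphisms of the columns get inverted. -/
lemma isSq_sqInv (hR : IsSq R) : IsSq (sqInv R) where
  nonempty := by
    obtain ⟨n₁, e', n₂, e, h⟩ := hR.nonempty
    exact ⟨pinv n₁, e, pinv n₂, e', h⟩
  phi_eq := by
    intro n₁ e n₂ e' h x
    have := hR.phi_eq h (N₂.phiInv (ofInv n₂) x)
    rw [phi_phiInv] at this
    rw [show N₁.inv.phi n₁ = _ from funext (N₁.inv_phi (ofInv n₁)), ← this, phiInv_phi,
      show N₂.inv.phi n₂ = _ from funext (N₂.inv_phi (ofInv n₂))]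
  l_iff := by
    intro n₁ e n₂ e' h g k m p
    change R (N₁.r (ofInv n₁) g⁻¹) (E'.l p e') (N₂.r (ofInv n₂) m⁻¹) (E.l k e) ↔ _
    rw [r_eq_l, r_eq_l, hR.l_iff h, ← hR.phi_eq h,
      show N₁.inv.phi n₁ k = _ from N₁.inv_phi (ofInv n₁) k,
      ← (N₁.phi_injective (ofInv n₁)).eq_iff (a := g * _), phi_mul, phi_mul, phi_phiInv,
      phi_inv, phi_inv, phi_inv]
    rw [eq_mul_inv_iff_mul_eq, mul_assoc, inv_mul_eq_iff_eq_mul, eq_comm]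

end

end Bitorsor
end NBG

namespace NBG

/-! ### Smoothness at a point of a base space -/

section SmoothAt

variable {k : ℕ} {H : Type u} [TopologicalSpace H] [ChartedSpace (EuclideanSpace ℝ (Fin k)) H]
  [Group H] {B B' : Base.{u}}

variable (k) in
/-- `f : B → H` is smooth at the point `b` of `B`. -/
def SmAt (f : B → H) (b : B) : Prop :=
  ContMDiffWithinAt B.I (𝓡 k) ∞ (Function.extend Subtype.val f (fun _ => 1)) B.S b.1

variable (k) in
/-- `(x, h) ↦ f x h` is smooth at all points `(b, h)`. -/
def SmAt₂ (f : B → H → H) (b : B) : Prop :=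
  ∀ h : H, ContMDiffWithinAt (B.I.prod (𝓡 k)) (𝓡 k) ∞
    (fun p : B.X × H => Function.extend Subtype.val (fun x => f x p.2) (fun _ => 1) p.1)
    (B.S ×ˢ univ) (b.1, h)

lemma eventually_nhdsWithin_base {p : B.X → Prop} {b : B} :
    (∀ᶠ x in 𝓝[B.S] b.1, p x) ↔ ∀ᶠ x in 𝓝 b, p x.1 := by
  rw [nhdsWithin_eq_map_subtype_coe b.2, Filter.eventually_map]

lemma image_mem_nhdsWithin {U : Opens B} {b : B} (hb : b ∈ U) :
    Subtype.val '' (U : Set B) ∈ 𝓝[B.S] b.1 := by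
  rw [nhdsWithin_eq_map_subtype_coe b.2]
  exact Filter.image_mem_map (U.isOpen.mem_nhds hb)

/-- Open subsets of `B` are neighbourhoods within `B.S`. Working at single points makes it
unnecessary to keep track of the domains of local sections. -/
lemma smoothOn_iff {f : B → H} {U : Opens B} : SmoothOn k f U ↔ ∀ b ∈ U, SmAt k f b := by
  constructor
  · intro h b hb
    exact (h b.1 ⟨b, hb, rfl⟩).mono_of_mem_nhdsWithin (image_mem_nhdsWithin hb)
  · rintro h _ ⟨b, hb, rfl⟩
    exact (h b hb).mono (by rintro _ ⟨x, -, rfl⟩; exact x.2)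

omit [Group H] in
lemma eventually_nhdsWithin_prod {p : B.X → Prop} {b : B} {h : H}
    (hp : ∀ᶠ x in 𝓝 b, p x.1) : ∀ᶠ x in 𝓝[B.S ×ˢ (univ : Set H)] (b.1, h), p x.1 := by
  rw [nhdsWithin_prod_eq]
  exact (eventually_nhdsWithin_base.2 hp).prod_inl _

lemma smoothOn₂_iff {f : B → H → H} {U : Opens B} : SmoothOn₂ k f U ↔ ∀ b ∈ U, SmAt₂ k f b := by
  constructor
  · intro h b hb a
    refine (h (b.1, a) ⟨⟨b, hb, rfl⟩, mem_univ _⟩).mono_of_mem_nhdsWithin ?_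
    rw [nhdsWithin_prod_eq]
    exact Filter.prod_mem_prod (image_mem_nhdsWithin hb) self_mem_nhdsWithin
  · rintro h ⟨_, a⟩ ⟨⟨b, hb, rfl⟩, -⟩
    exact (h b hb a).mono (prod_mono (by rintro _ ⟨x, -, rfl⟩; exact x.2) subset_rfl)

lemma SmAt.congr {f g : B → H} {b : B} (hf : SmAt k f b) (h : ∀ᶠ x in 𝓝 b, g x = f x) :
    SmAt k g b := by
  refine ContMDiffWithinAt.congr_of_eventuallyEq hf ?_ ?_
  · refine eventually_nhdsWithin_base.2 ?_
    filter_upwards [h] with x hx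
    rw [extend_val, extend_val, hx]
  · rw [extend_val, extend_val, h.self_of_nhds]

lemma SmAt₂.congr {f g : B → H → H} {b : B} (hf : SmAt₂ k f b)
    (h : ∀ᶠ x in 𝓝 b, ∀ a, g x a = f x a) : SmAt₂ k g b := by
  intro a
  refine ContMDiffWithinAt.congr_of_eventuallyEq (hf a) ?_ ?_
  · refine eventually_nhdsWithin_prod (p := fun x => ∀ a, Function.extend Subtype.val
      (fun x => g x a) (fun _ => 1) x = Function.extend Subtype.val
      (fun x => f x a) (fun _ => 1) x) ?_ |>.mono fun x hx => hx x.2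
    filter_upwards [h] with x hx a
    rw [extend_val, extend_val, hx]
  · simp only [extend_val, h.self_of_nhds]

lemma smAt_const (h : H) (b : B) : SmAt k (fun _ => h) b := by
  refine (contMDiffWithinAt_const (c := h)).congr_of_eventuallyEq ?_ ?_
  · refine eventually_nhdsWithin_base.2 (Filter.Eventually.of_forall fun x => ?_)
    rw [extend_val]
  · rw [extend_val]

lemma SmAt.mul [LieGroup (𝓡 k) ∞ H] {f g : B → H} {b : B} (hf : SmAt k f b) (hg : SmAt k g b) :
    SmAt k (fun x => f x * g x) b := by
  refine (ContMDiffWithinAt.mul (I := 𝓡 k) (n := ∞) hf hg).congr_of_eventuallyEq ?_ ?_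
  · refine eventually_nhdsWithin_base.2 (Filter.Eventually.of_forall fun x => ?_)
    simp only [Pi.mul_apply, extend_val]
  · simp only [Pi.mul_apply, extend_val]

lemma SmAt.inv [LieGroup (𝓡 k) ∞ H] {f : B → H} {b : B} (hf : SmAt k f b) :
    SmAt k (fun x => (f x)⁻¹) b := by
  refine (ContMDiffWithinAt.inv (I := 𝓡 k) (n := ∞) hf).congr_of_eventuallyEq ?_ ?_
  · refine eventually_nhdsWithin_base.2 (Filter.Eventually.of_forall fun x => ?_)
    simp only [extend_val]
  · simp only [extend_val]

lemma SmAt₂.apply {f : B → H → H} {g : B → H} {b : B} (hf : SmAt₂ k f b) (hg : SmAt k g b) :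
    SmAt k (fun x => f x (g x)) b := by
  have h1 : ContMDiffWithinAt B.I (B.I.prod (𝓡 k)) ∞
      (fun x => (x, Function.extend Subtype.val g (fun _ => 1) x)) B.S b.1 :=
    contMDiffWithinAt_id.prodMk hg
  refine (ContMDiffWithinAt.comp b.1 (t := B.S ×ˢ univ) (hf _) h1
    (fun x hx => ⟨hx, mem_univ _⟩)).congr_of_eventuallyEq ?_ ?_
  · refine eventually_nhdsWithin_base.2 (Filter.Eventually.of_forall fun x => ?_)
    simp only [Function.comp, extend_val]
  · simp only [Function.comp, extend_val]

lemma SmAt₂.comp {f g : B → H → H} {b : B} (hf : SmAt₂ k f b) (hg : SmAt₂ k g b) :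
    SmAt₂ k (fun x a => f x (g x a)) b := by
  intro a
  have h1 : ContMDiffWithinAt (B.I.prod (𝓡 k)) (B.I.prod (𝓡 k)) ∞
      (fun p : B.X × H => (p.1,
        Function.extend Subtype.val (fun x => g x p.2) (fun _ => 1) p.1))
      (B.S ×ˢ univ) (b.1, a) := contMDiffWithinAt_fst.prodMk (hg a)
  refine (ContMDiffWithinAt.comp (b.1, a) (t := B.S ×ˢ univ) (hf _) h1
    (fun x hx => ⟨hx.1, mem_univ _⟩)).congr ?_ ?_
  · rintro ⟨x, c⟩ ⟨hx, -⟩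
    lift x to B using hx
    simp only [Function.comp, extend_val]
  · simp only [Function.comp, extend_val]

/-- Only the behaviour near `x₀` matters, so one statement covers pull-backs, restrictions to open
subsets and extensions by arbitrary values. -/
lemma SmAt.transfer {f : B → H} {f' : B' → H} (g : B'.X → B.X) {x₀ : B'} {y₀ : B}
    (hf : SmAt k f y₀) (hg : ContMDiffWithinAt B'.I B.I ∞ g B'.S x₀.1) (h₀ : g x₀.1 = y₀.1)
    (h : ∀ᶠ x in 𝓝 x₀, ∃ y : B, y.1 = g x.1 ∧ f y = f' x) : SmAt k f' x₀ := by
  -- Since `g` is not assumed to map `B'` into `B`, composition within sets needs that it does so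
  -- near `x₀`.
  have hm : g ⁻¹' B.S ∈ 𝓝[B'.S] x₀.1 := by
    refine eventually_nhdsWithin_base.2 ?_
    filter_upwards [h] with x hx
    obtain ⟨y, hy, -⟩ := hx
    exact hy ▸ y.2
  unfold SmAt at hf
  rw [← h₀] at hf
  have key : ∀ x : B', (∃ y : B, y.1 = g x.1 ∧ f y = f' x) →
      Function.extend Subtype.val f' (fun _ => 1) x.1 =
      (Function.extend Subtype.val f (fun _ => 1) ∘ g) x.1 := by
    rintro x ⟨y, hy, hfy⟩
    rw [Function.comp, ← hy, extend_val, extend_val, hfy]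
  refine ((ContMDiffWithinAt.comp' x₀.1 hf hg).mono_of_mem_nhdsWithin
    (Filter.inter_mem self_mem_nhdsWithin hm)).congr_of_eventuallyEq ?_ (key x₀ h.self_of_nhds)
  refine eventually_nhdsWithin_base.2 ?_
  filter_upwards [h] with x hx using key x hx

lemma SmAt.pullback (g : Base.Map B' B) {f : B → H} {b : B'} (hf : SmAt k f (g.pt b)) :
    SmAt k (fun x => f (g.pt x)) b :=
  hf.transfer g.toFun (g.smooth b.1 b.2) rfl
    (Filter.Eventually.of_forall fun x => ⟨g.pt x, rfl, rfl⟩)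

lemma SmAt₂.transfer {f : B → H → H} {f' : B' → H → H} (g : B'.X → B.X) {x₀ : B'} {y₀ : B}
    (hf : SmAt₂ k f y₀) (hg : ContMDiffWithinAt B'.I B.I ∞ g B'.S x₀.1) (h₀ : g x₀.1 = y₀.1)
    (h : ∀ᶠ x in 𝓝 x₀, ∃ y : B, y.1 = g x.1 ∧ ∀ a, f y a = f' x a) : SmAt₂ k f' x₀ := by
  intro a
  have h1 : ContMDiffWithinAt (B'.I.prod (𝓡 k)) (B.I.prod (𝓡 k)) ∞
      (fun p : B'.X × H => (g p.1, p.2)) (B'.S ×ˢ univ) (x₀.1, a) :=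
    (ContMDiffWithinAt.comp (x₀.1, a) (t := B'.S) (f := Prod.fst) hg contMDiffWithinAt_fst
      (fun p hp => hp.1)).prodMk contMDiffWithinAt_snd
  have hm : (fun p : B'.X × H => (g p.1, p.2)) ⁻¹' (B.S ×ˢ univ) ∈
      𝓝[B'.S ×ˢ (univ : Set H)] (x₀.1, a) := by
    refine eventually_nhdsWithin_prod (p := fun x => g x ∈ B.S) ?_ |>.mono
      fun x hx => ⟨hx, mem_univ _⟩
    filter_upwards [h] with x hx
    obtain ⟨y, hy, -⟩ := hx
    exact hy ▸ y.2
  have hf' := hf a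
  rw [← h₀] at hf'
  have key : ∀ x : B', (∃ y : B, y.1 = g x.1 ∧ ∀ a, f y a = f' x a) → ∀ a,
      Function.extend Subtype.val (fun x => f' x a) (fun _ => 1) x.1 =
      Function.extend Subtype.val (fun x => f x a) (fun _ => 1) (g x.1) := by
    rintro x ⟨y, hy, hfy⟩ a
    rw [← hy, extend_val, extend_val, hfy]
  refine ((ContMDiffWithinAt.comp' (x₀.1, a) (g := fun p : B.X × H => Function.extend
      Subtype.val (fun x => f x p.2) (fun _ => 1) p.1) hf' h1).mono_of_mem_nhdsWithin
    (Filter.inter_mem self_mem_nhdsWithin hm)).congr_of_eventuallyEq ?_ (key x₀ h.self_of_nhds a)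
  refine eventually_nhdsWithin_prod (p := fun x => ∀ a,
      Function.extend Subtype.val (fun x => f' x a) (fun _ => 1) x =
      Function.extend Subtype.val (fun x => f x a) (fun _ => 1) (g x)) ?_ |>.mono
      fun x hx => hx x.2
  filter_upwards [h] with x hx using key x hx

lemma smAt₂_id (b : B) : SmAt₂ k (fun _ (h : H) => h) b := by
  intro a
  refine (contMDiffWithinAt_snd (s := B.S ×ˢ univ)).congr_of_eventuallyEq ?_ ?_
  · refine eventually_nhdsWithin_prod (p := fun x => ∀ a : H, Function.extend Subtype.val
      (fun _ : B => a) (fun _ => 1) x = a) ?_ |>.mono fun x hx => hx x.2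
    exact Filter.Eventually.of_forall fun x a => by rw [extend_val]
  · simp only [extend_val]

lemma SmAt.smAt₂ {f : B → H} {b : B} (hf : SmAt k f b) : SmAt₂ k (fun x _ => f x) b := by
  intro a
  exact ContMDiffWithinAt.comp (b.1, a) (t := B.S) (f := Prod.fst) hf contMDiffWithinAt_fst
      (fun p hp => hp.1)

lemma SmAt₂.mul [LieGroup (𝓡 k) ∞ H] {f g : B → H → H} {b : B} (hf : SmAt₂ k f b)
    (hg : SmAt₂ k g b) : SmAt₂ k (fun x a => f x a * g x a) b := by
  intro a
  refine (ContMDiffWithinAt.mul (I := 𝓡 k) (n := ∞) (hf a) (hg a)).congr_of_eventuallyEq ?_ ?_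
  · refine eventually_nhdsWithin_prod (p := fun x => ∀ a, Function.extend Subtype.val
      (fun x => f x a * g x a) (fun _ => 1) x = Function.extend Subtype.val
      (fun x => f x a) (fun _ => 1) x * Function.extend Subtype.val
      (fun x => g x a) (fun _ => 1) x) ?_ |>.mono fun x hx => hx x.2
    exact Filter.Eventually.of_forall fun x a => by simp only [extend_val]
  · simp only [Pi.mul_apply, extend_val]

end SmoothAt

/-! ### Sections smooth at a point -/

section Sections

variable {k : ℕ} {H : Type u} [TopologicalSpace H] [ChartedSpace (EuclideanSpace ℝ (Fin k)) H]
  [Group H] {B B' : Base.{u}}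

namespace Bibundle

/-- The section `s` is smooth at the point `b`. -/
def SecAt (E : Bibundle k H B) (s : ∀ b, E.fib b) (b : B) : Prop :=
  ∀ i, b ∈ E.dom i → SmAt k (fun b => (E.fib b).div (s b) (E.t i b)) b

variable {E : Bibundle k H B}

lemma isSection_iff {U : Opens B} {s : ∀ b, E.fib b} :
    E.IsSection U s ↔ ∀ b ∈ U, E.SecAt s b := by
  constructor
  · intro h b hb i hi
    exact smoothOn_iff.1 (h i) b ⟨hb, hi⟩
  · intro h i
    exact smoothOn_iff.2 fun b hb => h b hb.1 i hb.2

lemma smAt_trans {i j : E.idx} {b : B} (hi : b ∈ E.dom i) (hj : b ∈ E.dom j) :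
    SmAt k (fun b => (E.fib b).div (E.t i b) (E.t j b)) b :=
  smoothOn_iff.1 (E.trans_smooth i j) b ⟨hi, hj⟩

lemma secAt_t {i : E.idx} {b : B} (hi : b ∈ E.dom i) : E.SecAt (E.t i) b :=
  fun _ hj => smAt_trans hi hj

lemma exists_secAt (E : Bibundle k H B) (b : B) : ∃ s, E.SecAt s b :=
  let ⟨i, hi⟩ := E.dom_cover b
  ⟨E.t i, secAt_t hi⟩

lemma SecAt.congr {s s' : ∀ b, E.fib b} {b : B} (hs : E.SecAt s b)
    (h : ∀ᶠ x in 𝓝 b, s' x = s x) : E.SecAt s' b :=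
  fun i hi => (hs i hi).congr (h.mono fun x hx => by rw [hx])

lemma SecAt.pullback {s : ∀ b, E.fib b} (g : Base.Map B' B) {b : B'} (hs : E.SecAt s (g.pt b)) :
    (E.pullback g).SecAt (fun b => s (g.pt b)) b :=
  fun i hi => (hs i hi).pullback g

variable [LieGroup (𝓡 k) ∞ H] {s s' : ∀ b, E.fib b} {b : B}

/-- One chart around the point suffices because the transition functions are smooth. -/
lemma SecAt.of_smAt {i : E.idx} (hi : b ∈ E.dom i)
    (h : SmAt k (fun b => (E.fib b).div (s b) (E.t i b)) b) : E.SecAt s b :=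
  fun _ hj => (h.mul (smAt_trans hi hj)).congr
    (Filter.Eventually.of_forall fun _ => (Bitorsor.div_mul_div _ _ _ _).symm)

lemma SecAt.div (hs : E.SecAt s b) (hs' : E.SecAt s' b) :
    SmAt k (fun b => (E.fib b).div (s b) (s' b)) b := by
  obtain ⟨i, hi⟩ := E.dom_cover b
  refine ((hs i hi).mul (hs' i hi).inv).congr (Filter.Eventually.of_forall fun _ => ?_)
  rw [Bitorsor.div_inv, Bitorsor.div_mul_div]

lemma SecAt.of_div (hs : E.SecAt s b)
    (h : SmAt k (fun b => (E.fib b).div (s' b) (s b)) b) : E.SecAt s' b :=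
  fun i hi => (h.mul (hs i hi)).congr
    (Filter.Eventually.of_forall fun _ => (Bitorsor.div_mul_div _ _ _ _).symm)

lemma SecAt.l {g : B → H} (hg : SmAt k g b) (hs : E.SecAt s b) :
    E.SecAt (fun b => (E.fib b).l (g b) (s b)) b :=
  hs.of_div (hg.congr (Filter.Eventually.of_forall fun _ => Bitorsor.div_l_self _ _ _))

lemma SecAt.phi (hs : E.SecAt s b) : SmAt₂ k (fun b => (E.fib b).phi (s b)) b := by
  obtain ⟨i, hi⟩ := E.dom_cover b
  have h1 : SmAt₂ k (fun b => (E.fib b).phi (E.t i b)) b := smoothOn₂_iff.1 (E.phi_smooth i) b hi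
  exact (((hs i hi).smAt₂.mul h1).mul (hs i hi).inv.smAt₂).congr
    (Filter.Eventually.of_forall fun _ _ => Bitorsor.phi_eq_div _ _ _ _)

lemma SecAt.phiInv (hs : E.SecAt s b) : SmAt₂ k (fun b => (E.fib b).phiInv (s b)) b := by
  obtain ⟨i, hi⟩ := E.dom_cover b
  have h1 : SmAt₂ k (fun b => (E.fib b).phiInv (E.t i b)) b :=
    smoothOn₂_iff.1 (E.phiInv_smooth i) b hi
  exact (h1.comp (((hs i hi).inv.smAt₂.mul (smAt₂_id b)).mul (hs i hi).smAt₂)).congr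
    (Filter.Eventually.of_forall fun _ _ => Bitorsor.phiInv_eq_div _ _ _ _)

lemma SecAt.pinv (hs : E.SecAt s b) : E.inv.SecAt (fun b => Bitorsor.pinv (s b)) b :=
  fun _ hi => ((secAt_t (E := E) hi).phiInv.apply (hs _ hi).inv).congr
    (Filter.Eventually.of_forall fun _ => Bitorsor.inv_div _ _ _)

lemma SecAt.ofInv {s : ∀ b, E.inv.fib b} (hs : E.inv.SecAt s b) :
    E.SecAt (fun b => Bitorsor.ofInv (s b)) b := by
  intro i hi
  refine ((secAt_t hi).phi.apply (hs i hi)).inv.congr (Filter.Eventually.of_forall fun x => ?_)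
  have := Bitorsor.inv_div _ (Bitorsor.ofInv (s x)) (E.t i x)
  refine inv_inj.1 ?_
  rw [inv_inv]
  refine (Eq.trans (congrArg _ this) (Bitorsor.phi_phiInv _ _ _)).symm

variable {E' : Bibundle k H B} {r : ∀ b, E'.fib b}

lemma SecAt.pair (hs : E.SecAt s b) (hr : E'.SecAt r b) :
    (E.mul E').SecAt (fun b => Bitorsor.pair (s b) (r b)) b :=
  fun _ hi => ((hs _ hi.1).mul ((secAt_t hi.1).phi.apply (hr _ hi.2))).congr
    (Filter.Eventually.of_forall fun _ => Bitorsor.mul_div _ _ _ _)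

/-- In charts `[s, r]` has the representative `div s t * φ_t (div r t')`, which is solved for `div r
t'` by smooth operations. In this way the last factor of a smooth product is seen to be smooth. -/
lemma SecAt.of_pair_left (h : (E.mul E').SecAt (fun b => Bitorsor.pair (s b) (r b)) b)
    (hs : E.SecAt s b) : E'.SecAt r b := by
  intro j hj
  obtain ⟨i, hi⟩ := E.dom_cover b
  refine ((secAt_t hi).phiInv.apply ((hs _ hi).inv.mul (h (i, j) ⟨hi, hj⟩))).congr
    (Filter.Eventually.of_forall fun x => ?_)
  have := Bitorsor.mul_div (s x) (E.t i x) (r x) (E'.t j x)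
  refine (Eq.trans (congrArg (fun y => (E.fib x).phiInv _ (_ * y)) this) ?_).symm
  rw [inv_mul_cancel_left, Bitorsor.phiInv_phi]

end Bibundle

end Sections

end NBG

/-! ### Central sections as triangles, isomorphisms of bibundles as squares -/

namespace NBG

namespace Bitorsor

variable {H : Type u} [Group H] {N₁ E' N₂ E : Bitorsor H}

lemma pair_l_l_pinv_l {A B C : Bitorsor H} (a : A) (b : B) (c : C) (g k p : H) :
    pair (pair (A.l g a) (B.l k b)) (pinv (C.l p c)) =
      ((A.mul B).mul C.inv).l (g * A.phi a k)
        (((A.mul B).mul C.inv).r (pair (pair a b) (pinv c)) p⁻¹) := by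
  have h1 : pair (A.l g a) (B.l k b) = (A.mul B).l (g * A.phi a k) (pair a b) := by
    rw [← pair_mid, A.comm, A.r_eq_l, ← A.l_mul, pair_l]
  have h2 : pinv (C.l p c) = C.inv.r (pinv c) p⁻¹ := by rw [pinv_r, inv_inv]
  rw [h1, h2, ← pair_r, ← pair_l, Bitorsor.comm]

/-- The central point `y` identifies `E` with `T E` by `e ↦ [y, e]`. After this, a biequivariant map
out of `N₁ E' N₂⁻¹` with values in `T E` is an identification `n₁ e' = e n₂`. -/
lemma isSq_of_map {T : Bitorsor H} {y : T} (hy : ∀ h, T.r y h = T.l h y)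
    {θ : (N₁.mul E').mul N₂.inv → T.mul E}
    (hl : ∀ h p, θ (((N₁.mul E').mul N₂.inv).l h p) = (T.mul E).l h (θ p))
    (hr : ∀ p h, θ (((N₁.mul E').mul N₂.inv).r p h) = (T.mul E).r (θ p) h) :
    IsSq (fun (n₁ : N₁) (e' : E') (n₂ : N₂) (e : E) =>
      θ (pair (pair n₁ e') (pinv n₂)) = pair y e) := by
  have hy' : ∀ h, T.phi y h = h := fun h => T.div_eq (hy h).symm
  have hp : ∀ h (e : E), pair y (E.l h e) = (T.mul E).l h (pair y e) := by
    intro h e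
    rw [← pair_mid, hy, pair_l]
  refine ⟨?_, ?_, ?_⟩
  · obtain ⟨n₁⟩ := N₁.nonempty
    obtain ⟨e'⟩ := E'.nonempty
    obtain ⟨n₂⟩ := N₂.nonempty
    obtain ⟨e, he⟩ := exists_pair_left y (θ (pair (pair n₁ e') (pinv n₂)))
    exact ⟨n₁, e', n₂, e, he⟩
  · intro n₁ e' n₂ e h x
    have h1 : ((N₁.mul E').mul N₂.inv).phi (pair (pair n₁ e') (pinv n₂)) (N₂.phi n₂ x) =
        (T.mul E).phi (pair y e) (N₂.phi n₂ x) := by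
      symm
      apply div_eq
      rw [← h, ← hl, l_phi, hr]
    rw [phi_pair_pinv, phiInv_phi, mul_phi, hy'] at h1
    exact h1
  · intro n₁ e' n₂ e h g k m p
    rw [pair_l_l_pinv_l, hl, hr, h, pair_r, r_eq_l, hp, hp, ← Bitorsor.l_mul, phi_inv]
    constructor
    · intro hh
      exact mul_inv_eq_iff_eq_mul.1 (l_injective _ _ hh)
    · intro hh
      rw [hh, mul_inv_cancel_right]

lemma IsSq.exists_map {R : N₁ → E' → N₂ → E → Prop} (hR : IsSq R) {T : Bitorsor H} {y : T}
    (hy : ∀ h, T.r y h = T.l h y) :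
    ∃ θ : (N₁.mul E').mul N₂.inv → T.mul E,
      (∀ h p, θ (((N₁.mul E').mul N₂.inv).l h p) = (T.mul E).l h (θ p)) ∧
      (∀ p h, θ (((N₁.mul E').mul N₂.inv).r p h) = (T.mul E).r (θ p) h) ∧
      ∀ n₁ e' n₂ e, θ (pair (pair n₁ e') (pinv n₂)) = pair y e ↔ R n₁ e' n₂ e := by
  have hp : ∀ p : (N₁.mul E').mul N₂.inv, ∃ n₁ e' n₂, p = pair (pair n₁ e') (pinv n₂) := by
    intro p
    obtain ⟨q, c, rfl⟩ := exists_pair p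
    obtain ⟨a, b, rfl⟩ := exists_pair q
    exact ⟨a, b, ofInv c, rfl⟩
  -- Well-definedness on classes: two representatives differ by a translation across each of the two
  -- products, and the square absorbs them by `right` and `mid`.
  have hwd : ∀ a b c a' b' c' e, pair (T' := N₂.inv) (pair (T := N₁) (T' := E') a b) (pinv c) =
      pair (pair a' b') (pinv c') → R a b c e → R a' b' c' e := by
    intro a b c a' b' c' e h hh
    obtain ⟨x, h1, h2⟩ := pt_eq_iff.1 h
    rw [pair_r] at h1
    obtain ⟨z, rfl, h4⟩ := pt_eq_iff.1 h1.symm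
    have h2' : c = N₂.r c' x⁻¹ := h2
    subst h2'
    have h5 := hR.right x hh
    rw [r_inv_r, h4] at h5
    exact (hR.mid z).2 h5
  have h1 : ∀ p : (N₁.mul E').mul N₂.inv, ∃ e, ∀ n₁ e' n₂, p = pair (pair n₁ e') (pinv n₂) →
      R n₁ e' n₂ e := by
    intro p
    obtain ⟨a, b, c, rfl⟩ := hp p
    obtain ⟨e, he, -⟩ := hR.existsUnique a b c
    exact ⟨e, fun _ _ _ h => hwd _ _ _ _ _ _ _ h he⟩
  choose F hF using h1
  refine ⟨fun p => pair y (F p), ?_, ?_, ?_⟩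
  · intro h p
    obtain ⟨a, b, c, rfl⟩ := hp p
    have h1 := hR.eq (hF _ (N₁.l h a) b c rfl) (hR.left h (hF _ a b c rfl))
    rw [pair_l, pair_l]
    simp only
    rw [h1, ← pair_mid, hy, pair_l]
  · intro p h
    obtain ⟨a, b, c, rfl⟩ := hp p
    have h1 : F (pair (pair a b) (pinv (N₂.l h⁻¹ c))) =
        E.r (F (pair (pair a b) (pinv c))) h := by
      refine hR.eq (hF _ a b (N₂.l h⁻¹ c) rfl) ?_
      rw [hR.mid', r_r_inv]
      exact hF _ a b c rfl
    rw [pair_r]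
    exact congrArg (pair y) h1
  · intro a b c e
    have h2 := hF _ a b c rfl
    constructor
    · intro h
      obtain ⟨x, h3, h4⟩ := pt_eq_iff.1 h
      have : x = 1 := T.r_injective y (by rw [← h3, T.r_one])
      subst this
      rw [E.l_one] at h4
      rwa [h4] at h2
    · intro h
      rw [hR.eq h h2]

lemma IsTri.congr {A B C : Bitorsor H} {R R' : A → B → C → Prop} (hR : IsTri R) (hR' : IsTri R')
    {a b c} (h : R a b c) (h' : R' a b c) (a' b' c') : R a' b' c' ↔ R' a' b' c' := by
  rw [hR.iff h, hR'.iff h']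

end Bitorsor

section Squares

variable {k : ℕ} {H : Type u} [TopologicalSpace H] [ChartedSpace (EuclideanSpace ℝ (Fin k)) H]
  [Group H] {D D' : Base.{u}}

/-- A smooth relation `n₁ e' = e n₂` that identifies the bibundles `N₁ E'` and `E N₂`. -/
structure IsSquare (N₁ E' N₂ E : Bibundle k H D)
    (R : ∀ b, N₁.fib b → E'.fib b → N₂.fib b → E.fib b → Prop) : Prop where
  isSq : ∀ b, Bitorsor.IsSq (R b)
  smooth : ∀ b, ∃ n₁ e' n₂ e, N₁.SecAt n₁ b ∧ E'.SecAt e' b ∧ N₂.SecAt n₂ b ∧ E.SecAt e b ∧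
    ∀ᶠ x in 𝓝 b, R x (n₁ x) (e' x) (n₂ x) (e x)

/-- A smooth relation `a b = c` that identifies the bibundles `A B` and `C`. -/
structure IsTriangle (A B C : Bibundle k H D)
    (R : ∀ b, A.fib b → B.fib b → C.fib b → Prop) : Prop where
  isTri : ∀ b, Bitorsor.IsTri (R b)
  smooth : ∀ x, ∃ a b c, A.SecAt a x ∧ B.SecAt b x ∧ C.SecAt c x ∧
    ∀ᶠ y in 𝓝 x, R y (a y) (b y) (c y)

section

variable {N₁ E' N₂ E : Bibundle k H D}
  {R : ∀ b, N₁.fib b → E'.fib b → N₂.fib b → E.fib b → Prop} (hR : IsSquare N₁ E' N₂ E R)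

include hR

lemma IsSquare.pullback (g : Base.Map D' D) :
    IsSquare (N₁.pullback g) (E'.pullback g) (N₂.pullback g) (E.pullback g)
      (fun b => R (g.pt b)) where
  isSq b := hR.isSq _
  smooth b := by
    obtain ⟨n₁, e', n₂, e, h1, h2, h3, h4, h5⟩ := hR.smooth (g.pt b)
    exact ⟨_, _, _, _, h1.pullback g, h2.pullback g, h3.pullback g, h4.pullback g,
      g.continuous_pt.continuousAt.eventually h5⟩

variable [LieGroup (𝓡 k) ∞ H] {n₁ : ∀ b, N₁.fib b} {e' : ∀ b, E'.fib b} {n₂ : ∀ b, N₂.fib b}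
  {e : ∀ b, E.fib b} {b : D}

/-- Relative to a smooth reference quadruple, the fourth entry is given by the equation of
`IsSq.iff`, whose solution involves only products, inverses and `φ`. The variants for other entries
and for triangles rest on the same computation. -/
lemma IsSquare.secAt (h₁ : N₁.SecAt n₁ b) (h' : E'.SecAt e' b) (h₂ : N₂.SecAt n₂ b)
    (h : ∀ᶠ x in 𝓝 b, R x (n₁ x) (e' x) (n₂ x) (e x)) : E.SecAt e b := by
  obtain ⟨m₁, d', m₂, d, g1, g2, g3, g4, g5⟩ := hR.smooth b
  refine g4.of_div ((((h₁.div g1).mul (g1.phi.apply (h'.div g2))).mul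
    (g4.phi.apply (h₂.div g3)).inv).congr ?_)
  filter_upwards [h, g5] with x hx gx
  rw [eq_mul_inv_iff_mul_eq, ← ((hR.isSq x).iff gx _ _ _ _).1 hx]

lemma IsSquare.secAt' (h₁ : N₁.SecAt n₁ b) (h₂ : N₂.SecAt n₂ b) (he : E.SecAt e b)
    (h : ∀ᶠ x in 𝓝 b, R x (n₁ x) (e' x) (n₂ x) (e x)) : E'.SecAt e' b := by
  obtain ⟨m₁, d', m₂, d, g1, g2, g3, g4, g5⟩ := hR.smooth b
  refine g2.of_div ((g1.phiInv.apply ((h₁.div g1).inv.mul ((he.div g4).mul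
    (g4.phi.apply (h₂.div g3))))).congr ?_)
  filter_upwards [h, g5] with x hx gx
  rw [← ((hR.isSq x).iff gx _ _ _ _).1 hx, inv_mul_cancel_left, Bitorsor.phiInv_phi]

end

section

variable {A B C : Bibundle k H D} {R : ∀ b, A.fib b → B.fib b → C.fib b → Prop}
  (hR : IsTriangle A B C R)

include hR

lemma IsTriangle.pullback (g : Base.Map D' D) :
    IsTriangle (A.pullback g) (B.pullback g) (C.pullback g) (fun b => R (g.pt b)) where
  isTri b := hR.isTri _
  smooth b := by
    obtain ⟨n₁, e', n₂, h1, h2, h3, h5⟩ := hR.smooth (g.pt b)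
    exact ⟨_, _, _, h1.pullback g, h2.pullback g, h3.pullback g,
      g.continuous_pt.continuousAt.eventually h5⟩

variable [LieGroup (𝓡 k) ∞ H] {a : ∀ b, A.fib b} {b : ∀ b, B.fib b} {c : ∀ b, C.fib b} {x : D}

lemma IsTriangle.secAt (ha : A.SecAt a x) (hb : B.SecAt b x)
    (h : ∀ᶠ y in 𝓝 x, R y (a y) (b y) (c y)) : C.SecAt c x := by
  obtain ⟨a', b', c', g1, g2, g3, g5⟩ := hR.smooth x
  refine g3.of_div (((ha.div g1).mul (g1.phi.apply (hb.div g2))).congr ?_)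
  filter_upwards [h, g5] with y hy gy
  exact (((hR.isTri y).iff gy _ _ _).1 hy).symm

lemma IsTriangle.secAt_right (ha : A.SecAt a x) (hc : C.SecAt c x)
    (h : ∀ᶠ y in 𝓝 x, R y (a y) (b y) (c y)) : B.SecAt b x := by
  obtain ⟨a', b', c', g1, g2, g3, g5⟩ := hR.smooth x
  refine g2.of_div ((g1.phiInv.apply ((ha.div g1).inv.mul (hc.div g3))).congr ?_)
  filter_upwards [h, g5] with y hy gy
  rw [← ((hR.isTri y).iff gy _ _ _).1 hy, inv_mul_cancel_left, Bitorsor.phiInv_phi]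

/-- Two triangles with a common diagonal form a square. -/
lemma IsTriangle.isSquare {F G : Bibundle k H D} {R' : ∀ b, G.fib b → F.fib b → C.fib b → Prop}
    (hR' : IsTriangle G F C R') :
    IsSquare A B F G (fun x a b f d => ∃ c, R x a b c ∧ R' x d f c) where
  isSq x := (hR.isTri x).isSq (hR'.isTri x)
  smooth x := by
    obtain ⟨a, b, c, g1, g2, g3, g5⟩ := hR.smooth x
    obtain ⟨d, hd⟩ := G.exists_secAt x
    choose f hf _ using fun y => (hR'.isTri y).existsUnique_right (d y) (c y)
    exact ⟨a, b, f, d, g1, g2, hR'.secAt_right hd g3 (Filter.Eventually.of_forall hf), hd,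
      g5.mono fun y hy => ⟨c y, hy, hf y⟩⟩

end

variable [LieGroup (𝓡 k) ∞ H]

lemma IsSquare.comp {N₁ E' N₂ E N₁' N₂' E'' : Bibundle k H D}
    {R : ∀ b, N₁.fib b → E'.fib b → N₂.fib b → E.fib b → Prop}
    {R' : ∀ b, N₁'.fib b → E''.fib b → N₂'.fib b → E'.fib b → Prop}
    (hR : IsSquare N₁ E' N₂ E R) (hR' : IsSquare N₁' E'' N₂' E' R') :
    IsSquare (N₁.mul N₁') E'' (N₂.mul N₂') E
      (fun b => Bitorsor.sqComp (R b) (R' b)) where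
  isSq b := Bitorsor.isSq_sqComp (hR.isSq b) (hR'.isSq b)
  smooth b := by
    obtain ⟨n₁', e'', n₂', e', g1, g2, g3, g4, g5⟩ := hR'.smooth b
    obtain ⟨n₁, h₁⟩ := N₁.exists_secAt b
    obtain ⟨n₂, h₂⟩ := N₂.exists_secAt b
    choose e he _ using fun y => (hR.isSq y).existsUnique (n₁ y) (e' y) (n₂ y)
    exact ⟨_, e'', _, e, h₁.pair g1, g2, h₂.pair g3,
      hR.secAt h₁ g4 h₂ (Filter.Eventually.of_forall he),
      g5.mono fun y hy => ⟨_, _, _, _, _, rfl, rfl, he y, hy⟩⟩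

lemma IsSquare.inv {N₁ E' N₂ E : Bibundle k H D}
    {R : ∀ b, N₁.fib b → E'.fib b → N₂.fib b → E.fib b → Prop}
    (hR : IsSquare N₁ E' N₂ E R) :
    IsSquare N₁.inv E N₂.inv E' (fun b => Bitorsor.sqInv (R b)) where
  isSq b := Bitorsor.isSq_sqInv (hR.isSq b)
  smooth b := by
    obtain ⟨n₁, e', n₂, e, g1, g2, g3, g4, g5⟩ := hR.smooth b
    exact ⟨_, e, _, e', g1.pinv, g4, g3.pinv, g2, g5⟩

/-- For smooth `a`, `b` completed to `a b = c`, the product `[a, b, c⁻¹]` is the inverse of the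
given smooth section; cancelling `[a, b]` shows that `c` is smooth. -/
lemma CentralSection.isTriangle {A B C : Bibundle k H D}
    (f : CentralSection ((A.mul B).mul C.inv).inv) :
    IsTriangle A B C (fun x a b c => Bibundle.Rep (f.val x) a b c) := by
  have hT : ∀ x, Bitorsor.IsTri (fun a b c => Bibundle.Rep (f.val x) a b c) :=
    fun x => Bitorsor.isTri_of_central (f.central x)
  refine ⟨hT, fun x => ?_⟩
  obtain ⟨a, ha⟩ := A.exists_secAt x
  obtain ⟨b, hb⟩ := B.exists_secAt x
  choose c hc _ using fun y => (hT y).existsUnique (a y) (b y)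
  refine ⟨a, b, c, ha, hb, ?_, Filter.Eventually.of_forall hc⟩
  have h1 : ((A.mul B).mul C.inv).SecAt (fun y => Bitorsor.ofInv (f.val y)) x :=
    (Bibundle.isSection_iff.1 f.smooth x trivial).ofInv
  have h2 : ((A.mul B).mul C.inv).SecAt (fun y => Bitorsor.pair (Bitorsor.pair (a y) (b y))
      (Bitorsor.pinv (c y))) x :=
    h1.congr (Filter.Eventually.of_forall fun y => (hc y).symm)
  exact (h2.of_pair_left (ha.pair hb)).ofInv

lemma IsTriangle.exists_centralSection {A B C : Bibundle k H D}
    {R : ∀ b, A.fib b → B.fib b → C.fib b → Prop} (hR : IsTriangle A B C R) :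
    ∃ f : CentralSection ((A.mul B).mul C.inv).inv,
      ∀ x a b c, Bibundle.Rep (f.val x) a b c ↔ R x a b c := by
  -- The triples are chosen pointwise, without continuity. By `hrep` the point `[a, b, c⁻¹]⁻¹` is
  -- the same for every triple of the triangle, so a smooth triple computes it near each point.
  choose a b c h using fun x => (hR.isTri x).nonempty
  have hcen : ∀ x h, (((A.mul B).mul C.inv).inv.fib x).l h (Bitorsor.pinv (Bitorsor.pair
      (Bitorsor.pair (a x) (b x)) (Bitorsor.pinv (c x)))) =
      (((A.mul B).mul C.inv).inv.fib x).r (Bitorsor.pinv (Bitorsor.pair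
      (Bitorsor.pair (a x) (b x)) (Bitorsor.pinv (c x)))) h :=
    fun x => (Bitorsor.central_iff (a x) (b x) (c x)).2 ((hR.isTri x).phi_eq (h x))
  have hrep : ∀ x a' b' c', Bibundle.Rep (A := A) (B' := B) (C := C) (Bitorsor.pinv (Bitorsor.pair
      (Bitorsor.pair (a x) (b x)) (Bitorsor.pinv (c x)))) a' b' c' ↔ R x a' b' c' :=
    fun x => (Bitorsor.isTri_of_central (hcen x)).congr (hR.isTri x) rfl (h x)
  refine ⟨⟨fun x => Bitorsor.pinv (Bitorsor.pair (Bitorsor.pair (a x) (b x))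
    (Bitorsor.pinv (c x))), ?_, hcen⟩, hrep⟩
  refine Bibundle.isSection_iff.2 fun x _ => ?_
  obtain ⟨a', b', c', g1, g2, g3, g5⟩ := hR.smooth x
  exact ((g1.pair g2).pair g3.pinv).pinv.congr (g5.mono fun y hy => (hrep y _ _ _).2 hy)

variable (k H) in
/-- The trivial bibundle. -/
noncomputable def Bibundle.trivial (D : Base.{u}) : Bibundle k H D where
  fib _ := Bitorsor.twist 1
  idx := PUnit
  dom _ := ⊤
  dom_cover _ := ⟨⟨⟩, Set.mem_univ _⟩
  t _ _ := (1 : H)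
  trans_smooth _ _ := smoothOn_iff.2 fun b _ => (smAt_const 1 b).congr
    (Filter.Eventually.of_forall fun _ => Bitorsor.div_self _ _)
  phi_smooth _ := smoothOn₂_iff.2 fun b _ => (smAt₂_id b).congr
    (Filter.Eventually.of_forall fun _ _ => (Bitorsor.twist_phi _ _ _).trans (by simp))
  phiInv_smooth _ := smoothOn₂_iff.2 fun b _ => (smAt₂_id b).congr
    (Filter.Eventually.of_forall fun _ _ => (Bitorsor.twist_phiInv _ _ _).trans
      (by simp; rfl))

variable (k H) in
/-- The unit section of the inverse of the trivial bibundle. -/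
noncomputable def Bibundle.trivialSection (D : Base.{u}) :
    CentralSection (Bibundle.trivial k H D).inv where
  val _ := Bitorsor.pinv (T := Bitorsor.twist 1) (1 : H)
  smooth := Bibundle.isSection_iff.2 fun b _ =>
    Bibundle.SecAt.pinv (E := Bibundle.trivial k H D) (Bibundle.secAt_t (E := Bibundle.trivial k H D) (i := PUnit.unit) (Set.mem_univ b))
  central _ h := by
    change (1 : H) * h⁻¹ = h⁻¹ * 1
    simp

variable {N₁ E' N₂ E : Bibundle k H D}

/-- The central section trivialises `η`, so `Θ` identifies `N₁ E' N₂⁻¹` with `E`. The charts of the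
three factors provide the smooth reference quadruple. -/
lemma BibundleIso.isSquare {η : Bibundle k H D} (ℓ : CentralSection η.inv)
    (Θ : BibundleIso ((N₁.mul E').mul N₂.inv) (η.mul E)) :
    IsSquare N₁ E' N₂ E (fun b n₁ e' n₂ e =>
      Θ.toFun b (Bitorsor.pair (Bitorsor.pair n₁ e') (Bitorsor.pinv n₂)) =
        Bitorsor.pair (Bitorsor.ofInv (ℓ.val b)) e) := by
  have hy : ∀ b h, (η.fib b).r (Bitorsor.ofInv (ℓ.val b)) h =
      (η.fib b).l h (Bitorsor.ofInv (ℓ.val b)) := by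
    intro b h
    have h1 : (η.fib b).r (Bitorsor.ofInv (ℓ.val b)) h⁻¹⁻¹ =
      (η.fib b).l h⁻¹⁻¹ (Bitorsor.ofInv (ℓ.val b)) := ℓ.central b h⁻¹
    rwa [inv_inv] at h1
  have hS : ∀ b, Bitorsor.IsSq (fun n₁ e' n₂ e =>
      Θ.toFun b (Bitorsor.pair (Bitorsor.pair n₁ e') (Bitorsor.pinv n₂)) =
        Bitorsor.pair (Bitorsor.ofInv (ℓ.val b)) e) :=
    fun b => Bitorsor.isSq_of_map (hy b) (Θ.map_l b) (Θ.map_r b)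
  refine ⟨hS, fun b => ?_⟩
  obtain ⟨i, hi⟩ := N₁.dom_cover b
  obtain ⟨j, hj⟩ := E'.dom_cover b
  obtain ⟨l, hl⟩ := N₂.dom_cover b
  choose e he _ using fun y => (hS y).existsUnique (N₁.t i y) (E'.t j y) (N₂.t l y)
  refine ⟨N₁.t i, E'.t j, N₂.t l, e, Bibundle.secAt_t hi, Bibundle.secAt_t hj,
    Bibundle.secAt_t hl, ?_, Filter.Eventually.of_forall he⟩
  have h1 := Bibundle.isSection_iff.1 (Θ.smooth ((i, j), l)) b ⟨⟨hi, hj⟩, hl⟩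
  have h2 : η.SecAt (fun b => Bitorsor.ofInv (ℓ.val b)) b :=
    (Bibundle.isSection_iff.1 ℓ.smooth b trivial).ofInv
  exact Bibundle.SecAt.of_pair_left (h1.congr (Filter.Eventually.of_forall fun y => (he y).symm)) h2

/-- The converse of `BibundleIso.isSquare`. Nothing is lost by taking for `η` the trivial bibundle
and for `ℓ` its unit section. -/
lemma IsSquare.exists_iso {R : ∀ b, N₁.fib b → E'.fib b → N₂.fib b → E.fib b → Prop}
    (hR : IsSquare N₁ E' N₂ E R) :
    ∃ (η : Bibundle k H D) (ℓ : CentralSection η.inv)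
      (Θ : BibundleIso ((N₁.mul E').mul N₂.inv) (η.mul E)), ∀ b n₁ e' n₂ e,
      Θ.toFun b (Bitorsor.pair (Bitorsor.pair n₁ e') (Bitorsor.pinv n₂)) =
        Bitorsor.pair (Bitorsor.ofInv (ℓ.val b)) e ↔ R b n₁ e' n₂ e := by
  choose θ hl hr hθ using fun b => (hR.isSq b).exists_map
    (T := Bitorsor.twist 1) (y := (1 : H)) fun h => (one_mul h).trans (mul_one h).symm
  refine ⟨Bibundle.trivial k H D, Bibundle.trivialSection k H D, ⟨θ, hl, hr, ?_⟩, hθ⟩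
  rintro ⟨⟨i, j⟩, l⟩
  refine Bibundle.isSection_iff.2 ?_
  rintro b ⟨⟨hi, hj⟩, hl'⟩
  choose e he _ using fun y => (hR.isSq y).existsUnique (N₁.t i y) (E'.t j y) (N₂.t l y)
  have h1 : E.SecAt e b := hR.secAt (Bibundle.secAt_t hi) (Bibundle.secAt_t hj)
    (Bibundle.secAt_t hl') (Filter.Eventually.of_forall he)
  have h2 : (Bibundle.trivial k H D).SecAt (fun _ => (1 : H)) b :=
    Bibundle.secAt_t (E := Bibundle.trivial k H D) (i := ⟨⟩) trivial
  exact (h2.pair h1).congr (Filter.Eventually.of_forall fun y => (hθ y _ _ _ _).2 (he y))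

end Squares

end NBG

/-! ### Comparisons of gerbes; stable equivalence is an equivalence relation -/

namespace NBG

section GerbeComparison

variable {k : ℕ} {H : Type u} [TopologicalSpace H] [ChartedSpace (EuclideanSpace ℝ (Fin k)) H]
  [Group H] [LieGroup (𝓡 k) ∞ H]
  {m : ℕ} {M : Type u} [TopologicalSpace M] [ChartedSpace (EuclideanSpace ℝ (Fin m)) M]
  [IsManifold (𝓡 m) ∞ M]

namespace Gerbe

variable {G G' G'' : Gerbe M k H m}

/-- The multiplication `e₁₂ e₂₃ = e₁₃` of a gerbe, encoded by its section `f`. -/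
def Tri (G : Gerbe M k H m) (a b c : G.C.idx) {x : M} (ha : x ∈ G.C.O a) (hb : x ∈ G.C.O b)
    (hc : x ∈ G.C.O c) (e₁₂ : (G.E a b).fib ⟨x, ha, hb⟩) (e₂₃ : (G.E b c).fib ⟨x, hb, hc⟩)
    (e₁₃ : (G.E a c).fib ⟨x, ha, hc⟩) : Prop :=
  Bibundle.Rep ((G.f a b c).val ⟨x, ha, hb, hc⟩) e₁₂ e₂₃ e₁₃

lemma isTriangle (G : Gerbe M k H m) (a b c : G.C.idx) :
    IsTriangle ((G.E a b).pullback (r12 m (G.C.O a) (G.C.O b) (G.C.O c)))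
      ((G.E b c).pullback (r23 m (G.C.O a) (G.C.O b) (G.C.O c)))
      ((G.E a c).pullback (r13 m (G.C.O a) (G.C.O b) (G.C.O c)))
      (fun x => G.Tri a b c x.2.1 x.2.2.1 x.2.2.2) :=
  (G.f a b c).isTriangle

lemma isTri (G : Gerbe M k H m) (a b c : G.C.idx) {x : M} (ha : x ∈ G.C.O a) (hb : x ∈ G.C.O b)
    (hc : x ∈ G.C.O c) : Bitorsor.IsTri (G.Tri a b c ha hb hc) :=
  (G.isTriangle a b c).isTri ⟨x, ha, hb, hc⟩

/-- The cocycle condition says that `e₁₂ (e₂₃ e₃₄)` and `(e₁₂ e₂₃) e₃₄` agree once both are formed;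
existence of products turns this into an equivalence. -/
lemma Tri.assoc {a b c d : G.C.idx} {x : M} {ha : x ∈ G.C.O a} {hb : x ∈ G.C.O b}
    {hc : x ∈ G.C.O c} {hd : x ∈ G.C.O d} {e₁₂ : (G.E a b).fib ⟨x, ha, hb⟩}
    {e₂₃ : (G.E b c).fib ⟨x, hb, hc⟩} {e₁₃ : (G.E a c).fib ⟨x, ha, hc⟩}
    {e₃₄ : (G.E c d).fib ⟨x, hc, hd⟩} {e₂₄ : (G.E b d).fib ⟨x, hb, hd⟩}
    {e₁₄ : (G.E a d).fib ⟨x, ha, hd⟩}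
    (h₁ : G.Tri a b c ha hb hc e₁₂ e₂₃ e₁₃) (h₂ : G.Tri b c d hb hc hd e₂₃ e₃₄ e₂₄) :
    G.Tri a b d ha hb hd e₁₂ e₂₄ e₁₄ ↔ G.Tri a c d ha hc hd e₁₃ e₃₄ e₁₄ := by
  constructor
  · intro h
    obtain ⟨y, hy, -⟩ := (G.isTri a c d ha hc hd).existsUnique e₁₃ e₃₄
    rwa [G.cocycle a b c d x ha hb hc hd e₁₂ e₂₃ e₃₄ e₁₃ e₂₄ e₁₄ y h₂ h h₁ hy]
  · intro h
    obtain ⟨y, hy, -⟩ := (G.isTri a b d ha hb hd).existsUnique e₁₂ e₂₄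
    rwa [← G.cocycle a b c d x ha hb hc hd e₁₂ e₂₃ e₃₄ e₁₃ e₂₄ y e₁₄ h₂ hy h₁ h]

/-- A comparison of two gerbes on a common refinement of their covers: bibundles `N_a` and
identifications `N_a E'_{ab} = E_{ab} N_b` compatible with the multiplications. -/
structure Comparison (G G' : Gerbe M k H m) (P : Cover M) (r : P.idx → G.C.idx)
    (r' : P.idx → G'.C.idx) (hr : ∀ a, P.O a ≤ G.C.O (r a))
    (hr' : ∀ a, P.O a ≤ G'.C.O (r' a)) : Type (u + 1) where
  N : ∀ a, Bibundle k H (onSet m (P.O a : Set M))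
  R : ∀ a b (x : on2 m (P.O a) (P.O b)), ((N a).pullback (inclL m (P.O a) (P.O b))).fib x →
    ((G'.E (r' a) (r' b)).pullback (incl2 m (hr' a) (hr' b))).fib x →
    ((N b).pullback (inclR m (P.O a) (P.O b))).fib x →
    ((G.E (r a) (r b)).pullback (incl2 m (hr a) (hr b))).fib x → Prop
  isSquare : ∀ a b, IsSquare ((N a).pullback (inclL m (P.O a) (P.O b)))
    ((G'.E (r' a) (r' b)).pullback (incl2 m (hr' a) (hr' b)))
    ((N b).pullback (inclR m (P.O a) (P.O b)))
    ((G.E (r a) (r b)).pullback (incl2 m (hr a) (hr b))) (R a b)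
  comp : ∀ (a b c : P.idx) (x : M) (ha : x ∈ P.O a) (hb : x ∈ P.O b) (hc : x ∈ P.O c)
      (n₁ : (N a).fib ⟨x, ha⟩) (n₂ : (N b).fib ⟨x, hb⟩) (n₃ : (N c).fib ⟨x, hc⟩)
      (e₁₂ : (G.E (r a) (r b)).fib ⟨x, hr a ha, hr b hb⟩)
      (e₂₃ : (G.E (r b) (r c)).fib ⟨x, hr b hb, hr c hc⟩)
      (e₁₃ : (G.E (r a) (r c)).fib ⟨x, hr a ha, hr c hc⟩)
      (e'₁₂ : (G'.E (r' a) (r' b)).fib ⟨x, hr' a ha, hr' b hb⟩)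
      (e'₂₃ : (G'.E (r' b) (r' c)).fib ⟨x, hr' b hb, hr' c hc⟩)
      (e'₁₃ : (G'.E (r' a) (r' c)).fib ⟨x, hr' a ha, hr' c hc⟩),
      R a b ⟨x, ha, hb⟩ n₁ e'₁₂ n₂ e₁₂ → R b c ⟨x, hb, hc⟩ n₂ e'₂₃ n₃ e₂₃ →
      G'.Tri (r' a) (r' b) (r' c) (hr' a ha) (hr' b hb) (hr' c hc) e'₁₂ e'₂₃ e'₁₃ →
      G.Tri (r a) (r b) (r c) (hr a ha) (hr b hb) (hr c hc) e₁₂ e₂₃ e₁₃ →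
      R a c ⟨x, ha, hc⟩ n₁ e'₁₃ n₃ e₁₃

/-- The point `d₁₃` in the definition is the unique completion of the square over `ac`, so the
condition `e₁₃ = d₁₃` says that multiplying the squares over `ab` and `bc` gives the square over
`ac`. -/
lemma stableEquiv_iff : G.StableEquiv G' ↔ ∃ P r r' hr hr',
    Nonempty (Comparison G G' P r r' hr hr') := by
  constructor
  · rintro ⟨P, r, r', hr, hr', N, η, ℓ, Θ, h⟩
    refine ⟨P, r, r', hr, hr', ⟨⟨N, _, fun a b => (Θ a b).isSquare (ℓ a b), ?_⟩⟩⟩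
    intro a b c x ha hb hc n₁ n₂ n₃ e₁₂ e₂₃ e₁₃ e'₁₂ e'₂₃ e'₁₃ h₁ h₂ h' h''
    obtain ⟨d, hd, -⟩ := (((Θ a c).isSquare (ℓ a c)).isSq ⟨x, ha, hc⟩).existsUnique n₁ e'₁₃ n₃
    have := h a b c x ha hb hc n₁ n₂ n₃ e₁₂ e₂₃ e₁₃ d e'₁₂ e'₂₃ e'₁₃ h₁ h₂ hd h' h''
    rwa [this]
  · rintro ⟨P, r, r', hr, hr', ⟨⟨N, R, hR, h⟩⟩⟩
    choose η ℓ Θ hΘ using fun a b => (hR a b).exists_iso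
    refine ⟨P, r, r', hr, hr', N, η, ℓ, Θ, ?_⟩
    intro a b c x ha hb hc n₁ n₂ n₃ e₁₂ e₂₃ e₁₃ d e'₁₂ e'₂₃ e'₁₃ h₁ h₂ hd h' h''
    have h₃ := h a b c x ha hb hc n₁ n₂ n₃ e₁₂ e₂₃ e₁₃ e'₁₂ e'₂₃ e'₁₃
      ((hΘ a b _ _ _ _ _).1 h₁) ((hΘ b c _ _ _ _ _).1 h₂) h' h''
    exact ((hR a c).isSq ⟨x, ha, hc⟩).eq h₃ ((hΘ a c _ _ _ _ _).1 hd)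

namespace Comparison

variable {P : Cover M} {r : P.idx → G.C.idx} {r' : P.idx → G'.C.idx} {r'' : P.idx → G''.C.idx}
  {hr : ∀ a, P.O a ≤ G.C.O (r a)} {hr' : ∀ a, P.O a ≤ G'.C.O (r' a)}
  {hr'' : ∀ a, P.O a ≤ G''.C.O (r'' a)}

/-- Restriction of a comparison to a finer cover. -/
noncomputable def refine (c : Comparison G G' P r r' hr hr') (Q : Cover M) (s : Q.idx → P.idx)
    (hs : ∀ a, Q.O a ≤ P.O (s a)) :
    Comparison G G' Q (r ∘ s) (r' ∘ s) (fun a => (hs a).trans (hr (s a)))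
      (fun a => (hs a).trans (hr' (s a))) where
  N a := (c.N (s a)).pullback (incl m (hs a))
  R a b x := c.R (s a) (s b) ((incl2 m (hs a) (hs b)).pt x)
  isSquare a b := (c.isSquare (s a) (s b)).pullback (incl2 m (hs a) (hs b))
  comp a₁ a₂ a₃ x h₁ h₂ h₃ := c.comp (s a₁) (s a₂) (s a₃) x (hs _ h₁) (hs _ h₂) (hs _ h₃)

/-- Two refinement maps into the cover of a gerbe are compared by `N_a = E_{r a, r' a}`. -/
noncomputable def ofRefinements (G : Gerbe M k H m) (P : Cover M) (r r' : P.idx → G.C.idx)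
    (hr : ∀ a, P.O a ≤ G.C.O (r a)) (hr' : ∀ a, P.O a ≤ G.C.O (r' a)) :
    Comparison G G P r r' hr hr' where
  N a := (G.E (r a) (r' a)).pullback (incl m fun _ h => ⟨hr a h, hr' a h⟩)
  R a b x n₁ e' n₂ e := ∃ c,
    G.Tri (r a) (r' a) (r' b) (hr a x.2.1) (hr' a x.2.1) (hr' b x.2.2) n₁ e' c ∧
    G.Tri (r a) (r b) (r' b) (hr a x.2.1) (hr b x.2.2) (hr' b x.2.2) e n₂ c
  isSquare a b :=
    ((G.isTriangle (r a) (r' a) (r' b)).pullback (D' := on2 m (P.O a) (P.O b))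
      (incl m fun _ h => ⟨hr a h.1, hr' a h.1, hr' b h.2⟩)).isSquare
    ((G.isTriangle (r a) (r b) (r' b)).pullback (D' := on2 m (P.O a) (P.O b))
      (incl m fun _ h => ⟨hr a h.1, hr b h.2, hr' b h.2⟩))
  comp := by
    rintro a b c x ha hb hc n₁ n₂ n₃ e₁₂ e₂₃ e₁₃ e'₁₂ e'₂₃ e'₁₃ ⟨c₁, h₁, h₁'⟩ ⟨c₂, h₂, h₂'⟩ h' h
    obtain ⟨d, hd, -⟩ := (G.isTri (r a) (r' a) (r' c) (hr a ha) (hr' a ha)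
      (hr' c hc)).existsUnique n₁ e'₁₃
    -- `n₁ e'₁₃ = (n₁ e'₁₂) e'₂₃ = (e₁₂ n₂) e'₂₃ = e₁₂ (e₂₃ n₃) = e₁₃ n₃`.
    exact ⟨d, hd, (h.assoc h₂').1 ((h₁'.assoc h₂).2 ((h₁.assoc h').1 hd))⟩

/-- Composition of comparisons on the same cover. -/
noncomputable def trans (c : Comparison G G' P r r' hr hr') (c' : Comparison G' G'' P r' r'' hr' hr'') :
    Comparison G G'' P r r'' hr hr'' where
  N a := (c.N a).mul (c'.N a)
  R a b x := Bitorsor.sqComp (c.R a b x) (c'.R a b x)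
  isSquare a b := (c.isSquare a b).comp (c'.isSquare a b)
  comp := by
    intro a b d x ha hb hd p₁ p₂ p₃ e₁₂ e₂₃ e₁₃ e'₁₂ e'₂₃ e'₁₃ h₁ h₂ h'' h
    obtain ⟨n₁, n₁', rfl⟩ := Bitorsor.exists_pair p₁
    obtain ⟨n₂, n₂', rfl⟩ := Bitorsor.exists_pair p₂
    obtain ⟨n₃, n₃', rfl⟩ := Bitorsor.exists_pair p₃
    obtain ⟨u, h₃, h₃'⟩ := (Bitorsor.sqComp_pair_iff ((c.isSquare a b).isSq _)
      ((c'.isSquare a b).isSq _) _ _ _ _ _ _).1 h₁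
    obtain ⟨v, h₄, h₄'⟩ := (Bitorsor.sqComp_pair_iff ((c.isSquare b d).isSq _)
      ((c'.isSquare b d).isSq _) _ _ _ _ _ _).1 h₂
    -- The intermediate points `u`, `v` lie in the middle gerbe; their product `w` splits the claim
    -- into the conditions for `c` and `c'`.
    obtain ⟨w, hw, -⟩ := (G'.isTri (r' a) (r' b) (r' d) (hr' a ha) (hr' b hb)
      (hr' d hd)).existsUnique u v
    exact ⟨n₁, n₁', n₃, n₃', w, rfl, rfl, c.comp a b d x ha hb hd _ _ _ _ _ _ _ _ _ h₃ h₄ hw h,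
      c'.comp a b d x ha hb hd _ _ _ _ _ _ _ _ _ h₃' h₄' h'' hw⟩

/-- The inverse of a comparison. -/
noncomputable def symm (c : Comparison G G' P r r' hr hr') : Comparison G' G P r' r hr' hr where
  N a := (c.N a).inv
  R a b x := Bitorsor.sqInv (c.R a b x)
  isSquare a b := (c.isSquare a b).inv
  comp a b d x ha hb hd _ _ _ _ _ _ _ _ _ h₁ h₂ h h' :=
    c.comp a b d x ha hb hd _ _ _ _ _ _ _ _ _ h₁ h₂ h' h

end Comparison

end Gerbe

/-- The common refinement of two covers. -/
def Cover.inf (C D : Cover M) : Cover M where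
  idx := C.idx × D.idx
  O a := C.O a.1 ⊓ D.O a.2
  covers x :=
    let ⟨a, ha⟩ := C.covers x
    let ⟨b, hb⟩ := D.covers x
    ⟨(a, b), ha, hb⟩

namespace Gerbe

variable {G G' : Gerbe M k H m}

/-- Stably equivalent gerbes can be compared on any common refinement, after passing to a
finer cover. -/
lemma StableEquiv.exists_comparison (h : G.StableEquiv G') (Q : Cover M) (s : Q.idx → G.C.idx)
    (s' : Q.idx → G'.C.idx) (hs : ∀ a, Q.O a ≤ G.C.O (s a)) (hs' : ∀ a, Q.O a ≤ G'.C.O (s' a)) :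
    ∃ (P : Cover M) (t : P.idx → Q.idx) (ht : ∀ a, P.O a ≤ Q.O (t a)),
      Nonempty (Comparison G G' P (s ∘ t) (s' ∘ t) (fun a => (ht a).trans (hs _))
        (fun a => (ht a).trans (hs' _))) := by
  obtain ⟨P, r, r', hr, hr', ⟨c⟩⟩ := stableEquiv_iff.1 h
  refine ⟨Q.inf P, Prod.fst, fun _ => inf_le_left, ⟨?_⟩⟩
  -- The given comparison uses the refinement maps `r`, `r'`; composing with self-comparisons of `G`
  -- and `G'` on both sides replaces them by `s`, `s'`.
  exact ((Comparison.ofRefinements G (Q.inf P) (s ∘ Prod.fst) (r ∘ Prod.snd)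
    (fun a => inf_le_left.trans (hs _)) (fun a => inf_le_right.trans (hr _))).trans
    (c.refine (Q.inf P) Prod.snd fun _ => inf_le_right)).trans
    (Comparison.ofRefinements G' (Q.inf P) (r' ∘ Prod.snd) (s' ∘ Prod.fst)
      (fun a => inf_le_right.trans (hr' _)) (fun a => inf_le_left.trans (hs' _)))

/-- In transitivity the two comparisons refine the cover of the middle gerbe by different maps; a
self-comparison of `G'` inserted between them bridges the difference. Another self-comparison gives
reflexivity. -/
lemma stableEquiv_equivalence :
    Equivalence (StableEquiv (k := k) (H := H) (m := m) (M := M)) where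
  refl G := stableEquiv_iff.2 ⟨G.C, id, id, fun _ => le_rfl, fun _ => le_rfl,
    ⟨Comparison.ofRefinements _ _ _ _ _ _⟩⟩
  symm h := by
    obtain ⟨P, r, r', hr, hr', ⟨c⟩⟩ := stableEquiv_iff.1 h
    exact stableEquiv_iff.2 ⟨P, r', r, hr', hr, ⟨c.symm⟩⟩
  trans {G G' G''} h h' := by
    obtain ⟨P, r, r', hr, hr', ⟨c⟩⟩ := stableEquiv_iff.1 h
    obtain ⟨Q, s', s, hs', hs, ⟨d⟩⟩ := stableEquiv_iff.1 h'
    refine stableEquiv_iff.2 ⟨P.inf Q, r ∘ Prod.fst, s ∘ Prod.snd,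
      fun a => inf_le_left.trans (hr _), fun a => inf_le_right.trans (hs _), ⟨?_⟩⟩
    exact ((c.refine (P.inf Q) Prod.fst fun _ => inf_le_left).trans
      (Comparison.ofRefinements G' (P.inf Q) (r' ∘ Prod.fst) (s' ∘ Prod.snd)
        (fun a => inf_le_left.trans (hr' _)) (fun a => inf_le_right.trans (hs' _)))).trans
      (d.refine (P.inf Q) Prod.snd fun _ => inf_le_right)

end Gerbe

end GerbeComparison

end NBG

/-! ### Triangles generated by one triple; smooth maps on subsets of `M` -/

namespace NBG

namespace Bitorsor

variable {H : Type u} [Group H]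

lemma phiAut_l (T : Bitorsor H) (g : H) (e : T) :
    T.phiAut (T.l g e) = MulAut.conj g * T.phiAut e := by
  ext h
  exact T.phi_l g e h

lemma conj_div (T : Bitorsor H) (e f : T) :
    MulAut.conj (T.div e f) = T.phiAut e * (T.phiAut f)⁻¹ := by
  rw [eq_mul_inv_iff_mul_eq, ← phiAut_l, l_div]

lemma IsSq.congr {N₁ E' N₂ E : Bitorsor H} {R R' : N₁ → E' → N₂ → E → Prop} (hR : IsSq R)
    (hR' : IsSq R') {a b c d} (h : R a b c d) (h' : R' a b c d) (a' b' c' d') :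
    R a' b' c' d' ↔ R' a' b' c' d' := by
  rw [hR.iff h, hR'.iff h']

variable {A B C : Bitorsor H}

/-- The identification of `A B` with `C` generated by one triple. -/
def triOf (a : A) (b : B) (c : C) (a' : A) (b' : B) (c' : C) : Prop :=
  A.div a' a * A.phi a (B.div b' b) = C.div c' c

lemma triOf_self (a : A) (b : B) (c : C) : triOf a b c a b c := by
  simp [triOf]

lemma isTri_triOf {a : A} {b : B} {c : C} (h : ∀ x, A.phi a (B.phi b x) = C.phi c x) :
    IsTri (triOf a b c) where
  nonempty := ⟨a, b, c, triOf_self _ _ _⟩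
  phi_eq := by
    intro a' b' c' hh x
    unfold triOf at hh
    rw [A.phi_eq_div a' a, B.phi_eq_div b' b, C.phi_eq_div c' c, ← hh]
    simp only [phi_mul, phi_inv, h]
    group
  l_iff := by
    intro a' b' c' hh g k p
    unfold triOf at hh ⊢
    rw [div_l, div_l, div_l, ← hh, A.phi_eq_div a' a, phi_mul, ← mul_assoc, ← mul_assoc,
      mul_left_inj]
    constructor
    · intro h1
      rw [← mul_assoc, ← mul_assoc, h1]
      group
    · rintro rfl
      group

end Bitorsor

section OnSet

variable {k : ℕ} {H : Type u} [TopologicalSpace H] [ChartedSpace (EuclideanSpace ℝ (Fin k)) H]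
  [Group H]
  {m : ℕ} {M : Type u} [TopologicalSpace M] [ChartedSpace (EuclideanSpace ℝ (Fin m)) M]
  [IsManifold (𝓡 m) ∞ M]

/-- Local data are functions on `M` smooth on open sets, whereas bibundles live on subsets `S`. This
and the next three lemmas pass between the two; openness of `U` dispenses with any relation between
`U` and `S`. -/
lemma smAt_of_contMDiffOn {F : M → H} {U : Set M} (hU : IsOpen U)
    (hF : ContMDiffOn (𝓡 m) (𝓡 k) ∞ F U) {S : Set M} (x : onSet m S) (hx : x.1 ∈ U) :
    SmAt k (fun y : onSet m S => F y.1) x := by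
  have h1 : ContMDiffWithinAt (𝓡 m) (𝓡 k) ∞ F S x.1 :=
    ((hF x.1 hx).contMDiffAt (hU.mem_nhds hx)).contMDiffWithinAt
  refine ContMDiffWithinAt.congr h1 (fun y hy => ?_) ?_
  · exact extend_val (B := onSet m S) (fun y => F y.1) _ ⟨y, hy⟩
  · exact extend_val (B := onSet m S) (fun y => F y.1) _ x

lemma smAt₂_of_contMDiffOn {F : M → H → H} {U : Set M} (hU : IsOpen U)
    (hF : ContMDiffOn ((𝓡 m).prod (𝓡 k)) (𝓡 k) ∞ (fun p : M × H => F p.1 p.2) (U ×ˢ univ))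
    {S : Set M} (x : onSet m S) (hx : x.1 ∈ U) :
    SmAt₂ k (fun y : onSet m S => F y.1) x := by
  intro a
  have h1 : ContMDiffWithinAt ((𝓡 m).prod (𝓡 k)) (𝓡 k) ∞ (fun p : M × H => F p.1 p.2)
      (S ×ˢ univ) (x.1, a) :=
    ((hF (x.1, a) ⟨hx, mem_univ _⟩).contMDiffAt
      ((hU.prod isOpen_univ).mem_nhds ⟨hx, mem_univ _⟩)).contMDiffWithinAt
  refine ContMDiffWithinAt.congr h1 ?_ ?_
  · rintro ⟨y, c⟩ ⟨hy, -⟩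
    exact extend_val (B := onSet m S) (fun y => F y.1 c) _ ⟨y, hy⟩
  · exact extend_val (B := onSet m S) (fun y => F y.1 a) _ x

lemma contMDiffOn_of_smAt {S U : Set M} {f : onSet m S → H} {F : M → H}
    (hUS : U ⊆ S) (hF : ∀ y (hy : y ∈ U), F y = f ⟨y, hUS hy⟩)
    (hf : ∀ y (hy : y ∈ U), SmAt k f ⟨y, hUS hy⟩) : ContMDiffOn (𝓡 m) (𝓡 k) ∞ F U := by
  intro x hx
  have h1 : ContMDiffWithinAt (𝓡 m) (𝓡 k) ∞
      (fun y : M => Function.extend (Subtype.val : onSet m S → M) f (fun _ => 1) y) S x := hf x hx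
  refine (h1.mono hUS).congr (fun y hy => ?_) ?_
  · rw [hF y hy]
    exact (extend_val (B := onSet m S) f _ ⟨y, hUS hy⟩).symm
  · rw [hF x hx]
    exact (extend_val (B := onSet m S) f _ ⟨x, hUS hx⟩).symm

lemma contMDiffOn_of_smAt₂ {S U : Set M} {f : onSet m S → H → H}
    {F : M → H → H} (hUS : U ⊆ S) (hF : ∀ y (hy : y ∈ U) a, F y a = f ⟨y, hUS hy⟩ a)
    (hf : ∀ y (hy : y ∈ U), SmAt₂ k f ⟨y, hUS hy⟩) :
    ContMDiffOn ((𝓡 m).prod (𝓡 k)) (𝓡 k) ∞ (fun p : M × H => F p.1 p.2) (U ×ˢ univ) := by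
  rintro ⟨x, a⟩ ⟨hx, -⟩
  have h1 : ContMDiffWithinAt ((𝓡 m).prod (𝓡 k)) (𝓡 k) ∞
      (fun p : M × H => Function.extend (Subtype.val : onSet m S → M) (fun x => f x p.2)
        (fun _ => 1) p.1) (S ×ˢ univ) (x, a) := hf x hx a
  refine (h1.mono (prod_mono hUS subset_rfl)).congr ?_ ?_
  · rintro ⟨y, c⟩ ⟨hy, -⟩
    simp only
    rw [hF y hy]
    exact (extend_val (B := onSet m S) (fun x => f x c) _ ⟨y, hUS hy⟩).symm
  · simp only
    rw [hF x hx]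
    exact (extend_val (B := onSet m S) (fun x => f x a) _ ⟨x, hUS hx⟩).symm

/-- Extension of a section over an open subset by arbitrary values. -/
lemma Bibundle.exists_extension {S S' : Set M} (hS : IsOpen S) (h : S ⊆ S')
    (E : Bibundle k H (onSet m S')) (t : ∀ x, (E.pullback (incl m h)).fib x) :
    ∃ T : ∀ x, E.fib x, (∀ x (hx : x ∈ S), T ⟨x, h hx⟩ = t ⟨x, hx⟩) ∧
      ∀ x (hx : x ∈ S), (E.pullback (incl m h)).SecAt t ⟨x, hx⟩ → E.SecAt T ⟨x, h hx⟩ := by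
  classical
  let T : ∀ x, E.fib x := fun y =>
    if hy : y.1 ∈ S then t ⟨y.1, hy⟩ else (E.fib y).nonempty.some
  have hT : ∀ x (hx : x ∈ S), T ⟨x, h hx⟩ = t ⟨x, hx⟩ := fun x hx => dif_pos hx
  refine ⟨T, hT, fun x hx ht i hi => ?_⟩
  refine SmAt.transfer (B := onSet m S) (B' := onSet m S') (fun y => y) (ht i hi)
    (contMDiff_id (I := 𝓡 m) (M := M)).contMDiffAt.contMDiffWithinAt rfl ?_
  have h1 : ∀ᶠ y : onSet m S' in 𝓝 (⟨x, h hx⟩ : onSet m S'), y.1 ∈ S :=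
    continuous_subtype_val.continuousAt.eventually (hS.mem_nhds hx)
  filter_upwards [h1] with y hy
  refine ⟨⟨y.1, hy⟩, rfl, ?_⟩
  have := hT y.1 hy
  exact congrArg (fun z => (E.fib y).div z (E.t i y)) this.symm

end OnSet

/-! ### Bibundles from local data -/

section OfLocalData

variable {k : ℕ} {H : Type u} [TopologicalSpace H] [ChartedSpace (EuclideanSpace ℝ (Fin k)) H]
  [Group H]

/-- The bibundle with transition functions `h^{ij}` and automorphisms `φ^i`. -/
noncomputable def Bibundle.ofLocalData {B : Base.{u}} {ι : Type u} (dom : ι → Opens B)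
    (cov : ∀ b, ∃ i, b ∈ dom i) (h : ι → ι → B → H) (φ : ι → B → MulAut H)
    (h_smooth : ∀ i j b, b ∈ dom i → b ∈ dom j → SmAt k (h i j) b)
    (φ_smooth : ∀ i b, b ∈ dom i → SmAt₂ k (fun b a => φ i b a) b)
    (φ_symm_smooth : ∀ i b, b ∈ dom i → SmAt₂ k (fun b a => (φ i b).symm a) b)
    (h_cocycle : ∀ i j l b, b ∈ dom i → b ∈ dom j → b ∈ dom l → h i j b * h j l b = h i l b)
    (Ad_h : ∀ i j b, b ∈ dom i → b ∈ dom j → MulAut.conj (h i j b) = φ i b * (φ j b)⁻¹) :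
    Bibundle k H B where
  -- The fibre at `b` uses an arbitrarily chosen chart index `i(b)`, and `t^i` is `h^{i i(b)}`
  -- there. The choice cancels in the quotients `t^i / t^j = h^{ij}` and, by `Ad_h`, in `φ_{t^i} =
  -- φ^i`.
  fib b := Bitorsor.twist (φ (cov b).choose b)
  idx := ι
  dom := dom
  dom_cover := cov
  t i b := h i (cov b).choose b
  trans_smooth i j := smoothOn_iff.2 fun b hb => (h_smooth i j b hb.1 hb.2).congr <| by
    filter_upwards [(dom i ⊓ dom j).isOpen.mem_nhds hb] with x hx
    refine (Bitorsor.twist_div _ _ _).trans ?_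
    rw [mul_inv_eq_iff_eq_mul, h_cocycle _ _ _ _ hx.1 hx.2 (cov x).choose_spec]
  phi_smooth i := smoothOn₂_iff.2 fun b hb => (φ_smooth i b hb).congr <| by
    filter_upwards [(dom i).isOpen.mem_nhds hb] with x hx a
    refine (Bitorsor.twist_phi _ _ _).trans ?_
    have := Ad_h _ _ x hx (cov x).choose_spec
    rw [eq_mul_inv_iff_mul_eq] at this
    rw [← this]
    rfl
  phiInv_smooth i := smoothOn₂_iff.2 fun b hb => (φ_symm_smooth i b hb).congr <| by
    filter_upwards [(dom i).isOpen.mem_nhds hb] with x hx a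
    refine (Bitorsor.twist_phiInv _ _ _).trans ?_
    have := Ad_h _ _ x hx (cov x).choose_spec
    rw [eq_mul_inv_iff_mul_eq] at this
    rw [← this, MulEquiv.symm_apply_eq]
    change _ = (φ _ x) ((φ _ x)⁻¹ ((MulAut.conj _)⁻¹ a))
    rw [MulAut.apply_inv_self, MulAut.conj_inv_apply]

variable {B : Base.{u}} {ι : Type u} {dom : ι → Opens B}
    {cov : ∀ b, ∃ i, b ∈ dom i} {h : ι → ι → B → H} {φ : ι → B → MulAut H}
    {h_smooth : ∀ i j b, b ∈ dom i → b ∈ dom j → SmAt k (h i j) b}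
    {φ_smooth : ∀ i b, b ∈ dom i → SmAt₂ k (fun b a => φ i b a) b}
    {φ_symm_smooth : ∀ i b, b ∈ dom i → SmAt₂ k (fun b a => (φ i b).symm a) b}
    {h_cocycle : ∀ i j l b, b ∈ dom i → b ∈ dom j → b ∈ dom l → h i j b * h j l b = h i l b}
    {Ad_h : ∀ i j b, b ∈ dom i → b ∈ dom j → MulAut.conj (h i j b) = φ i b * (φ j b)⁻¹}
    {i j : ι} {b : B}

lemma Bibundle.ofLocalData_div (hi : b ∈ dom i) (hj : b ∈ dom j) :
    ((Bibundle.ofLocalData dom cov h φ h_smooth φ_smooth φ_symm_smooth h_cocycle Ad_h).fib b).div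
      ((Bibundle.ofLocalData dom cov h φ h_smooth φ_smooth φ_symm_smooth h_cocycle Ad_h).t i b)
      ((Bibundle.ofLocalData dom cov h φ h_smooth φ_smooth φ_symm_smooth h_cocycle Ad_h).t j b) =
      h i j b := by
  refine (Bitorsor.twist_div _ _ _).trans ?_
  change h i (cov b).choose b * (h j (cov b).choose b)⁻¹ = _
  rw [mul_inv_eq_iff_eq_mul, h_cocycle _ _ _ _ hi hj (cov b).choose_spec]

lemma Bibundle.ofLocalData_phi (hi : b ∈ dom i) (a : H) :
    ((Bibundle.ofLocalData dom cov h φ h_smooth φ_smooth φ_symm_smooth h_cocycle Ad_h).fib b).phi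
      ((Bibundle.ofLocalData dom cov h φ h_smooth φ_smooth φ_symm_smooth h_cocycle Ad_h).t i b) a =
      φ i b a := by
  refine (Bitorsor.twist_phi _ _ _).trans ?_
  have := Ad_h _ _ b hi (cov b).choose_spec
  rw [eq_mul_inv_iff_mul_eq] at this
  rw [← this]
  rfl

end OfLocalData

/-! ### Refined covers -/

section RefinedCover

variable {M : Type u} [TopologicalSpace M]

open Classical in
/-- The refinement of a cover by the open sets that are good for a finite set of indices. -/
noncomputable def RefinedCover.ofGood (C : Cover M) (good : Finset C.idx → Opens M → Prop)
    (h₁ : ∀ A U, good A U → ∀ a ∈ A, U ≤ C.O a)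
    (h₂ : ∀ (A : Finset C.idx) x, (∀ a ∈ A, x ∈ C.O a) → ∃ U, x ∈ U ∧ good A U) :
    RefinedCover M where
  toCover := C
  -- An index consists of a finite set of members of the cover and an open set good for it. For all
  -- other members `O^i_a` is empty, so that nothing has to be checked there.
  idx' := {p : Finset C.idx × Opens M // good p.1 p.2}
  O' i a := if a ∈ i.1.1 then i.1.2 else ⊥
  le i a := by
    split_ifs with h
    · exact h₁ _ _ i.2 a h
    · exact bot_le
  covers' A x hx := by
    obtain ⟨U, hU, hg⟩ := h₂ A x hx
    refine ⟨⟨(A, U), hg⟩, fun a ha => ?_⟩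
    simp only [if_pos ha]
    exact hU

open Classical in
lemma RefinedCover.mem_ofGood {C : Cover M} {good : Finset C.idx → Opens M → Prop}
    {h₁ : ∀ A U, good A U → ∀ a ∈ A, U ≤ C.O a}
    {h₂ : ∀ (A : Finset C.idx) x, (∀ a ∈ A, x ∈ C.O a) → ∃ U, x ∈ U ∧ good A U}
    (i : (RefinedCover.ofGood C good h₁ h₂).idx') (a : C.idx) (x : M) :
    x ∈ (RefinedCover.ofGood C good h₁ h₂).O' i a ↔ a ∈ i.1.1 ∧ x ∈ i.1.2 := by
  change x ∈ (if a ∈ i.1.1 then i.1.2 else ⊥ : Opens M) ↔ _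
  split_ifs with h
  · simp [h]
  · simp only [h, false_and, iff_false]
    exact fun hx => hx

/-- One refinement index has to serve finitely many members of a cover at once, so finitely many
local conditions are intersected. -/
lemma exists_open_of_finset {ι : Type*} (A : Finset ι) (x : M) {p : ι → Opens M → Prop}
    (mono : ∀ a U V, V ≤ U → p a U → p a V) (h : ∀ a ∈ A, ∃ U : Opens M, x ∈ U ∧ p a U) :
    ∃ U : Opens M, x ∈ U ∧ ∀ a ∈ A, p a U := by
  classical
  induction A using Finset.induction_on with
  | empty => exact ⟨⊤, trivial, by simp⟩
  | insert a A ha ih =>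
    obtain ⟨U, hU, h1⟩ := ih fun b hb => h b (Finset.mem_insert_of_mem hb)
    obtain ⟨V, hV, h2⟩ := h a (Finset.mem_insert_self _ _)
    refine ⟨U ⊓ V, ⟨hU, hV⟩, fun b hb => ?_⟩
    rcases Finset.mem_insert.1 hb with rfl | hb
    · exact mono _ _ _ inf_le_right h2
    · exact mono _ _ _ inf_le_left (h1 b hb)

end RefinedCover

section

variable {k : ℕ} {H : Type u} [TopologicalSpace H] [ChartedSpace (EuclideanSpace ℝ (Fin k)) H]
  [Group H]
  {m : ℕ} {M : Type u} [TopologicalSpace M] [ChartedSpace (EuclideanSpace ℝ (Fin m)) M]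
  [IsManifold (𝓡 m) ∞ M]

lemma Bibundle.exists_section_nhds {S : Set M} (hS : IsOpen S) (E : Bibundle k H (onSet m S))
    {x : M} (hx : x ∈ S) : ∃ U : Opens M, x ∈ U ∧ ∃ s : ∀ y, E.fib y,
      ∀ y (hy : y ∈ S), y ∈ U → E.SecAt s ⟨y, hy⟩ := by
  obtain ⟨i, hi⟩ := E.dom_cover ⟨x, hx⟩
  refine ⟨⟨Subtype.val '' (E.dom i : Set (onSet m S)),
    hS.isOpenMap_subtype_val _ (E.dom i).isOpen⟩, ⟨_, hi, rfl⟩, E.t i, ?_⟩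
  rintro y hy ⟨z, hz, rfl⟩
  exact secAt_t hz

lemma RefinedCover.isOpen_D2 (C : RefinedCover M) (i : C.idx') (a b : C.idx) :
    IsOpen (C.D2 i a b) := (C.O' i a).isOpen.inter (C.O' i b).isOpen

lemma RefinedCover.isOpen_D3 (C : RefinedCover M) (i : C.idx') (a b c : C.idx) :
    IsOpen (C.D3 i a b c) :=
  (C.O' i a).isOpen.inter ((C.O' i b).isOpen.inter (C.O' i c).isOpen)

end

end NBG

/-! ### Local data of a gerbe -/

namespace NBG

section

variable {k : ℕ} {H : Type u} [TopologicalSpace H] [ChartedSpace (EuclideanSpace ℝ (Fin k)) H]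
  [Group H] [LieGroup (𝓡 k) ∞ H]
  {m : ℕ} {M : Type u} [TopologicalSpace M] [ChartedSpace (EuclideanSpace ℝ (Fin m)) M]
  [IsManifold (𝓡 m) ∞ M]

lemma isOpen_on2 (U V : Opens M) : IsOpen {x | x ∈ U ∧ x ∈ V} := U.isOpen.inter V.isOpen

/-- For a finite set `A` of indices, a small neighbourhood of a point of their common intersection
carries sections of all `E_{ab}` with `a, b ∈ A` simultaneously; such neighbourhoods are the good
sets of the refinement. -/
lemma Gerbe.exists_refinedCover (G : Gerbe M k H m) :
    ∃ (C : RefinedCover M) (r : C.idx → G.C.idx) (_ : ∀ a, C.O a ≤ G.C.O (r a))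
      (s : ∀ (_ : C.idx') (a b : C.idx) x, (G.E (r a) (r b)).fib x),
      ∀ i a b x ha hb, x ∈ C.O' i a → x ∈ C.O' i b → (G.E (r a) (r b)).SecAt (s i a b) ⟨x, ha, hb⟩ := by
  let p : G.C.idx × G.C.idx → Opens M → Prop := fun a U =>
    ∃ s : ∀ x, (G.E a.1 a.2).fib x, ∀ x ha hb, x ∈ U → (G.E a.1 a.2).SecAt s ⟨x, ha, hb⟩
  let good : Finset G.C.idx → Opens M → Prop := fun A U =>
    (∀ a ∈ A, U ≤ G.C.O a) ∧ ∀ a ∈ A ×ˢ A, p a U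
  have h₂ : ∀ (A : Finset G.C.idx) x, (∀ a ∈ A, x ∈ G.C.O a) → ∃ U, x ∈ U ∧ good A U := by
    intro A x hx
    obtain ⟨U, hU, h1⟩ := exists_open_of_finset A x (p := fun a U => U ≤ G.C.O a)
      (fun a U V h h' => h.trans h') (fun a ha => ⟨G.C.O a, hx a ha, le_rfl⟩)
    obtain ⟨V, hV, h2⟩ := exists_open_of_finset (A ×ˢ A) x (p := p)
      (fun a U V h ⟨s, hs⟩ => ⟨s, fun x ha hb hx => hs x ha hb (h hx)⟩) (by
        rintro ⟨a, b⟩ hab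
        obtain ⟨ha, hb⟩ := Finset.mem_product.1 hab
        obtain ⟨U, hU, s, hs⟩ := Bibundle.exists_section_nhds (isOpen_on2 _ _) (G.E a b)
          (x := x) ⟨hx a ha, hx b hb⟩
        exact ⟨U, hU, s, fun x ha hb hx => hs x ⟨ha, hb⟩ hx⟩)
    exact ⟨U ⊓ V, ⟨hU, hV⟩, fun a ha => inf_le_left.trans (h1 a ha), fun a ha =>
      let ⟨s, hs⟩ := h2 a ha
      ⟨s, fun x ha hb hx => hs x ha hb hx.2⟩⟩
  have h3 : ∀ (i : (RefinedCover.ofGood G.C good (fun _ _ h => h.1) h₂).idx') (a b : G.C.idx),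
      ∃ s : ∀ x, (G.E a b).fib x, ∀ x ha hb,
        x ∈ (RefinedCover.ofGood G.C good (fun _ _ h => h.1) h₂).O' i a →
        x ∈ (RefinedCover.ofGood G.C good (fun _ _ h => h.1) h₂).O' i b →
        (G.E a b).SecAt s ⟨x, ha, hb⟩ := by
    intro i a b
    -- Outside the finite set of `i`, the intersection `O^i_a ∩ O^i_b` is empty and any values will
    -- do.
    by_cases h : a ∈ i.1.1 ∧ b ∈ i.1.1
    · obtain ⟨s, hs⟩ := i.2.2 (a, b) (Finset.mem_product.2 h)
      exact ⟨s, fun x ha hb hxa _ => hs x ha hb ((RefinedCover.mem_ofGood i a x).1 hxa).2⟩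
    · refine ⟨fun x => ((G.E a b).fib x).nonempty.some, fun x ha hb hxa hxb => ?_⟩
      exact absurd ⟨((RefinedCover.mem_ofGood i a x).1 hxa).1,
        ((RefinedCover.mem_ofGood i b x).1 hxb).1⟩ h
  choose s hs using h3
  exact ⟨RefinedCover.ofGood G.C good (fun _ _ h => h.1) h₂, id, fun _ => le_rfl, s, hs⟩

/-- The chosen sections serve as coordinates: `h` and `φ` are their quotients and automorphisms, and
`f` is fixed by `t_{ab} t_{bc} = f_{abc} t_{ac}`. All relations of local data are consequences of
the calculus of triangles. -/
theorem Gerbe.exists_localData (G : Gerbe M k H m) :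
    ∃ L : LocalData M k H m, L.IsLocalDataOf G := by
  classical
  obtain ⟨C, r, hr, s, hs⟩ := G.exists_refinedCover
  have m2 : ∀ {i a b x}, x ∈ C.D2 i a b → x ∈ G.C.O (r a) ∧ x ∈ G.C.O (r b) :=
    fun h => ⟨hr _ (C.le _ _ h.1), hr _ (C.le _ _ h.2)⟩
  have m3 : ∀ {i a b c x}, x ∈ C.D3 i a b c →
      x ∈ G.C.O (r a) ∧ x ∈ G.C.O (r b) ∧ x ∈ G.C.O (r c) :=
    fun h => ⟨hr _ (C.le _ _ h.1), hr _ (C.le _ _ h.2.1), hr _ (C.le _ _ h.2.2)⟩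
  have hs2 : ∀ i a b x (hx : x ∈ C.D2 i a b),
      (G.E (r a) (r b)).SecAt (s i a b) ⟨x, m2 hx⟩ :=
    fun i a b x hx => hs i a b x (m2 hx).1 (m2 hx).2 hx.1 hx.2
  have hp : ∀ (i : C.idx') (a b c : C.idx) (x : on3 m (G.C.O (r a)) (G.C.O (r b)) (G.C.O (r c))),
      ∃ e, G.Tri (r a) (r b) (r c) x.2.1 x.2.2.1 x.2.2.2 (s i a b ⟨x.1, x.2.1, x.2.2.1⟩)
        (s i b c ⟨x.1, x.2.2.1, x.2.2.2⟩) e := fun i a b c x =>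
    ((G.isTri (r a) (r b) (r c) x.2.1 x.2.2.1 x.2.2.2).existsUnique _ _).exists
  choose p hp using hp
  -- The functions are needed on all of `M`; the value `1` off the overlaps is irrelevant.
  let h : C.idx' → C.idx' → C.idx → C.idx → M → H := fun i j a b x =>
    if hx : x ∈ G.C.O (r a) ∧ x ∈ G.C.O (r b) then
      ((G.E (r a) (r b)).fib ⟨x, hx⟩).div (s i a b ⟨x, hx⟩) (s j a b ⟨x, hx⟩) else 1
  let φ : C.idx' → C.idx → C.idx → M → MulAut H := fun i a b x =>
    if hx : x ∈ G.C.O (r a) ∧ x ∈ G.C.O (r b) then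
      ((G.E (r a) (r b)).fib ⟨x, hx⟩).phiAut (s i a b ⟨x, hx⟩) else 1
  let f : C.idx' → C.idx → C.idx → C.idx → M → H := fun i a b c x =>
    if hx : x ∈ G.C.O (r a) ∧ x ∈ G.C.O (r b) ∧ x ∈ G.C.O (r c) then
      ((G.E (r a) (r c)).fib ⟨x, hx.1, hx.2.2⟩).div (p i a b c ⟨x, hx⟩)
        (s i a c ⟨x, hx.1, hx.2.2⟩) else 1
  have h_eq : ∀ i j a b {x} (hx : x ∈ G.C.O (r a) ∧ x ∈ G.C.O (r b)), h i j a b x =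
      ((G.E (r a) (r b)).fib ⟨x, hx⟩).div (s i a b ⟨x, hx⟩) (s j a b ⟨x, hx⟩) :=
    fun i j a b x hx => dif_pos hx
  have φ_eq : ∀ i a b {x} (hx : x ∈ G.C.O (r a) ∧ x ∈ G.C.O (r b)), φ i a b x =
      ((G.E (r a) (r b)).fib ⟨x, hx⟩).phiAut (s i a b ⟨x, hx⟩) := fun i a b x hx => dif_pos hx
  have f_eq : ∀ i a b c {x} (hx : x ∈ G.C.O (r a) ∧ x ∈ G.C.O (r b) ∧ x ∈ G.C.O (r c)),
      f i a b c x = ((G.E (r a) (r c)).fib ⟨x, hx.1, hx.2.2⟩).div (p i a b c ⟨x, hx⟩)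
        (s i a c ⟨x, hx.1, hx.2.2⟩) := fun i a b c x hx => dif_pos hx
  have f_tri : ∀ i a b c {x} (hx : x ∈ G.C.O (r a) ∧ x ∈ G.C.O (r b) ∧ x ∈ G.C.O (r c)),
      G.Tri (r a) (r b) (r c) hx.1 hx.2.1 hx.2.2 (s i a b ⟨x, hx.1, hx.2.1⟩)
        (s i b c ⟨x, hx.2⟩) (((G.E (r a) (r c)).fib ⟨x, hx.1, hx.2.2⟩).l (f i a b c x)
          (s i a c ⟨x, hx.1, hx.2.2⟩)) := by
    intro i a b c x hx
    rw [f_eq i a b c hx, Bitorsor.l_div]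
    exact hp i a b c ⟨x, hx⟩
  let L : LocalData M k H m :=
    { C := C
      h := h
      φ := φ
      f := f
      h_smooth := fun i j a b => contMDiffOn_of_smAt (fun x hx => m2 hx.1)
        (fun x hx => h_eq i j a b (m2 hx.1)) fun x hx =>
          (hs2 i a b x hx.1).div (hs2 j a b x hx.2)
      φ_smooth := fun i a b => ⟨contMDiffOn_of_smAt₂ (F := fun x y => φ i a b x y)
          (fun x hx => m2 hx) (fun x hx y => by rw [φ_eq i a b (m2 hx)]; rfl)
          (fun x hx => (hs2 i a b x hx).phi),
        contMDiffOn_of_smAt₂ (F := fun x y => (φ i a b x).symm y)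
          (fun x hx => m2 hx) (fun x hx y => by rw [φ_eq i a b (m2 hx)]; rfl)
          (fun x hx => (hs2 i a b x hx).phiInv)⟩
      f_smooth := fun i a b c => contMDiffOn_of_smAt (fun x hx => m3 hx)
        (fun x hx => f_eq i a b c (m3 hx)) fun x hx => by
          have h1 := (hs i a b x (m3 hx).1 (m3 hx).2.1 hx.1 hx.2.1).pullback
            (b := ⟨x, m3 hx⟩) (r12 m (G.C.O (r a)) (G.C.O (r b)) (G.C.O (r c)))
          have h2 := (hs i b c x (m3 hx).2.1 (m3 hx).2.2 hx.2.1 hx.2.2).pullback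
            (b := ⟨x, m3 hx⟩) (r23 m (G.C.O (r a)) (G.C.O (r b)) (G.C.O (r c)))
          have h3 := (hs i a c x (m3 hx).1 (m3 hx).2.2 hx.1 hx.2.2).pullback
            (b := ⟨x, m3 hx⟩) (r13 m (G.C.O (r a)) (G.C.O (r b)) (G.C.O (r c)))
          have h4 := (G.isTriangle (r a) (r b) (r c)).secAt h1 h2
            (Filter.Eventually.of_forall (hp i a b c))
          exact h4.div h3
      h_cocycle := fun i j l a b x hx => by
        rw [h_eq i j a b (m2 hx.1.1), h_eq j l a b (m2 hx.1.1), h_eq i l a b (m2 hx.1.1),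
          Bitorsor.div_mul_div]
      Ad_h := fun i j a b x hx => by
        rw [h_eq i j a b (m2 hx.1), φ_eq i a b (m2 hx.1), φ_eq j a b (m2 hx.1),
          Bitorsor.conj_div]
      -- The triples of index `i` and of index `j` belong to the same triangle; `IsTri.iff` based at
      -- the triple of `j` is the relation.
      h_mul := fun i j a b c x hx => by
        have hx' := m3 hx.1
        have h1 := ((G.isTri (r a) (r b) (r c) hx'.1 hx'.2.1 hx'.2.2).iff
          (f_tri j a b c hx') _ _ _).1 (f_tri i a b c hx')
        rw [h_eq i j a b ⟨hx'.1, hx'.2.1⟩, h_eq i j b c hx'.2, h_eq i j a c ⟨hx'.1, hx'.2.2⟩,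
          φ_eq j a b ⟨hx'.1, hx'.2.1⟩, Bitorsor.phiAut_apply, h1, Bitorsor.div_l,
          Bitorsor.div_l_right, mul_assoc]
      φ_mul := fun i a b c x hx => by
        have hx' := m3 hx
        rw [φ_eq i a b ⟨hx'.1, hx'.2.1⟩, φ_eq i b c hx'.2, φ_eq i a c ⟨hx'.1, hx'.2.2⟩,
          ← Bitorsor.phiAut_l]
        ext y
        exact (G.isTri (r a) (r b) (r c) hx'.1 hx'.2.1 hx'.2.2).phi_eq (f_tri i a b c hx') y
      -- The product `t_{ab} t_{bc} t_{cd}` is bracketed in both ways, and the coefficients of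
      -- `t_{ad}` are compared.
      f_cocycle := fun i a b c d x hx hxd => by
        have hx' := m3 hx
        have hd := hr _ (C.le _ _ hxd)
        have habd := f_tri i a b d ⟨hx'.1, hx'.2.1, hd⟩
        have hacd := f_tri i a c d ⟨hx'.1, hx'.2.2, hd⟩
        have habc := f_tri i a b c hx'
        have hbcd := f_tri i b c d ⟨hx'.2.1, hx'.2.2, hd⟩
        have h1 := ((G.isTri _ _ _ _ _ _).l_iff habd 1 (f i b c d x) _).2 rfl
        rw [Bitorsor.l_one] at h1
        have h2 := (habc.assoc hbcd).1 h1
        have h3 := (G.isTri _ _ _ _ _ _).left (f i a b c x) hacd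
        have h4 := ((G.isTri _ _ _ _ _ _).existsUnique _ _).unique h2 h3
        rw [← Bitorsor.l_mul, ← Bitorsor.l_mul] at h4
        have h5 := Bitorsor.l_injective _ _ h4
        rw [φ_eq i a b ⟨hx'.1, hx'.2.1⟩, Bitorsor.phiAut_apply]
        rw [one_mul] at h5
        exact h5 }
  refine ⟨L, r, hr, fun i a b x => s i a b ⟨x.1, m2 x.2⟩, ?_, ?_, ?_, ?_⟩
  · intro i a b
    refine Bibundle.isSection_iff.2 fun x _ => ?_
    exact (hs2 i a b x.1 x.2).pullback (b := x)
      (incl2 m ((C.le i a).trans (hr a)) ((C.le i b).trans (hr b)))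
  · intro i j a b x hia hib hja hjb
    have := h_eq i j a b (m2 (i := i) ⟨hia, hib⟩)
    change _ = Bitorsor.l _ (h i j a b x) _
    rw [this, Bitorsor.l_div]
  · intro i a b x ha hb g
    change φ i a b x g = _
    rw [φ_eq i a b (m2 ⟨ha, hb⟩)]
    rfl
  · intro i a b c x ha hb hc
    have hx' := m3 (i := i) ⟨ha, hb, hc⟩
    change G.Tri (r a) (r b) (r c) hx'.1 hx'.2.1 hx'.2.2 _ _ _
    have := (G.isTri _ _ _ _ _ _).left (f i a b c x)⁻¹ (f_tri i a b c hx')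
    rwa [Bitorsor.l_inv_l] at this

end

end NBG

/-! ### The gerbe glued from local data -/

namespace NBG

section

variable {k : ℕ} {H : Type u} [TopologicalSpace H] [ChartedSpace (EuclideanSpace ℝ (Fin k)) H]
  [Group H] [LieGroup (𝓡 k) ∞ H]
  {m : ℕ} {M : Type u} [TopologicalSpace M] [ChartedSpace (EuclideanSpace ℝ (Fin m)) M]
  [IsManifold (𝓡 m) ∞ M]

lemma RefinedCover.exists_mem₂ (C : RefinedCover M) {a b : C.idx} {x : M} (ha : x ∈ C.O a)
    (hb : x ∈ C.O b) : ∃ i, x ∈ C.O' i a ∧ x ∈ C.O' i b := by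
  classical
  obtain ⟨i, hi⟩ := C.covers' {a, b} x (by simp [ha, hb])
  exact ⟨i, hi a (by simp), hi b (by simp)⟩

lemma RefinedCover.exists_mem₃ (C : RefinedCover M) {a b c : C.idx} {x : M} (ha : x ∈ C.O a)
    (hb : x ∈ C.O b) (hc : x ∈ C.O c) : ∃ i, x ∈ C.O' i a ∧ x ∈ C.O' i b ∧ x ∈ C.O' i c := by
  classical
  obtain ⟨i, hi⟩ := C.covers' {a, b, c} x (by simp [ha, hb, hc])
  exact ⟨i, hi a (by simp), hi b (by simp), hi c (by simp)⟩

lemma RefinedCover.exists_mem₄ (C : RefinedCover M) {a b c d : C.idx} {x : M} (ha : x ∈ C.O a)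
    (hb : x ∈ C.O b) (hc : x ∈ C.O c) (hd : x ∈ C.O d) :
    ∃ i, x ∈ C.O' i a ∧ x ∈ C.O' i b ∧ x ∈ C.O' i c ∧ x ∈ C.O' i d := by
  classical
  obtain ⟨i, hi⟩ := C.covers' {a, b, c, d} x (by simp [ha, hb, hc, hd])
  exact ⟨i, hi a (by simp), hi b (by simp), hi c (by simp), hi d (by simp)⟩

namespace LocalData

/-- The bibundle `E_{ab}` glued from local data. -/
noncomputable def bibundle (L : LocalData M k H m) (a b : L.C.idx) :
    Bibundle k H (on2 m (L.C.O a) (L.C.O b)) :=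
  Bibundle.ofLocalData (ι := L.C.idx')
    (fun i => ⟨{x | x.1 ∈ L.C.D2 i a b},
      (L.C.isOpen_D2 i a b).preimage continuous_subtype_val⟩)
    (fun x => L.C.exists_mem₂ x.2.1 x.2.2)
    (fun i j x => L.h i j a b x.1) (fun i x => L.φ i a b x.1)
    (fun i j x hi hj => smAt_of_contMDiffOn
      ((L.C.isOpen_D2 i a b).inter (L.C.isOpen_D2 j a b)) (L.h_smooth i j a b) x ⟨hi, hj⟩)
    (fun i x hi => smAt₂_of_contMDiffOn (F := fun x y => L.φ i a b x y)
      (L.C.isOpen_D2 i a b) (L.φ_smooth i a b).1 x hi)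
    (fun i x hi => smAt₂_of_contMDiffOn (F := fun x y => (L.φ i a b x).symm y)
      (L.C.isOpen_D2 i a b) (L.φ_smooth i a b).2 x hi)
    (fun i j l x hi hj hl => L.h_cocycle i j l a b x.1 ⟨⟨hi, hj⟩, hl⟩)
    (fun i j x hi hj => L.Ad_h i j a b x.1 ⟨hi, hj⟩)

variable (L : LocalData M k H m)

/-- The sections `t^i_{ab}` of the bibundle glued from local data. -/
noncomputable def sec (i : L.C.idx') (a b : L.C.idx) (x : on2 m (L.C.O a) (L.C.O b)) :
    (L.bibundle a b).fib x :=
  (L.bibundle a b).t i x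

variable {L} {i j : L.C.idx'} {a b c d : L.C.idx} {x : M}

omit [LieGroup (𝓡 k) ∞ H] in
lemma sec_div (ha : x ∈ L.C.O a) (hb : x ∈ L.C.O b) (hi : x ∈ L.C.D2 i a b)
    (hj : x ∈ L.C.D2 j a b) : ((L.bibundle a b).fib ⟨x, ha, hb⟩).div (L.sec i a b ⟨x, ha, hb⟩)
      (L.sec j a b ⟨x, ha, hb⟩) = L.h i j a b x :=
  Bibundle.ofLocalData_div (B := on2 m (L.C.O a) (L.C.O b)) (b := ⟨x, ha, hb⟩) hi hj

omit [LieGroup (𝓡 k) ∞ H] in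
lemma sec_phi (ha : x ∈ L.C.O a) (hb : x ∈ L.C.O b) (hi : x ∈ L.C.D2 i a b) (y : H) :
    ((L.bibundle a b).fib ⟨x, ha, hb⟩).phi (L.sec i a b ⟨x, ha, hb⟩) y = L.φ i a b x y :=
  Bibundle.ofLocalData_phi (B := on2 m (L.C.O a) (L.C.O b)) (b := ⟨x, ha, hb⟩) hi y

omit [LieGroup (𝓡 k) ∞ H] in
lemma secAt_sec (ha : x ∈ L.C.O a) (hb : x ∈ L.C.O b) (hi : x ∈ L.C.D2 i a b) :
    (L.bibundle a b).SecAt (L.sec i a b) ⟨x, ha, hb⟩ :=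
  Bibundle.secAt_t (E := L.bibundle a b) (i := i) (b := ⟨x, ha, hb⟩) hi

/-- The triangle `t^i_{ab} t^i_{bc} = f^i_{abc} t^i_{ac}`. -/
def tri (i : L.C.idx') (ha : x ∈ L.C.O a) (hb : x ∈ L.C.O b) (hc : x ∈ L.C.O c) :=
  Bitorsor.triOf (L.sec i a b ⟨x, ha, hb⟩) (L.sec i b c ⟨x, hb, hc⟩)
    (((L.bibundle a c).fib ⟨x, ha, hc⟩).l (L.f i a b c x) (L.sec i a c ⟨x, ha, hc⟩))

omit [LieGroup (𝓡 k) ∞ H] in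
-- At the generating triple, the condition for a triangle is the relation `φ_mul`.
lemma isTri_tri (ha : x ∈ L.C.O a) (hb : x ∈ L.C.O b) (hc : x ∈ L.C.O c)
    (hi : x ∈ L.C.D3 i a b c) : Bitorsor.IsTri (L.tri i ha hb hc) := by
  refine Bitorsor.isTri_triOf fun y => ?_
  rw [Bitorsor.phi_l, sec_phi ha hb ⟨hi.1, hi.2.1⟩, sec_phi hb hc hi.2,
    sec_phi ha hc ⟨hi.1, hi.2.2⟩]
  exact DFunLike.congr_fun (L.φ_mul i a b c x hi) y

omit [LieGroup (𝓡 k) ∞ H] in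
lemma tri_self (ha : x ∈ L.C.O a) (hb : x ∈ L.C.O b) (hc : x ∈ L.C.O c) :
    L.tri i ha hb hc (L.sec i a b ⟨x, ha, hb⟩) (L.sec i b c ⟨x, hb, hc⟩)
    (((L.bibundle a c).fib ⟨x, ha, hc⟩).l (L.f i a b c x) (L.sec i a c ⟨x, ha, hc⟩)) :=
  Bitorsor.triOf_self _ _ _

omit [LieGroup (𝓡 k) ∞ H] in
-- The relation `h_mul` says that the generating triple of index `i` lies in the triangle of index
-- `j`. Hence the multiplication does not depend on the index.
lemma tri_congr (ha : x ∈ L.C.O a) (hb : x ∈ L.C.O b) (hc : x ∈ L.C.O c)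
    (hi : x ∈ L.C.D3 i a b c) (hj : x ∈ L.C.D3 j a b c) (e e' e'') :
    L.tri i ha hb hc e e' e'' ↔ L.tri j ha hb hc e e' e'' := by
  refine (isTri_tri ha hb hc hi).congr (isTri_tri ha hb hc hj) (tri_self ha hb hc) ?_ _ _ _
  unfold tri Bitorsor.triOf
  rw [Bitorsor.div_l, Bitorsor.div_l_right, sec_div ha hb ⟨hi.1, hi.2.1⟩ ⟨hj.1, hj.2.1⟩,
    sec_div hb hc hi.2 hj.2, sec_div ha hc ⟨hi.1, hi.2.2⟩ ⟨hj.1, hj.2.2⟩,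
    sec_phi ha hb ⟨hj.1, hj.2.1⟩, L.h_mul i j a b c x ⟨hi, hj⟩, mul_assoc]

/-- Each relation has its role: `h_cocycle` and `Ad_h` glue the bibundles, `φ_mul` and `h_mul` give
a well-defined multiplication, `f_cocycle` makes it associative. The covering condition on finite
sets supplies one index `i` valid for three or four members at a point. -/
theorem exists_gerbe (L : LocalData M k H m) : ∃ G : Gerbe M k H m, L.IsLocalDataOf G := by
  have hT : ∀ a b c, IsTriangle
      ((L.bibundle a b).pullback (r12 m (L.C.O a) (L.C.O b) (L.C.O c)))
      ((L.bibundle b c).pullback (r23 m (L.C.O a) (L.C.O b) (L.C.O c)))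
      ((L.bibundle a c).pullback (r13 m (L.C.O a) (L.C.O b) (L.C.O c)))
      (fun x e e' e'' => ∀ i, x.1 ∈ L.C.D3 i a b c → L.tri i x.2.1 x.2.2.1 x.2.2.2 e e' e'') := by
    intro a b c
    -- The relation quantifies over all indices to avoid a choice; by `tri_congr` any single one
    -- decides.
    have key : ∀ (x : M) (ha : x ∈ L.C.O a) (hb : x ∈ L.C.O b) (hc : x ∈ L.C.O c) i
        (_ : x ∈ L.C.D3 i a b c), (fun e e' e'' => ∀ i, x ∈ L.C.D3 i a b c →
          L.tri i ha hb hc e e' e'') = L.tri i ha hb hc := by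
      intro x ha hb hc i hi
      funext e e' e''
      exact propext ⟨fun h => h i hi, fun h j hj => (tri_congr ha hb hc hi hj e e' e'').1 h⟩
    refine ⟨fun ⟨x, ha, hb, hc⟩ => ?_, fun ⟨x, ha, hb, hc⟩ => ?_⟩
    · obtain ⟨i, hi⟩ := L.C.exists_mem₃ ha hb hc
      exact (key x ha hb hc i hi).symm ▸ isTri_tri ha hb hc hi
    · obtain ⟨i, hi⟩ := L.C.exists_mem₃ ha hb hc
      have h1 := (secAt_sec (i := i) ha hb ⟨hi.1, hi.2.1⟩).pullback (b := ⟨x, ha, hb, hc⟩)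
        (r12 m (L.C.O a) (L.C.O b) (L.C.O c))
      have h2 := (secAt_sec (i := i) hb hc hi.2).pullback (b := ⟨x, ha, hb, hc⟩)
        (r23 m (L.C.O a) (L.C.O b) (L.C.O c))
      have h3 := (secAt_sec (i := i) ha hc ⟨hi.1, hi.2.2⟩).pullback (b := ⟨x, ha, hb, hc⟩)
        (r13 m (L.C.O a) (L.C.O b) (L.C.O c))
      have h4 : SmAt k (fun y : on3 m (L.C.O a) (L.C.O b) (L.C.O c) => L.f i a b c y.1)
          ⟨x, ha, hb, hc⟩ :=
        smAt_of_contMDiffOn (L.C.isOpen_D3 i a b c) (L.f_smooth i a b c) _ hi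
      refine ⟨_, _, _, h1, h2, h3.l h4, ?_⟩
      filter_upwards [((L.C.isOpen_D3 i a b c).preimage continuous_subtype_val).mem_nhds hi]
      rintro ⟨y, hya, hyb, hyc⟩ hy
      exact (congr_fun (congr_fun (congr_fun (key y hya hyb hyc i hy) _) _) _).mpr
        (tri_self hya hyb hyc)
  choose f hf using fun a b c => (hT a b c).exists_centralSection
  let G : Gerbe M k H m :=
    { C := L.C.toCover
      E := L.bibundle
      f := f
      cocycle := by
        intro a b c d x ha hb hc hd e₁₂ e₂₃ e₃₄ e₁₃ e₂₄ e₁₄ e'₁₄ h₁ h₂ h₃ h₄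
        obtain ⟨i, hia, hib, hic, hid⟩ := L.C.exists_mem₄ ha hb hc hd
        have g₁ := (hf b c d _ _ _ _).1 h₁ i ⟨hib, hic, hid⟩
        have g₂ := (hf a b d _ _ _ _).1 h₂ i ⟨hia, hib, hid⟩
        have g₃ := (hf a b c _ _ _ _).1 h₃ i ⟨hia, hib, hic⟩
        have g₄ := (hf a c d _ _ _ _).1 h₄ i ⟨hia, hic, hid⟩
        -- In coordinates relative to `t^i` the four products become equations between quotients;
        -- `φ_mul` and `f_cocycle` then equate the coordinates of `e₁₄` and `e'₁₄`.
        unfold tri Bitorsor.triOf at g₁ g₂ g₃ g₄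
        rw [Bitorsor.div_l_right] at g₁ g₂ g₃ g₄
        rw [sec_phi hb hc ⟨hib, hic⟩] at g₁
        rw [sec_phi ha hb ⟨hia, hib⟩] at g₂ g₃
        rw [sec_phi ha hc ⟨hia, hic⟩] at g₄
        rw [eq_mul_inv_iff_mul_eq] at g₁ g₂ g₃ g₄
        have hcoc := L.f_cocycle i a b c d x ⟨hia, hib, hic⟩ hid
        have hmul := DFunLike.congr_fun (L.φ_mul i a b c x ⟨hia, hib, hic⟩)
          (((L.bibundle c d).fib ⟨x, hc, hd⟩).div e₃₄ (L.sec i c d ⟨x, hc, hd⟩))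
        simp only [MulAut.mul_apply, MulAut.conj_apply] at hmul
        rw [← ((L.bibundle a d).fib ⟨x, ha, hd⟩).l_div e₁₄ (L.sec i a d ⟨x, ha, hd⟩),
          ← ((L.bibundle a d).fib ⟨x, ha, hd⟩).l_div e'₁₄ (L.sec i a d ⟨x, ha, hd⟩)]
        congr 1
        rw [← g₂, ← g₄, ← g₁, ← g₃, map_mul, map_mul, hmul]
        simp only [mul_assoc]
        rw [hcoc]
        simp only [inv_mul_cancel_left] }
  refine ⟨G, id, fun _ => le_rfl,
    fun i a b x => L.sec i a b ⟨x.1, L.C.le i a x.2.1, L.C.le i b x.2.2⟩, ?_, ?_, ?_, ?_⟩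
  · intro i a b
    refine Bibundle.isSection_iff.2 fun x _ => ?_
    exact (secAt_sec (L.C.le i a x.2.1) (L.C.le i b x.2.2) x.2).pullback (b := x)
      (incl2 m (L.C.le i a) (L.C.le i b))
  · intro i j a b x hia hib hja hjb
    change L.sec i a b ⟨x, L.C.le i a hia, L.C.le i b hib⟩ =
      ((L.bibundle a b).fib ⟨x, L.C.le i a hia, L.C.le i b hib⟩).l (L.h i j a b x)
        (L.sec j a b ⟨x, L.C.le i a hia, L.C.le i b hib⟩)
    rw [← sec_div (L.C.le i a hia) (L.C.le i b hib) ⟨hia, hib⟩ ⟨hja, hjb⟩, Bitorsor.l_div]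
  · intro i a b x ha hb g
    exact (sec_phi (L.C.le i a ha) (L.C.le i b hb) ⟨ha, hb⟩ g).symm
  · intro i a b c x ha hb hc
    have ha' := L.C.le i a ha
    have hb' := L.C.le i b hb
    have hc' := L.C.le i c hc
    refine (hf a b c ⟨x, ha', hb', hc'⟩ _ _ _).2 fun j hj => ?_
    refine (tri_congr ha' hb' hc' hj ⟨ha, hb, hc⟩ _ _ _).2 ?_
    have := (isTri_tri ha' hb' hc' ⟨ha, hb, hc⟩).left (L.f i a b c x)⁻¹
      (tri_self (i := i) ha' hb' hc')
    rwa [Bitorsor.l_inv_l] at this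

end LocalData

end

end NBG

/-! ### From stable equivalence of gerbes to stable isomorphism of local data -/

namespace NBG

section

variable {k : ℕ} {H : Type u} [TopologicalSpace H] [ChartedSpace (EuclideanSpace ℝ (Fin k)) H]
  [Group H] [LieGroup (𝓡 k) ∞ H]
  {m : ℕ} {M : Type u} [TopologicalSpace M] [ChartedSpace (EuclideanSpace ℝ (Fin m)) M]
  [IsManifold (𝓡 m) ∞ M]

namespace Bitorsor

variable {H : Type u} [Group H]

lemma IsSq.exists_l {N₁ E' N₂ E : Bitorsor H} {R : N₁ → E' → N₂ → E → Prop} (hR : IsSq R)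
    (n₁ e' n₂ e) : ∃ g, R n₁ e' n₂ (E.l g e) := by
  obtain ⟨d, hd, -⟩ := hR.existsUnique n₁ e' n₂
  exact ⟨E.div d e, by rwa [l_div]⟩

/-- With the columns kept fixed, translating `e'` by `g` changes the coefficient of `e` by the
factor `φ_{n₁}(g)`. With `g = f'_{abc}` and `p = ℓ_{ac}` this is the relation for `φ_a(f'_{abc})`.
-/
lemma IsSq.phi_eq_mul_inv {N₁ E' N₂ E : Bitorsor H} {R : N₁ → E' → N₂ → E → Prop} (hR : IsSq R)
    {n₁ e' n₂ e p q g} (h : R n₁ e' n₂ (E.l p e)) (h' : R n₁ (E'.l g e') n₂ (E.l q e)) :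
    N₁.phi n₁ g = q * p⁻¹ := by
  have := (hR.iff h _ _ _ _).1 h'
  rwa [div_self, div_self, phi_one, mul_one, one_mul, div_l_self, div_l, div_l_right, div_self,
    one_mul] at this

lemma IsTri.of_left_inv {A B C : Bitorsor H} {R : A → B → C → Prop} (hR : IsTri R) {g : H} {a b c}
    (h : R (A.l g⁻¹ a) b c) : R a b (C.l g c) := by
  have := hR.left g h
  rwa [l_l_inv] at this

end Bitorsor

namespace LocalData

/-- Local sections `t^i_{ab}` of a gerbe that give rise to the local data `L`; the values of
`t^i_{ab}` outside `O^i_{ab}` play no role. -/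
structure Sections (L : LocalData M k H m) (G : Gerbe M k H m) (r : L.C.idx → G.C.idx)
    (hr : ∀ a, L.C.O a ≤ G.C.O (r a)) : Type u where
  t : ∀ (_ : L.C.idx') (a b : L.C.idx) x, (G.E (r a) (r b)).fib x
  secAt : ∀ {i a b x} (hx : x ∈ G.C.O (r a) ∧ x ∈ G.C.O (r b)), x ∈ L.C.D2 i a b →
    (G.E (r a) (r b)).SecAt (t i a b) ⟨x, hx⟩
  div_eq : ∀ {i j a b x} (hx : x ∈ G.C.O (r a) ∧ x ∈ G.C.O (r b)), x ∈ L.C.D2 i a b →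
    x ∈ L.C.D2 j a b → ((G.E (r a) (r b)).fib ⟨x, hx⟩).div (t i a b ⟨x, hx⟩) (t j a b ⟨x, hx⟩) =
      L.h i j a b x
  phiAut_eq : ∀ {i a b x} (hx : x ∈ G.C.O (r a) ∧ x ∈ G.C.O (r b)), x ∈ L.C.D2 i a b →
    ((G.E (r a) (r b)).fib ⟨x, hx⟩).phiAut (t i a b ⟨x, hx⟩) = L.φ i a b x
  tri : ∀ {i a b c x} (ha : x ∈ G.C.O (r a)) (hb : x ∈ G.C.O (r b)) (hc : x ∈ G.C.O (r c)),
    x ∈ L.C.D3 i a b c → G.Tri (r a) (r b) (r c) ha hb hc (t i a b ⟨x, ha, hb⟩)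
      (t i b c ⟨x, hb, hc⟩) (((G.E (r a) (r c)).fib ⟨x, ha, hc⟩).l (L.f i a b c x)
        (t i a c ⟨x, ha, hc⟩))

variable {L L' : LocalData M k H m} {G G' : Gerbe M k H m}

/-- The sections over `O^i_{ab}` are extended by arbitrary values, which removes their dependent
domains. -/
lemma IsLocalDataOf.exists_sections (h : L.IsLocalDataOf G) :
    ∃ r hr, Nonempty (L.Sections G r hr) := by
  obtain ⟨r, hr, t, h1, h2, h3, h4⟩ := h
  choose T hT hT' using fun i a b => Bibundle.exists_extension
    (isOpen_on2 (L.C.O' i a) (L.C.O' i b))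
    (S' := {x | x ∈ G.C.O (r a) ∧ x ∈ G.C.O (r b)})
    (fun _ hx => ⟨(L.C.le i a).trans (hr a) hx.1, (L.C.le i b).trans (hr b) hx.2⟩)
    (G.E (r a) (r b)) (t i a b)
  refine ⟨r, hr, ⟨T, ?_, ?_, ?_, ?_⟩⟩
  · intro i a b x hx hi
    exact hT' i a b x hi (Bibundle.isSection_iff.1 (h1 i a b) _ trivial)
  · intro i j a b x hx hi hj
    rw [hT i a b x hi, hT j a b x hj]
    exact Bitorsor.div_eq _ (h2 i j a b x hi.1 hi.2 hj.1 hj.2).symm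
  · intro i a b x hx hi
    rw [hT i a b x hi]
    ext y
    exact (h3 i a b x hi.1 hi.2 y).symm
  · intro i a b c x ha hb hc hi
    rw [hT i a b x ⟨hi.1, hi.2.1⟩, hT i b c x hi.2, hT i a c x ⟨hi.1, hi.2.2⟩]
    exact (G.isTri _ _ _ ha hb hc).of_left_inv (h4 i a b c x hi.1 hi.2.1 hi.2.2)

end LocalData

open Classical in
omit [LieGroup (𝓡 k) ∞ H] in
-- A single index of `C` and a single one of `D` must serve a whole finite set of members of `P`, so
-- the covering conditions are applied to the images of that set. The open sets are also shrunk
-- until every `N_a` concerned has a section.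
lemma RefinedCover.exists_common (C D : RefinedCover M) (P : Cover M) (t : P.idx → C.idx)
    (t' : P.idx → D.idx) (ht : ∀ a, P.O a ≤ C.O (t a)) (ht' : ∀ a, P.O a ≤ D.O (t' a))
    (N : ∀ a, Bibundle k H (onSet m (P.O a : Set M))) :
    ∃ (Q : RefinedCover M) (q : Q.idx → P.idx) (_ : ∀ a, Q.O a ≤ P.O (q a))
      (s : Q.idx' → C.idx') (s' : Q.idx' → D.idx') (n : ∀ (_ : Q.idx') (a : Q.idx) x,
        (N (q a)).fib x),
      (∀ i a, Q.O' i a ≤ C.O' (s i) (t (q a))) ∧ (∀ i a, Q.O' i a ≤ D.O' (s' i) (t' (q a))) ∧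
      ∀ i a x hx, x ∈ Q.O' i a → (N (q a)).SecAt (n i a) ⟨x, hx⟩ := by
  let good : Finset P.idx → Opens M → Prop := fun A U =>
    (∀ a ∈ A, U ≤ P.O a) ∧ (∃ i, ∀ a ∈ A, U ≤ C.O' i (t a)) ∧ (∃ i, ∀ a ∈ A, U ≤ D.O' i (t' a)) ∧
      ∀ a ∈ A, ∃ n : ∀ x, (N a).fib x, ∀ x hx, x ∈ U → (N a).SecAt n ⟨x, hx⟩
  have h₂ : ∀ (A : Finset P.idx) x, (∀ a ∈ A, x ∈ P.O a) → ∃ U, x ∈ U ∧ good A U := by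
    intro A x hx
    obtain ⟨i, hi⟩ := C.covers' (A.image t) x (by
      intro b hb
      obtain ⟨a, ha, rfl⟩ := Finset.mem_image.1 hb
      exact ht a (hx a ha))
    obtain ⟨j, hj⟩ := D.covers' (A.image t') x (by
      intro b hb
      obtain ⟨a, ha, rfl⟩ := Finset.mem_image.1 hb
      exact ht' a (hx a ha))
    obtain ⟨U, hU, h⟩ := exists_open_of_finset A x (p := fun a U => U ≤ P.O a ∧
      U ≤ C.O' i (t a) ∧ U ≤ D.O' j (t' a) ∧
      ∃ n : ∀ x, (N a).fib x, ∀ x hx, x ∈ U → (N a).SecAt n ⟨x, hx⟩)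
      (fun a U V h ⟨h1, h2, h3, n, hn⟩ => ⟨h.trans h1, h.trans h2, h.trans h3, n,
        fun x hx hxV => hn x hx (h hxV)⟩) (fun a ha => by
        obtain ⟨U, hU, n, hn⟩ := Bibundle.exists_section_nhds (P.O a).isOpen (N a) (hx a ha)
        exact ⟨P.O a ⊓ (C.O' i (t a) ⊓ (D.O' j (t' a) ⊓ U)),
          ⟨hx a ha, hi _ (Finset.mem_image_of_mem _ ha), hj _ (Finset.mem_image_of_mem _ ha), hU⟩,
          inf_le_left, inf_le_right.trans inf_le_left,
          inf_le_right.trans (inf_le_right.trans inf_le_left), n,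
          fun y hy hyU => hn y hy hyU.2.2.2⟩)
    exact ⟨U, hU, fun a ha => (h a ha).1, ⟨i, fun a ha => (h a ha).2.1⟩,
      ⟨j, fun a ha => (h a ha).2.2.1⟩, fun a ha => (h a ha).2.2.2⟩
  let Q : RefinedCover M := RefinedCover.ofGood P good (fun _ _ h => h.1) h₂
  have h3 : ∀ (i : Q.idx') (a : P.idx), ∃ n : ∀ x, (N a).fib x,
      ∀ x hx, x ∈ Q.O' i a → (N a).SecAt n ⟨x, hx⟩ := by
    intro i a
    by_cases h : a ∈ i.1.1
    · obtain ⟨n, hn⟩ := i.2.2.2.2 a h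
      exact ⟨n, fun x hx hxa => hn x hx ((RefinedCover.mem_ofGood i a x).1 hxa).2⟩
    · exact ⟨fun x => ((N a).fib x).nonempty.some,
        fun x hx hxa => absurd ((RefinedCover.mem_ofGood i a x).1 hxa).1 h⟩
  choose n hn using h3
  choose s hs using fun i : Q.idx' => i.2.2.1
  choose s' hs' using fun i : Q.idx' => i.2.2.2.1
  refine ⟨Q, id, fun _ => le_rfl, s, s', n, fun i a x hx => ?_, fun i a x hx => ?_, hn⟩
  · obtain ⟨h, h'⟩ := (RefinedCover.mem_ofGood i a x).1 hx
    exact hs i a h h'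
  · obtain ⟨h, h'⟩ := (RefinedCover.mem_ofGood i a x).1 hx
    exact hs' i a h h'

namespace LocalData

variable {L L' : LocalData M k H m} {G G' : Gerbe M k H m}

open Classical in
-- `ℓ^i_{ab}` is the coordinate of a square: `n^i_a t'^i_{ab} = (ℓ^i_{ab} t^i_{ab}) n^i_b`. The
-- relations of a stable isomorphism state that the quadruples for `i` and `j` lie in one square,
-- that the automorphisms of its two sides agree, and that squares are compatible with the
-- multiplications.
lemma Sections.stableIso {r : L.C.idx → G.C.idx} {hr : ∀ a, L.C.O a ≤ G.C.O (r a)}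
    {r' : L'.C.idx → G'.C.idx} {hr' : ∀ a, L'.C.O a ≤ G'.C.O (r' a)} (t : L.Sections G r hr)
    (t' : L'.Sections G' r' hr') (P : RefinedCover M) (α : P.idx → L.C.idx) (α' : P.idx → L'.C.idx)
    (hα : ∀ a, P.O a ≤ L.C.O (α a)) (hα' : ∀ a, P.O a ≤ L'.C.O (α' a))
    (s : P.idx' → L.C.idx') (s' : P.idx' → L'.C.idx')
    (hs : ∀ i a, P.O' i a ≤ L.C.O' (s i) (α a)) (hs' : ∀ i a, P.O' i a ≤ L'.C.O' (s' i) (α' a))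
    (c : Gerbe.Comparison G G' P.toCover (r ∘ α) (r' ∘ α') (fun a => (hα a).trans (hr (α a)))
      (fun a => (hα' a).trans (hr' (α' a))))
    (n : ∀ (_ : P.idx') (a : P.idx) x, (c.N a).fib x)
    (hn : ∀ i a x hx, x ∈ P.O' i a → (c.N a).SecAt (n i a) ⟨x, hx⟩) : L.StableIso L' := by
  have g : ∀ {a x}, x ∈ P.O a → x ∈ G.C.O (r (α a)) := fun h => hr _ (hα _ h)
  have g' : ∀ {a x}, x ∈ P.O a → x ∈ G'.C.O (r' (α' a)) := fun h => hr' _ (hα' _ h)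
  have hsq : ∀ a b {x} (ha : x ∈ P.O a) (hb : x ∈ P.O b), Bitorsor.IsSq (c.R a b ⟨x, ha, hb⟩) :=
    fun a b x ha hb => (c.isSquare a b).isSq ⟨x, ha, hb⟩
  choose ℓ hR using fun i a b x (hx : x ∈ P.O a ∧ x ∈ P.O b) =>
    (hsq a b hx.1 hx.2).exists_l (n i a ⟨x, hx.1⟩)
    (t'.t (s' i) (α' a) (α' b) ⟨x, g' hx.1, g' hx.2⟩) (n i b ⟨x, hx.2⟩)
    (t.t (s i) (α a) (α b) ⟨x, g hx.1, g hx.2⟩)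
  let hN : P.idx' → P.idx' → P.idx → M → H := fun i j a x =>
    if hx : x ∈ P.O a then ((c.N a).fib ⟨x, hx⟩).div (n i a ⟨x, hx⟩) (n j a ⟨x, hx⟩) else 1
  let φN : P.idx' → P.idx → M → MulAut H := fun i a x =>
    if hx : x ∈ P.O a then ((c.N a).fib ⟨x, hx⟩).phiAut (n i a ⟨x, hx⟩) else 1
  let ℓN : P.idx' → P.idx → P.idx → M → H := fun i a b x =>
    if hx : x ∈ P.O a ∧ x ∈ P.O b then ℓ i a b x hx else 1
  have hN_eq : ∀ i j a {x} (hx : x ∈ P.O a), hN i j a x =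
    ((c.N a).fib ⟨x, hx⟩).div (n i a ⟨x, hx⟩) (n j a ⟨x, hx⟩) := fun i j a x hx => dif_pos hx
  have φN_eq : ∀ i a {x} (hx : x ∈ P.O a), φN i a x =
    ((c.N a).fib ⟨x, hx⟩).phiAut (n i a ⟨x, hx⟩) := fun i a x hx => dif_pos hx
  have ℓ_eq : ∀ i a b {x} (hx : x ∈ P.O a ∧ x ∈ P.O b), ℓN i a b x = ℓ i a b x hx :=
    fun i a b x hx => dif_pos hx
  have d2 : ∀ {i a b x}, x ∈ P.D2 i a b → x ∈ L.C.D2 (s i) (α a) (α b) :=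
    fun h => ⟨hs _ _ h.1, hs _ _ h.2⟩
  have d2' : ∀ {i a b x}, x ∈ P.D2 i a b → x ∈ L'.C.D2 (s' i) (α' a) (α' b) :=
    fun h => ⟨hs' _ _ h.1, hs' _ _ h.2⟩
  have hφ : ∀ i a b {x}, x ∈ P.D2 i a b → φN i a x * L'.φ (s' i) (α' a) (α' b) x =
      MulAut.conj (ℓN i a b x) * L.φ (s i) (α a) (α b) x * φN i b x := by
    intro i a b x hx
    have ha := P.le _ _ hx.1
    have hb := P.le _ _ hx.2
    rw [ℓ_eq i a b ⟨ha, hb⟩, φN_eq i a ha, φN_eq i b hb, ← t'.phiAut_eq ⟨g' ha, g' hb⟩ (d2' hx),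
      ← t.phiAut_eq ⟨g ha, g hb⟩ (d2 hx), ← Bitorsor.phiAut_l]
    ext y
    exact (hsq a b ha hb).phi_eq (hR i a b x ⟨ha, hb⟩) y
  refine ⟨P, α, α', s, s', hN, φN, ℓN, hα, hα', hs, hs', ?_, ?_, ?_, ?_, ?_, ?_, ?_, ?_⟩
  · exact fun i j a => contMDiffOn_of_smAt (fun x hx => P.le _ _ hx.1)
      (fun x hx => hN_eq i j a _) fun x hx => (hn i a x _ hx.1).div (hn j a x _ hx.2)
  · exact fun i a => ⟨contMDiffOn_of_smAt₂ (F := fun x y => φN i a x y)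
      (fun x hx => P.le _ _ hx) (fun x hx y => by rw [φN_eq i a (P.le _ _ hx)]; rfl)
      (fun x hx => (hn i a x _ hx).phi),
      contMDiffOn_of_smAt₂ (F := fun x y => (φN i a x).symm y)
      (fun x hx => P.le _ _ hx) (fun x hx y => by rw [φN_eq i a (P.le _ _ hx)]; rfl)
      (fun x hx => (hn i a x _ hx).phiInv)⟩
  · refine fun i a b => contMDiffOn_of_smAt (S := {x | x ∈ P.O a ∧ x ∈ P.O b})
      (f := fun y => ℓ i a b y.1 y.2)
      (fun x hx => ⟨P.le _ _ hx.1, P.le _ _ hx.2⟩)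
      (fun x hx => ℓ_eq i a b ⟨P.le _ _ hx.1, P.le _ _ hx.2⟩) fun x hx => ?_
    have ha := P.le _ _ hx.1
    have hb := P.le _ _ hx.2
    have h1 := (hn i a x ha hx.1).pullback (b := ⟨x, ha, hb⟩) (inclL m (P.O a) (P.O b))
    have h2 := (hn i b x hb hx.2).pullback (b := ⟨x, ha, hb⟩) (inclR m (P.O a) (P.O b))
    have h3 := (t'.secAt ⟨g' ha, g' hb⟩ (d2' hx)).pullback (b := ⟨x, ha, hb⟩)
      (incl2 m (U := P.O a) (V := P.O b) (fun _ h => g' h) (fun _ h => g' h))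
    have h4 := (t.secAt ⟨g ha, g hb⟩ (d2 hx)).pullback (b := ⟨x, ha, hb⟩)
      (incl2 m (U := P.O a) (V := P.O b) (fun _ h => g h) (fun _ h => g h))
    have h5 := (c.isSquare a b).secAt h1 h3 h2 
      (Filter.Eventually.of_forall fun y => hR i a b y.1 y.2)
    exact (h5.div h4).congr (Filter.Eventually.of_forall fun y =>
      (Bitorsor.div_l_self _ _ _).symm)
  · intro i j l a x hx
    have ha := P.le _ _ hx.1.1
    rw [hN_eq i j a ha, hN_eq j l a ha, hN_eq i l a ha, Bitorsor.div_mul_div]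
  · intro i j a x hx
    have ha := P.le _ _ hx.1
    rw [hN_eq i j a ha, φN_eq i a ha, φN_eq j a ha, Bitorsor.conj_div]
  · intro i j a b x hx
    have ha := P.le _ _ hx.1.1
    have hb := P.le _ _ hx.1.2
    have h1 := ((hsq a b ha hb).iff (hR j a b x ⟨ha, hb⟩) _ _ _ _).1 (hR i a b x ⟨ha, hb⟩)
    -- The composite automorphism is `φ` at the point `ℓ^j_{ab} t^j_{ab}`, which is what `IsSq.iff`
    -- applies to the quotient of the `n_b`.
    have h2 : φN j a x * L'.φ (s' j) (α' a) (α' b) x * (φN j b x)⁻¹ =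
        ((G.E (r (α a)) (r (α b))).fib ⟨x, g ha, g hb⟩).phiAut
          (((G.E (r (α a)) (r (α b))).fib ⟨x, g ha, g hb⟩).l (ℓ j a b x ⟨ha, hb⟩)
            (t.t (s j) (α a) (α b) ⟨x, g ha, g hb⟩)) := by
      rw [hφ j a b hx.2, mul_inv_cancel_right, Bitorsor.phiAut_l, ℓ_eq j a b ⟨ha, hb⟩,
        t.phiAut_eq ⟨g ha, g hb⟩ (d2 hx.2)]
    rw [h2, map_inv, ← t'.div_eq ⟨g' ha, g' hb⟩ (d2' hx.1) (d2' hx.2),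
      ← t.div_eq ⟨g ha, g hb⟩ (d2 hx.1) (d2 hx.2), φN_eq j a ha, hN_eq i j a ha, hN_eq i j b hb,
      mul_inv_eq_iff_eq_mul, ℓ_eq i a b ⟨ha, hb⟩, ℓ_eq j a b ⟨ha, hb⟩, ← Bitorsor.div_l,
      ← Bitorsor.div_l_right]
    exact h1
  · intro i a b x hx
    rw [hφ i a b hx, mul_inv_cancel_right]
  · intro i a b d x hx
    have ha := P.le _ _ hx.1
    have hb := P.le _ _ hx.2.1
    have hd := P.le _ _ hx.2.2
    have h1 := t'.tri (g' ha) (g' hb) (g' hd) ⟨(d2' ⟨hx.1, hx.2.1⟩).1, d2' hx.2⟩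
    have h2 := t.tri (g ha) (g hb) (g hd) ⟨(d2 ⟨hx.1, hx.2.1⟩).1, d2 hx.2⟩
    -- The product of `ℓ_{ab} t_{ab}` and `ℓ_{bd} t_{bd}`, with its coefficient of `t_{ad}`.
    have h3 := ((G.isTri _ _ _ (g ha) (g hb) (g hd)).l_iff h2 (ℓ i a b x ⟨ha, hb⟩) (ℓ i b d x ⟨hb, hd⟩) _).2 rfl
    rw [← Bitorsor.l_mul] at h3
    have h4 := c.comp a b d x ha hb hd _ _ _ _ _ _ _ _ _ (hR i a b x ⟨ha, hb⟩) (hR i b d x ⟨hb, hd⟩) h1 h3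
    rw [ℓ_eq i a b ⟨ha, hb⟩, ℓ_eq i b d ⟨hb, hd⟩, ℓ_eq i a d ⟨ha, hd⟩, φN_eq i a ha,
      ← t.phiAut_eq ⟨g ha, g hb⟩ (d2 ⟨hx.1, hx.2.1⟩)]
    exact (hsq a d ha hd).phi_eq_mul_inv (hR i a d x ⟨ha, hd⟩) h4

theorem stableIso_of_stableEquiv (hL : L.IsLocalDataOf G) (hL' : L'.IsLocalDataOf G')
    (h : G.StableEquiv G') : L.StableIso L' := by
  obtain ⟨r, hr, ⟨t⟩⟩ := hL.exists_sections
  obtain ⟨r', hr', ⟨t'⟩⟩ := hL'.exists_sections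
  obtain ⟨P, τ, hτ, ⟨c⟩⟩ := h.exists_comparison (L.C.toCover.inf L'.C.toCover) (r ∘ Prod.fst)
    (r' ∘ Prod.snd) (fun a => inf_le_left.trans (hr _)) (fun a => inf_le_right.trans (hr' _))
  obtain ⟨Q, q, hq, s, s', n, h1, h2, h3⟩ := RefinedCover.exists_common L.C L'.C P
    (fun a => (τ a).1) (fun a => (τ a).2) (fun a => (hτ a).trans inf_le_left)
    (fun a => (hτ a).trans inf_le_right) c.N
  exact t.stableIso t' Q (fun a => (τ (q a)).1) (fun a => (τ (q a)).2)
    (fun a => (hq a).trans ((hτ _).trans inf_le_left))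
    (fun a => (hq a).trans ((hτ _).trans inf_le_right)) s s' h1 h2
    (c.refine Q.toCover q hq) (fun i a x => n i a ((incl m (hq a)).pt x))
    (fun i a x hx hxi => (h3 i a x (hq a hx) hxi).pullback (incl m (hq a)))

end LocalData

end

end NBG

/-! ### From stable isomorphism of local data to stable equivalence of gerbes -/

namespace NBG

namespace Bitorsor

variable {H : Type u} [Group H]

lemma IsSq.of_phi_eq_mul_inv {N₁ E' N₂ E : Bitorsor H} {R : N₁ → E' → N₂ → E → Prop}
    (hR : IsSq R) {n₁ e' n₂ e p q g} (h : R n₁ e' n₂ (E.l p e)) (h' : N₁.phi n₁ g = q * p⁻¹) :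
    R n₁ (E'.l g e') n₂ (E.l q e) := by
  rw [hR.iff h, div_self, div_self, phi_one, mul_one, one_mul, div_l_self, div_l, div_l_right,
    div_self, one_mul, h']

/-- Squares that are compatible with the multiplication in one point are compatible with the
multiplication. -/
lemma IsSq.comp_of_base {N₁ N₂ N₃ E₁₂ E₂₃ E₁₃ E'₁₂ E'₂₃ E'₁₃ : Bitorsor H}
    {R : N₁ → E'₁₂ → N₂ → E₁₂ → Prop} {R' : N₂ → E'₂₃ → N₃ → E₂₃ → Prop}
    {R'' : N₁ → E'₁₃ → N₃ → E₁₃ → Prop} {T : E₁₂ → E₂₃ → E₁₃ → Prop}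
    {T' : E'₁₂ → E'₂₃ → E'₁₃ → Prop} (hR : IsSq R) (hR' : IsSq R') (hR'' : IsSq R'')
    (hT : IsTri T) (hT' : IsTri T') {n₁ n₂ n₃ e₁₂ e₂₃ e₁₃ e'₁₂ e'₂₃ e'₁₃}
    (h₁ : R n₁ e'₁₂ n₂ e₁₂) (h₂ : R' n₂ e'₂₃ n₃ e₂₃) (h₃ : R'' n₁ e'₁₃ n₃ e₁₃)
    (h₄ : T e₁₂ e₂₃ e₁₃) (h₅ : T' e'₁₂ e'₂₃ e'₁₃) {a₁ a₂ a₃ d₁₂ d₂₃ d₁₃ d'₁₂ d'₂₃ d'₁₃}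
    (k₁ : R a₁ d'₁₂ a₂ d₁₂) (k₂ : R' a₂ d'₂₃ a₃ d₂₃) (k₅ : T' d'₁₂ d'₂₃ d'₁₃)
    (k₄ : T d₁₂ d₂₃ d₁₃) : R'' a₁ d'₁₃ a₃ d₁₃ := by
  rw [hR.iff h₁] at k₁
  rw [hR'.iff h₂] at k₂
  rw [hT.iff h₄] at k₄
  rw [hT'.iff h₅] at k₅
  rw [hR''.iff h₃, ← k₅, ← k₄, phi_mul, ← mul_assoc, k₁, hR.phi_eq h₁, mul_assoc, ← phi_mul, k₂,
    phi_mul, hT.phi_eq h₄, mul_assoc]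

end Bitorsor

section

variable {k : ℕ} {H : Type u} [TopologicalSpace H] [ChartedSpace (EuclideanSpace ℝ (Fin k)) H]
  [Group H] [LieGroup (𝓡 k) ∞ H]
  {m : ℕ} {M : Type u} [TopologicalSpace M] [ChartedSpace (EuclideanSpace ℝ (Fin m)) M]
  [IsManifold (𝓡 m) ∞ M]

namespace LocalData

variable {L L' : LocalData M k H m} {G G' : Gerbe M k H m}

/-- The argument of `Sections.stableIso` run backwards: `N_a` is glued from `hN`, `φN`, and the
quadruple `(n^i_a, t'^i_{ab}, n^i_b, ℓ^i_{ab} t^i_{ab})` generates a square. It is one by `eq₂`, it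
does not depend on `i` by `eq₁`, and it respects the multiplications by `eq₃`. -/
theorem stableEquiv_of_stableIso (hL : L.IsLocalDataOf G) (hL' : L'.IsLocalDataOf G')
    (h : L.StableIso L') : G.StableEquiv G' := by
  obtain ⟨r, hr, ⟨t⟩⟩ := hL.exists_sections
  obtain ⟨r', hr', ⟨t'⟩⟩ := hL'.exists_sections
  obtain ⟨P, α, α', s, s', hN, φN, ℓ, hα, hα', hs, hs', hN_smooth, φN_smooth, ℓ_smooth, hN_cocycle,
    Ad_hN, eq₁, eq₂, eq₃⟩ := h
  have g : ∀ {a x}, x ∈ P.O a → x ∈ G.C.O (r (α a)) := fun h => hr _ (hα _ h)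
  have g' : ∀ {a x}, x ∈ P.O a → x ∈ G'.C.O (r' (α' a)) := fun h => hr' _ (hα' _ h)
  have d2 : ∀ {i a b x}, x ∈ P.D2 i a b → x ∈ L.C.D2 (s i) (α a) (α b) :=
    fun h => ⟨hs _ _ h.1, hs _ _ h.2⟩
  have d2' : ∀ {i a b x}, x ∈ P.D2 i a b → x ∈ L'.C.D2 (s' i) (α' a) (α' b) :=
    fun h => ⟨hs' _ _ h.1, hs' _ _ h.2⟩
  obtain ⟨N, n, n_secAt, n_div, n_phi⟩ : ∃ (N : ∀ a, Bibundle k H (onSet m (P.O a : Set M)))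
      (n : ∀ (_ : P.idx') (a : P.idx) x, (N a).fib x),
      (∀ i a x hx, x ∈ P.O' i a → (N a).SecAt (n i a) ⟨x, hx⟩) ∧
      (∀ i j a x hx, x ∈ P.O' i a → x ∈ P.O' j a →
        ((N a).fib ⟨x, hx⟩).div (n i a ⟨x, hx⟩) (n j a ⟨x, hx⟩) = hN i j a x) ∧
      (∀ i a x hx, x ∈ P.O' i a → ((N a).fib ⟨x, hx⟩).phiAut (n i a ⟨x, hx⟩) = φN i a x) := by
    refine ⟨fun a => Bibundle.ofLocalData (ι := P.idx')
      (fun i => ⟨{x | x.1 ∈ P.O' i a}, (P.O' i a).isOpen.preimage continuous_subtype_val⟩)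
      (fun x => (P.covers' {a} x.1 (fun b hb => Finset.mem_singleton.1 hb ▸ x.2)).imp fun i hi => hi a (by simp))
      (fun i j x => hN i j a x.1) (fun i x => φN i a x.1)
      (fun i j x hi hj => smAt_of_contMDiffOn
        ((P.O' i a).isOpen.inter (P.O' j a).isOpen) (hN_smooth i j a) x ⟨hi, hj⟩)
      (fun i x hi => smAt₂_of_contMDiffOn (F := fun x y => φN i a x y)
        (P.O' i a).isOpen (φN_smooth i a).1 x hi)
      (fun i x hi => smAt₂_of_contMDiffOn (F := fun x y => (φN i a x).symm y)
        (P.O' i a).isOpen (φN_smooth i a).2 x hi)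
      (fun i j l x hi hj hl => hN_cocycle i j l a x.1 ⟨⟨hi, hj⟩, hl⟩)
      (fun i j x hi hj => Ad_hN i j a x.1 ⟨hi, hj⟩),
      fun i a => Bibundle.t _ i, fun i a x hx hi => Bibundle.secAt_t hi,
      fun i j a x hx hi hj => Bibundle.ofLocalData_div hi hj, fun i a x hx hi => ?_⟩
    ext y
    exact Bibundle.ofLocalData_phi hi y
  let S := fun i a b x (ha : x ∈ P.O a) (hb : x ∈ P.O b) =>
    Bitorsor.sqOf (n i a ⟨x, ha⟩) (t'.t (s' i) (α' a) (α' b) ⟨x, g' ha, g' hb⟩) (n i b ⟨x, hb⟩)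
      (((G.E (r (α a)) (r (α b))).fib ⟨x, g ha, g hb⟩).l (ℓ i a b x)
        (t.t (s i) (α a) (α b) ⟨x, g ha, g hb⟩))
  have S_self : ∀ i a b x (ha : x ∈ P.O a) (hb : x ∈ P.O b), S i a b x ha hb (n i a ⟨x, ha⟩)
      (t'.t (s' i) (α' a) (α' b) ⟨x, g' ha, g' hb⟩) (n i b ⟨x, hb⟩)
      (((G.E (r (α a)) (r (α b))).fib ⟨x, g ha, g hb⟩).l (ℓ i a b x)
        (t.t (s i) (α a) (α b) ⟨x, g ha, g hb⟩)) :=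
    fun i a b x ha hb => Bitorsor.sqOf_self _ _ _ _
  have hS : ∀ i a b x (ha : x ∈ P.O a) (hb : x ∈ P.O b), x ∈ P.D2 i a b →
      Bitorsor.IsSq (S i a b x ha hb) := by
    intro i a b x ha hb hi
    refine Bitorsor.isSq_sqOf fun y => ?_
    have h1 := eq₂ i a b x hi
    rw [mul_inv_eq_iff_eq_mul, ← n_phi i a x ha hi.1, ← n_phi i b x hb hi.2,
      ← t'.phiAut_eq ⟨g' ha, g' hb⟩ (d2' hi), ← t.phiAut_eq ⟨g ha, g hb⟩ (d2 hi),
      ← Bitorsor.phiAut_l] at h1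
    exact DFunLike.congr_fun h1 y
  have S_congr : ∀ i j a b x (ha : x ∈ P.O a) (hb : x ∈ P.O b), x ∈ P.D2 i a b → x ∈ P.D2 j a b →
      S i a b x ha hb = S j a b x ha hb := by
    intro i j a b x ha hb hi hj
    funext n₁ e' n₂ e
    refine propext ((hS i a b x ha hb hi).congr (hS j a b x ha hb hj) (S_self i a b x ha hb) ?_
      _ _ _ _)
    have h1 := eq₁ i j a b x ⟨hi, hj⟩
    rw [eq₂ j a b x hj, map_inv, mul_inv_eq_iff_eq_mul, ← n_phi j a x ha hj.1,
      ← n_div i j a x ha hi.1 hj.1, ← n_div i j b x hb hi.2 hj.2,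
      ← t'.div_eq ⟨g' ha, g' hb⟩ (d2' hi) (d2' hj), ← t.div_eq ⟨g ha, g hb⟩ (d2 hi) (d2 hj),
      ← t.phiAut_eq ⟨g ha, g hb⟩ (d2 hj), ← Bitorsor.phiAut_l, ← Bitorsor.div_l,
      ← Bitorsor.div_l_right] at h1
    exact h1
  let R : ∀ a b (x : on2 m (P.O a) (P.O b)), (N a).fib ⟨x.1, x.2.1⟩ →
      (G'.E (r' (α' a)) (r' (α' b))).fib ⟨x.1, g' x.2.1, g' x.2.2⟩ → (N b).fib ⟨x.1, x.2.2⟩ →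
      (G.E (r (α a)) (r (α b))).fib ⟨x.1, g x.2.1, g x.2.2⟩ → Prop :=
    fun a b x n₁ e' n₂ e => ∀ i, x.1 ∈ P.D2 i a b → S i a b x.1 x.2.1 x.2.2 n₁ e' n₂ e
  have hR : ∀ i a b x (ha : x ∈ P.O a) (hb : x ∈ P.O b), x ∈ P.D2 i a b →
      R a b ⟨x, ha, hb⟩ = S i a b x ha hb := by
    intro i a b x ha hb hi
    funext n₁ e' n₂ e
    refine propext ⟨fun h => h i hi, fun h j hj => ?_⟩
    rwa [S_congr j i a b x ha hb hj hi]
  refine Gerbe.stableEquiv_iff.2 ⟨P.toCover, r ∘ α, r' ∘ α', fun a _ h => g h, fun a _ h => g' h,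
    ⟨⟨N, R, fun a b => ⟨?_, ?_⟩, ?_⟩⟩⟩
  · rintro ⟨x, ha, hb⟩
    obtain ⟨i, hi⟩ := P.exists_mem₂ ha hb
    exact (hR i a b x ha hb hi).symm ▸ hS i a b x ha hb hi
  · rintro ⟨x, ha, hb⟩
    obtain ⟨i, hi⟩ := P.exists_mem₂ ha hb
    have h1 := (n_secAt i a x ha hi.1).pullback (b := ⟨x, ha, hb⟩) (inclL m (P.O a) (P.O b))
    have h2 := (n_secAt i b x hb hi.2).pullback (b := ⟨x, ha, hb⟩) (inclR m (P.O a) (P.O b))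
    have h3 := (t'.secAt ⟨g' ha, g' hb⟩ (d2' hi)).pullback (b := ⟨x, ha, hb⟩)
      (incl2 m (U := P.O a) (V := P.O b) (fun _ h => g' h) (fun _ h => g' h))
    have h4 := (t.secAt ⟨g ha, g hb⟩ (d2 hi)).pullback (b := ⟨x, ha, hb⟩)
      (incl2 m (U := P.O a) (V := P.O b) (fun _ h => g h) (fun _ h => g h))
    have h5 : SmAt k (fun y : on2 m (P.O a) (P.O b) => ℓ i a b y.1) ⟨x, ha, hb⟩ :=
      smAt_of_contMDiffOn (P.isOpen_D2 i a b) (ℓ_smooth i a b) _ hi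
    refine ⟨_, _, _, _, h1, h3, h2, h4.l h5, ?_⟩
    filter_upwards [((P.isOpen_D2 i a b).preimage continuous_subtype_val).mem_nhds hi]
    rintro ⟨y, hya, hyb⟩ hy
    exact (hR i a b y hya hyb hy).symm ▸ S_self i a b y hya hyb
  · intro a b d x ha hb hd n₁ n₂ n₃ e₁₂ e₂₃ e₁₃ e'₁₂ e'₂₃ e'₁₃ h₁ h₂ h₃ h₄
    obtain ⟨i, hia, hib, hid⟩ := P.exists_mem₃ ha hb hd
    rw [hR i a d x ha hd ⟨hia, hid⟩]
    have k1 := t'.tri (g' ha) (g' hb) (g' hd) ⟨(d2' ⟨hia, hib⟩).1, d2' ⟨hib, hid⟩⟩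
    have k2 := t.tri (g ha) (g hb) (g hd) ⟨(d2 ⟨hia, hib⟩).1, d2 ⟨hib, hid⟩⟩
    have k3 := ((G.isTri _ _ _ (g ha) (g hb) (g hd)).l_iff k2 (ℓ i a b x) (ℓ i b d x) _).2 rfl
    rw [← Bitorsor.l_mul] at k3
    -- By `eq₃` the product of the generating quadruples lies in the square over `ad`; one such
    -- instance implies compatibility everywhere.
    have k4 := (hS i a d x ha hd ⟨hia, hid⟩).of_phi_eq_mul_inv (S_self i a d x ha hd)
      (g := L'.f (s' i) (α' a) (α' b) (α' d) x) (q := ℓ i a b x *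
        L.φ (s i) (α a) (α b) x (ℓ i b d x) * L.f (s i) (α a) (α b) (α d) x) (by
        rw [← eq₃ i a b d x ⟨hia, hib, hid⟩, ← n_phi i a x ha hia]
        rfl)
    rw [← t.phiAut_eq ⟨g ha, g hb⟩ (d2 ⟨hia, hib⟩)] at k4
    exact (hS i a b x ha hb ⟨hia, hib⟩).comp_of_base (hS i b d x hb hd ⟨hib, hid⟩)
      (hS i a d x ha hd ⟨hia, hid⟩) (G.isTri _ _ _ (g ha) (g hb) (g hd))
      (G'.isTri _ _ _ (g' ha) (g' hb) (g' hd)) (S_self i a b x ha hb) (S_self i b d x hb hd)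
      k4 k3 k1 (h₁ i ⟨hia, hib⟩) (h₂ i ⟨hib, hid⟩) h₃ h₄

/-- Inherited from gerbes: all local data belong to some gerbe, and the two relations correspond. -/
lemma stableIso_equivalence :
    Equivalence (StableIso (k := k) (H := H) (m := m) (M := M)) where
  refl L := by
    obtain ⟨G, hG⟩ := L.exists_gerbe
    exact stableIso_of_stableEquiv hG hG (Gerbe.stableEquiv_equivalence.refl G)
  symm {L L'} h := by
    obtain ⟨G, hG⟩ := L.exists_gerbe
    obtain ⟨G', hG'⟩ := L'.exists_gerbe
    exact stableIso_of_stableEquiv hG' hG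
      (Gerbe.stableEquiv_equivalence.symm (stableEquiv_of_stableIso hG hG' h))
  trans {L L' L''} h h' := by
    obtain ⟨G, hG⟩ := L.exists_gerbe
    obtain ⟨G', hG'⟩ := L'.exists_gerbe
    obtain ⟨G'', hG''⟩ := L''.exists_gerbe
    exact stableIso_of_stableEquiv hG hG'' (Gerbe.stableEquiv_equivalence.trans
      (stableEquiv_of_stableIso hG hG' h) (stableEquiv_of_stableIso hG' hG'' h'))

end LocalData

end

end NBG

/-! ### Local sections of submersions; comparisons of bundle gerbes and their pull-back -/

namespace NBG

section

variable {m : ℕ} {M : Type u} [TopologicalSpace M] [ChartedSpace (EuclideanSpace ℝ (Fin m)) M]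
  [IsManifold (𝓡 m) ∞ M]

omit [IsManifold (𝓡 m) ∞ M] in
-- In suitable charts a submersion is a linear projection `(u, v) ↦ u`, and `u ↦ (u, v₀)` is a
-- section, `v₀` being the second coordinate of a chosen point over `x`.
lemma Submersion.exists_local_section (P : Submersion m M) (x : M) :
    ∃ (U : Opens M) (σ : M → P.Y), x ∈ U ∧ ContMDiffOn (𝓡 m) (𝓡 P.n) ∞ σ U ∧
      ∀ z ∈ U, P.proj (σ z) = z := by
  obtain ⟨y, rfl⟩ := P.surjective x
  obtain ⟨F, _, _, h⟩ := P.isSubmersion.isSubmersionAt y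
  let s : M → EuclideanSpace ℝ (Fin P.n) := fun z => h.equiv.symm (h.codChart z, (h.equiv (h.domChart y)).2)
  have hψs : ContMDiffOn (𝓡 m) (𝓡 m) ∞ h.codChart h.codChart.source :=
    contMDiffOn_of_mem_maximalAtlas h.codChart_mem_maximalAtlas
  have hφs : ContMDiffOn (𝓡 P.n) (𝓡 P.n) ∞ h.domChart.symm h.domChart.target :=
    contMDiffOn_symm_of_mem_maximalAtlas h.domChart_mem_maximalAtlas
  have hw := h.writtenInCharts
  have hs : ContMDiffOn (𝓡 m) (𝓡 P.n) ∞ s h.codChart.source := by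
    have h1 : ContDiff ℝ ∞ (fun v : EuclideanSpace ℝ (Fin m) => h.equiv.symm (v, (h.equiv (h.domChart y)).2)) := by
      fun_prop
    exact h1.contMDiff.comp_contMDiffOn hψs
  -- The neighbourhood is shrunk until the candidate coordinates stay in the range of the chart of
  -- `Y`.
  refine ⟨⟨h.codChart.source ∩ s ⁻¹' h.domChart.target, hs.continuousOn.isOpen_inter_preimage h.codChart.open_source
    h.domChart.open_target⟩, h.domChart.symm ∘ s, ⟨h.mem_codChart_source, ?_⟩, ?_, ?_⟩
  · have h1 : h.codChart (P.proj y) = (h.equiv (h.domChart y)).1 := by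
      have := hw (x := h.domChart y) (by simpa using h.domChart.map_source h.mem_domChart_source)
      simpa [h.domChart.left_inv h.mem_domChart_source] using this
    simp only [mem_preimage, s, h1, Prod.mk.eta, ContinuousLinearEquiv.symm_apply_apply]
    exact h.domChart.map_source h.mem_domChart_source
  · exact hφs.comp (hs.mono inter_subset_left) fun z hz => hz.2
  · rintro z ⟨hz, hz'⟩
    have h1 : h.codChart (P.proj (h.domChart.symm (s z))) = h.codChart z := by
      have := hw (x := s z) (by simpa using hz')
      simpa [s] using this
    exact h.codChart.injOn (h.source_subset_preimage_source (h.domChart.map_target hz')) hz h1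

omit [IsManifold (𝓡 m) ∞ M] in
theorem Submersion.nonempty_localSections (P : Submersion m M) : Nonempty (LocalSections P) := by
  choose U σ hU hσ hσ' using P.exists_local_section
  exact ⟨⟨⟨M, U, fun x => ⟨x, hU x⟩⟩, σ, hσ, hσ'⟩⟩

end

namespace Bitorsor

variable {H : Type u} [Group H]

/-- The compatibility of three squares with two multiplications. -/
def Compat {N₁ N₂ N₃ E₁₂ E₂₃ E₁₃ E'₁₂ E'₂₃ E'₁₃ : Bitorsor H}
    (T : E₁₂ → E₂₃ → E₁₃ → Prop) (T' : E'₁₂ → E'₂₃ → E'₁₃ → Prop)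
    (R₁₂ : N₁ → E'₁₂ → N₂ → E₁₂ → Prop) (R₂₃ : N₂ → E'₂₃ → N₃ → E₂₃ → Prop)
    (R₁₃ : N₁ → E'₁₃ → N₃ → E₁₃ → Prop) : Prop :=
  ∀ n₁ n₂ n₃ e₁₂ e₂₃ e₁₃ e'₁₂ e'₂₃ e'₁₃, R₁₂ n₁ e'₁₂ n₂ e₁₂ → R₂₃ n₂ e'₂₃ n₃ e₂₃ →
    T' e'₁₂ e'₂₃ e'₁₃ → T e₁₂ e₂₃ e₁₃ → R₁₃ n₁ e'₁₃ n₃ e₁₃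

variable {N₁ N₂ N₃ N'₁ N'₂ N'₃ E₁₂ E₂₃ E₁₃ E'₁₂ E'₂₃ E'₁₃ E''₁₂ E''₂₃ E''₁₃ : Bitorsor H}
    {T : E₁₂ → E₂₃ → E₁₃ → Prop} {T' : E'₁₂ → E'₂₃ → E'₁₃ → Prop}
    {T'' : E''₁₂ → E''₂₃ → E''₁₃ → Prop}
    {R₁₂ : N₁ → E'₁₂ → N₂ → E₁₂ → Prop} {R₂₃ : N₂ → E'₂₃ → N₃ → E₂₃ → Prop}
    {R₁₃ : N₁ → E'₁₃ → N₃ → E₁₃ → Prop}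
    {R'₁₂ : N'₁ → E''₁₂ → N'₂ → E'₁₂ → Prop} {R'₂₃ : N'₂ → E''₂₃ → N'₃ → E'₂₃ → Prop}
    {R'₁₃ : N'₁ → E''₁₃ → N'₃ → E'₁₃ → Prop}

lemma Compat.comp (h : Compat T T' R₁₂ R₂₃ R₁₃) (h' : Compat T' T'' R'₁₂ R'₂₃ R'₁₃)
    (hT' : IsTri T') (h₁₂ : IsSq R₁₂) (h₂₃ : IsSq R₂₃) (h'₁₂ : IsSq R'₁₂) (h'₂₃ : IsSq R'₂₃) :
    Compat T T'' (sqComp R₁₂ R'₁₂) (sqComp R₂₃ R'₂₃) (sqComp R₁₃ R'₁₃) := by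
  intro p₁ p₂ p₃ e₁₂ e₂₃ e₁₃ e'₁₂ e'₂₃ e'₁₃ h₁ h₂ k k'
  obtain ⟨n₁, n₁', rfl⟩ := exists_pair p₁
  obtain ⟨n₂, n₂', rfl⟩ := exists_pair p₂
  obtain ⟨n₃, n₃', rfl⟩ := exists_pair p₃
  obtain ⟨u, h₃, h₃'⟩ := (sqComp_pair_iff h₁₂ h'₁₂ _ _ _ _ _ _).1 h₁
  obtain ⟨v, h₄, h₄'⟩ := (sqComp_pair_iff h₂₃ h'₂₃ _ _ _ _ _ _).1 h₂
  obtain ⟨w, hw, -⟩ := hT'.existsUnique u v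
  exact ⟨n₁, n₁', n₃, n₃', w, rfl, rfl, h _ _ _ _ _ _ _ _ _ h₃ h₄ hw k',
    h' _ _ _ _ _ _ _ _ _ h₃' h₄' k hw⟩

lemma Compat.inv (h : Compat T T' R₁₂ R₂₃ R₁₃) :
    Compat T' T (sqInv R₁₂) (sqInv R₂₃) (sqInv R₁₃) :=
  fun _ _ _ _ _ _ _ _ _ h₁ h₂ k k' => h _ _ _ _ _ _ _ _ _ h₁ h₂ k' k

end Bitorsor

section

variable {k : ℕ} {H : Type u} [TopologicalSpace H] [ChartedSpace (EuclideanSpace ℝ (Fin k)) H]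
  [Group H] [LieGroup (𝓡 k) ∞ H]
  {m : ℕ} {M : Type u} [TopologicalSpace M] [ChartedSpace (EuclideanSpace ℝ (Fin m)) M]
  [IsManifold (𝓡 m) ∞ M]

namespace BundleGerbe

/-- The multiplication `e₁₂ e₂₃ = e₁₃` of a bundle gerbe, encoded by its section `f`. -/
def Tri (G : BundleGerbe k H m M) {y₁ y₂ y₃ : G.P.Y} (h₁₂ : G.P.proj y₁ = G.P.proj y₂)
    (h₂₃ : G.P.proj y₂ = G.P.proj y₃) (e₁₂ : G.E.fib ⟨(y₁, y₂), h₁₂⟩)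
    (e₂₃ : G.E.fib ⟨(y₂, y₃), h₂₃⟩) (e₁₃ : G.E.fib ⟨(y₁, y₃), h₁₂.trans h₂₃⟩) : Prop :=
  Bibundle.Rep (G.f.val ⟨(y₁, y₂, y₃), h₁₂, h₂₃⟩) e₁₂ e₂₃ e₁₃

omit [IsManifold (𝓡 m) ∞ M] in
lemma isTriangle (G : BundleGerbe k H m M) :
    IsTriangle (G.E.pullback G.P.p12) (G.E.pullback G.P.p23) (G.E.pullback G.P.p13)
      (fun y => G.Tri y.2.1 y.2.2) :=
  G.f.isTriangle

omit [IsManifold (𝓡 m) ∞ M] in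
lemma isTri (G : BundleGerbe k H m M) {y₁ y₂ y₃ : G.P.Y} (h₁₂ : G.P.proj y₁ = G.P.proj y₂)
    (h₂₃ : G.P.proj y₂ = G.P.proj y₃) : Bitorsor.IsTri (G.Tri h₁₂ h₂₃) :=
  G.isTriangle.isTri ⟨(y₁, y₂, y₃), h₁₂, h₂₃⟩

omit [IsManifold (𝓡 m) ∞ M] in
lemma Tri.assoc {G : BundleGerbe k H m M} {y₁ y₂ y₃ y₄ : G.P.Y} {h₁₂ : G.P.proj y₁ = G.P.proj y₂}
    {h₂₃ : G.P.proj y₂ = G.P.proj y₃} {h₃₄ : G.P.proj y₃ = G.P.proj y₄}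
    {e₁₂ : G.E.fib ⟨(y₁, y₂), h₁₂⟩} {e₂₃ : G.E.fib ⟨(y₂, y₃), h₂₃⟩}
    {e₃₄ : G.E.fib ⟨(y₃, y₄), h₃₄⟩} {e₁₃ : G.E.fib ⟨(y₁, y₃), h₁₂.trans h₂₃⟩}
    {e₂₄ : G.E.fib ⟨(y₂, y₄), h₂₃.trans h₃₄⟩}
    {e₁₄ : G.E.fib ⟨(y₁, y₄), h₁₂.trans (h₂₃.trans h₃₄)⟩}
    (h₁ : G.Tri h₁₂ h₂₃ e₁₂ e₂₃ e₁₃) (h₂ : G.Tri h₂₃ h₃₄ e₂₃ e₃₄ e₂₄) :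
    G.Tri h₁₂ (h₂₃.trans h₃₄) e₁₂ e₂₄ e₁₄ ↔ G.Tri (h₁₂.trans h₂₃) h₃₄ e₁₃ e₃₄ e₁₄ := by
  constructor
  · intro h
    obtain ⟨y, hy, -⟩ := (G.isTri (h₁₂.trans h₂₃) h₃₄).existsUnique e₁₃ e₃₄
    rwa [G.cocycle y₁ y₂ y₃ y₄ h₁₂ h₂₃ h₃₄ e₁₂ e₂₃ e₃₄ e₁₃ e₂₄ e₁₄ y h₂ h h₁ hy]
  · intro h
    obtain ⟨y, hy, -⟩ := (G.isTri h₁₂ (h₂₃.trans h₃₄)).existsUnique e₁₂ e₂₄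
    rwa [← G.cocycle y₁ y₂ y₃ y₄ h₁₂ h₂₃ h₃₄ e₁₂ e₂₃ e₃₄ e₁₃ e₂₄ y e₁₄ h₂ hy h₁ h]

variable {G G' : BundleGerbe k H m M}

/-- A comparison of two bundle gerbes: a bibundle `N` on `Y ×_M Y'` and an identification
`N₁ E' = E N₂` compatible with the multiplications. -/
structure Comparison (G G' : BundleGerbe k H m M) : Type (u + 1) where
  N : Bibundle k H (Submersion.fibProd G.P G'.P)
  R : ∀ z, (N.pullback (Submersion.z1 G.P G'.P)).fib z →
    (G'.E.pullback (Submersion.q' G.P G'.P)).fib z →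
    (N.pullback (Submersion.z2 G.P G'.P)).fib z → (G.E.pullback (Submersion.q G.P G'.P)).fib z →
    Prop
  isSquare : IsSquare (N.pullback (Submersion.z1 G.P G'.P))
    (G'.E.pullback (Submersion.q' G.P G'.P)) (N.pullback (Submersion.z2 G.P G'.P))
    (G.E.pullback (Submersion.q G.P G'.P)) R
  comp : ∀ (y₁ y₂ y₃ : G.P.Y) (y'₁ y'₂ y'₃ : G'.P.Y)
      (h₁ : G.P.proj y₁ = G'.P.proj y'₁) (h₂ : G.P.proj y₂ = G'.P.proj y'₂)
      (h₃ : G.P.proj y₃ = G'.P.proj y'₃)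
      (h₁₂ : G.P.proj y₁ = G.P.proj y₂) (h₂₃ : G.P.proj y₂ = G.P.proj y₃)
      (h'₁₂ : G'.P.proj y'₁ = G'.P.proj y'₂) (h'₂₃ : G'.P.proj y'₂ = G'.P.proj y'₃),
      Bitorsor.Compat (G.Tri h₁₂ h₂₃) (G'.Tri h'₁₂ h'₂₃)
        (R ⟨((y₁, y'₁), (y₂, y'₂)), h₁, h₂, h₁₂⟩) (R ⟨((y₂, y'₂), (y₃, y'₃)), h₂, h₃, h₂₃⟩)
        (R ⟨((y₁, y'₁), (y₃, y'₃)), h₁, h₃, h₁₂.trans h₂₃⟩)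

omit [IsManifold (𝓡 m) ∞ M] in
lemma stableIso_iff : G.StableIso G' ↔ Nonempty (Comparison G G') := by
  constructor
  · rintro ⟨N, η, ℓ, Θ, h⟩
    refine ⟨⟨N, _, Θ.isSquare ℓ, ?_⟩⟩
    intro y₁ y₂ y₃ y'₁ y'₂ y'₃ h₁ h₂ h₃ h₁₂ h₂₃ h'₁₂ h'₂₃ n₁ n₂ n₃ e₁₂ e₂₃ e₁₃ e'₁₂ e'₂₃ e'₁₃
      k₁ k₂ k' k''
    obtain ⟨d, hd, -⟩ := ((Θ.isSquare ℓ).isSq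
      ⟨((y₁, y'₁), (y₃, y'₃)), h₁, h₃, h₁₂.trans h₂₃⟩).existsUnique n₁ e'₁₃ n₃
    have := h y₁ y₂ y₃ y'₁ y'₂ y'₃ h₁ h₂ h₃ h₁₂ h₂₃ h'₁₂ h'₂₃ n₁ n₂ n₃ e₁₂ e₂₃ e₁₃ d
      e'₁₂ e'₂₃ e'₁₃ k₁ k₂ hd k' k''
    rwa [this]
  · rintro ⟨⟨N, R, hR, h⟩⟩
    obtain ⟨η, ℓ, Θ, hΘ⟩ := hR.exists_iso
    refine ⟨N, η, ℓ, Θ, ?_⟩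
    intro y₁ y₂ y₃ y'₁ y'₂ y'₃ h₁ h₂ h₃ h₁₂ h₂₃ h'₁₂ h'₂₃ n₁ n₂ n₃ e₁₂ e₂₃ e₁₃ d e'₁₂ e'₂₃ e'₁₃
      k₁ k₂ hd k' k''
    have k₃ := h y₁ y₂ y₃ y'₁ y'₂ y'₃ h₁ h₂ h₃ h₁₂ h₂₃ h'₁₂ h'₂₃ n₁ n₂ n₃ e₁₂ e₂₃ e₁₃
      e'₁₂ e'₂₃ e'₁₃ ((hΘ _ _ _ _ _).1 k₁) ((hΘ _ _ _ _ _).1 k₂) k' k''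
    exact (hR.isSq _).eq k₃ ((hΘ _ _ _ _ _).1 hd)

/-- The map `(σ_a, σ'_{a'}) : O_{a} ∩ O'_{a'} → Y ×_M Y'`. -/
def _root_.NBG.LocalSections.mapProd {P P' : Submersion m M} (σ : LocalSections P)
    (σ' : LocalSections P') (a : σ.C.idx × σ'.C.idx) :
    Base.Map (onSet m ((σ.C.inf σ'.C).O a : Set M)) (Submersion.fibProd P P') where
  toFun x := (σ.σ a.1 x, σ'.σ a.2 x)
  smooth := ((σ.smooth a.1).mono fun _ h => h.1).prodMk ((σ'.smooth a.2).mono fun _ h => h.2)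
  maps x h := (σ.isSection a.1 x h.1).trans (σ'.isSection a.2 x h.2).symm

/-- The map `((σ_a, σ'_{a'}), (σ_b, σ'_{b'}))` to `Z^{[2]}` for `Z = Y ×_M Y'`. -/
def _root_.NBG.LocalSections.mapProdDbl {P P' : Submersion m M} (σ : LocalSections P)
    (σ' : LocalSections P') (a b : σ.C.idx × σ'.C.idx) :
    Base.Map (on2 m ((σ.C.inf σ'.C).O a) ((σ.C.inf σ'.C).O b)) (Submersion.fibProdDbl P P') where
  toFun x := ((σ.σ a.1 x, σ'.σ a.2 x), (σ.σ b.1 x, σ'.σ b.2 x))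
  smooth := (((σ.smooth a.1).mono fun _ h => h.1.1).prodMk
    ((σ'.smooth a.2).mono fun _ h => h.1.2)).prodMk
    (((σ.smooth b.1).mono fun _ h => h.2.1).prodMk ((σ'.smooth b.2).mono fun _ h => h.2.2))
  maps x h := ⟨(σ.isSection a.1 x h.1.1).trans (σ'.isSection a.2 x h.1.2).symm,
    (σ.isSection b.1 x h.2.1).trans (σ'.isSection b.2 x h.2.2).symm,
    (σ.isSection a.1 x h.1.1).trans (σ.isSection b.1 x h.2.1).symm⟩

/-- Pull-back of a comparison along local sections. -/
noncomputable def Comparison.toGerbe (c : Comparison G G') (σ : LocalSections G.P)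
    (σ' : LocalSections G'.P) :
    Gerbe.Comparison (G.toGerbe σ) (G'.toGerbe σ') (σ.C.inf σ'.C) Prod.fst Prod.snd
      (fun _ => inf_le_left) (fun _ => inf_le_right) where
  N a := c.N.pullback (σ.mapProd σ' a)
  R a b x := c.R ((σ.mapProdDbl σ' a b).pt x)
  isSquare a b := c.isSquare.pullback (σ.mapProdDbl σ' a b)
  comp a b d _ ha hb hd := c.comp _ _ _ _ _ _
    ((σ.mapProd σ' a).maps ha) ((σ.mapProd σ' b).maps hb) ((σ.mapProd σ' d).maps hd) _ _ _ _

theorem StableIso.toGerbe (h : G.StableIso G') (σ : LocalSections G.P) (σ' : LocalSections G'.P) :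
    (G.toGerbe σ).StableEquiv (G'.toGerbe σ') := by
  obtain ⟨c⟩ := stableIso_iff.1 h
  exact Gerbe.stableEquiv_iff.2 ⟨_, _, _, _, _, ⟨c.toGerbe σ σ'⟩⟩

end BundleGerbe

end

end NBG

/-! ### Restriction to open subsets and descent for bibundles -/

namespace NBG

/-- The restriction of a base space to a subset. -/
def Base.restr (B : Base.{u}) (V : Set B.X) : Base.{u} where
  E := B.E
  F := B.F
  I := B.I
  X := B.X
  S := {z | z ∈ B.S ∧ z ∈ V}

/-- The inclusion of restrictions of a base space. -/
def Base.restrIncl (B : Base.{u}) {V V' : Set B.X} (h : V ⊆ V') :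
    Base.Map (B.restr V) (B.restr V') where
  toFun z := z
  smooth := contMDiffOn_id (I := B.I) (M := B.X)
  maps _ hz := ⟨hz.1, h hz.2⟩

section Restriction

variable {k : ℕ} {H : Type u} [TopologicalSpace H] [ChartedSpace (EuclideanSpace ℝ (Fin k)) H]
  [Group H] {B D : Base.{u}}

lemma SmAt.of_restr {V : Set B.X} (hV : IsOpen V) {f : B.restr V → H} {f' : B → H} {z : B.X}
    {hz : z ∈ B.S} {hzV : z ∈ V} (hf : SmAt k f ⟨z, hz, hzV⟩)
    (h : ∀ (w : B.X) hw hwV, f ⟨w, hw, hwV⟩ = f' ⟨w, hw⟩) : SmAt k f' ⟨z, hz⟩ := by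
  refine SmAt.transfer (B := B.restr V) (B' := B) (fun w => w) hf
    (contMDiff_id (I := B.I) (M := B.X)).contMDiffAt.contMDiffWithinAt rfl ?_
  have h1 : ∀ᶠ y : B in 𝓝 (⟨z, hz⟩ : B), y.1 ∈ V :=
    continuous_subtype_val.continuousAt.eventually (hV.mem_nhds hzV)
  filter_upwards [h1] with y hy
  exact ⟨⟨y.1, y.2, hy⟩, rfl, h y.1 y.2 hy⟩

lemma SmAt₂.of_restr {V : Set B.X} (hV : IsOpen V) {f : B.restr V → H → H} {f' : B → H → H}
    {z : B.X} {hz : z ∈ B.S} {hzV : z ∈ V} (hf : SmAt₂ k f ⟨z, hz, hzV⟩)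
    (h : ∀ (w : B.X) hw hwV a, f ⟨w, hw, hwV⟩ a = f' ⟨w, hw⟩ a) : SmAt₂ k f' ⟨z, hz⟩ := by
  refine SmAt₂.transfer (B := B.restr V) (B' := B) (fun w => w) hf
    (contMDiff_id (I := B.I) (M := B.X)).contMDiffAt.contMDiffWithinAt rfl ?_
  have h1 : ∀ᶠ y : B in 𝓝 (⟨z, hz⟩ : B), y.1 ∈ V :=
    continuous_subtype_val.continuousAt.eventually (hV.mem_nhds hzV)
  filter_upwards [h1] with y hy
  exact ⟨⟨y.1, y.2, hy⟩, rfl, h y.1 y.2 hy⟩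

lemma Base.isOpen_of_restr {V : Set B.X} (hV : IsOpen V) (U : Opens (B.restr V)) :
    IsOpen {z : B | ∃ h : z.1 ∈ V, (⟨z.1, z.2, h⟩ : B.restr V) ∈ U} := by
  obtain ⟨W, hW, hWU⟩ := isOpen_induced_iff.1 U.isOpen
  have : {z : B | ∃ h : z.1 ∈ V, (⟨z.1, z.2, h⟩ : B.restr V) ∈ U} =
      Subtype.val ⁻¹' (W ∩ V) := by
    ext z
    have h1 : ∀ h : z.1 ∈ V, (⟨z.1, z.2, h⟩ : B.restr V) ∈ U ↔ z.1 ∈ W := fun h => by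
      rw [← SetLike.mem_coe, ← hWU]
      rfl
    exact ⟨fun ⟨h, h'⟩ => ⟨(h1 h).1 h', h⟩, fun ⟨h, h'⟩ => ⟨h', (h1 h').2 h⟩⟩
  rw [this]
  exact (hW.inter hV).preimage continuous_subtype_val

open Classical in
/-- Descent for bibundles: bibundles on the members of an open cover, with compatible
identifications on the overlaps, glue to a bibundle. -/
theorem Bibundle.exists_glue [LieGroup (𝓡 k) ∞ H] {ι : Type u} (V : ι → Set B.X)
    (hV : ∀ a, IsOpen (V a)) (cov : ∀ z ∈ B.S, ∃ a, z ∈ V a)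
    (N : ∀ a, Bibundle k H (B.restr (V a)))
    (Ψ : ∀ a b (z : B.X) (hz : z ∈ B.S) (ha : z ∈ V a) (hb : z ∈ V b),
      (N a).fib ⟨z, hz, ha⟩ → (N b).fib ⟨z, hz, hb⟩)
    (Ψ_l : ∀ a b (z : B.X) hz ha hb g n, Ψ a b z hz ha hb (((N a).fib ⟨z, hz, ha⟩).l g n) =
      ((N b).fib ⟨z, hz, hb⟩).l g (Ψ a b z hz ha hb n))
    (Ψ_phi : ∀ a b (z : B.X) hz ha hb n h, ((N b).fib ⟨z, hz, hb⟩).phi (Ψ a b z hz ha hb n) h =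
      ((N a).fib ⟨z, hz, ha⟩).phi n h)
    (Ψ_trans : ∀ a b c (z : B.X) hz ha hb hc n,
      Ψ b c z hz hb hc (Ψ a b z hz ha hb n) = Ψ a c z hz ha hc n)
    (Ψ_smooth : ∀ a b (z : B.X) hz ha hb (s : ∀ z, (N a).fib z), (N a).SecAt s ⟨z, hz, ha⟩ →
      ∃ s' : ∀ z, (N b).fib z, (N b).SecAt s' ⟨z, hz, hb⟩ ∧
        ∀ (w : B.X) hw ha hb, s' ⟨w, hw, hb⟩ = Ψ a b w hw ha hb (s ⟨w, hw, ha⟩)) :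
    ∃ (E : Bibundle k H B) (θ : ∀ a (z : B.X) (hz : z ∈ B.S) (ha : z ∈ V a),
        (N a).fib ⟨z, hz, ha⟩ → E.fib ⟨z, hz⟩),
      (∀ a (z : B.X) hz ha g n, θ a z hz ha (((N a).fib ⟨z, hz, ha⟩).l g n) =
        (E.fib ⟨z, hz⟩).l g (θ a z hz ha n)) ∧
      (∀ a (z : B.X) hz ha n h, (E.fib ⟨z, hz⟩).phi (θ a z hz ha n) h =
        ((N a).fib ⟨z, hz, ha⟩).phi n h) ∧
      (∀ a b (z : B.X) hz ha hb n, θ b z hz hb (Ψ a b z hz ha hb n) = θ a z hz ha n) ∧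
      (∀ a (z : B.X) hz ha (s : ∀ z, (N a).fib z), (N a).SecAt s ⟨z, hz, ha⟩ →
        ∃ s' : ∀ z, E.fib z, E.SecAt s' ⟨z, hz⟩ ∧
          ∀ (w : B.X) hw ha, s' ⟨w, hw⟩ = θ a w hw ha (s ⟨w, hw, ha⟩)) := by
  choose A hA using cov
  -- The fibre at `z` is taken from an arbitrarily chosen member of the cover; `θ a` is the
  -- transition map into it.
  let F : B → Bitorsor H := fun z => (N (A z.1 z.2)).fib ⟨z.1, z.2, hA z.1 z.2⟩
  let θ : ∀ a (z : B.X) (hz : z ∈ B.S) (ha : z ∈ V a), (N a).fib ⟨z, hz, ha⟩ → F ⟨z, hz⟩ :=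
    fun a z hz ha n => Ψ a (A z hz) z hz ha (hA z hz) n
  have θ_l : ∀ a (z : B.X) hz ha g n, θ a z hz ha (((N a).fib ⟨z, hz, ha⟩).l g n) =
      (F ⟨z, hz⟩).l g (θ a z hz ha n) := fun a z hz ha => Ψ_l a (A z hz) z hz ha _
  have θ_phi : ∀ a (z : B.X) hz ha n h, (F ⟨z, hz⟩).phi (θ a z hz ha n) h =
      ((N a).fib ⟨z, hz, ha⟩).phi n h := fun a z hz ha => Ψ_phi a (A z hz) z hz ha _
  have θ_Ψ : ∀ a b (z : B.X) hz ha hb n, θ b z hz hb (Ψ a b z hz ha hb n) = θ a z hz ha n :=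
    fun a b z hz ha hb => Ψ_trans a b (A z hz) z hz ha hb _
  have θ_div : ∀ a (z : B.X) hz ha n n', (F ⟨z, hz⟩).div (θ a z hz ha n) (θ a z hz ha n') =
      ((N a).fib ⟨z, hz, ha⟩).div n n' := by
    intro a z hz ha n n'
    apply Bitorsor.div_eq
    rw [← θ_l, Bitorsor.l_div]
  let ext : ∀ a, (∀ z, (N a).fib z) → ∀ z, F z := fun a s z =>
    if ha : z.1 ∈ V a then θ a z.1 z.2 ha (s ⟨z.1, z.2, ha⟩) else (F z).nonempty.some
  have ext_eq : ∀ a s (z : B.X) hz ha, ext a s ⟨z, hz⟩ = θ a z hz ha (s ⟨z, hz, ha⟩) :=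
    fun a s z hz ha => dif_pos ha
  -- Quotients do not see the chosen members: over `V a ∩ V b` both sections are moved into `N b`,
  -- where the quotient is smooth by `Ψ_smooth`.
  have ext_div : ∀ a b s s' (z : B.X) hz ha hb, (N a).SecAt s ⟨z, hz, ha⟩ → (N b).SecAt s' ⟨z, hz, hb⟩ →
      SmAt k (fun z => (F z).div (ext a s z) (ext b s' z)) ⟨z, hz⟩ := by
    intro a b s s' z hz ha hb hs hs'
    obtain ⟨s₁, h₁, h₂⟩ := Ψ_smooth a b z hz ha hb s hs
    have h3 := (h₁.div hs').pullback (B' := B.restr (V a ∩ V b)) (b := ⟨z, hz, ha, hb⟩)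
      (B.restrIncl inter_subset_right)
    refine SmAt.of_restr (hzV := ⟨ha, hb⟩) ((hV a).inter (hV b)) h3 ?_
    rintro w hw ⟨hwa, hwb⟩
    rw [ext_eq a s w hw hwa, ext_eq b s' w hw hwb, ← θ_Ψ a b w hw hwa hwb, θ_div, ← h₂]
    rfl
  let E : Bibundle k H B :=
    { fib := F
      idx := Σ a, (N a).idx
      dom := fun i => ⟨_, Base.isOpen_of_restr (hV i.1) ((N i.1).dom i.2)⟩
      dom_cover := fun z => by
        obtain ⟨i, hi⟩ := (N (A z.1 z.2)).dom_cover ⟨z.1, z.2, hA z.1 z.2⟩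
        exact ⟨⟨A z.1 z.2, i⟩, hA z.1 z.2, hi⟩
      t := fun i => ext i.1 ((N i.1).t i.2)
      trans_smooth := fun i j => smoothOn_iff.2 fun ⟨z, hz⟩ ⟨⟨ha, hi⟩, ⟨hb, hj⟩⟩ =>
        ext_div _ _ _ _ z hz ha hb (secAt_t hi) (secAt_t hj)
      phi_smooth := fun i => smoothOn₂_iff.2 fun ⟨z, hz⟩ ⟨ha, hi⟩ =>
        SmAt₂.of_restr (hV i.1) (secAt_t (E := N i.1) hi).phi (hz := hz) (hzV := ha) (by
          intro w hw hwa y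
          rw [ext_eq i.1 _ w hw hwa]
          exact (θ_phi _ _ _ _ _ _).symm)
      phiInv_smooth := fun i => smoothOn₂_iff.2 fun ⟨z, hz⟩ ⟨ha, hi⟩ =>
        SmAt₂.of_restr (hV i.1) (secAt_t (E := N i.1) hi).phiInv (hz := hz) (hzV := ha) (by
          intro w hw hwa y
          rw [ext_eq i.1 _ w hw hwa]
          apply (Bitorsor.phi_injective _ (θ i.1 w hw hwa ((N i.1).t i.2 ⟨w, hw, hwa⟩)))
          rw [Bitorsor.phi_phiInv]
          exact (θ_phi _ _ _ _ _ _).trans (Bitorsor.phi_phiInv _ _ _)) }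
  refine ⟨E, θ, θ_l, θ_phi, θ_Ψ, fun a z hz ha s hs => ⟨ext a s, ?_, ext_eq a s⟩⟩
  obtain ⟨i, hi⟩ := (N a).dom_cover ⟨z, hz, ha⟩
  exact Bibundle.SecAt.of_smAt (E := E) (i := ⟨a, i⟩) ⟨ha, hi⟩
    (ext_div _ _ _ _ z hz ha ha hs (secAt_t hi))

/-- Pull-back of a bibundle along a map of points that underlies a smooth map. -/
def Bibundle.pullbackPt (E : Bibundle k H B) (p : D → B) (hp : ∃ g : Base.Map D B, g.pt = p) :
    Bibundle k H D where
  fib b := E.fib (p b)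
  idx := E.idx
  dom i := ⟨p ⁻¹' E.dom i, by
    obtain ⟨g, rfl⟩ := hp
    exact (g.comap (E.dom i)).isOpen⟩
  dom_cover b := E.dom_cover (p b)
  t i b := E.t i (p b)
  trans_smooth i j := by
    obtain ⟨g, rfl⟩ := hp
    exact (E.pullback g).trans_smooth i j
  phi_smooth i := by
    obtain ⟨g, rfl⟩ := hp
    exact (E.pullback g).phi_smooth i
  phiInv_smooth i := by
    obtain ⟨g, rfl⟩ := hp
    exact (E.pullback g).phiInv_smooth i

/-- Maps that agree on `D` may still differ off `D` in the ambient manifold; the pull-back only sees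
the points, and `pullbackPt` makes this visible. -/
lemma Bibundle.pullback_congr (E : Bibundle k H B) {g g' : Base.Map D B} (h : g.pt = g'.pt) :
    E.pullback g = E.pullback g' := by
  change E.pullbackPt g.pt ⟨g, rfl⟩ = E.pullbackPt g'.pt ⟨g', rfl⟩
  simp only [h]

/-- A square remains a square if the pull-back maps are replaced by maps that agree pointwise. -/
lemma IsSquare.congr_pt {B₁ B₂ B₃ B₄ : Base.{u}} {A₁ : Bibundle k H B₁} {A₂ : Bibundle k H B₂}
    {A₃ : Bibundle k H B₃} {A₄ : Bibundle k H B₄} {g₁ g₁' : Base.Map D B₁} {g₂ g₂' : Base.Map D B₂}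
    {g₃ g₃' : Base.Map D B₃} {g₄ g₄' : Base.Map D B₄}
    {R : ∀ z, (A₁.pullback g₁).fib z → (A₂.pullback g₂).fib z → (A₃.pullback g₃).fib z →
      (A₄.pullback g₄).fib z → Prop}
    {R' : ∀ z, (A₁.pullback g₁').fib z → (A₂.pullback g₂').fib z → (A₃.pullback g₃').fib z →
      (A₄.pullback g₄').fib z → Prop}
    (hR : IsSquare (A₁.pullback g₁) (A₂.pullback g₂) (A₃.pullback g₃) (A₄.pullback g₄) R)
    (h₁ : g₁.pt = g₁'.pt) (h₂ : g₂.pt = g₂'.pt) (h₃ : g₃.pt = g₃'.pt) (h₄ : g₄.pt = g₄'.pt)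
    (h : ∀ z, HEq (R z) (R' z)) :
    IsSquare (A₁.pullback g₁') (A₂.pullback g₂') (A₃.pullback g₃') (A₄.pullback g₄') R' := by
  have e₁ := A₁.pullback_congr h₁
  have e₂ := A₂.pullback_congr h₂
  have e₃ := A₃.pullback_congr h₃
  have e₄ := A₄.pullback_congr h₄
  generalize A₁.pullback g₁ = X₁ at *
  generalize A₂.pullback g₂ = X₂ at *
  generalize A₃.pullback g₃ = X₃ at *
  generalize A₄.pullback g₄ = X₄ at *
  subst e₁ e₂ e₃ e₄
  obtain rfl : R = R' := funext fun z => eq_of_heq (h z)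
  exact hR

end Restriction

end NBG

/-! ### Units and canonical squares of a bundle gerbe -/

namespace NBG

namespace Bitorsor

variable {H : Type u} [Group H]

lemma IsSq.existsUnique₂ {N₁ E' N₂ E : Bitorsor H} {R : N₁ → E' → N₂ → E → Prop} (hR : IsSq R)
    (n₁ e' e) : ∃! n₂, R n₁ e' n₂ e := by
  obtain ⟨a, b, c, d, h⟩ := hR.nonempty
  refine ⟨N₂.l (E.phiInv d ((E.div e d)⁻¹ * (N₁.div n₁ a * N₁.phi a (E'.div e' b)))) c, ?_, ?_⟩
  · simp only
    rw [hR.iff h, div_l_self, phi_phiInv, mul_inv_cancel_left]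
  · intro y hy
    rw [hR.iff h] at hy
    rw [hy, inv_mul_cancel_left, phiInv_phi, l_div]

/-- Used with `e` a unit, whose automorphism is trivial: left translations then pass through the
square unchanged. -/
lemma IsSq.l_l {N₁ E' N₂ E : Bitorsor H} {R : N₁ → E' → N₂ → E → Prop} (hR : IsSq R)
    {n₁ e' n₂ e} (he : ∀ h, E.phi e h = h) (h : R n₁ e' n₂ e) (g : H) :
    R (N₁.l g n₁) e' (N₂.l g n₂) e := by
  have := (hR.l_iff h g 1 g 1).2 (by simp [he])
  simpa only [l_one] using this

/-- Squares are invariant under isomorphisms of the vertical bitorsors. -/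
lemma IsSq.map {N₁ E' N₂ E N₁' N₂' : Bitorsor H} {R : N₁ → E' → N₂ → E → Prop} (hR : IsSq R)
    {R' : N₁' → E' → N₂' → E → Prop} (f₁ : N₁ → N₁') (f₂ : N₂ → N₂')
    (f₁_l : ∀ g n, f₁ (N₁.l g n) = N₁'.l g (f₁ n)) (f₂_l : ∀ g n, f₂ (N₂.l g n) = N₂'.l g (f₂ n))
    (f₁_phi : ∀ n h, N₁'.phi (f₁ n) h = N₁.phi n h) (f₂_phi : ∀ n h, N₂'.phi (f₂ n) h = N₂.phi n h)
    (h : ∀ n₁ e' n₂ e, R' (f₁ n₁) e' (f₂ n₂) e ↔ R n₁ e' n₂ e) : IsSq R' := by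
  have s₁ : Function.Surjective f₁ := fun n => by
    obtain ⟨m⟩ := N₁.nonempty
    exact ⟨N₁.l (N₁'.div n (f₁ m)) m, by rw [f₁_l, l_div]⟩
  have s₂ : Function.Surjective f₂ := fun n => by
    obtain ⟨m⟩ := N₂.nonempty
    exact ⟨N₂.l (N₂'.div n (f₂ m)) m, by rw [f₂_l, l_div]⟩
  refine ⟨?_, ?_, ?_⟩
  · obtain ⟨a, b, c, d, habcd⟩ := hR.nonempty
    exact ⟨_, _, _, _, (h _ _ _ _).2 habcd⟩
  · intro n₁ e' n₂ e hh x
    obtain ⟨m₁, rfl⟩ := s₁ n₁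
    obtain ⟨m₂, rfl⟩ := s₂ n₂
    rw [f₁_phi, f₂_phi]
    exact hR.phi_eq ((h _ _ _ _).1 hh) x
  · intro n₁ e' n₂ e hh g k m p
    obtain ⟨m₁, rfl⟩ := s₁ n₁
    obtain ⟨m₂, rfl⟩ := s₂ n₂
    rw [← f₁_l, ← f₂_l, f₁_phi, h]
    exact hR.l_iff ((h _ _ _ _).1 hh) g k m p

end Bitorsor

section

variable {k : ℕ} {H : Type u} [TopologicalSpace H] [ChartedSpace (EuclideanSpace ℝ (Fin k)) H]
  [Group H] [LieGroup (𝓡 k) ∞ H] {D : Base.{u}}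

lemma IsSquare.secAt₂ {N₁ E' N₂ E : Bibundle k H D}
    {R : ∀ b, N₁.fib b → E'.fib b → N₂.fib b → E.fib b → Prop} (hR : IsSquare N₁ E' N₂ E R)
    {n₁ : ∀ b, N₁.fib b} {e' : ∀ b, E'.fib b} {n₂ : ∀ b, N₂.fib b} {e : ∀ b, E.fib b} {b : D}
    (h₁ : N₁.SecAt n₁ b) (h' : E'.SecAt e' b) (he : E.SecAt e b)
    (h : ∀ᶠ x in 𝓝 b, R x (n₁ x) (e' x) (n₂ x) (e x)) : N₂.SecAt n₂ b := by
  obtain ⟨m₁, d', m₂, d, g1, g2, g3, g4, g5⟩ := hR.smooth b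
  refine g3.of_div ((g4.phiInv.apply ((he.div g4).inv.mul
    ((h₁.div g1).mul (g1.phi.apply (h'.div g2))))).congr ?_)
  filter_upwards [h, g5] with x hx gx
  rw [((hR.isSq x).iff gx _ _ _ _).1 hx, inv_mul_cancel_left, Bitorsor.phiInv_phi]

lemma IsTriangle.secAt_left {A B C : Bibundle k H D}
    {R : ∀ b, A.fib b → B.fib b → C.fib b → Prop} (hR : IsTriangle A B C R)
    {a : ∀ b, A.fib b} {b : ∀ b, B.fib b} {c : ∀ b, C.fib b} {x : D} (hb : B.SecAt b x)
    (hc : C.SecAt c x) (h : ∀ᶠ y in 𝓝 x, R y (a y) (b y) (c y)) : A.SecAt a x := by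
  obtain ⟨a', b', c', g1, g2, g3, g5⟩ := hR.smooth x
  refine g1.of_div (((hc.div g3).mul (g1.phi.apply (hb.div g2)).inv).congr ?_)
  filter_upwards [h, g5] with y hy gy
  rw [← ((hR.isTri y).iff gy _ _ _).1 hy, mul_inv_cancel_right]

omit [LieGroup (𝓡 k) ∞ H] in
lemma Bibundle.SecAt.of_restr {E : Bibundle k H D} {V : Set D.X} (hV : IsOpen V)
    {g : Base.Map (D.restr V) D} (hg : ∀ w, g.toFun w = w)
    {s : ∀ w, (E.pullback g).fib w} {s' : ∀ w, E.fib w} {z : D.X} {hz : z ∈ D.S} {hzV : z ∈ V}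
    (hs : (E.pullback g).SecAt s ⟨z, hz, hzV⟩)
    (h : ∀ w, s w = s' (g.pt w)) : E.SecAt s' ⟨z, hz⟩ := by
  have hg' : ∀ (w : D.X) hw hwV, g.pt ⟨w, hw, hwV⟩ = ⟨w, hw⟩ := fun w hw hwV => Subtype.ext (hg w)
  intro i hi
  have hi' : g.pt ⟨z, hz, hzV⟩ ∈ E.dom i := by rwa [hg' z hz hzV]
  refine SmAt.of_restr (hzV := hzV) hV (hs i hi') fun w hw hwV => ?_
  rw [h]
  change (fun x => (E.fib x).div (s' x) (E.t i x)) (g.pt ⟨w, hw, hwV⟩) = _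
  rw [hg' w hw hwV]

end

section

variable {k : ℕ} {H : Type u} [TopologicalSpace H] [ChartedSpace (EuclideanSpace ℝ (Fin k)) H]
  [Group H] [LieGroup (𝓡 k) ∞ H]
  {m : ℕ} {M : Type u} [TopologicalSpace M] [ChartedSpace (EuclideanSpace ℝ (Fin m)) M]
  [IsManifold (𝓡 m) ∞ M]

/-- The total space of a submersion as a base space. -/
noncomputable def Submersion.total (P : Submersion m M) : Base.{u} where
  E := EuclideanSpace ℝ (Fin P.n)
  F := EuclideanSpace ℝ (Fin P.n)
  I := 𝓡 P.n
  X := P.Y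
  S := univ

/-- The diagonal `Y → Y^{[2]}`. -/
noncomputable def Submersion.diag (P : Submersion m M) : Base.Map P.total P.dbl where
  toFun y := (y, y)
  smooth := (contMDiff_id (I := 𝓡 P.n) (M := P.Y)).contMDiffOn.prodMk contMDiff_id.contMDiffOn
  maps _ _ := rfl

/-- The diagonal `Y → Y^{[3]}`. -/
noncomputable def Submersion.diag₃ (P : Submersion m M) : Base.Map P.total P.tpl where
  toFun y := (y, y, y)
  smooth := (contMDiff_id (I := 𝓡 P.n) (M := P.Y)).contMDiffOn.prodMk
    (contMDiff_id.contMDiffOn.prodMk contMDiff_id.contMDiffOn)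
  maps _ _ := ⟨rfl, rfl⟩

omit [IsManifold (𝓡 m) ∞ M] in
lemma Submersion.contMDiff_proj (P : Submersion m M) : ContMDiff (𝓡 P.n) (𝓡 m) ∞ P.proj :=
  P.isSubmersion.contMDiff

namespace BundleGerbe

variable {G G' : BundleGerbe k H m M}

omit [IsManifold (𝓡 m) ∞ M] in
-- Solve `u e = e`. Then `(u u) e = u (u e) = e`, and uniqueness of the left factor gives `u u = u`.
lemma exists_unit (G : BundleGerbe k H m M) (y : G.P.Y) :
    ∃ u : G.E.fib ⟨(y, y), rfl⟩, G.Tri rfl rfl u u u := by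
  obtain ⟨e⟩ := (G.E.fib ⟨(y, y), rfl⟩).nonempty
  obtain ⟨u, hu, h⟩ := (G.isTri (y₁ := y) rfl rfl).existsUnique_left e e
  obtain ⟨w, hw, -⟩ := (G.isTri (y₁ := y) rfl rfl).existsUnique u u
  obtain rfl := h w ((hw.assoc hu).1 hu)
  exact ⟨w, hw⟩

/-- The unit of a bundle gerbe. -/
noncomputable def unit (G : BundleGerbe k H m M) (y : G.P.Y) : G.E.fib ⟨(y, y), rfl⟩ :=
  (G.exists_unit y).choose

omit [IsManifold (𝓡 m) ∞ M] in
lemma unit_unit (G : BundleGerbe k H m M) (y : G.P.Y) :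
    G.Tri rfl rfl (G.unit y) (G.unit y) (G.unit y) :=
  (G.exists_unit y).choose_spec

omit [IsManifold (𝓡 m) ∞ M] in
-- For `w = u e`, associativity gives `u w = (u u) e = w = u e`; cancel `u`.
lemma unit_left {y₁ y₂ : G.P.Y} (h : G.P.proj y₁ = G.P.proj y₂) (e : G.E.fib ⟨(y₁, y₂), h⟩) :
    G.Tri rfl h (G.unit y₁) e e := by
  obtain ⟨w, hw, -⟩ := (G.isTri (y₁ := y₁) rfl h).existsUnique (G.unit y₁) e
  rwa [← ((G.isTri (y₁ := y₁) rfl h).existsUnique_right (G.unit y₁) w).unique hw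
    (((G.unit_unit y₁).assoc hw).2 hw)] at hw

omit [IsManifold (𝓡 m) ∞ M] in
lemma unit_right {y₁ y₂ : G.P.Y} (h : G.P.proj y₁ = G.P.proj y₂) (e : G.E.fib ⟨(y₁, y₂), h⟩) :
    G.Tri h rfl e (G.unit y₂) e := by
  obtain ⟨w, hw, -⟩ := (G.isTri h (y₃ := y₂) rfl).existsUnique e (G.unit y₂)
  rwa [← ((G.isTri h (y₃ := y₂) rfl).existsUnique_left (G.unit y₂) w).unique hw
    ((hw.assoc (G.unit_unit y₂)).1 hw)] at hw

omit [IsManifold (𝓡 m) ∞ M] in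
-- `φ_u φ_u = φ_u` because `u u = u`, and `φ_u` is injective.
lemma phi_unit (G : BundleGerbe k H m M) (y : G.P.Y) (h : H) :
    (G.E.fib ⟨(y, y), rfl⟩).phi (G.unit y) h = h :=
  Bitorsor.phi_injective _ (G.unit y) ((G.isTri rfl rfl).phi_eq (G.unit_unit y) h)

omit [IsManifold (𝓡 m) ∞ M] in
-- Along the diagonal the unit is the solution of `u e = e` for a smooth `e`.
lemma secAt_unit (G : BundleGerbe k H m M) (y : G.P.total) :
    (G.E.pullback G.P.diag).SecAt (fun y => G.unit y.1) y := by
  obtain ⟨e, he⟩ := (G.E.pullback G.P.diag).exists_secAt y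
  exact (G.isTriangle.pullback G.P.diag₃).secAt_left he he
    (Filter.Eventually.of_forall fun y => unit_left rfl (e y))

/-- The square `e₁ d = e e₂` in a bundle gerbe. -/
def Sq (G : BundleGerbe k H m M) {y₁ y₂ t₁ t₂ : G.P.Y} (h₁ : G.P.proj y₁ = G.P.proj t₁)
    (h₂ : G.P.proj y₂ = G.P.proj t₂) (h : G.P.proj y₁ = G.P.proj y₂)
    (e₁ : G.E.fib ⟨(y₁, t₁), h₁⟩) (d : G.E.fib ⟨(t₁, t₂), h₁.symm.trans (h.trans h₂)⟩)
    (e₂ : G.E.fib ⟨(y₂, t₂), h₂⟩) (e : G.E.fib ⟨(y₁, y₂), h⟩) : Prop :=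
  ∃ c, G.Tri h₁ (h₁.symm.trans (h.trans h₂)) e₁ d c ∧ G.Tri h h₂ e e₂ c

omit [IsManifold (𝓡 m) ∞ M] in
lemma isSq_sq {y₁ y₂ t₁ t₂ : G.P.Y} (h₁ : G.P.proj y₁ = G.P.proj t₁)
    (h₂ : G.P.proj y₂ = G.P.proj t₂) (h : G.P.proj y₁ = G.P.proj y₂) :
    Bitorsor.IsSq (G.Sq h₁ h₂ h) :=
  (G.isTri _ _).isSq (G.isTri _ _)

omit [IsManifold (𝓡 m) ∞ M] in
lemma compat_sq {y₁ y₂ y₃ t₁ t₂ t₃ : G.P.Y} (h₁ : G.P.proj y₁ = G.P.proj t₁)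
    (h₂ : G.P.proj y₂ = G.P.proj t₂) (h₃ : G.P.proj y₃ = G.P.proj t₃)
    (h₁₂ : G.P.proj y₁ = G.P.proj y₂) (h₂₃ : G.P.proj y₂ = G.P.proj y₃) :
    Bitorsor.Compat (G.Tri h₁₂ h₂₃)
      (G.Tri (h₁.symm.trans (h₁₂.trans h₂)) (h₂.symm.trans (h₂₃.trans h₃)))
      (G.Sq h₁ h₂ h₁₂) (G.Sq h₂ h₃ h₂₃) (G.Sq h₁ h₃ (h₁₂.trans h₂₃)) := by
  rintro n₁ n₂ n₃ e₁₂ e₂₃ e₁₃ e'₁₂ e'₂₃ e'₁₃ ⟨c₁, k₁, k₁'⟩ ⟨c₂, k₂, k₂'⟩ k' k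
  obtain ⟨d, hd, -⟩ := (G.isTri h₁ (h₁.symm.trans ((h₁₂.trans h₂₃).trans h₃))).existsUnique n₁ e'₁₃
  exact ⟨d, hd, (k.assoc k₂').1 ((k₁'.assoc k₂).2 ((k₁.assoc k').1 hd))⟩

end BundleGerbe

end

end NBG

/-! ### Squares over `Y ×_M Y'` from a comparison of the induced gerbes -/

namespace NBG

/-- The inclusion of a restriction of a base space. -/
def Base.ofRestr (B : Base.{u}) (V : Set B.X) : Base.Map (B.restr V) B where
  toFun z := z
  smooth := contMDiffOn_id (I := B.I) (M := B.X)
  maps _ hz := hz.1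

namespace Base.Map

variable {B D F : Base.{u}}

/-- A map with values in a subset. -/
def codRestr (g : Base.Map D B) (V : Set B.X) (h : ∀ z ∈ D.S, g.toFun z ∈ V) :
    Base.Map D (B.restr V) where
  toFun := g.toFun
  smooth := g.smooth
  maps z hz := ⟨g.maps hz, h z hz⟩

/-- Composition of maps of base spaces. -/
def comp (g : Base.Map B F) (f : Base.Map D B) : Base.Map D F where
  toFun := g.toFun ∘ f.toFun
  smooth := g.smooth.comp f.smooth f.maps
  maps := g.maps.comp f.maps

end Base.Map

section

variable {m : ℕ} {M : Type u} [TopologicalSpace M] [ChartedSpace (EuclideanSpace ℝ (Fin m)) M]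
  [IsManifold (𝓡 m) ∞ M] {D : Base.{u}} {P P' : Submersion m M}

namespace Submersion

/-- The map to `Y^{[2]}` with given components. -/
def dblMk (u v : Base.Map D P.total)
    (h : ∀ z ∈ D.S, P.proj (u.toFun z) = P.proj (v.toFun z)) : Base.Map D P.dbl where
  toFun z := (u.toFun z, v.toFun z)
  smooth := ContMDiffOn.prodMk (I' := 𝓡 P.n) (J' := 𝓡 P.n) u.smooth v.smooth
  maps z hz := h z hz

/-- The map to `Y^{[3]}` with given components. -/
def tplMk (u v w : Base.Map D P.total)
    (h : ∀ z ∈ D.S, P.proj (u.toFun z) = P.proj (v.toFun z))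
    (h' : ∀ z ∈ D.S, P.proj (v.toFun z) = P.proj (w.toFun z)) : Base.Map D P.tpl where
  toFun z := (u.toFun z, v.toFun z, w.toFun z)
  smooth := ContMDiffOn.prodMk (I' := 𝓡 P.n) (J' := (𝓡 P.n).prod (𝓡 P.n)) u.smooth
    (ContMDiffOn.prodMk (I' := 𝓡 P.n) (J' := 𝓡 P.n) v.smooth w.smooth)
  maps z hz := ⟨h z hz, h' z hz⟩

/-- The projection to the base manifold. -/
def toOn (u : Base.Map D P.total) {O : Set M} (h : ∀ z ∈ D.S, P.proj (u.toFun z) ∈ O) :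
    Base.Map D (onSet m O) where
  toFun z := P.proj (u.toFun z)
  smooth := P.contMDiff_proj.comp_contMDiffOn (I' := 𝓡 P.n) u.smooth
  maps z hz := h z hz

variable (P P') in
/-- The projection `Y ×_M Y' → Y`. -/
noncomputable def fibFst : Base.Map (fibProd P P') P.total where
  toFun z := z.1
  smooth := (contMDiff_fst (I := 𝓡 P.n) (J := 𝓡 P'.n) (M := P.Y) (N := P'.Y)).contMDiffOn
  maps _ _ := mem_univ _

variable (P P') in
/-- The projection `Y ×_M Y' → Y'`. -/
noncomputable def fibSnd : Base.Map (fibProd P P') P'.total where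
  toFun z := z.2
  smooth := (contMDiff_snd (I := 𝓡 P.n) (J := 𝓡 P'.n) (M := P.Y) (N := P'.Y)).contMDiffOn
  maps _ _ := mem_univ _

end Submersion

/-- A local section, composed with a map to its domain. -/
def LocalSections.at (σ : LocalSections P) (α : σ.C.idx) {O : Set M} (hO : O ⊆ σ.C.O α)
    (x : Base.Map D (onSet m O)) : Base.Map D P.total where
  toFun z := σ.σ α (x.toFun z)
  smooth := ((σ.smooth α).mono hO).comp (I := D.I) x.smooth x.maps
  maps _ _ := mem_univ _

end

section

variable {k : ℕ} {H : Type u} [TopologicalSpace H] [ChartedSpace (EuclideanSpace ℝ (Fin k)) H]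
  [Group H] [LieGroup (𝓡 k) ∞ H]
  {m : ℕ} {M : Type u} [TopologicalSpace M] [ChartedSpace (EuclideanSpace ℝ (Fin m)) M]
  [IsManifold (𝓡 m) ∞ M]
  {G G' : BundleGerbe k H m M} {σ : LocalSections G.P} {σ' : LocalSections G'.P} {P : Cover M}
  {r : P.idx → (G.toGerbe σ).C.idx} {r' : P.idx → (G'.toGerbe σ').C.idx}
  {hr : ∀ a, P.O a ≤ (G.toGerbe σ).C.O (r a)} {hr' : ∀ a, P.O a ≤ (G'.toGerbe σ').C.O (r' a)}

open Bitorsor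

namespace BundleGerbe

omit [IsManifold (𝓡 m) ∞ M] in
lemma isSquare_sq {D : Base.{u}} (y₁ y₂ t₁ t₂ : Base.Map D G.P.total)
    (h₁ : ∀ z ∈ D.S, G.P.proj (y₁.toFun z) = G.P.proj (t₁.toFun z))
    (h₂ : ∀ z ∈ D.S, G.P.proj (y₂.toFun z) = G.P.proj (t₂.toFun z))
    (h : ∀ z ∈ D.S, G.P.proj (y₁.toFun z) = G.P.proj (y₂.toFun z)) :
    IsSquare (G.E.pullback (Submersion.dblMk y₁ t₁ h₁))
      (G.E.pullback (Submersion.dblMk t₁ t₂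
        fun z hz => (h₁ z hz).symm.trans ((h z hz).trans (h₂ z hz))))
      (G.E.pullback (Submersion.dblMk y₂ t₂ h₂)) (G.E.pullback (Submersion.dblMk y₁ y₂ h))
      (fun z => G.Sq (h₁ z.1 z.2) (h₂ z.1 z.2) (h z.1 z.2)) :=
  (G.isTriangle.pullback (Submersion.tplMk y₁ t₁ t₂ h₁
    fun z hz => (h₁ z hz).symm.trans ((h z hz).trans (h₂ z hz)))).isSquare
    (G.isTriangle.pullback (Submersion.tplMk y₁ y₂ t₂ h h₂))

end BundleGerbe

namespace Gerbe.Comparison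

variable (c : Gerbe.Comparison (G.toGerbe σ) (G'.toGerbe σ') P r r' hr hr')

lemma proj_section {hr : ∀ a, P.O a ≤ (G.toGerbe σ).C.O (r a)} {a b} {x₁ x₂ : M} (hx : x₁ = x₂) (ha : x₁ ∈ P.O a) (hb : x₂ ∈ P.O b) :
    G.P.proj (σ.σ (r a) x₁) = G.P.proj (σ.σ (r b) x₂) :=
  (σ.isSection (r a) x₁ (hr a ha)).trans (hx.trans (σ.isSection (r b) x₂ (hr b hb)).symm)

/-- The relation of a comparison, at two points that agree propositionally. -/
def twoPt (a b : P.idx) {x₁ x₂ : M} (hx : x₁ = x₂) (ha : x₁ ∈ P.O a) (hb : x₂ ∈ P.O b) :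
    (c.N a).fib ⟨x₁, ha⟩ →
    G'.E.fib ⟨(σ'.σ (r' a) x₁, σ'.σ (r' b) x₂), proj_section (hr := hr') hx ha hb⟩ →
    (c.N b).fib ⟨x₂, hb⟩ →
    G.E.fib ⟨(σ.σ (r a) x₁, σ.σ (r b) x₂), proj_section (hr := hr) hx ha hb⟩ → Prop := by
  -- `x₁` and `x₂` will be the projections of two points of a fibre product, which are equal only
  -- propositionally.
  subst hx
  exact c.R a b ⟨x₁, ha, hb⟩

lemma heq_twoPt (a b : P.idx) {x₁ x₂ : M} (hx : x₁ = x₂) (ha : x₁ ∈ P.O a) (hb : x₂ ∈ P.O b) :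
    HEq (c.R a b ⟨x₁, ha, hx ▸ hb⟩) (c.twoPt a b hx ha hb) := by
  subst hx
  rfl

lemma isSq_twoPt (a b : P.idx) {x₁ x₂ : M} (hx : x₁ = x₂) (ha : x₁ ∈ P.O a) (hb : x₂ ∈ P.O b) :
    IsSq (c.twoPt a b hx ha hb) := by
  subst hx
  exact (c.isSquare a b).isSq ⟨x₁, ha, hb⟩

lemma compat_twoPt (a₁ a₂ a₃ : P.idx) {x₁ x₂ x₃ : M} (h₁₂ : x₁ = x₂) (h₂₃ : x₂ = x₃)
    (h₁ : x₁ ∈ P.O a₁) (h₂ : x₂ ∈ P.O a₂) (h₃ : x₃ ∈ P.O a₃) :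
    Compat (G.Tri (proj_section (hr := hr) h₁₂ h₁ h₂) (proj_section (hr := hr) h₂₃ h₂ h₃))
      (G'.Tri (proj_section (hr := hr') h₁₂ h₁ h₂) (proj_section (hr := hr') h₂₃ h₂ h₃))
      (c.twoPt a₁ a₂ h₁₂ h₁ h₂) (c.twoPt a₂ a₃ h₂₃ h₂ h₃) (c.twoPt a₁ a₃ (h₁₂.trans h₂₃) h₁ h₃) := by
  subst h₁₂ h₂₃
  exact c.comp a₁ a₂ a₃ x₁ h₁ h₂ h₃

/-- The fibre at `(y, y')` of the bibundle constructed from a comparison of gerbes. -/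
abbrev locFib (a : P.idx) (x : M) (hx : x ∈ P.O a) (y : G.P.Y) (y' : G'.P.Y) (hy : G.P.proj y = x)
    (hy' : G'.P.proj y' = x) : Bitorsor H :=
  (G.E.fib ⟨(y, σ.σ (r a) x), hy.trans (σ.isSection (r a) x (hr a hx)).symm⟩).mul
    (((c.N a).fib ⟨x, hx⟩).mul (G'.E.fib ⟨(y', σ'.σ (r' a) x),
      hy'.trans (σ'.isSection (r' a) x (hr' a hx)).symm⟩).inv)

section

variable {a b d : P.idx} {x₁ x₂ x₃ : M} (h₁₂ : x₁ = x₂) (h₂₃ : x₂ = x₃)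
  (h₁ : x₁ ∈ P.O a) (h₂ : x₂ ∈ P.O b) (h₃ : x₃ ∈ P.O d)
  {y₁ y₂ y₃ : G.P.Y} {y'₁ y'₂ y'₃ : G'.P.Y} (hy₁ : G.P.proj y₁ = x₁) (hy₂ : G.P.proj y₂ = x₂)
  (hy₃ : G.P.proj y₃ = x₃) (hy'₁ : G'.P.proj y'₁ = x₁) (hy'₂ : G'.P.proj y'₂ = x₂)
  (hy'₃ : G'.P.proj y'₃ = x₃)

/-- The square of bitorsors constructed from a comparison of gerbes. -/
def locR : c.locFib a x₁ h₁ y₁ y'₁ hy₁ hy'₁ →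
    G'.E.fib ⟨(y'₁, y'₂), hy'₁.trans (h₁₂.trans hy'₂.symm)⟩ → c.locFib b x₂ h₂ y₂ y'₂ hy₂ hy'₂ →
    G.E.fib ⟨(y₁, y₂), hy₁.trans (h₁₂.trans hy₂.symm)⟩ → Prop :=
  -- Three stacked squares lead from `E_{y₁y₂}` through `E_{σσ}` and `E'_{σ'σ'}` to `E'_{y'₁y'₂}`,
  -- with columns `E_{yσ}`, `N` and `E'_{y'σ'}⁻¹`.
  sqComp (G.Sq (hy₁.trans (σ.isSection (r a) x₁ (hr a h₁)).symm)
    (hy₂.trans (σ.isSection (r b) x₂ (hr b h₂)).symm) (hy₁.trans (h₁₂.trans hy₂.symm)))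
    (sqComp (c.twoPt a b h₁₂ h₁ h₂) (sqInv (G'.Sq
      (hy'₁.trans (σ'.isSection (r' a) x₁ (hr' a h₁)).symm)
      (hy'₂.trans (σ'.isSection (r' b) x₂ (hr' b h₂)).symm) (hy'₁.trans (h₁₂.trans hy'₂.symm)))))

lemma isSq_locR : IsSq (c.locR h₁₂ h₁ h₂ hy₁ hy₂ hy'₁ hy'₂) :=
  isSq_sqComp (BundleGerbe.isSq_sq _ _ _)
    (isSq_sqComp (c.isSq_twoPt _ _ _ _ _) (isSq_sqInv (BundleGerbe.isSq_sq _ _ _)))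

lemma compat_locR : Compat
    (G.Tri (hy₁.trans (h₁₂.trans hy₂.symm)) (hy₂.trans (h₂₃.trans hy₃.symm)))
    (G'.Tri (hy'₁.trans (h₁₂.trans hy'₂.symm)) (hy'₂.trans (h₂₃.trans hy'₃.symm)))
    (c.locR h₁₂ h₁ h₂ hy₁ hy₂ hy'₁ hy'₂) (c.locR h₂₃ h₂ h₃ hy₂ hy₃ hy'₂ hy'₃)
    (c.locR (h₁₂.trans h₂₃) h₁ h₃ hy₁ hy₃ hy'₁ hy'₃) :=
  (BundleGerbe.compat_sq _ _ _ _ _).comp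
    ((c.compat_twoPt a b d h₁₂ h₂₃ h₁ h₂ h₃).comp (BundleGerbe.compat_sq _ _ _ _ _).inv
      (G'.isTri _ _) (c.isSq_twoPt _ _ _ _ _) (c.isSq_twoPt _ _ _ _ _)
      (isSq_sqInv (BundleGerbe.isSq_sq _ _ _)) (isSq_sqInv (BundleGerbe.isSq_sq _ _ _)))
    (G.isTri _ _) (BundleGerbe.isSq_sq _ _ _) (BundleGerbe.isSq_sq _ _ _)
    (isSq_sqComp (c.isSq_twoPt _ _ _ _ _) (isSq_sqInv (BundleGerbe.isSq_sq _ _ _)))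
    (isSq_sqComp (c.isSq_twoPt _ _ _ _ _) (isSq_sqInv (BundleGerbe.isSq_sq _ _ _)))

end

section

variable {D : Base.{u}}

/-- The bibundle constructed from a comparison of gerbes. -/
noncomputable def locN (a : P.idx) (x : Base.Map D (onSet m (P.O a : Set M)))
    (y : Base.Map D G.P.total) (y' : Base.Map D G'.P.total)
    (hy : ∀ z ∈ D.S, G.P.proj (y.toFun z) = x.toFun z)
    (hy' : ∀ z ∈ D.S, G'.P.proj (y'.toFun z) = x.toFun z) : Bibundle k H D :=
  (G.E.pullback (Submersion.dblMk y (σ.at (r a) (hr a) x)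
    fun z hz => (hy z hz).trans (σ.isSection (r a) _ (hr a (x.maps hz))).symm)).mul
  (((c.N a).pullback x).mul (G'.E.pullback (Submersion.dblMk y' (σ'.at (r' a) (hr' a) x)
    fun z hz => (hy' z hz).trans (σ'.isSection (r' a) _ (hr' a (x.maps hz))).symm)).inv)

variable {a b : P.idx} (x₁ : Base.Map D (onSet m (P.O a : Set M)))
  (x₂ : Base.Map D (onSet m (P.O b : Set M))) (hx : ∀ z ∈ D.S, x₁.toFun z = x₂.toFun z)

include hx in
lemma isSquare_twoPt : IsSquare ((c.N a).pullback x₁)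
    (G'.E.pullback (Submersion.dblMk (σ'.at (r' a) (hr' a) x₁) (σ'.at (r' b) (hr' b) x₂)
      fun z hz => proj_section (hr := hr') (hx z hz) (x₁.maps hz) (x₂.maps hz)))
    ((c.N b).pullback x₂)
    (G.E.pullback (Submersion.dblMk (σ.at (r a) (hr a) x₁) (σ.at (r b) (hr b) x₂)
      fun z hz => proj_section (hr := hr) (hx z hz) (x₁.maps hz) (x₂.maps hz)))
    (fun z => c.twoPt a b (hx z.1 z.2) (x₁.maps z.2) (x₂.maps z.2)) := by
  have hb : ∀ z ∈ D.S, x₁.toFun z ∈ P.O b := fun z hz => hx z hz ▸ x₂.maps hz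
  -- Pulling back along `x₁` alone gives the square up to replacing `x₁` by `x₂`, which agrees with
  -- it on `D` only.
  let g : Base.Map D (on2 m (P.O a) (P.O b)) := ⟨x₁.toFun, x₁.smooth, fun z hz => ⟨x₁.maps hz, hb z hz⟩⟩
  refine IsSquare.congr_pt (g₁ := (inclL m (P.O a) (P.O b)).comp g)
    (g₂ := (σ'.map2 (r' a) (r' b)).comp ((incl2 m (hr' a) (hr' b)).comp g))
    (g₃ := (inclR m (P.O a) (P.O b)).comp g)
    (g₄ := (σ.map2 (r a) (r b)).comp ((incl2 m (hr a) (hr b)).comp g)) ((c.isSquare a b).pullback g)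
    rfl ?_ ?_ ?_ fun z => c.heq_twoPt a b (hx z.1 z.2) (x₁.maps z.2) (x₂.maps z.2)
  · funext z
    apply Subtype.ext
    exact congrArg (fun x => (σ'.σ (r' a) (x₁.toFun z), σ'.σ (r' b) x)) (hx z.1 z.2)
  · funext z
    exact Subtype.ext (hx z.1 z.2)
  · funext z
    apply Subtype.ext
    exact congrArg (fun x => (σ.σ (r a) (x₁.toFun z), σ.σ (r b) x)) (hx z.1 z.2)

variable (y₁ y₂ : Base.Map D G.P.total) (y'₁ y'₂ : Base.Map D G'.P.total)
    (hy₁ : ∀ z ∈ D.S, G.P.proj (y₁.toFun z) = x₁.toFun z)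
    (hy₂ : ∀ z ∈ D.S, G.P.proj (y₂.toFun z) = x₂.toFun z)
    (hy'₁ : ∀ z ∈ D.S, G'.P.proj (y'₁.toFun z) = x₁.toFun z)
    (hy'₂ : ∀ z ∈ D.S, G'.P.proj (y'₂.toFun z) = x₂.toFun z)

lemma isSquare_locR : IsSquare (c.locN a x₁ y₁ y'₁ hy₁ hy'₁)
    (G'.E.pullback (Submersion.dblMk y'₁ y'₂
      fun z hz => (hy'₁ z hz).trans ((hx z hz).trans (hy'₂ z hz).symm)))
    (c.locN b x₂ y₂ y'₂ hy₂ hy'₂)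
    (G.E.pullback (Submersion.dblMk y₁ y₂
      fun z hz => (hy₁ z hz).trans ((hx z hz).trans (hy₂ z hz).symm)))
    (fun z => c.locR (hx z.1 z.2) (x₁.maps z.2) (x₂.maps z.2) (hy₁ z.1 z.2) (hy₂ z.1 z.2)
      (hy'₁ z.1 z.2) (hy'₂ z.1 z.2)) :=
  (BundleGerbe.isSquare_sq y₁ y₂ _ _ _ _ _).comp
    ((c.isSquare_twoPt x₁ x₂ hx).comp (BundleGerbe.isSquare_sq y'₁ y'₂ _ _ _ _ _).inv)

end

end Gerbe.Comparison

end

end NBG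

/-! ### Transition maps between the local bibundles -/

namespace NBG

section

variable {k : ℕ} {H : Type u} [TopologicalSpace H] [ChartedSpace (EuclideanSpace ℝ (Fin k)) H]
  [Group H] [LieGroup (𝓡 k) ∞ H]
  {m : ℕ} {M : Type u} [TopologicalSpace M] [ChartedSpace (EuclideanSpace ℝ (Fin m)) M]
  [IsManifold (𝓡 m) ∞ M]
  {G G' : BundleGerbe k H m M} {σ : LocalSections G.P} {σ' : LocalSections G'.P} {P : Cover M}
  {r : P.idx → (G.toGerbe σ).C.idx} {r' : P.idx → (G'.toGerbe σ').C.idx}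
  {hr : ∀ a, P.O a ≤ (G.toGerbe σ).C.O (r a)} {hr' : ∀ a, P.O a ≤ (G'.toGerbe σ').C.O (r' a)}

open Bitorsor

namespace Gerbe.Comparison

variable (c : Gerbe.Comparison (G.toGerbe σ) (G'.toGerbe σ') P r r' hr hr')

section

variable {a b d : P.idx} {x : M} (ha : x ∈ P.O a) (hb : x ∈ P.O b) (hd : x ∈ P.O d)
  {y : G.P.Y} {y' : G'.P.Y} (hy : G.P.proj y = x) (hy' : G'.P.proj y' = x)

/-- A square whose horizontal sides are units identifies its two columns, which here belong to
different members of the cover. -/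
lemma existsUnique_locΨ (n : c.locFib a x ha y y' hy hy') :
    ∃! n', c.locR rfl ha hb hy hy hy' hy' n (G'.unit y') n' (G.unit y) :=
  (c.isSq_locR rfl ha hb hy hy hy' hy').existsUnique₂ _ _ _

/-- The transition map between the bibundles constructed from a comparison of gerbes. -/
noncomputable def locΨ (n : c.locFib a x ha y y' hy hy') : c.locFib b x hb y y' hy hy' :=
  (c.existsUnique_locΨ ha hb hy hy' n).choose

lemma locR_locΨ (n : c.locFib a x ha y y' hy hy') :
    c.locR rfl ha hb hy hy hy' hy' n (G'.unit y') (c.locΨ ha hb hy hy' n) (G.unit y) :=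
  (c.existsUnique_locΨ ha hb hy hy' n).choose_spec.1

lemma locΨ_eq {n : c.locFib a x ha y y' hy hy'} {n' : c.locFib b x hb y y' hy hy'}
    (h : c.locR rfl ha hb hy hy hy' hy' n (G'.unit y') n' (G.unit y)) :
    c.locΨ ha hb hy hy' n = n' :=
  (c.existsUnique_locΨ ha hb hy hy' n).unique (c.locR_locΨ ha hb hy hy' n) h

lemma locΨ_l (g : H) (n : c.locFib a x ha y y' hy hy') :
    c.locΨ ha hb hy hy' (Bitorsor.l _ g n) = Bitorsor.l _ g (c.locΨ ha hb hy hy' n) :=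
  c.locΨ_eq _ _ _ _ ((c.isSq_locR rfl ha hb hy hy hy' hy').l_l (G.phi_unit y)
    (c.locR_locΨ ha hb hy hy' n) g)

lemma phi_locΨ (n : c.locFib a x ha y y' hy hy') (h : H) :
    Bitorsor.phi _ (c.locΨ ha hb hy hy' n) h = Bitorsor.phi _ n h := by
  have := (c.isSq_locR rfl ha hb hy hy hy' hy').phi_eq (c.locR_locΨ ha hb hy hy' n) h
  rw [G'.phi_unit, G.phi_unit] at this
  exact this.symm

/-- Two adjacent unit squares multiply to a unit square, since `u u = u`. -/
lemma locΨ_locΨ (n : c.locFib a x ha y y' hy hy') :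
    c.locΨ hb hd hy hy' (c.locΨ ha hb hy hy' n) = c.locΨ ha hd hy hy' n :=
  (c.locΨ_eq _ _ _ _ (c.compat_locR rfl rfl ha hb hd hy hy hy hy' hy' hy' _ _ _ _ _ _ _ _ _
    (c.locR_locΨ ha hb hy hy' n) (c.locR_locΨ hb hd hy hy' _) (G'.unit_unit y')
    (G.unit_unit y))).symm

/-- An idempotent map that is surjective, here by left equivariance, is the identity. -/
lemma locΨ_self (n : c.locFib a x ha y y' hy hy') : c.locΨ ha ha hy hy' n = n := by
  obtain ⟨n', hn⟩ : ∃ n', c.locΨ ha ha hy hy' n' = n := by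
    refine ⟨Bitorsor.l _ (Bitorsor.div _ n (c.locΨ ha ha hy hy' n)) n, ?_⟩
    rw [c.locΨ_l, Bitorsor.l_div]
  have := c.locΨ_locΨ ha ha ha hy hy' n'
  rwa [hn] at this

end

/-- A square is multiplied by unit squares on the left and on the right. This changes the members of
the cover in both columns and leaves the horizontal sides alone. -/
lemma locR_locΨ_iff {a₁ b₁ a₂ b₂ : P.idx} {x₁ x₂ : M} (h₁₂ : x₁ = x₂) (ha₁ : x₁ ∈ P.O a₁)
    (hb₁ : x₁ ∈ P.O b₁) (ha₂ : x₂ ∈ P.O a₂) (hb₂ : x₂ ∈ P.O b₂) {y₁ y₂ : G.P.Y}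
    {y'₁ y'₂ : G'.P.Y} (hy₁ : G.P.proj y₁ = x₁) (hy₂ : G.P.proj y₂ = x₂)
    (hy'₁ : G'.P.proj y'₁ = x₁) (hy'₂ : G'.P.proj y'₂ = x₂)
    (n₁ : c.locFib a₁ x₁ ha₁ y₁ y'₁ hy₁ hy'₁) (n₂ : c.locFib a₂ x₂ ha₂ y₂ y'₂ hy₂ hy'₂) (e' e) :
    c.locR h₁₂ hb₁ hb₂ hy₁ hy₂ hy'₁ hy'₂ (c.locΨ ha₁ hb₁ hy₁ hy'₁ n₁) e'
      (c.locΨ ha₂ hb₂ hy₂ hy'₂ n₂) e ↔ c.locR h₁₂ ha₁ ha₂ hy₁ hy₂ hy'₁ hy'₂ n₁ e' n₂ e := by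
  have key : ∀ {a₁ b₁ a₂ b₂ : P.idx} (ha₁ : x₁ ∈ P.O a₁)
      (hb₁ : x₁ ∈ P.O b₁) (ha₂ : x₂ ∈ P.O a₂) (hb₂ : x₂ ∈ P.O b₂)
      (n₁ : c.locFib a₁ x₁ ha₁ y₁ y'₁ hy₁ hy'₁) (n₂ : c.locFib a₂ x₂ ha₂ y₂ y'₂ hy₂ hy'₂),
      c.locR h₁₂ hb₁ hb₂ hy₁ hy₂ hy'₁ hy'₂ (c.locΨ ha₁ hb₁ hy₁ hy'₁ n₁) e'
        (c.locΨ ha₂ hb₂ hy₂ hy'₂ n₂) e → c.locR h₁₂ ha₁ ha₂ hy₁ hy₂ hy'₁ hy'₂ n₁ e' n₂ e := by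
    intro a₁ b₁ a₂ b₂ ha₁ hb₁ ha₂ hb₂ n₁ n₂ h
    have h₁ := c.compat_locR rfl h₁₂ ha₁ hb₁ hb₂ hy₁ hy₁ hy₂ hy'₁ hy'₁ hy'₂ _ _ _ _ _ _ _ _ _
      (c.locR_locΨ ha₁ hb₁ hy₁ hy'₁ n₁) h (BundleGerbe.unit_left _ _) (BundleGerbe.unit_left _ _)
    have h₂ := c.locR_locΨ hb₂ ha₂ hy₂ hy'₂ (c.locΨ ha₂ hb₂ hy₂ hy'₂ n₂)
    rw [c.locΨ_locΨ, c.locΨ_self] at h₂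
    exact c.compat_locR h₁₂ rfl ha₁ hb₂ ha₂ hy₁ hy₂ hy₂ hy'₁ hy'₂ hy'₂ _ _ _ _ _ _ _ _ _
      h₁ h₂ (BundleGerbe.unit_right _ _) (BundleGerbe.unit_right _ _)
  refine ⟨key ha₁ hb₁ ha₂ hb₂ n₁ n₂, fun h => ?_⟩
  refine key hb₁ ha₁ hb₂ ha₂ _ _ ?_
  rw [c.locΨ_locΨ, c.locΨ_locΨ, c.locΨ_self, c.locΨ_self]
  exact h

/-- The part of `Y ×_M Y'` over a member of the cover. -/
def domOver (_ : Gerbe.Comparison (G.toGerbe σ) (G'.toGerbe σ') P r r' hr hr') (a : P.idx) :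
    Set (Submersion.fibProd G.P G'.P).X := {z | G.P.proj z.1 ∈ P.O a}

lemma isOpen_domOver (a : P.idx) : IsOpen (c.domOver a) :=
  (P.O a).isOpen.preimage (G.P.contMDiff_proj.continuous.comp continuous_fst)

/-- The bibundle constructed from a comparison of gerbes, over a member of the cover. -/
noncomputable def overN (a : P.idx) :
    Bibundle k H ((Submersion.fibProd G.P G'.P).restr (c.domOver a)) :=
  c.locN a (Submersion.toOn ((Submersion.fibFst G.P G'.P).comp (Base.ofRestr _ _)) fun _ hz => hz.2)
    ((Submersion.fibFst G.P G'.P).comp (Base.ofRestr _ _))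
    ((Submersion.fibSnd G.P G'.P).comp (Base.ofRestr _ _)) (fun _ _ => rfl)
    (fun _ hz => hz.1.symm)

open Classical in
-- The image of a smooth section completes a square whose horizontal sides are the smooth units,
-- hence is smooth; off `domOver a` it is extended arbitrarily.
lemma exists_secAt_locΨ (a b : P.idx) (z : (Submersion.fibProd G.P G'.P).X)
    (hz : z ∈ (Submersion.fibProd G.P G'.P).S) (ha : z ∈ c.domOver a) (hb : z ∈ c.domOver b)
    (s : ∀ z, (c.overN a).fib z) (hs : (c.overN a).SecAt s ⟨z, hz, ha⟩) :
    ∃ s' : ∀ z, (c.overN b).fib z, (c.overN b).SecAt s' ⟨z, hz, hb⟩ ∧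
      ∀ (w : (Submersion.fibProd G.P G'.P).X) hw ha hb,
        s' ⟨w, hw, hb⟩ = c.locΨ ha hb rfl hw.symm (s ⟨w, hw, ha⟩) := by
  let s' : ∀ z, (c.overN b).fib z := fun w => if ha : w.1 ∈ c.domOver a then
    c.locΨ ha w.2.2 rfl w.2.1.symm (s ⟨w.1, w.2.1, ha⟩) else ((c.overN b).fib w).nonempty.some
  have hs' : ∀ (w : (Submersion.fibProd G.P G'.P).X) hw ha hb,
      s' ⟨w, hw, hb⟩ = c.locΨ ha hb rfl hw.symm (s ⟨w, hw, ha⟩) := fun w hw ha hb => dif_pos ha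
  refine ⟨s', ?_, hs'⟩
  refine Bibundle.SecAt.of_restr (E := c.overN b)
    (c.isOpen_domOver a) (hzV := ha) (g := Base.ofRestr _ _) (fun _ => rfl)
    (s := fun w => s' ((Base.ofRestr _ _).pt w)) ?_ fun _ => rfl
  let D := ((Submersion.fibProd G.P G'.P).restr (c.domOver b)).restr (c.domOver a)
  let ι : Base.Map D (Submersion.fibProd G.P G'.P) := (Base.ofRestr _ _).comp (Base.ofRestr _ _)
  let y := (Submersion.fibFst G.P G'.P).comp ι
  let y' := (Submersion.fibSnd G.P G'.P).comp ι
  have hsq := c.isSquare_locR (a := a) (b := b) (D := D) (Submersion.toOn y fun _ hz => hz.2)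
    (Submersion.toOn y fun _ hz => hz.1.2) (fun _ _ => rfl) y y y' y' (fun _ _ => rfl)
    (fun _ _ => rfl) (fun _ hz => hz.1.1.symm) (fun _ hz => hz.1.1.symm)
  let w : D := ⟨z, ⟨hz, hb⟩, ha⟩
  exact hsq.secAt₂ (b := w)
    (Bibundle.SecAt.pullback (E := c.overN a) (b := w)
      (ι.codRestr (c.domOver a) fun _ hz => hz.2) hs)
    (Bibundle.SecAt.pullback (b := w) y' (G'.secAt_unit (y'.pt w)))
    (Bibundle.SecAt.pullback (b := w) y (G.secAt_unit (y.pt w)))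
    (Filter.Eventually.of_forall fun w => by
      have h1 := c.locR_locΨ w.2.2 w.2.1.2 rfl w.2.1.1.symm (s ⟨w.1, w.2.1.1, w.2.2⟩)
      rw [← hs' w.1 w.2.1.1 w.2.2 w.2.1.2] at h1
      exact h1)

end Gerbe.Comparison

end

end NBG

/-! ### Bundle gerbes are classified by their induced gerbes -/

namespace NBG

section

variable {k : ℕ} {H : Type u} [TopologicalSpace H] [ChartedSpace (EuclideanSpace ℝ (Fin k)) H]
  [Group H] [LieGroup (𝓡 k) ∞ H]
  {m : ℕ} {M : Type u} [TopologicalSpace M] [ChartedSpace (EuclideanSpace ℝ (Fin m)) M]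
  [IsManifold (𝓡 m) ∞ M]
  {G G' : BundleGerbe k H m M} {σ : LocalSections G.P} {σ' : LocalSections G'.P} {P : Cover M}
  {r : P.idx → (G.toGerbe σ).C.idx} {r' : P.idx → (G'.toGerbe σ').C.idx}
  {hr : ∀ a, P.O a ≤ (G.toGerbe σ).C.O (r a)} {hr' : ∀ a, P.O a ≤ (G'.toGerbe σ').C.O (r' a)}

open Bitorsor

namespace BundleGerbe

/-- Stable equivalences of the gerbes induced by local sections glue to stable isomorphisms of
bundle gerbes. -/
theorem nonempty_comparison (c : Gerbe.Comparison (G.toGerbe σ) (G'.toGerbe σ') P r r' hr hr') :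
    Nonempty (Comparison G G') := by
  obtain ⟨N, θ, θ_l, θ_phi, θ_Ψ, θ_smooth⟩ := Bibundle.exists_glue c.domOver c.isOpen_domOver
    (fun z _ => P.covers (G.P.proj z.1)) c.overN
    (fun a b z hz ha hb => c.locΨ ha hb rfl hz.symm)
    (fun a b z hz ha hb => c.locΨ_l ha hb rfl hz.symm)
    (fun a b z hz ha hb => c.phi_locΨ ha hb rfl hz.symm)
    (fun a b d z hz ha hb hd => c.locΨ_locΨ ha hb hd rfl hz.symm)
    (fun a b z hz ha hb => c.exists_secAt_locΨ a b z hz ha hb)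
  have θ_surj : ∀ a (z : (Submersion.fibProd G.P G'.P).X) hz ha,
      Function.Surjective (θ a z hz ha) := by
    intro a z hz ha n
    obtain ⟨n'⟩ := ((c.overN a).fib ⟨z, hz, ha⟩).nonempty
    exact ⟨Bitorsor.l _ (Bitorsor.div _ n (θ a z hz ha n')) n', by rw [θ_l, Bitorsor.l_div]⟩
  have θ_inj : ∀ a (z : (Submersion.fibProd G.P G'.P).X) hz ha,
      Function.Injective (θ a z hz ha) := by
    intro a z hz ha n n' h
    rw [← Bitorsor.l_div _ n n', θ_l] at h
    have h1 := Bitorsor.div_eq _ h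
    rw [Bitorsor.div_self] at h1
    rw [← Bitorsor.l_div _ n n', ← h1, Bitorsor.l_one]
  -- The local squares are transported to the glued bibundle; by `locR_locΨ_iff` the members chosen
  -- for the two columns do not matter, which is `hR`.
  let R : ∀ z, (N.pullback (Submersion.z1 G.P G'.P)).fib z →
    (G'.E.pullback (Submersion.q' G.P G'.P)).fib z →
    (N.pullback (Submersion.z2 G.P G'.P)).fib z → (G.E.pullback (Submersion.q G.P G'.P)).fib z →
    Prop := fun z n₁ e' n₂ e => ∃ a b ha hb m₁ m₂,
      θ a z.1.1 z.2.1 ha m₁ = n₁ ∧ θ b z.1.2 z.2.2.1 hb m₂ = n₂ ∧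
      c.locR z.2.2.2 ha hb rfl rfl z.2.1.symm z.2.2.1.symm m₁ e' m₂ e
  have hR : ∀ z a b ha hb m₁ e' m₂ e,
      R z (θ a z.1.1 z.2.1 ha m₁) e' (θ b z.1.2 z.2.2.1 hb m₂) e ↔
      c.locR z.2.2.2 ha hb rfl rfl z.2.1.symm z.2.2.1.symm m₁ e' m₂ e := by
    intro z a b ha hb m₁ e' m₂ e
    refine ⟨?_, fun h => ⟨a, b, ha, hb, m₁, m₂, rfl, rfl, h⟩⟩
    rintro ⟨a', b', ha', hb', m₁', m₂', h₁, h₂, h⟩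
    rw [← θ_inj _ _ _ _ ((θ_Ψ a' a _ _ ha' ha m₁').trans h₁),
      ← θ_inj _ _ _ _ ((θ_Ψ b' b _ _ hb' hb m₂').trans h₂)]
    exact (c.locR_locΨ_iff _ _ _ _ _ _ _ _ _ _ _ _ _).2 h
  have isSq : ∀ z, IsSq (R z) := by
    intro z
    obtain ⟨a, ha⟩ := P.covers (G.P.proj z.1.1.1)
    have hb : G.P.proj z.1.2.1 ∈ P.O a := z.2.2.2 ▸ ha
    exact (c.isSq_locR z.2.2.2 ha hb rfl rfl z.2.1.symm z.2.2.1.symm).map _ _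
      (θ_l a z.1.1 z.2.1 ha) (θ_l a z.1.2 z.2.2.1 hb) (θ_phi a z.1.1 z.2.1 ha)
      (θ_phi a z.1.2 z.2.2.1 hb) (hR z a a ha hb)
  refine ⟨⟨N, R, ⟨isSq, fun z => ?_⟩, ?_⟩⟩
  · obtain ⟨a, ha⟩ := P.covers (G.P.proj z.1.1.1)
    have hb : G.P.proj z.1.2.1 ∈ P.O a := z.2.2.2 ▸ ha
    obtain ⟨s₁, hs₁⟩ := (c.overN a).exists_secAt ⟨z.1.1, z.2.1, ha⟩
    obtain ⟨s₂, hs₂⟩ := (c.overN a).exists_secAt ⟨z.1.2, z.2.2.1, hb⟩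
    obtain ⟨n₁, hn₁, hn₁'⟩ := θ_smooth a z.1.1 z.2.1 ha s₁ hs₁
    obtain ⟨n₂, hn₂, hn₂'⟩ := θ_smooth a z.1.2 z.2.2.1 hb s₂ hs₂
    obtain ⟨e', he'⟩ := (G'.E.pullback (Submersion.q' G.P G'.P)).exists_secAt z
    choose e he _ using fun w => (isSq w).existsUnique (n₁ ((Submersion.z1 G.P G'.P).pt w)) (e' w)
      (n₂ ((Submersion.z2 G.P G'.P).pt w))
    refine ⟨_, e', _, e, Bibundle.SecAt.pullback (b := z) (Submersion.z1 G.P G'.P) hn₁, he',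
      Bibundle.SecAt.pullback (b := z) (Submersion.z2 G.P G'.P) hn₂, ?_,
      Filter.Eventually.of_forall he⟩
    -- Smoothness of the completion `e` is checked on the open part of `Z^{[2]}` over one member of
    -- the cover, where `isSquare_locR` applies.
    let V : Set (Submersion.fibProdDbl G.P G'.P).X := {w | w.1 ∈ c.domOver a ∧ w.2 ∈ c.domOver a}
    have hV : IsOpen V := ((c.isOpen_domOver a).preimage continuous_fst).inter
      ((c.isOpen_domOver a).preimage continuous_snd)
    let D := (Submersion.fibProdDbl G.P G'.P).restr V
    let ι : Base.Map D (Submersion.fibProdDbl G.P G'.P) := Base.ofRestr _ _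
    let z₀ : D := ⟨z.1, z.2, ha, hb⟩
    let ζ₁ := (Submersion.z1 G.P G'.P).comp ι
    let ζ₂ := (Submersion.z2 G.P G'.P).comp ι
    let y₁ := (Submersion.fibFst G.P G'.P).comp ζ₁
    let y₂ := (Submersion.fibFst G.P G'.P).comp ζ₂
    let y'₁ := (Submersion.fibSnd G.P G'.P).comp ζ₁
    let y'₂ := (Submersion.fibSnd G.P G'.P).comp ζ₂
    have hsq := c.isSquare_locR (a := a) (b := a) (D := D) (Submersion.toOn y₁ fun _ hz => hz.2.1)
      (Submersion.toOn y₂ fun _ hz => hz.2.2) (fun _ hz => hz.1.2.2) y₁ y₂ y'₁ y'₂ (fun _ _ => rfl)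
      (fun _ _ => rfl) (fun _ hz => hz.1.1.symm) (fun _ hz => hz.1.2.1.symm)
    refine Bibundle.SecAt.of_restr (E := G.E.pullback (Submersion.q G.P G'.P)) hV
      (hzV := ⟨ha, hb⟩) (g := Base.ofRestr _ _) (fun _ => rfl)
      (s := fun w => e ((Base.ofRestr _ _).pt w)) ?_ fun _ => rfl
    exact hsq.secAt (b := z₀)
      (Bibundle.SecAt.pullback (E := c.overN a) (b := z₀)
        (ζ₁.codRestr (c.domOver a) fun _ hz => hz.2.1) hs₁)
      (Bibundle.SecAt.pullback (E := G'.E.pullback (Submersion.q' G.P G'.P)) (b := z₀) ι he')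
      (Bibundle.SecAt.pullback (E := c.overN a) (b := z₀)
        (ζ₂.codRestr (c.domOver a) fun _ hz => hz.2.2) hs₂)
      (Filter.Eventually.of_forall fun w => by
        have h1 : ∀ p q, n₁ ⟨w.1.1, w.2.1.1⟩ = p → n₂ ⟨w.1.2, w.2.1.2.1⟩ = q →
            R ⟨w.1, w.2.1⟩ p (e' ⟨w.1, w.2.1⟩) q (e ⟨w.1, w.2.1⟩) := by
          rintro _ _ rfl rfl
          exact he ⟨w.1, w.2.1⟩
        exact (hR ⟨w.1, w.2.1⟩ a a w.2.2.1 w.2.2.2 _ _ _ _).1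
          (h1 _ _ (hn₁' _ _ w.2.2.1) (hn₂' _ _ w.2.2.2)))
  · intro y₁ y₂ y₃ y'₁ y'₂ y'₃ h₁ h₂ h₃ h₁₂ h₂₃ h'₁₂ h'₂₃ n₁ n₂ n₃ e₁₂ e₂₃ e₁₃ e'₁₂ e'₂₃ e'₁₃
      k₁ k₂ k' k
    obtain ⟨a, b, ha, hb, m₁, m₂, rfl, rfl, j₁⟩ := k₁
    obtain ⟨d, hd⟩ := P.covers (G.P.proj y₃)
    obtain ⟨m₃, rfl⟩ := θ_surj d (y₃, y'₃) h₃ hd n₃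
    exact (hR ⟨((y₁, y'₁), (y₃, y'₃)), h₁, h₃, h₁₂.trans h₂₃⟩ a d ha hd _ _ _ _).2
      (c.compat_locR h₁₂ h₂₃ ha hb hd rfl rfl rfl h₁.symm h₂.symm h₃.symm _ _ _ _ _ _ _ _ _ j₁
      ((hR ⟨((y₂, y'₂), (y₃, y'₃)), h₂, h₃, h₂₃⟩ b d hb hd _ _ _ _).1 k₂) k' k)

theorem stableIso_of_toGerbe (σ : LocalSections G.P) (σ' : LocalSections G'.P)
    (h : (G.toGerbe σ).StableEquiv (G'.toGerbe σ')) : G.StableIso G' := by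
  obtain ⟨P, r, r', hr, hr', ⟨c⟩⟩ := Gerbe.stableEquiv_iff.1 h
  exact stableIso_iff.2 (nonempty_comparison c)

theorem stableIso_iff_toGerbe (σ : LocalSections G.P) (σ' : LocalSections G'.P) :
    G.StableIso G' ↔ (G.toGerbe σ).StableEquiv (G'.toGerbe σ') :=
  ⟨fun h => h.toGerbe σ σ', stableIso_of_toGerbe σ σ'⟩

/-- Inherited from gerbes through `stableIso_iff_toGerbe`, with local sections fixed for each bundle
gerbe. -/
lemma stableIso_equivalence :
    Equivalence (BundleGerbe.StableIso (k := k) (H := H) (m := m) (M := M)) := by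
  have σ (G : BundleGerbe k H m M) : LocalSections G.P := G.P.nonempty_localSections.some
  have e := Gerbe.stableEquiv_equivalence (k := k) (H := H) (m := m) (M := M)
  refine ⟨fun G => ?_, fun {G G'} h => ?_, fun {G G' G''} h h' => ?_⟩
  · exact (stableIso_iff_toGerbe (σ G) (σ G)).2 (e.refl _)
  · exact (stableIso_iff_toGerbe (σ G') (σ G)).2
      (e.symm ((stableIso_iff_toGerbe (σ G) (σ G')).1 h))
  · exact (stableIso_iff_toGerbe (σ G) (σ G'')).2
      (e.trans ((stableIso_iff_toGerbe (σ G) (σ G')).1 h)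
        ((stableIso_iff_toGerbe (σ G') (σ G'')).1 h'))

/-- The class of the gerbe induced by local sections does not depend on them. -/
lemma toGerbe_stableEquiv (G : BundleGerbe k H m M) (σ σ' : LocalSections G.P) :
    (G.toGerbe σ).StableEquiv (G.toGerbe σ') :=
  (stableIso_iff_toGerbe σ σ').1 (stableIso_equivalence.refl G)

end BundleGerbe

end

end NBG

/-! ### The submersion attached to an open cover -/

namespace NBG

section LocalHomeomorph

variable {m : ℕ} {M : Type u} [TopologicalSpace M] [ChartedSpace (EuclideanSpace ℝ (Fin m)) M]
  {Y : Type u} [TopologicalSpace Y] {p : Y → M} (hp : IsLocalHomeomorph p)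

/-- The manifold structure pulled back along a local homeomorphism. -/
@[reducible]
noncomputable def _root_.IsLocalHomeomorph.domChartedSpace :
    ChartedSpace (EuclideanSpace ℝ (Fin m)) Y where
  atlas := {e | ∃ (f : OpenPartialHomeomorph Y M) (g : OpenPartialHomeomorph M _),
    p = f ∧ g ∈ atlas (EuclideanSpace ℝ (Fin m)) M ∧ e = f ≫ₕ g}
  chartAt y := (hp y).choose ≫ₕ chartAt _ (p y)
  mem_chart_source y := by
    obtain ⟨h₁, h₂⟩ := (hp y).choose_spec
    refine ⟨h₁, ?_⟩
    change (hp y).choose y ∈ (chartAt (EuclideanSpace ℝ (Fin m)) (p y)).source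
    rw [← h₂]
    exact mem_chart_source _ _
  chart_mem_atlas y := ⟨_, _, (hp y).choose_spec.2, chart_mem_atlas _ _, rfl⟩

/-- Since `f'` and `f` are both restrictions of `p`, the composite `f' ∘ f⁻¹` is the identity, and a
change of charts upstairs restricts one of `M`. -/
lemma _root_.IsLocalHomeomorph.isManifold_domChartedSpace [IsManifold (𝓡 m) ∞ M] :
    let := hp.domChartedSpace (m := m)
    IsManifold (𝓡 m) ∞ Y := by
  let := hp.domChartedSpace (m := m)
  apply isManifold_of_contDiffOn
  rintro _ _ ⟨f, g, hf, hg, rfl⟩ ⟨f', g', hf', hg', rfl⟩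
  have h1 := ModelWithCorners.contDiffOn_extendCoordChange (I := 𝓡 m) (n := ∞)
    (IsManifold.subset_maximalAtlas hg) (IsManifold.subset_maximalAtlas hg')
  have key : ∀ x ∈ f.target, f' (f.symm x) = x := fun x hx => by
    rw [← hf', hf, f.right_inv hx]
  refine (h1.mono ?_).congr ?_
  · intro x hx
    simp only [OpenPartialHomeomorph.trans_symm_eq_symm_trans_symm, mem_inter_iff, mem_preimage,
      OpenPartialHomeomorph.trans_source, OpenPartialHomeomorph.symm_source,
      OpenPartialHomeomorph.coe_trans, Function.comp] at hx
    obtain ⟨⟨⟨hx₁, hx₂⟩, hx₃, hx₄⟩, -⟩ := hx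
    rw [key _ hx₂] at hx₄
    simpa using ⟨hx₁, hx₄⟩
  · intro x hx
    simp only [OpenPartialHomeomorph.trans_symm_eq_symm_trans_symm, mem_inter_iff, mem_preimage,
      OpenPartialHomeomorph.trans_source, OpenPartialHomeomorph.symm_source] at hx
    have := key (g.symm x) hx.1.1.2
    simp [this]

/-- In the chart at `y` and the chart at `p y` the map is the identity, a projection with
zero-dimensional complement `PUnit`. -/
lemma _root_.IsLocalHomeomorph.isSubmersion [IsManifold (𝓡 m) ∞ M] :
    let := hp.domChartedSpace (m := m)
    Manifold.IsSubmersion (𝓡 m) (𝓡 m) ∞ p := by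
  let := hp.domChartedSpace (m := m)
  have := hp.isManifold_domChartedSpace (m := m)
  refine ⟨PUnit, inferInstance, inferInstance, fun y => ?_⟩
  obtain ⟨h₁, h₂⟩ := (hp y).choose_spec
  refine Manifold.IsSubmersionAtOfComplement.mk_of_charts
    (ContinuousLinearEquiv.prodUnique ℝ (EuclideanSpace ℝ (Fin m)) PUnit).symm
    (chartAt _ y) (chartAt _ (p y)) (mem_chart_source _ _) (mem_chart_source _ _)
    (IsManifold.chart_mem_maximalAtlas _) (IsManifold.chart_mem_maximalAtlas _) ?_ ?_
  · intro z hz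
    have h3 : (hp y).choose z ∈ (chartAt (EuclideanSpace ℝ (Fin m)) (p y)).source := hz.2
    rwa [← h₂] at h3
  · intro x hx
    have hx' : x ∈ (chartAt (EuclideanSpace ℝ (Fin m)) y).target := by simpa using hx
    have h3 := (chartAt (EuclideanSpace ℝ (Fin m)) y).right_inv hx'
    change chartAt _ (p y) ((hp y).choose _) = x at h3
    rw [← h₂] at h3
    simpa using h3

/-- A chart of `Y` is a chart of `M` composed with `p`, so `g` and `p ∘ g` have the same expression
in charts; continuity has to be supplied separately. -/
lemma _root_.IsLocalHomeomorph.contMDiffOn_of_comp {E F X : Type*} [NormedAddCommGroup E]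
    [NormedSpace ℝ E] [TopologicalSpace F] {I : ModelWithCorners ℝ E F} [TopologicalSpace X]
    [ChartedSpace F X] {S : Set X} {g : X → Y} (hg : ContinuousOn g S)
    (hpg : ContMDiffOn I (𝓡 m) ∞ (p ∘ g) S) :
    let := hp.domChartedSpace (m := m)
    ContMDiffOn I (𝓡 m) ∞ g S := by
  intro _ x hx
  refine contMDiffWithinAt_iff.2 ⟨hg x hx, ?_⟩
  have h1 := (contMDiffWithinAt_iff.1 (hpg x hx)).2
  obtain ⟨h₁, h₂⟩ := (hp (g x)).choose_spec
  have h3 : extChartAt (𝓡 m) (g x) ∘ g = extChartAt (𝓡 m) ((p ∘ g) x) ∘ (p ∘ g) := by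
    funext z
    change extChartAt (𝓡 m) (p (g x)) ((hp (g x)).choose (g z)) = _
    rw [← h₂]
    rfl
  rw [← Function.comp_assoc, h3]
  exact h1

end LocalHomeomorph

section

variable {m : ℕ} {M : Type u} [TopologicalSpace M] [ChartedSpace (EuclideanSpace ℝ (Fin m)) M]
  [IsManifold (𝓡 m) ∞ M]

/-- The disjoint union of the members of a cover. -/
abbrev Cover.Total (C : Cover M) : Type u := Σ α, C.O α

/-- The projection from the disjoint union of the members of a cover. -/
def Cover.totalProj (C : Cover M) (y : C.Total) : M := y.2.1

omit [ChartedSpace (EuclideanSpace ℝ (Fin m)) M] [IsManifold (𝓡 m) ∞ M] in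
lemma Cover.isLocalHomeomorph (C : Cover M) : IsLocalHomeomorph C.totalProj := by
  apply IsLocalHomeomorph.mk
  rintro ⟨α, x⟩
  have : Nonempty (C.O α) := ⟨x⟩
  have h1 : Topology.IsOpenEmbedding (fun y : C.O α => (⟨α, y⟩ : C.Total)) := .sigmaMk (σ := fun α => C.O α)
  have h2 : Topology.IsOpenEmbedding (Subtype.val : C.O α → M) := (C.O α).isOpen.isOpenEmbedding_subtypeVal
  refine ⟨(h1.toOpenPartialHomeomorph _).symm ≫ₕ h2.toOpenPartialHomeomorph _, ?_, ?_⟩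
  · simp
  · rintro _ ⟨⟨y, -, rfl⟩, -⟩
    have h3 := (h1.toOpenPartialHomeomorph _).left_inv (x := y) (by simp)
    simp only [OpenPartialHomeomorph.coe_trans, Function.comp]
    have h4 : (h1.toOpenPartialHomeomorph _).symm ⟨α, y⟩ = y := h3
    exact (congrArg Subtype.val h4).symm

/-- The submersion from the disjoint union of the members of a cover. -/
noncomputable def Cover.submersion [T2Space M] (C : Cover M) : Submersion m M where
  -- The topology and the Hausdorff property of the disjoint union are inferred; the latter uses
  -- that `M` is Hausdorff.
  n := m
  Y := C.Total
  charted := C.isLocalHomeomorph.domChartedSpace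
  isManifold := C.isLocalHomeomorph.isManifold_domChartedSpace
  proj := C.totalProj
  surjective x :=
    let ⟨α, hα⟩ := C.covers x
    ⟨⟨α, x, hα⟩, rfl⟩
  isSubmersion := C.isLocalHomeomorph.isSubmersion

variable [T2Space M]

open Classical in
/-- The canonical local sections of the submersion of a cover. -/
noncomputable def Cover.localSections (C : Cover M) : LocalSections (C.submersion (m := m)) where
  C := C
  σ α x := if hx : x ∈ C.O α then ⟨α, x, hx⟩ else (C.submersion (m := m)).surjective x |>.choose
  smooth α := by
    refine C.isLocalHomeomorph.contMDiffOn_of_comp (m := m) (I := 𝓡 m) ?_ ?_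
    · refine continuousOn_iff_continuous_domRestrict.2 ?_
      refine (continuous_sigmaMk (σ := fun α => C.O α) (i := α)).congr fun x => ?_
      exact (dif_pos (c := x.1 ∈ C.O α) (t := fun hx => (⟨α, x.1, hx⟩ : C.Total)) x.2).symm
    · exact (contMDiffOn_id (I := 𝓡 m) (M := M)).congr fun x hx =>
        congrArg C.totalProj (dif_pos hx)
  isSection α x hx := congrArg C.totalProj (dif_pos hx)

lemma Cover.localSections_apply (C : Cover M) (α : C.idx) {x : M} (hx : x ∈ C.O α) :
    (C.localSections (m := m)).σ α x = ⟨α, x, hx⟩ :=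
  dif_pos hx

end

end NBG

/-! ### Transport along isomorphisms; gluing over disjoint covers -/

namespace NBG

namespace Bitorsor

variable {H : Type u} [Group H]

lemma injective_of_l {A B : Bitorsor H} {f : A → B} (hf : ∀ g n, f (A.l g n) = B.l g (f n)) :
    Function.Injective f := by
  intro n n' h
  rw [← A.l_div n n', hf] at h
  have h1 := B.div_eq h
  rw [div_self] at h1
  rw [← A.l_div n n', ← h1, l_one]

lemma surjective_of_l {A B : Bitorsor H} {f : A → B} (hf : ∀ g n, f (A.l g n) = B.l g (f n)) :
    Function.Surjective f := by
  intro n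
  obtain ⟨m⟩ := A.nonempty
  exact ⟨A.l (B.div n (f m)) m, by rw [hf, l_div]⟩

lemma div_map {A B : Bitorsor H} {f : A → B} (hf : ∀ g n, f (A.l g n) = B.l g (f n)) (n n') :
    B.div (f n) (f n') = A.div n n' :=
  B.div_eq (by rw [← hf, l_div])

/-- Triangles are invariant under isomorphisms. -/
lemma IsTri.map {A B C A' B' C' : Bitorsor H} {R : A → B → C → Prop} (hR : IsTri R)
    {R' : A' → B' → C' → Prop} {f₁ : A → A'} {f₂ : B → B'} {f₃ : C → C'}
    (l₁ : ∀ g n, f₁ (A.l g n) = A'.l g (f₁ n)) (l₂ : ∀ g n, f₂ (B.l g n) = B'.l g (f₂ n))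
    (l₃ : ∀ g n, f₃ (C.l g n) = C'.l g (f₃ n)) (phi₁ : ∀ n h, A'.phi (f₁ n) h = A.phi n h)
    (phi₂ : ∀ n h, B'.phi (f₂ n) h = B.phi n h) (phi₃ : ∀ n h, C'.phi (f₃ n) h = C.phi n h)
    (h : ∀ a b c, R' (f₁ a) (f₂ b) (f₃ c) ↔ R a b c) : IsTri R' := by
  refine ⟨?_, ?_, ?_⟩
  · obtain ⟨a, b, c, habc⟩ := hR.nonempty
    exact ⟨_, _, _, (h _ _ _).2 habc⟩
  · intro a b c hh x
    obtain ⟨a, rfl⟩ := surjective_of_l l₁ a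
    obtain ⟨b, rfl⟩ := surjective_of_l l₂ b
    obtain ⟨c, rfl⟩ := surjective_of_l l₃ c
    rw [phi₁, phi₂, phi₃]
    exact hR.phi_eq ((h _ _ _).1 hh) x
  · intro a b c hh g k p
    obtain ⟨a, rfl⟩ := surjective_of_l l₁ a
    obtain ⟨b, rfl⟩ := surjective_of_l l₂ b
    obtain ⟨c, rfl⟩ := surjective_of_l l₃ c
    rw [← l₁, ← l₂, ← l₃, phi₁, h]
    exact hR.l_iff ((h _ _ _).1 hh) g k p

end Bitorsor

section

variable {k : ℕ} {H : Type u} [TopologicalSpace H] [ChartedSpace (EuclideanSpace ℝ (Fin k)) H]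
  [Group H] [LieGroup (𝓡 k) ∞ H] {D : Base.{u}}

/-- An equivariant map preserves quotients, so one smooth section with smooth image is enough. -/
lemma Bibundle.SecAt.map {E E' : Bibundle k H D} {f : ∀ b, E.fib b → E'.fib b}
    (hf : ∀ b g n, f b ((E.fib b).l g n) = (E'.fib b).l g (f b n)) {s t : ∀ b, E.fib b} {b : D}
    (hs : E.SecAt s b) (hfs : E'.SecAt (fun b => f b (s b)) b) (ht : E.SecAt t b) :
    E'.SecAt (fun b => f b (t b)) b :=
  hfs.of_div ((ht.div hs).congr
    (Filter.Eventually.of_forall fun x => Bitorsor.div_map (hf x) _ _))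

omit [LieGroup (𝓡 k) ∞ H] in
open Classical in
lemma Bibundle.SecAt.exists_extension {E : Bibundle k H D} {V : Set D.X} (hV : IsOpen V) {z : D.X}
    {hz : z ∈ D.S} {hzV : z ∈ V} {s : ∀ w, (E.pullback (Base.ofRestr D V)).fib w}
    (hs : (E.pullback (Base.ofRestr D V)).SecAt s ⟨z, hz, hzV⟩) :
    ∃ s' : ∀ w, E.fib w, E.SecAt s' ⟨z, hz⟩ ∧
      ∀ (w : D.X) (hw : w ∈ D.S) (hwV : w ∈ V), s' ⟨w, hw⟩ = s ⟨w, hw, hwV⟩ := by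
  let s' : ∀ w, E.fib w := fun w => if h : w.1 ∈ V then s ⟨w.1, w.2, h⟩ else (E.fib w).nonempty.some
  have h : ∀ (w : D.X) (hw : w ∈ D.S) (hwV : w ∈ V), s' ⟨w, hw⟩ = s ⟨w, hw, hwV⟩ :=
    fun w hw hwV => dif_pos hwV
  exact ⟨s', Bibundle.SecAt.of_restr (hzV := hzV) hV (fun _ => rfl) hs
    fun w => (h w.1 w.2.1 w.2.2).symm, h⟩

/-- Locality: `a` and `b` are extended from the open set arbitrarily, and `c` is recomputed from the
extensions. -/
lemma IsTriangle.of_restr {A B C : Bibundle k H D} {R : ∀ b, A.fib b → B.fib b → C.fib b → Prop}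
    (h : ∀ z : D, ∃ V, IsOpen V ∧ z.1 ∈ V ∧ IsTriangle (A.pullback (Base.ofRestr D V))
      (B.pullback (Base.ofRestr D V)) (C.pullback (Base.ofRestr D V))
      (fun w => R ((Base.ofRestr D V).pt w))) : IsTriangle A B C R := by
  refine ⟨fun z => ?_, fun z => ?_⟩
  · obtain ⟨V, -, hz, hT⟩ := h z
    exact hT.isTri ⟨z.1, z.2, hz⟩
  · obtain ⟨V, hV, hz, hT⟩ := h z
    obtain ⟨a, b, c, ha, hb, hc, habc⟩ := hT.smooth ⟨z.1, z.2, hz⟩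
    obtain ⟨a', ha', ha''⟩ := ha.exists_extension (hzV := hz) hV
    obtain ⟨b', hb', hb''⟩ := hb.exists_extension (hzV := hz) hV
    have hTri : ∀ w, Bitorsor.IsTri (R w) := fun w => by
      obtain ⟨V, -, hz, hT⟩ := h w
      exact hT.isTri ⟨w.1, w.2, hz⟩
    choose c' hc' _ using fun w => (hTri w).existsUnique (a' w) (b' w)
    refine ⟨a', b', c', ha', hb', ?_, Filter.Eventually.of_forall hc'⟩
    refine Bibundle.SecAt.of_restr (hzV := hz) hV (fun _ => rfl)
      (s := fun w => c' ((Base.ofRestr D V).pt w)) ?_ fun _ => rfl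
    refine hT.secAt ha hb (Filter.Eventually.of_forall fun w => ?_)
    have := hc' ((Base.ofRestr D V).pt w)
    rw [← ha'' w.1 w.2.1 w.2.2, ← hb'' w.1 w.2.1 w.2.2]
    exact this

omit [LieGroup (𝓡 k) ∞ H] in
/-- Triangles are invariant under isomorphisms. -/
lemma IsTriangle.map {A B C A' B' C' : Bibundle k H D}
    {R : ∀ b, A.fib b → B.fib b → C.fib b → Prop} (hR : IsTriangle A B C R)
    {R' : ∀ b, A'.fib b → B'.fib b → C'.fib b → Prop} {f₁ : ∀ b, A.fib b → A'.fib b}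
    {f₂ : ∀ b, B.fib b → B'.fib b} {f₃ : ∀ b, C.fib b → C'.fib b}
    (l₁ : ∀ b g n, f₁ b ((A.fib b).l g n) = (A'.fib b).l g (f₁ b n))
    (l₂ : ∀ b g n, f₂ b ((B.fib b).l g n) = (B'.fib b).l g (f₂ b n))
    (l₃ : ∀ b g n, f₃ b ((C.fib b).l g n) = (C'.fib b).l g (f₃ b n))
    (phi₁ : ∀ b n h, (A'.fib b).phi (f₁ b n) h = (A.fib b).phi n h)
    (phi₂ : ∀ b n h, (B'.fib b).phi (f₂ b n) h = (B.fib b).phi n h)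
    (phi₃ : ∀ b n h, (C'.fib b).phi (f₃ b n) h = (C.fib b).phi n h)
    (s₁ : ∀ b s, A.SecAt s b → A'.SecAt (fun b => f₁ b (s b)) b)
    (s₂ : ∀ b s, B.SecAt s b → B'.SecAt (fun b => f₂ b (s b)) b)
    (s₃ : ∀ b s, C.SecAt s b → C'.SecAt (fun b => f₃ b (s b)) b)
    (h : ∀ x a b c, R' x (f₁ x a) (f₂ x b) (f₃ x c) ↔ R x a b c) : IsTriangle A' B' C' R' := by
  refine ⟨fun x => (hR.isTri x).map (l₁ x) (l₂ x) (l₃ x) (phi₁ x) (phi₂ x) (phi₃ x) (h x),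
    fun x => ?_⟩
  obtain ⟨a, b, c, ha, hb, hc, habc⟩ := hR.smooth x
  exact ⟨_, _, _, s₁ _ _ ha, s₂ _ _ hb, s₃ _ _ hc, habc.mono fun y hy => (h _ _ _ _).2 hy⟩

/-- Bibundles on the members of a disjoint open cover glue. -/
theorem Bibundle.exists_glue_of_disjoint {ι : Type u} (V : ι → Set D.X)
    (hV : ∀ a, IsOpen (V a)) (cov : ∀ z ∈ D.S, ∃ a, z ∈ V a)
    (disj : ∀ a b z, z ∈ D.S → z ∈ V a → z ∈ V b → a = b)
    (N : ∀ a, Bibundle k H (D.restr (V a))) :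
    ∃ (E : Bibundle k H D) (θ : ∀ a (z : D.X) (hz : z ∈ D.S) (ha : z ∈ V a),
        (N a).fib ⟨z, hz, ha⟩ → E.fib ⟨z, hz⟩),
      (∀ a (z : D.X) hz ha g n, θ a z hz ha (((N a).fib ⟨z, hz, ha⟩).l g n) =
        (E.fib ⟨z, hz⟩).l g (θ a z hz ha n)) ∧
      (∀ a (z : D.X) hz ha n h, (E.fib ⟨z, hz⟩).phi (θ a z hz ha n) h =
        ((N a).fib ⟨z, hz, ha⟩).phi n h) ∧
      (∀ a (z : D.X) hz ha (s : ∀ z, (N a).fib z), (N a).SecAt s ⟨z, hz, ha⟩ →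
        ∃ s' : ∀ z, E.fib z, E.SecAt s' ⟨z, hz⟩ ∧
          ∀ (w : D.X) hw ha, s' ⟨w, hw⟩ = θ a w hw ha (s ⟨w, hw, ha⟩)) := by
  -- Two members that meet have the same index, so the transition maps are identities.
  let Ψ : ∀ a b (z : D.X) (hz : z ∈ D.S) (ha : z ∈ V a) (hb : z ∈ V b),
      (N a).fib ⟨z, hz, ha⟩ → (N b).fib ⟨z, hz, hb⟩ := fun a b z hz ha hb n => by
    obtain rfl := disj a b z hz ha hb
    exact n
  have Ψ_self : ∀ a z hz ha n, Ψ a a z hz ha ha n = n := fun _ _ _ _ _ => rfl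
  obtain ⟨E, θ, h₁, h₂, -, h₃⟩ := Bibundle.exists_glue V hV cov N Ψ
    (fun a b z hz ha hb g n => by
      obtain rfl := disj a b z hz ha hb
      rfl)
    (fun a b z hz ha hb n h => by
      obtain rfl := disj a b z hz ha hb
      rfl)
    (fun a b c z hz ha hb hc n => by
      obtain rfl := disj a b z hz ha hb
      rfl)
    (fun a b z hz ha hb s hs => by
      obtain rfl := disj a b z hz ha hb
      exact ⟨s, hs, fun _ _ _ _ => rfl⟩)
  exact ⟨E, θ, h₁, h₂, h₃⟩

variable {m : ℕ} {M : Type u} [TopologicalSpace M] [ChartedSpace (EuclideanSpace ℝ (Fin m)) M]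
  [IsManifold (𝓡 m) ∞ M]

/-- A gerbe is stably equivalent to a gerbe that is isomorphic to it on its cover. -/
theorem Gerbe.stableEquiv_of_iso (G G' : Gerbe M k H m) (r : G.C.idx → G'.C.idx)
    (hr : ∀ a, G.C.O a ≤ G'.C.O (r a))
    (θ : ∀ a b (x : on2 m (G.C.O a) (G.C.O b)),
      (G.E a b).fib x → ((G'.E (r a) (r b)).pullback (incl2 m (hr a) (hr b))).fib x)
    (θ_l : ∀ a b x g n, θ a b x (((G.E a b).fib x).l g n) = Bitorsor.l _ g (θ a b x n))
    (θ_phi : ∀ a b x n h, Bitorsor.phi _ (θ a b x n) h = ((G.E a b).fib x).phi n h)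
    (θ_smooth : ∀ a b x s, (G.E a b).SecAt s x →
      ((G'.E (r a) (r b)).pullback (incl2 m (hr a) (hr b))).SecAt (fun y => θ a b y (s y)) x)
    (θ_tri : ∀ a b c x (ha : x ∈ G.C.O a) (hb : x ∈ G.C.O b) (hc : x ∈ G.C.O c) e₁₂ e₂₃ e₁₃,
      G.Tri a b c ha hb hc e₁₂ e₂₃ e₁₃ → G'.Tri (r a) (r b) (r c) (hr a ha) (hr b hb) (hr c hc)
        (θ a b ⟨x, ha, hb⟩ e₁₂) (θ b c ⟨x, hb, hc⟩ e₂₃) (θ a c ⟨x, ha, hc⟩ e₁₃)) :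
    G.StableEquiv G' := by
  -- The self-comparison of `G'` becomes a comparison of `G` with `G'` once its fourth side is
  -- precomposed with `θ`.
  let c := Comparison.ofRefinements G' G.C r r hr hr
  refine stableEquiv_iff.2 ⟨G.C, id, r, fun _ => le_rfl, hr, ⟨⟨c.N,
    fun a b x n₁ e' n₂ e => c.R a b x n₁ e' n₂ (θ a b x e), ?_, ?_⟩⟩⟩
  · intro a b
    have hsq : ∀ x, Bitorsor.IsSq (fun n₁ e' n₂ e => c.R a b x n₁ e' n₂ (θ a b x e)) := by
      intro x
      have h := (c.isSquare a b).isSq x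
      refine ⟨?_, ?_, ?_⟩
      · obtain ⟨n₁, e', n₂, e, he⟩ := h.nonempty
        obtain ⟨e, rfl⟩ := Bitorsor.surjective_of_l (θ_l a b x) e
        exact ⟨n₁, e', n₂, e, he⟩
      · intro n₁ e' n₂ e he y
        rw [h.phi_eq he y]
        exact θ_phi _ _ _ _ _
      · intro n₁ e' n₂ e he g k p q
        have := h.l_iff he g k p q
        rw [θ_l]
        rw [this, θ_phi]
    refine ⟨hsq, fun x => ?_⟩
    obtain ⟨n₁, hn₁⟩ := ((c.N a).pullback (inclL m (G.C.O a) (G.C.O b))).exists_secAt x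
    obtain ⟨n₂, hn₂⟩ := ((c.N b).pullback (inclR m (G.C.O a) (G.C.O b))).exists_secAt x
    obtain ⟨e, he⟩ := (G.E a b).exists_secAt x
    choose e' he' _ using fun y => (hsq y).existsUnique' (n₁ y) (n₂ y) (e y)
    exact ⟨n₁, e', n₂, e, hn₁, (c.isSquare a b).secAt' hn₁ hn₂ (θ_smooth a b x e he)
      (Filter.Eventually.of_forall he'), hn₂, he, Filter.Eventually.of_forall he'⟩
  · intro a b d x ha hb hd n₁ n₂ n₃ e₁₂ e₂₃ e₁₃ e'₁₂ e'₂₃ e'₁₃ h₁ h₂ h' h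
    exact c.comp a b d x ha hb hd n₁ n₂ n₃ _ _ _ _ _ _ h₁ h₂ h' (θ_tri _ _ _ _ _ _ _ _ _ _ h)

end

end NBG

/-! ### The total bibundle of a gerbe -/

namespace NBG

section

variable {k : ℕ} {H : Type u} [TopologicalSpace H] [ChartedSpace (EuclideanSpace ℝ (Fin k)) H]
  [Group H] [LieGroup (𝓡 k) ∞ H]
  {m : ℕ} {M : Type u} [TopologicalSpace M] [ChartedSpace (EuclideanSpace ℝ (Fin m)) M]
  [IsManifold (𝓡 m) ∞ M] [T2Space M]

/-- `y` is the point `x` of `O_α` in the disjoint union of the members of a cover. -/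
structure Cover.IsPt (C : Cover M) (α : C.idx) (x : M) (y : (C.submersion (m := m)).Y) : Prop where
  mem : x ∈ C.O α
  eq : y = (⟨α, x, mem⟩ : C.Total)

namespace Cover.IsPt

variable {C : Cover M} {α β : C.idx} {x x' : M} {y : (C.submersion (m := m)).Y}

lemma proj_eq (h : C.IsPt α x y) : (C.submersion (m := m)).proj y = x := by
  rw [h.eq]
  rfl

lemma self (h : C.IsPt α x y) : C.IsPt α ((C.submersion (m := m)).proj y) y := by
  rwa [h.proj_eq]

lemma idx_eq (h : C.IsPt α x y) (h' : C.IsPt β x' y) : α = β :=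
  congrArg Sigma.fst (h.eq.symm.trans h'.eq)

variable (m) in
lemma isOpen (C : Cover M) (α : C.idx) :
    IsOpen {y | C.IsPt α ((C.submersion (m := m)).proj y) y} := by
  have h1 : IsOpen (range (fun y : C.O α => (⟨α, y⟩ : C.Total))) :=
    isOpen_range_sigmaMk (σ := fun α => C.O α)
  have h2 : {y | C.IsPt α ((C.submersion (m := m)).proj y) y} =
      range (fun y : C.O α => (⟨α, y⟩ : C.Total)) := by
    refine Set.ext fun y => ⟨fun h => ⟨⟨_, h.mem⟩, h.eq.symm⟩, ?_⟩
    rintro ⟨x, rfl⟩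
    exact ⟨x.2, rfl⟩
  rw [h2]
  exact h1

end Cover.IsPt

namespace Gerbe

/-- The bibundles of a gerbe form a bibundle on the fibre product of the disjoint union of the
members of the cover. -/
theorem exists_total (G : Gerbe M k H m) :
    ∃ (E : Bibundle k H (G.C.submersion (m := m)).dbl)
      (θ : ∀ α β x y₁ y₂ (h₁ : G.C.IsPt (m := m) α x y₁) (h₂ : G.C.IsPt (m := m) β x y₂),
        (G.E α β).fib ⟨x, h₁.mem, h₂.mem⟩ → E.fib ⟨(y₁, y₂), h₁.proj_eq.trans h₂.proj_eq.symm⟩),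
      (∀ α β x y₁ y₂ h₁ h₂ g n, θ α β x y₁ y₂ h₁ h₂ (Bitorsor.l _ g n) =
        Bitorsor.l _ g (θ α β x y₁ y₂ h₁ h₂ n)) ∧
      (∀ α β x y₁ y₂ h₁ h₂ n h, Bitorsor.phi _ (θ α β x y₁ y₂ h₁ h₂ n) h =
        Bitorsor.phi _ n h) ∧
      ∀ α β (D : Base.{u}) (x : Base.Map D (on2 m (G.C.O α) (G.C.O β)))
        (y₁ y₂ : Base.Map D (G.C.submersion (m := m)).total)
        (h₁ : ∀ z ∈ D.S, G.C.IsPt (m := m) α (x.toFun z) (y₁.toFun z))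
        (h₂ : ∀ z ∈ D.S, G.C.IsPt (m := m) β (x.toFun z) (y₂.toFun z)) (z : D) s,
        ((G.E α β).pullback x).SecAt s z →
        (E.pullback (Submersion.dblMk y₁ y₂ fun z hz =>
          (h₁ z hz).proj_eq.trans (h₂ z hz).proj_eq.symm)).SecAt
          (fun z => θ α β _ _ _ (h₁ z.1 z.2) (h₂ z.1 z.2) (s z)) z := by
  let P := G.C.submersion (m := m)
  let V : G.C.idx × G.C.idx → Set P.dbl.X := fun a =>
    {z | G.C.IsPt a.1 (P.proj z.1) z.1 ∧ G.C.IsPt a.2 (P.proj z.2) z.2}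
  have hV : ∀ a, IsOpen (V a) := fun a =>
    ((Cover.IsPt.isOpen m G.C a.1).preimage continuous_fst).inter
      ((Cover.IsPt.isOpen m G.C a.2).preimage continuous_snd)
  have cov : ∀ z ∈ P.dbl.S, ∃ a, z ∈ V a := fun z _ =>
    ⟨(Sigma.fst z.1, Sigma.fst z.2), ⟨z.1.2.2, rfl⟩, ⟨z.2.2.2, rfl⟩⟩
  have disj : ∀ a b z, z ∈ P.dbl.S → z ∈ V a → z ∈ V b → a = b := fun a b z _ ha hb =>
    Prod.ext (ha.1.idx_eq hb.1) (ha.2.idx_eq hb.2)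
  let g : ∀ a, Base.Map (P.dbl.restr (V a)) (on2 m (G.C.O a.1) (G.C.O a.2)) := fun a =>
    { toFun := fun z => P.proj z.1
      smooth := (P.contMDiff_proj.comp contMDiff_fst).contMDiffOn
      maps := fun z hz => ⟨hz.2.1.mem, by
        have h : ∀ x, x = P.proj z.2 → x ∈ G.C.O a.2 := by
          rintro _ rfl
          exact hz.2.2.mem
        exact h _ hz.1⟩ }
  obtain ⟨E, θ, θ_l, θ_phi, θ_smooth⟩ := Bibundle.exists_glue_of_disjoint V hV cov disj
    fun a => (G.E a.1 a.2).pullback (g a)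
  -- `θ` is based at the projection of the first point; `θ'` admits any name `x` for it, so that the
  -- three edges over one triple overlap share a base point.
  let θ' : ∀ α β x y₁ y₂ (h₁ : G.C.IsPt (m := m) α x y₁) (h₂ : G.C.IsPt (m := m) β x y₂),
        (G.E α β).fib ⟨x, h₁.mem, h₂.mem⟩ →
        E.fib ⟨(y₁, y₂), h₁.proj_eq.trans h₂.proj_eq.symm⟩ := fun α β x y₁ y₂ h₁ h₂ n => by
    have e := h₁.proj_eq
    subst e
    exact θ (α, β) (y₁, y₂) (h₁.proj_eq.trans h₂.proj_eq.symm) ⟨h₁, h₂.self⟩ n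
  have θ'_l : ∀ α β x y₁ y₂ h₁ h₂ g n, θ' α β x y₁ y₂ h₁ h₂ (Bitorsor.l _ g n) =
      Bitorsor.l _ g (θ' α β x y₁ y₂ h₁ h₂ n) := by
    intro α β x y₁ y₂ h₁ h₂ l n
    have e := h₁.proj_eq
    subst e
    exact θ_l (α, β) (y₁, y₂) _ _ l n
  refine ⟨E, θ', θ'_l, ?_, ?_⟩
  · intro α β x y₁ y₂ h₁ h₂ n h
    have e := h₁.proj_eq
    subst e
    exact θ_phi (α, β) (y₁, y₂) _ _ n h
  · intro α β D x y₁ y₂ h₁ h₂ z s hs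
    -- By `SecAt.map` smoothness need only be tested on one section, chosen to be pulled back from
    -- the overlap.
    obtain ⟨s₀, hs₀⟩ := (G.E α β).exists_secAt (x.pt z)
    let w : P.dbl.restr (V (α, β)) := ⟨(y₁.toFun z, y₂.toFun z),
      (h₁ z.1 z.2).proj_eq.trans (h₂ z.1 z.2).proj_eq.symm, (h₁ z.1 z.2).self, (h₂ z.1 z.2).self⟩
    have hw : (g (α, β)).pt w = x.pt z := Subtype.ext (h₁ z.1 z.2).proj_eq
    obtain ⟨t, ht, ht'⟩ := θ_smooth (α, β) w.1 w.2.1 w.2.2 (fun w => s₀ ((g (α, β)).pt w))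
      (Bibundle.SecAt.pullback (b := w) (g (α, β)) (hw ▸ hs₀))
    have key : ∀ x y₁ y₂ (h₁ : G.C.IsPt (m := m) α x y₁) (h₂ : G.C.IsPt (m := m) β x y₂),
        t ⟨(y₁, y₂), h₁.proj_eq.trans h₂.proj_eq.symm⟩ =
          θ' α β x y₁ y₂ h₁ h₂ (s₀ ⟨x, h₁.mem, h₂.mem⟩) := by
      intro x y₁ y₂ h₁ h₂
      have e := h₁.proj_eq
      subst e
      exact ht' (y₁, y₂) (h₁.proj_eq.trans h₂.proj_eq.symm) ⟨h₁, h₂.self⟩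
    refine Bibundle.SecAt.map (E := (G.E α β).pullback x)
      (E' := E.pullback (Submersion.dblMk y₁ y₂ fun z hz =>
          (h₁ z hz).proj_eq.trans (h₂ z hz).proj_eq.symm))
      (f := fun z => θ' α β _ _ _ (h₁ z.1 z.2) (h₂ z.1 z.2)) (fun _ => θ'_l _ _ _ _ _ _ _)
      (Bibundle.SecAt.pullback (b := z) x hs₀) ?_ hs
    · refine (Bibundle.SecAt.pullback (b := z) (Submersion.dblMk y₁ y₂ fun z hz =>
          (h₁ z hz).proj_eq.trans (h₂ z hz).proj_eq.symm) ht).congr ?_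
      exact Filter.Eventually.of_forall fun z => (key _ _ _ (h₁ z.1 z.2) (h₂ z.1 z.2)).symm

end Gerbe

end

end NBG

/-! ### Every gerbe comes from a bundle gerbe -/

namespace NBG

section

variable {k : ℕ} {H : Type u} [TopologicalSpace H] [ChartedSpace (EuclideanSpace ℝ (Fin k)) H]
  [Group H] [LieGroup (𝓡 k) ∞ H]
  {m : ℕ} {M : Type u} [TopologicalSpace M] [ChartedSpace (EuclideanSpace ℝ (Fin m)) M]
  [IsManifold (𝓡 m) ∞ M] [T2Space M]

/-- Every gerbe is stably equivalent to a gerbe that comes from a bundle gerbe. -/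
theorem Gerbe.exists_bundleGerbe (G : Gerbe M k H m) :
    ∃ (G' : BundleGerbe k H m M) (σ : LocalSections G'.P), G.StableEquiv (G'.toGerbe σ) := by
  obtain ⟨E, θ, θ_l, θ_phi, θ_smooth⟩ := G.exists_total
  let P := G.C.submersion (m := m)
  -- The multiplication of `G` transported by `θ`. A point of the disjoint union determines its
  -- index, so the existential has no ambiguity; this is `hT`.
  let T : ∀ (y₁ y₂ y₃ : P.Y) (h₁₂ : P.proj y₁ = P.proj y₂) (h₂₃ : P.proj y₂ = P.proj y₃),
      E.fib ⟨(y₁, y₂), h₁₂⟩ → E.fib ⟨(y₂, y₃), h₂₃⟩ → E.fib ⟨(y₁, y₃), h₁₂.trans h₂₃⟩ → Prop :=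
    fun y₁ y₂ y₃ _ _ a b c => ∃ (α β γ : G.C.idx) (x : M) (h₁ : G.C.IsPt (m := m) α x y₁)
      (h₂ : G.C.IsPt (m := m) β x y₂) (h₃ : G.C.IsPt (m := m) γ x y₃) (a₀ : _) (b₀ : _) (c₀ : _),
      θ α β x y₁ y₂ h₁ h₂ a₀ = a ∧ θ β γ x y₂ y₃ h₂ h₃ b₀ = b ∧ θ α γ x y₁ y₃ h₁ h₃ c₀ = c ∧
      G.Tri α β γ h₁.mem h₂.mem h₃.mem a₀ b₀ c₀
  have hT : ∀ (α β γ : G.C.idx) (x : M) (y₁ y₂ y₃ : P.Y) (h₁ : G.C.IsPt (m := m) α x y₁)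
      (h₂ : G.C.IsPt (m := m) β x y₂) (h₃ : G.C.IsPt (m := m) γ x y₃) a b c,
      T y₁ y₂ y₃ (h₁.proj_eq.trans h₂.proj_eq.symm) (h₂.proj_eq.trans h₃.proj_eq.symm)
        (θ α β x y₁ y₂ h₁ h₂ a) (θ β γ x y₂ y₃ h₂ h₃ b) (θ α γ x y₁ y₃ h₁ h₃ c) ↔
      G.Tri α β γ h₁.mem h₂.mem h₃.mem a b c := by
    intro α β γ x y₁ y₂ y₃ h₁ h₂ h₃ a b c
    refine ⟨?_, fun h => ⟨α, β, γ, x, h₁, h₂, h₃, a, b, c, rfl, rfl, rfl, h⟩⟩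
    rintro ⟨α', β', γ', x', h₁', h₂', h₃', a', b', c', ea, eb, ec, ht⟩
    obtain rfl := h₁'.idx_eq h₁
    obtain rfl := h₂'.idx_eq h₂
    obtain rfl := h₃'.idx_eq h₃
    obtain rfl := h₁'.proj_eq.symm.trans h₁.proj_eq
    obtain rfl := Bitorsor.injective_of_l (θ_l _ _ _ _ _ _ _) ea
    obtain rfl := Bitorsor.injective_of_l (θ_l _ _ _ _ _ _ _) eb
    obtain rfl := Bitorsor.injective_of_l (θ_l _ _ _ _ _ _ _) ec
    exact ht
  have pt : ∀ y : P.Y, ∃ α, G.C.IsPt (m := m) α (P.proj y) y := fun y => ⟨y.1, y.2.2, rfl⟩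
  have pt' : ∀ {α : G.C.idx} {y y' : P.Y}, P.proj y = P.proj y' →
      G.C.IsPt (m := m) α (P.proj y') y' → G.C.IsPt (m := m) α (P.proj y) y' :=
    fun h h' => h ▸ h'
  have tri : IsTriangle (E.pullback P.p12) (E.pullback P.p23) (E.pullback P.p13)
      (fun y => T y.1.1 y.1.2.1 y.1.2.2 y.2.1 y.2.2) := by
    refine IsTriangle.of_restr fun z => ?_
    obtain ⟨α, hα⟩ := pt z.1.1
    obtain ⟨β, hβ⟩ := pt z.1.2.1
    obtain ⟨γ, hγ⟩ := pt z.1.2.2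
    -- On the open part of `Y^{[3]}` lying in the members `α`, `β`, `γ`, the triangle is the
    -- pull-back of the one of `G`.
    let V : Set P.tpl.X := {w | G.C.IsPt (m := m) α (P.proj w.1) w.1 ∧
      G.C.IsPt (m := m) β (P.proj w.2.1) w.2.1 ∧ G.C.IsPt (m := m) γ (P.proj w.2.2) w.2.2}
    have hV : IsOpen V :=
      ((Cover.IsPt.isOpen m G.C α).preimage continuous_fst).inter
        (((Cover.IsPt.isOpen m G.C β).preimage (continuous_fst.comp continuous_snd)).inter
          ((Cover.IsPt.isOpen m G.C γ).preimage (continuous_snd.comp continuous_snd)))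
    have h₁ : ∀ w ∈ (P.tpl.restr V).S, G.C.IsPt (m := m) α (P.proj w.1) w.1 := fun w hw => hw.2.1
    have h₂ : ∀ w ∈ (P.tpl.restr V).S, G.C.IsPt (m := m) β (P.proj w.1) w.2.1 :=
      fun w hw => pt' hw.1.1 hw.2.2.1
    have h₃ : ∀ w ∈ (P.tpl.restr V).S, G.C.IsPt (m := m) γ (P.proj w.1) w.2.2 :=
      fun w hw => pt' (hw.1.1.trans hw.1.2) hw.2.2.2
    have c₁ := contMDiff_fst (n := ∞) (I := 𝓡 P.n) (J := (𝓡 P.n).prod (𝓡 P.n)) (M := P.Y)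
      (N := P.Y × P.Y)
    have c₂ := contMDiff_snd (n := ∞) (I := 𝓡 P.n) (J := (𝓡 P.n).prod (𝓡 P.n)) (M := P.Y)
      (N := P.Y × P.Y)
    have c₃ := contMDiff_fst (n := ∞) (I := 𝓡 P.n) (J := 𝓡 P.n) (M := P.Y) (N := P.Y)
    have c₄ := contMDiff_snd (n := ∞) (I := 𝓡 P.n) (J := 𝓡 P.n) (M := P.Y) (N := P.Y)
    let y₁ : Base.Map (P.tpl.restr V) P.total :=
      { toFun := fun w => w.1
        smooth := c₁.contMDiffOn
        maps := fun _ _ => mem_univ _ }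
    let y₂ : Base.Map (P.tpl.restr V) P.total :=
      { toFun := fun w => w.2.1
        smooth := (c₃.comp c₂).contMDiffOn
        maps := fun _ _ => mem_univ _ }
    let y₃ : Base.Map (P.tpl.restr V) P.total :=
      { toFun := fun w => w.2.2
        smooth := (c₄.comp c₂).contMDiffOn
        maps := fun _ _ => mem_univ _ }
    let g : Base.Map (P.tpl.restr V) (on3 m (G.C.O α) (G.C.O β) (G.C.O γ)) :=
      { toFun := fun w => P.proj w.1
        smooth := (P.contMDiff_proj.comp c₁).contMDiffOn
        maps := fun w hw => ⟨(h₁ w hw).mem, (h₂ w hw).mem, (h₃ w hw).mem⟩ }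
    refine ⟨V, hV, ⟨hα, hβ, hγ⟩, ((G.isTriangle α β γ).pullback g).map
      (f₁ := fun w => θ α β _ _ _ (h₁ w.1 w.2) (h₂ w.1 w.2))
      (f₂ := fun w => θ β γ _ _ _ (h₂ w.1 w.2) (h₃ w.1 w.2))
      (f₃ := fun w => θ α γ _ _ _ (h₁ w.1 w.2) (h₃ w.1 w.2))
      (fun _ => θ_l _ _ _ _ _ _ _) (fun _ => θ_l _ _ _ _ _ _ _) (fun _ => θ_l _ _ _ _ _ _ _)
      (fun _ => θ_phi _ _ _ _ _ _ _) (fun _ => θ_phi _ _ _ _ _ _ _)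
      (fun _ => θ_phi _ _ _ _ _ _ _)
      (θ_smooth α β _ ((r12 m _ _ _).comp g) y₁ y₂ h₁ h₂)
      (θ_smooth β γ _ ((r23 m _ _ _).comp g) y₂ y₃ h₂ h₃)
      (θ_smooth α γ _ ((r13 m _ _ _).comp g) y₁ y₃ h₁ h₃)
      (fun w => hT α β γ _ _ _ _ (h₁ w.1 w.2) (h₂ w.1 w.2) (h₃ w.1 w.2))⟩
  obtain ⟨f, hf⟩ := tri.exists_centralSection
  let G' : BundleGerbe k H m M :=
    { P := P
      E := E
      f := f
      cocycle := by
        intro y₁ y₂ y₃ y₄ h₁₂ h₂₃ h₃₄ e₁₂ e₂₃ e₃₄ e₁₃ e₂₄ e₁₄ e'₁₄ t₁ t₂ t₃ t₄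
        obtain ⟨α, hα⟩ := pt y₁
        obtain ⟨β, hβ⟩ := pt y₂
        obtain ⟨γ, hγ⟩ := pt y₃
        obtain ⟨δ, hδ⟩ := pt y₄
        replace hβ := pt' h₁₂ hβ
        replace hγ := pt' (h₁₂.trans h₂₃) hγ
        replace hδ := pt' (h₁₂.trans (h₂₃.trans h₃₄)) hδ
        obtain ⟨e₁₂, rfl⟩ := Bitorsor.surjective_of_l (θ_l _ _ _ _ _ hα hβ) e₁₂
        obtain ⟨e₂₃, rfl⟩ := Bitorsor.surjective_of_l (θ_l _ _ _ _ _ hβ hγ) e₂₃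
        obtain ⟨e₃₄, rfl⟩ := Bitorsor.surjective_of_l (θ_l _ _ _ _ _ hγ hδ) e₃₄
        obtain ⟨e₁₃, rfl⟩ := Bitorsor.surjective_of_l (θ_l _ _ _ _ _ hα hγ) e₁₃
        obtain ⟨e₂₄, rfl⟩ := Bitorsor.surjective_of_l (θ_l _ _ _ _ _ hβ hδ) e₂₄
        obtain ⟨e₁₄, rfl⟩ := Bitorsor.surjective_of_l (θ_l _ _ _ _ _ hα hδ) e₁₄
        obtain ⟨e'₁₄, rfl⟩ := Bitorsor.surjective_of_l (θ_l _ _ _ _ _ hα hδ) e'₁₄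
        exact congrArg _ (G.cocycle α β γ δ _ hα.mem hβ.mem hγ.mem hδ.mem _ _ _ _ _ _ _
          ((hT _ _ _ _ _ _ _ hβ hγ hδ _ _ _).1 ((hf ⟨(y₂, y₃, y₄), h₂₃, h₃₄⟩ _ _ _).1 t₁))
          ((hT _ _ _ _ _ _ _ hα hβ hδ _ _ _).1
            ((hf ⟨(y₁, y₂, y₄), h₁₂, h₂₃.trans h₃₄⟩ _ _ _).1 t₂))
          ((hT _ _ _ _ _ _ _ hα hβ hγ _ _ _).1 ((hf ⟨(y₁, y₂, y₃), h₁₂, h₂₃⟩ _ _ _).1 t₃))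
          ((hT _ _ _ _ _ _ _ hα hγ hδ _ _ _).1
            ((hf ⟨(y₁, y₃, y₄), h₁₂.trans h₂₃, h₃₄⟩ _ _ _).1 t₄))) }
  let σ : LocalSections G'.P := G.C.localSections
  have hσ : ∀ (α : G.C.idx) (x : M), x ∈ G.C.O α → G.C.IsPt (m := m) α x (σ.σ α x) :=
    fun α x hx => ⟨hx, G.C.localSections_apply α hx⟩
  refine ⟨G', σ, Gerbe.stableEquiv_of_iso G (G'.toGerbe σ) id (fun _ => le_rfl)
    (fun a b x => θ a b x.1 _ _ (hσ a x.1 x.2.1) (hσ b x.1 x.2.2))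
    (fun a b x => θ_l _ _ _ _ _ _ _) (fun a b x => θ_phi _ _ _ _ _ _ _) ?_ ?_⟩
  · intro a b x s hs
    exact θ_smooth a b _ (incl2 m le_rfl le_rfl)
      (σ.at a (O := {x | x ∈ G.C.O a ∧ x ∈ G.C.O b}) (fun _ h => h.1) (incl2 m le_rfl le_rfl))
      (σ.at b (O := {x | x ∈ G.C.O a ∧ x ∈ G.C.O b}) (fun _ h => h.2) (incl2 m le_rfl le_rfl))
      (fun x hx => hσ a x hx.1) (fun x hx => hσ b x hx.2) x s hs
  · intro a b c x ha hb hc e₁₂ e₂₃ e₁₃ h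
    exact (hf ((σ.map3 a b c).pt ⟨x, ha, hb, hc⟩) _ _ _).2
      ((hT a b c x _ _ _ (hσ a x ha) (hσ b x hb) (hσ c x hc) _ _ _).2 h)

end

end NBG

/-! ### Bijections of classes -/

namespace NBG

/-- A correspondence between two types with equivalence relations that is total in both
directions, and preserves and reflects the relations, induces a bijection of the quotients. -/
theorem exists_quot_equiv {α β : Type*} {r : α → α → Prop} {s : β → β → Prop}
    (hr : Equivalence r) (hs : Equivalence s) (R : α → β → Prop) (left : ∀ a, ∃ b, R a b)
    (right : ∀ b, ∃ a, R a b) (iff : ∀ a a' b b', R a b → R a' b' → (r a a' ↔ s b b')) :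
    ∃ Φ : Quot r ≃ Quot s, ∀ a b, R a b → Φ (Quot.mk _ a) = Quot.mk _ b := by
  choose F hF using left
  choose G hG using right
  refine ⟨⟨Quot.map F fun a a' h => (iff _ _ _ _ (hF a) (hF a')).1 h,
    Quot.map G fun b b' h => (iff _ _ _ _ (hG b) (hG b')).2 h, ?_, ?_⟩, ?_⟩
  · rintro ⟨a⟩
    exact Quot.sound ((iff _ _ _ _ (hG _) (hF a)).2 (hs.refl _))
  · rintro ⟨b⟩
    exact Quot.sound ((iff _ _ _ _ (hF _) (hG b)).1 (hr.refl _))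
  · intro a b h
    exact Quot.sound ((iff _ _ _ _ (hF a) h).1 (hr.refl _))

end NBG

theorem mainTheorem4 (k : ℕ) (H : Type u) [TopologicalSpace H]
    [ChartedSpace (EuclideanSpace ℝ (Fin k)) H] [Group H] [LieGroup (𝓡 k) ∞ H]
    (m : ℕ) (M : Type u) [TopologicalSpace M] [ChartedSpace (EuclideanSpace ℝ (Fin m)) M]
    [IsManifold (𝓡 m) ∞ M] [T2Space M] :
    -- the three relations are equivalence relations
    Equivalence (NBG.BundleGerbe.StableIso (k := k) (H := H) (m := m) (M := M)) ∧
    Equivalence (NBG.Gerbe.StableEquiv (k := k) (H := H) (m := m) (M := M)) ∧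
    Equivalence (NBG.LocalData.StableIso (k := k) (H := H) (m := m) (M := M)) ∧
    -- every bundle gerbe induces gerbes, whose class does not depend on the local sections
    (∀ G : NBG.BundleGerbe k H m M, Nonempty (NBG.LocalSections G.P)) ∧
    (∀ (G : NBG.BundleGerbe k H m M) (σ σ' : NBG.LocalSections G.P),
      (G.toGerbe σ).StableEquiv (G.toGerbe σ')) ∧
    -- pull-back along local sections is a bijection on classes
    (∃ Φ : Quot (NBG.BundleGerbe.StableIso (k := k) (H := H) (m := m) (M := M)) ≃
        Quot (NBG.Gerbe.StableEquiv (k := k) (H := H) (m := m) (M := M)),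
      ∀ (G : NBG.BundleGerbe k H m M) (σ : NBG.LocalSections G.P),
        Φ (Quot.mk _ G) = Quot.mk _ (G.toGerbe σ)) ∧
    -- passing to local data is a bijection on classes
    (∀ G : NBG.Gerbe M k H m, ∃ L : NBG.LocalData M k H m, L.IsLocalDataOf G) ∧
    (∀ L : NBG.LocalData M k H m, ∃ G : NBG.Gerbe M k H m, L.IsLocalDataOf G) ∧
    (∃ Ψ : Quot (NBG.Gerbe.StableEquiv (k := k) (H := H) (m := m) (M := M)) ≃
        Quot (NBG.LocalData.StableIso (k := k) (H := H) (m := m) (M := M)),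
      ∀ (G : NBG.Gerbe M k H m) (L : NBG.LocalData M k H m), L.IsLocalDataOf G →
        Ψ (Quot.mk _ G) = Quot.mk _ L) := by
  have e₁ := NBG.BundleGerbe.stableIso_equivalence (k := k) (H := H) (m := m) (M := M)
  have e₂ := NBG.Gerbe.stableEquiv_equivalence (k := k) (H := H) (m := m) (M := M)
  have e₃ := NBG.LocalData.stableIso_equivalence (k := k) (H := H) (m := m) (M := M)
  refine ⟨e₁, e₂, e₃, fun G => G.P.nonempty_localSections, fun G σ σ' => G.toGerbe_stableEquiv σ σ',
    ?_, fun G => G.exists_localData, fun L => L.exists_gerbe, ?_⟩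
  · obtain ⟨Φ, hΦ⟩ := NBG.exists_quot_equiv e₁ e₂
      -- The correspondence asks for stable equivalence with an induced gerbe, because a given gerbe
      -- is obtained from a bundle gerbe only up to stable equivalence.
      (fun G G' => ∃ σ : NBG.LocalSections G.P, (G.toGerbe σ).StableEquiv G')
      (fun G => G.P.nonempty_localSections.elim fun σ => ⟨_, σ, e₂.refl _⟩)
      (fun G => let ⟨G', σ, h⟩ := G.exists_bundleGerbe; ⟨G', σ, e₂.symm h⟩) (by
        rintro G₁ G₂ G₁' G₂' ⟨σ₁, h₁⟩ ⟨σ₂, h₂⟩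
        rw [NBG.BundleGerbe.stableIso_iff_toGerbe σ₁ σ₂]
        exact ⟨fun h => e₂.trans (e₂.symm h₁) (e₂.trans h h₂),
          fun h => e₂.trans h₁ (e₂.trans h (e₂.symm h₂))⟩)
    exact ⟨Φ, fun G σ => hΦ _ _ ⟨σ, e₂.refl _⟩⟩
  · exact NBG.exists_quot_equiv e₂ e₃ (fun G L => L.IsLocalDataOf G)
      (fun G => G.exists_localData) (fun L => L.exists_gerbe) fun G G' L L' hL hL' =>
        ⟨NBG.LocalData.stableIso_of_stableEquiv hL hL', NBG.LocalData.stableEquiv_of_stableIso hL hL'⟩
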